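/- **Proposition.** Let $(\Omega,\mathcal F,\mathbb P)$ be a probability space and $J$ a positive random variable with $\mathbb E(J^2)<\infty$. Let $\mu:[0,1]\to\mathbb R_+$ be nondecreasing (hence bounded), and let $\varphi:\mathbb R_+\to\mathbb R_+^{2\times 2}$ be measurable, locally bounded and integrable, such that the matrix $K=\mathbb E(J)\int_0^\infty|\varphi(u)|\,du$ has spectral radius $\rho(K)<1$. For each $T>0$ let $N=N^{(T)}=(N^{+},N^{-})^\top$ be, on $[0,T]$, a bivariate marked Hawkes process with horizon $T$ (for some filtration $(\mathcal F_t)$, which may depend on $T$): its arrivals occur at times $0<\tau_1<\tau_2<\cdots$, each arrival is upward ($+$) or downward ($-$) and carries a mark, and the random measure $N^{\pm}(dt,dx)$ of the times and marks of the $\pm$ arrivals is adapted with $(\mathcal F_t)$-compensator $\lambda^{\pm}_t\,dt\otimes\mathbb P(J\in dx)$, where $$\begin{pmatrix}\lambda^+_t\\ \lambda^-_t\end{pmatrix}=\mu\!\left(\tfrac tT\right)\begin{pmatrix}1\\1\end{pmatrix}+\int_{[0,t)}\int \varphi(t-s)\,x\begin{pmatrix}N^+(ds,dx)\\ N^-(ds,dx)\end{pmatrix}.$$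 For $i\in\{0,1,2\}$ let $N^i_t=\int_0^t (J_s)^i\,dN_s\in\mathbb R^2$ be the vector whose $\pm$ coordinate is the sum of the $i$-th powers of the marks of the $\pm$ arrivals up to time $t$. If $\mathbb E(J^{2i})<\infty$, put $$R^i_T=\sup_{v\in[0,1]}\Big\|T^{-1}N^i_{vT}-(I_2-K)^{-1}\begin{pmatrix}1\\1\end{pmatrix}\mathbb E(J^i)\int_0^v\mu(s)\,ds\Big\| .$$ Then, as $T\to\infty$ through the real numbers: 1. $R^i_T$ is a random variable (it is measurable up to a $\mathbb P$-null set) and $R^i_T\to0$ in $L^2(\mathbb P)$, whatever the joint law of the processes $N^{(T)}$ for the different $T$. 2. $R^i_T\to0$ almost surely, if the processes $N^{(T)}$, $T>0$, are constructed on $\Omega$ by thinning of a common marked Poisson random measure. That is: there is a Poisson random measure $Q=(Q^+,Q^-)$ on $\{+,-\}\times(0,\infty)\times(0,\infty)\times\mathbb R$ with intensity measure (counting) $\otimes\, dt\otimes dz\otimes\mathbb P(J\in dx)$ such that, almost surely, for all $T>0$ simultaneously, on $(0,T]\times\mathbb R$, $$N^{(T),\pm}(dt,dx)=\int_{z>0}\mathbf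 1_{\{z\le\lambda^{(T),\pm}_t\}}\,Q^{\pm}(dt,dz,dx).$$ -/

import Mathlib

open MeasureTheory ProbabilityTheory Filter Topology
open scoped NNReal ENNReal

/-- A random sequence of marked arrivals.  The `n`-th arrival happens at time `time n`, it is an
upward move if `side n = 0` and a downward move if `side n = 1`, and it carries the mark (jump
size) `mark n`. -/
structure MarkedArrivals (Ω : Type*) where
  time : ℕ → Ω → ℝ
  side : ℕ → Ω → Fin 2
  mark : ℕ → Ω → ℝ

namespace MarkedArrivals

variable {Ω : Type*} (X : MarkedArrivals Ω)

/-- The `ℝ²`-valued sum of the `i`-th powers of the marks of the arrivals up to time `t`: the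
coordinate `p` is `∑_{n : τ_n ≤ t, side n = p} (J_n)^i`, that is `∫_0^t (J_s)^i dN^p_s`. -/
noncomputable def powerSum (i : ℕ) (t : ℝ) (ω : Ω) : EuclideanSpace ℝ (Fin 2) :=
  open Classical in
  WithLp.toLp 2 fun p =>
    ∑' n, if X.time n ω ≤ t ∧ X.side n ω = p then X.mark n ω ^ i else 0

/-- The Hawkes intensity, on the horizon `[0, T]`, with baseline `μ (· / T)` and kernel `φ`:
`λ^p_t = μ (t / T) + ∑_q ∫_{[0,t)} φ_{pq} (t - s) J_s dN^q_s`.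
It is written with values in `[0, ∞]`; all the terms are nonnegative in the model.  Only arrivals
strictly before `t` enter, which is the predictable version. -/
noncomputable def intensity (μ : ℝ → ℝ) (φ : ℝ → Matrix (Fin 2) (Fin 2) ℝ) (T : ℝ)
    (p : Fin 2) (t : ℝ) (ω : Ω) : ℝ≥0∞ :=
  open Classical in
  ENNReal.ofReal (μ (t / T)) +
    ∑' n, if X.time n ω < t
      then ENNReal.ofReal (φ (t - X.time n ω) p (X.side n ω) * X.mark n ω) else 0

/-- `X` is, on `[0, T]`, a bivariate marked Hawkes process for the filtration `ℱ`, with baseline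
`μ (· / T)`, kernel `φ` and marks distributed as the random variable `J`:
the arrival times are positive and increasing, the marked arrivals are adapted, and the marked
point process `N^p(dt, dx)` of the arrivals on side `p` has the `ℱ`-compensator
`λ^p_t dt ⊗ law(J)(dx)`.  (What the sequence does after time `T` is irrelevant.) -/
structure IsMarkedHawkes {mΩ : MeasurableSpace Ω} (P : Measure Ω) (ℱ : Filtration ℝ≥0 mΩ)
    (μ : ℝ → ℝ) (φ : ℝ → Matrix (Fin 2) (Fin 2) ℝ) (J : Ω → ℝ) (T : ℝ) : Prop where
  measurable_time : ∀ n, Measurable (X.time n)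
  measurable_side : ∀ n, Measurable (X.side n)
  measurable_mark : ∀ n, Measurable (X.mark n)
  time_pos : ∀ n ω, 0 < X.time n ω
  time_strictMono : ∀ ω, StrictMono fun n => X.time n ω
  /-- The `n`-th arrival time is a stopping time and the side and the mark of the `n`-th arrival
  are known at that time. -/
  adapted : ∀ (n : ℕ) (t : ℝ≥0), (t : ℝ) ≤ T → ∀ (p : Fin 2) (B : Set ℝ), MeasurableSet B →
    MeasurableSet[ℱ t] {ω | X.time n ω ≤ t ∧ X.side n ω = p ∧ X.mark n ω ∈ B}
  /-- For all `n`, `p` and `B`, the process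
  `N^p ([0, t ∧ τ_n] × B) - P(J ∈ B) ∫_0^{t ∧ τ_n} λ^p_u du` is a martingale on `[0, T]`: its
  increments over `(s, t]` have mean zero on every event `A` of `ℱ_s`.  (`N` has at most `n + 1`
  points in `[0, τ_n]`, so both sides are finite.) -/
  compensator : ∀ (n : ℕ) (s t : ℝ≥0), s ≤ t → (t : ℝ) ≤ T → ∀ A, MeasurableSet[ℱ s] A →
    ∀ (p : Fin 2) (B : Set ℝ), MeasurableSet B →
    ∑ k ∈ Finset.range (n + 1), P (A ∩ {ω | (s : ℝ) < X.time k ω ∧ X.time k ω ≤ t ∧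
        X.side k ω = p ∧ X.mark k ω ∈ B}) =
      P (J ⁻¹' B) *
        ∫⁻ ω in A, (∫⁻ u in Set.Ioc (s : ℝ) t ∩ Set.Iic (X.time n ω), X.intensity μ φ T p u ω) ∂P

end MarkedArrivals

/-- `Q` is a Poisson random measure with intensity measure `ν`. -/
structure IsPoissonRandomMeasure {Ω E : Type*} {mΩ : MeasurableSpace Ω} {mE : MeasurableSpace E}
    (P : Measure Ω) (ν : Measure E) (Q : Ω → Measure E) : Prop where
  measurable : ∀ A, MeasurableSet A → Measurable fun ω => Q ω A
  law : ∀ A, MeasurableSet A → ν A ≠ ∞ →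
    P.map (fun ω => Q ω A) = (poissonMeasure (ν A).toNNReal).map (Nat.cast : ℕ → ℝ≥0∞)
  indep : ∀ (m : ℕ) (A : Fin m → Set E), (∀ j, MeasurableSet (A j)) →
    Pairwise (fun j k => Disjoint (A j) (A k)) → iIndepFun (fun j ω => Q ω (A j)) P

/-- The measure `(counting on the two sides) ⊗ dt ⊗ dz ⊗ ρ(dx)` on points `(p, t, z, x)` with
`t > 0` and `z > 0`, where `ρ` is the law of the marks. -/
noncomputable def drivingIntensity (ρ : Measure ℝ) : Measure (Fin 2 × ℝ × ℝ × ℝ) :=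
  Measure.count.prod ((volume.restrict (Set.Ioi 0)).prod ((volume.restrict (Set.Ioi 0)).prod ρ))

/-- The thinning equation on `(0, T]`, for the outcome `ω`: the marked arrivals of `X` on side `p`
are exactly the points `(t, x)` such that the driving measure `Q ω` has an atom at `(p, t, z, x)`
with `z ≤ λ^p_t`, that is
`N^p(dt, dx) = ∫ 1_{z ≤ λ^p_t} Q(p, dt, dz, dx)`. -/
def MarkedArrivals.SolvesThinning {Ω : Type*} (X : MarkedArrivals Ω)
    (Q : Ω → Measure (Fin 2 × ℝ × ℝ × ℝ)) (μ : ℝ → ℝ) (φ : ℝ → Matrix (Fin 2) (Fin 2) ℝ)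
    (T : ℝ) (ω : Ω) : Prop :=
  open Classical in
  ∀ (p : Fin 2) (A : Set (ℝ × ℝ)), MeasurableSet A → A ⊆ Set.Ioc 0 T ×ˢ Set.univ →
    (∑' n, if X.side n ω = p ∧ (X.time n ω, X.mark n ω) ∈ A then (1 : ℝ≥0∞) else 0) =
      Q ω {e | e.1 = p ∧ (e.2.1, e.2.2.2) ∈ A ∧
        ENNReal.ofReal e.2.2.1 ≤ X.intensity μ φ T p e.2.1 ω}

/-- The matrix `K = E(J) ∫_0^∞ |φ(u)| du`, entry by entry; `m` stands for `E(J)`. -/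
noncomputable def kernelMatrix (m : ℝ) (φ : ℝ → Matrix (Fin 2) (Fin 2) ℝ) :
    Matrix (Fin 2) (Fin 2) ℝ :=
  Matrix.of fun p q => m * ∫ u in Set.Ioi (0 : ℝ), |φ u p q|

/-- The limit `(I - K)⁻¹ (1, 1)ᵀ m_i ∫_0^v μ(s) ds`; here `m_i` stands for `E(J^i)`. -/
noncomputable def llnLimit (μ : ℝ → ℝ) (K : Matrix (Fin 2) (Fin 2) ℝ) (m_i : ℝ) (v : ℝ) :
    EuclideanSpace ℝ (Fin 2) :=
  (m_i * ∫ s in (0 : ℝ)..v, μ s) • WithLp.toLp 2 ((1 - K)⁻¹.mulVec fun _ => 1)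

/-- `sup_{v ∈ [0,1]} ‖T⁻¹ N^i_{vT} - L(v)‖`, with values in `[0, ∞]`. -/
noncomputable def MarkedArrivals.supError {Ω : Type*} (X : MarkedArrivals Ω) (i : ℕ) (T : ℝ)
    (L : ℝ → EuclideanSpace ℝ (Fin 2)) (ω : Ω) : ℝ≥0∞ :=
  ⨆ v ∈ Set.Icc (0 : ℝ) 1, ‖T⁻¹ • X.powerSum i (v * T) ω - L v‖ₑ

/-! Contraction. The vector `w = (1 - K)⁻¹ 1` satisfies `w = 1 + K w ≥ 1`
(`Matrix.resolvent_mulVec_one`), hence `K w ≤ r w` for some `r < 1`. Convolution with the kernel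
therefore contracts the norms weighted by `w`, both for deterministic vectors and in `L²`
(`lintegral_sq_convolution_le`). The moment estimates for the Hawkes process all follow one pattern:
a quantity bounded by a forcing term plus `r` times itself is at most the forcing term divided by `1
- r`, provided that it is finite (`ENNReal.le_of_self_improving`). Finiteness is secured by stopping
at the `n`-th arrival, and the stopping is then removed by Fatou's lemma and monotone convergence.

Convergence in `L²`. Let `N` be the sum of the `i`-th powers of the marks on one side, `Λ` the
integrated intensity on that side and `m_i = E(J^i)`. The process `N - m_i Λ` is a martingale whose
second moment is at most twice the expected sum of the squared jumps (`lintegral_sqDist_le_atoms`),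
which is `O(T)`. For `i = 1`, `Λ` and its mean solve renewal equations with the same kernel, so the
fluctuation of `N` is this martingale plus a convolution of its own past, and the contraction gives
a variance `O(T)` (`lintegral_sqDist_cnt_one_le`). Other powers follow, because the fluctuation of
`Λ` is read off from the case `i = 1` (`lintegral_sqDist_cnt_le`). The mean of `Λ(t)` differs from
`w ∫₀ᵗ μ(s/T) ds` by `o(T)`, since the baseline is bounded and the kernel integrable
(`enorm_mean_sub_le`, `tailErr_div_tendsto`). This settles each fixed `v`. As `N` is nondecreasing
in time and the limit is Lipschitz, finitely many grid points control the supremum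
(`abs_sub_le_sum_grid`). Only one horizon is considered at a time, so no coupling enters.

Almost sure convergence. Along the horizons `(n + 1)²` the normalized variances are summable, which
gives almost sure convergence on all grids (`ae_tendsto_compErr_squareTime`). The remaining real
horizons are reached pathwise. Since `μ` is nondecreasing, a longer horizon has a smaller baseline
`μ(t/T)`, and thinning the same Poisson points keeps fewer of them (`lam_le_lam`). For `a ≤ T ≤ b`
this bounds `N^(T)` below by `N^(b)` on `[0, T]` and above by `N^(a)` on `[0, a]`. What is left is
the mass of `N^(T)` in `(a, b]`, which must be bounded for all `T` at once. A dominating process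
with a constant baseline, built from the driving points by Picard iteration (`envelope`,
`lam_le_domRate`), provides the bound: its mass in a window of length `ℓ ≥ 1` has second moment
`O(ℓ²)` (`exists_lintegral_envTotal_sq_le`). Between consecutive squares `b - a` is of order `√a`,
so this mass divided by `a` tends to zero almost surely, again by summability.

The moments of the dominating process come from Mecke's formula
(`IsPoissonRandomMeasure.lintegral_lintegral`), derived here from the Poisson laws and the
independence on disjoint sets. It replaces the compensator identity and needs no filtration: being
known before a time is expressed as insensitivity to points added later. -/

section LinearAlgebra

-- Nonnegative matrices with spectral radius below one

attribute [local instance] Matrix.linftyOpNormedRing Matrix.linftyOpNormedAlgebra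

/-- Gelfand's formula: for `r` strictly between the spectral radius and `1`, eventually `‖A ^ k‖ ≤ r
^ k`, and every entry is bounded by the row-sum norm. -/
theorem Matrix.tendsto_pow_zero_of_spectralRadius_lt_one {n : Type*} [Fintype n] [DecidableEq n]
    (A : Matrix n n ℂ) (hA : spectralRadius ℂ A < 1) (p q : n) :
    Tendsto (fun k : ℕ => (A ^ k) p q) atTop (𝓝 0) := by
  have : CompleteSpace (Matrix n n ℂ) := FiniteDimensional.complete ℂ _
  obtain ⟨r, hr1, hr2⟩ := exists_between hA
  have h := (spectrum.pow_nnnorm_pow_one_div_tendsto_nhds_spectralRadius A).eventually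
    (gt_mem_nhds hr1)
  have hr : Tendsto (fun k : ℕ => r ^ k) atTop (𝓝 0) :=
    ENNReal.tendsto_pow_atTop_nhds_zero_of_lt_one hr2
  rw [tendsto_zero_iff_enorm_tendsto_zero]
  refine tendsto_of_tendsto_of_tendsto_of_le_of_le' tendsto_const_nhds hr
    (Eventually.of_forall fun _ => zero_le) ?_
  have hentry : ∀ B : Matrix n n ℂ, ‖B p q‖₊ ≤ ‖B‖₊ := fun B => by
    rw [Matrix.linfty_opNNNorm_def]
    exact (Finset.single_le_sum (f := fun j => ‖B p j‖₊) (fun _ _ => zero_le)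
      (Finset.mem_univ q)).trans (Finset.le_sup (f := fun i => ∑ j, ‖B i j‖₊) (Finset.mem_univ p))
  filter_upwards [h, eventually_gt_atTop 0] with k hk hk0
  have hk1 : ((‖A ^ k‖₊ : ℝ≥0∞) ^ (1 / k : ℝ)) ^ (k : ℝ) ≤ r ^ (k : ℝ) :=
    ENNReal.rpow_le_rpow hk.le (Nat.cast_nonneg k)
  rw [← ENNReal.rpow_mul, one_div, inv_mul_cancel₀ (by positivity), ENNReal.rpow_one,
    ENNReal.rpow_natCast] at hk1
  exact le_trans (by exact_mod_cast hentry _) hk1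

theorem Matrix.isUnit_one_sub_of_spectralRadius_lt_one {n : Type*} [Fintype n] [DecidableEq n]
    (A : Matrix n n ℂ) (hA : spectralRadius ℂ A < 1) : IsUnit (1 - A) := by
  have h : (1 : ℂ) ∈ resolventSet ℂ A :=
    spectrum.mem_resolventSet_of_spectralRadius_lt (by simpa using hA)
  simpa [resolventSet] using h

/-- For a nonnegative matrix `K` with spectral radius less than one, `w = (1 - K)⁻¹ 1` satisfies
`w = 1 + K w ≥ 1`. -/
theorem Matrix.resolvent_mulVec_one {n : Type*} [Fintype n] [DecidableEq n]
    (K : Matrix n n ℝ) (hK : ∀ p q, 0 ≤ K p q)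
    (hr : spectralRadius ℂ (K.map (fun x : ℝ => (x : ℂ))) < 1) :
    let w := (1 - K)⁻¹.mulVec fun _ => 1
    (∀ p, 1 ≤ w p) ∧ ∀ p, w p = 1 + ∑ q, K p q * w q := by
  intro w
  have hmap : K.map (fun x : ℝ => (x : ℂ)) = (Complex.ofRealHom.mapMatrix K) := rfl
  have hdet : IsUnit (1 - K).det := by
    have h1 := Matrix.isUnit_one_sub_of_spectralRadius_lt_one _ hr
    rw [Matrix.isUnit_iff_isUnit_det, hmap] at h1
    have h2 : (1 - Complex.ofRealHom.mapMatrix K : Matrix n n ℂ)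
        = Complex.ofRealHom.mapMatrix (1 - K) := by rw [map_sub, map_one]
    rw [h2, ← RingHom.map_det] at h1
    simpa using h1
  have hpow : Tendsto (fun k : ℕ => K ^ k) atTop (𝓝 0) := by
    refine tendsto_pi_nhds.2 fun p => tendsto_pi_nhds.2 fun q => ?_
    have h1 := Matrix.tendsto_pow_zero_of_spectralRadius_lt_one _ hr p q
    rw [hmap] at h1
    have := (Complex.continuous_re.tendsto _).comp h1
    simp only [← map_pow] at this
    simpa [Function.comp_def] using this
  -- Neumann series: the partial sums equal `(1 - K)⁻¹ (1 - K ^ k)`. Their terms are nonnegative and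
  -- the one with `j = 0` is the identity, whence the lower bound `1`.
  have hsum : Tendsto (fun k : ℕ => (∑ j ∈ Finset.range k, K ^ j).mulVec fun _ => (1 : ℝ)) atTop
      (𝓝 w) := by
    have h2 : ∀ k : ℕ, (∑ j ∈ Finset.range k, K ^ j) = (1 - K)⁻¹ * (1 - K ^ k) := by
      intro k
      rw [← mul_neg_geom_sum, ← Matrix.mul_assoc, Matrix.nonsing_inv_mul _ hdet, Matrix.one_mul]
    have h3 : Tendsto (fun k : ℕ => ((1 - K)⁻¹ * (1 - K ^ k)).mulVec fun _ => (1 : ℝ)) atTop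
        (𝓝 (((1 - K)⁻¹ * (1 - 0)).mulVec fun _ => (1 : ℝ))) := by
      have hc : Continuous fun A : Matrix n n ℝ =>
          ((1 - K)⁻¹ * (1 - A)).mulVec fun _ => (1 : ℝ) := by fun_prop
      exact (hc.tendsto 0).comp hpow
    simpa [h2, w] using h3
  have hKj : ∀ (j : ℕ) p q, 0 ≤ (K ^ j) p q := by
    intro j
    induction j with
    | zero => intro p q; simp only [pow_zero, Matrix.one_apply]; split_ifs <;> norm_num
    | succ j ih =>
      intro p q
      rw [pow_succ, Matrix.mul_apply]
      exact Finset.sum_nonneg fun l _ => mul_nonneg (ih p l) (hK l q)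
  refine ⟨fun p => ?_, fun p => ?_⟩
  · refine ge_of_tendsto ((tendsto_pi_nhds.1 hsum) p) ?_
    filter_upwards [eventually_gt_atTop 0] with k hk
    obtain ⟨k, rfl⟩ := Nat.exists_eq_succ_of_ne_zero hk.ne'
    rw [Finset.sum_range_succ', Matrix.add_mulVec]
    simp only [pow_zero, Matrix.one_mulVec, Pi.add_apply, le_add_iff_nonneg_left]
    simp only [Matrix.mulVec, dotProduct, mul_one, Matrix.sum_apply]
    exact Finset.sum_nonneg fun _ _ => Finset.sum_nonneg fun j _ => hKj _ _ _
  · have h4 : (1 - K).mulVec w = fun _ => 1 := by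
      simp only [w]
      rw [Matrix.mulVec_mulVec, Matrix.mul_nonsing_inv _ hdet, Matrix.one_mulVec]
    have h5 := congrFun h4 p
    rw [Matrix.sub_mulVec, Matrix.one_mulVec] at h5
    simp only [Pi.sub_apply, Matrix.mulVec, dotProduct] at h5
    linarith

end LinearAlgebra

/-! ### Cauchy–Schwarz, contraction in weighted `L²`, approximation on a grid -/

section Inequalities

/-- Cauchy–Schwarz for `g^{1/2}` and `g^{1/2} f`; the total mass of the weight `g` is kept as a
factor, and it is this mass that the contraction makes small. -/
theorem ENNReal.sq_lintegral_mul_le {α : Type*} {mα : MeasurableSpace α} (ν : Measure α)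
    {g f : α → ℝ≥0∞} (hg : Measurable g) (hf : Measurable f) :
    (∫⁻ a, g a * f a ∂ν) ^ 2 ≤ (∫⁻ a, g a ∂ν) * ∫⁻ a, g a * f a ^ 2 ∂ν := by
  have h := ENNReal.lintegral_mul_le_Lp_mul_Lq ν Real.HolderConjugate.two_two
    (f := fun a => g a ^ (1 / 2 : ℝ)) (g := fun a => g a ^ (1 / 2 : ℝ) * f a)
    (by fun_prop) (by fun_prop)
  have hs : ∀ x : ℝ≥0∞, x ^ (1 / 2 : ℝ) * x ^ (1 / 2 : ℝ) = x := fun x => by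
    rw [← ENNReal.rpow_add_of_nonneg _ _ (by norm_num) (by norm_num)]; norm_num
  have hs2 : ∀ x : ℝ≥0∞, (x ^ (1 / 2 : ℝ)) ^ 2 = x := fun x => by rw [sq, hs]
  simp only [Pi.mul_apply, ← mul_assoc, hs, ENNReal.rpow_two, hs2, mul_pow] at h
  calc (∫⁻ a, g a * f a ∂ν) ^ 2
      ≤ ((∫⁻ a, g a ∂ν) ^ (1 / 2 : ℝ) * (∫⁻ a, g a * f a ^ 2 ∂ν) ^ (1 / 2 : ℝ)) ^ 2 := by gcongr
    _ = _ := by rw [mul_pow, hs2, hs2]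

/-- The convolution with a kernel `κ` that is contracting for the weights `W` is a contraction
of the weighted `L²` norms. -/
theorem lintegral_sq_convolution_le {Ω : Type*} {mΩ : MeasurableSpace Ω} (P : Measure Ω) [SFinite P]
    {κ : Fin 2 → ℝ → ℝ≥0∞} (hκ : ∀ q, Measurable (κ q)) {W : Fin 2 → ℝ≥0∞}
    (hW0 : ∀ q, W q ≠ 0) (hWt : ∀ q, W q ≠ ∞) {R : ℝ≥0∞}
    (hR : ∑ q, (∫⁻ u in Set.Ioi 0, κ q u) * W q ≤ R)
    {f : Fin 2 → ℝ → Ω → ℝ≥0∞} (hf : ∀ q, Measurable fun x : ℝ × Ω => f q x.1 x.2) {B : ℝ≥0∞}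
    (hB : ∀ q, ∀ u, 0 < u → ∫⁻ ω, f q u ω ^ 2 ∂P ≤ W q ^ 2 * B) :
    ∫⁻ ω, (∑ q, ∫⁻ u in Set.Ioi 0, κ q u * f q u ω) ^ 2 ∂P ≤ R ^ 2 * B := by
  -- Merging the sum over the sides and the integral over the lag into one integral lets
  -- Cauchy–Schwarz be applied once, with weight `κ W` of mass at most `R` and integrand `f / W`.
  set ν : Measure (Fin 2 × ℝ) := Measure.count.prod (volume.restrict (Set.Ioi 0)) with hν
  have hsum : ∀ F : Fin 2 × ℝ → ℝ≥0∞, Measurable F →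
      ∫⁻ x, F x ∂ν = ∑ q, ∫⁻ u in Set.Ioi 0, F (q, u) := by
    intro F hF
    rw [hν, lintegral_prod _ hF.aemeasurable, lintegral_count, tsum_fintype]
  have hW : ∀ q, W q * (W q)⁻¹ = 1 := fun q => ENNReal.mul_inv_cancel (hW0 q) (hWt q)
  have hκ' : Measurable fun x : Fin 2 × ℝ => κ x.1 x.2 * W x.1 :=
    measurable_from_prod_countable_right fun q => (hκ q).mul_const (W q)
  have hf' : ∀ ω, Measurable fun x : Fin 2 × ℝ => f x.1 x.2 ω * (W x.1)⁻¹ := fun ω =>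
    measurable_from_prod_countable_right fun q =>
      ((hf q).comp (measurable_id.prodMk (measurable_const (a := ω)))).mul_const (W q)⁻¹
  have hf'' : Measurable fun x : (Fin 2 × ℝ) × Ω => f x.1.1 x.1.2 x.2 * (W x.1.1)⁻¹ := by
    have : Measurable fun x : Fin 2 × (ℝ × Ω) => f x.1 x.2.1 x.2.2 * (W x.1)⁻¹ :=
      measurable_from_prod_countable_right fun q => (hf q).mul_const (W q)⁻¹
    exact this.comp (MeasurableEquiv.prodAssoc.measurable)
  have hmass : ∫⁻ x, κ x.1 x.2 * W x.1 ∂ν ≤ R := by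
    rw [hsum _ hκ']
    refine le_trans (Finset.sum_le_sum fun q _ => ?_) hR
    exact (lintegral_mul_const _ (hκ q)).le
  calc ∫⁻ ω, (∑ q, ∫⁻ u in Set.Ioi 0, κ q u * f q u ω) ^ 2 ∂P
      = ∫⁻ ω, (∫⁻ x, (κ x.1 x.2 * W x.1) * (f x.1 x.2 ω * (W x.1)⁻¹) ∂ν) ^ 2 ∂P := by
        congr 1 with ω
        rw [hsum (fun x => (κ x.1 x.2 * W x.1) * (f x.1 x.2 ω * (W x.1)⁻¹)) (hκ'.mul (hf' ω))]
        congr 2 with q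
        congr 1 with u
        rw [show κ q u * W q * (f q u ω * (W q)⁻¹) = κ q u * f q u ω * (W q * (W q)⁻¹) by ring,
          hW, mul_one]
    _ ≤ ∫⁻ ω, R * ∫⁻ x, (κ x.1 x.2 * W x.1) * (f x.1 x.2 ω * (W x.1)⁻¹) ^ 2 ∂ν ∂P := by
        refine lintegral_mono fun ω => (ENNReal.sq_lintegral_mul_le ν hκ' (hf' ω)).trans ?_
        gcongr
    _ = R * ∫⁻ x, ∫⁻ ω, (κ x.1 x.2 * W x.1) * (f x.1 x.2 ω * (W x.1)⁻¹) ^ 2 ∂P ∂ν := by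
        have hm : Measurable fun x : Ω × (Fin 2 × ℝ) =>
            (κ x.2.1 x.2.2 * W x.2.1) * (f x.2.1 x.2.2 x.1 * (W x.2.1)⁻¹) ^ 2 :=
          (hκ'.comp measurable_snd).mul ((hf''.comp measurable_swap).pow_const 2)
        rw [lintegral_const_mul _ hm.lintegral_prod_right', lintegral_lintegral_swap hm.aemeasurable]
    _ ≤ R * ∫⁻ x, (κ x.1 x.2 * W x.1) * B ∂ν := by
        gcongr R * ?_
        have h0 : ∀ᵐ x ∂ν, 0 < x.2 := by
          have : ∀ᵐ u ∂(volume.restrict (Set.Ioi (0:ℝ))), 0 < u :=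
            ae_restrict_mem measurableSet_Ioi
          rw [hν]
          exact Measure.quasiMeasurePreserving_snd.ae this
        refine lintegral_mono_ae ?_
        filter_upwards [h0] with x hx
        have hfm : Measurable fun ω => f x.1 x.2 ω := (hf x.1).comp measurable_prodMk_left
        rw [lintegral_const_mul _ (by fun_prop)]
        gcongr
        simp_rw [mul_pow]
        rw [lintegral_mul_const _ (by fun_prop)]
        calc _ ≤ W x.1 ^ 2 * B * (W x.1)⁻¹ ^ 2 := by gcongr; exact hB _ _ hx
          _ = (W x.1 * (W x.1)⁻¹) ^ 2 * B := by ring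
          _ = B := by rw [hW]; simp
    _ ≤ R * (R * B) := by
        rw [lintegral_mul_const _ hκ']
        gcongr
    _ = R ^ 2 * B := by ring

/-- `(a + b)² ≤ a² / (1 - r) + b² / r`. -/
theorem ENNReal.add_sq_le_convex {r : ℝ} (h0 : 0 < r) (h1 : r < 1) (a b : ℝ≥0∞) :
    (a + b) ^ 2 ≤ ENNReal.ofReal (1 - r)⁻¹ * a ^ 2 + ENNReal.ofReal r⁻¹ * b ^ 2 := by
  have h1' : 0 < 1 - r := by linarith
  rcases eq_or_ne a ∞ with rfl | ha
  · simp [ENNReal.mul_top, h1']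
  rcases eq_or_ne b ∞ with rfl | hb
  · simp [ENNReal.mul_top, h0]
  lift a to ℝ≥0 using ha
  lift b to ℝ≥0 using hb
  rw [← ENNReal.ofReal_coe_nnreal, ← ENNReal.ofReal_coe_nnreal, ← ENNReal.ofReal_add (by simp) (by simp),
    ← ENNReal.ofReal_pow (by positivity), ← ENNReal.ofReal_pow (by positivity),
    ← ENNReal.ofReal_pow (by positivity), ← ENNReal.ofReal_mul (by positivity),
    ← ENNReal.ofReal_mul (by positivity), ← ENNReal.ofReal_add (by positivity) (by positivity)]
  apply ENNReal.ofReal_le_ofReal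
  rw [inv_mul_eq_div, inv_mul_eq_div, div_add_div _ _ h1'.ne' h0.ne', le_div_iff₀ (by positivity)]
  -- After clearing denominators the two sides differ exactly by `(r a - (1 - r) b)²`.
  nlinarith [sq_nonneg (r * a - (1 - r) * b)]

theorem ENNReal.add_sq_le_two (a b : ℝ≥0∞) : (a + b) ^ 2 ≤ 2 * a ^ 2 + 2 * b ^ 2 := by
  have := ENNReal.add_sq_le_convex (r := 1 / 2) (by norm_num) (by norm_num) a b
  norm_num at this
  exact this

/-- If `b ≤ a + r b` with `r < 1` and `b` finite, then `b ≤ a / (1 - r)`. -/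
theorem ENNReal.le_of_le_add_mul {r : ℝ} (h0 : 0 < r) (h1 : r < 1) {a b : ℝ≥0∞} (hb : b ≠ ∞)
    (h : b ≤ a + ENNReal.ofReal r * b) : b ≤ ENNReal.ofReal (1 - r)⁻¹ * a := by
  have h1' : 0 < 1 - r := by linarith
  rcases eq_or_ne a ∞ with rfl | ha
  · simp [ENNReal.mul_top, h1']
  lift a to ℝ≥0 using ha
  lift b to ℝ≥0 using hb
  rw [← ENNReal.ofReal_coe_nnreal, ← ENNReal.ofReal_coe_nnreal, ← ENNReal.ofReal_mul h0.le,
    ← ENNReal.ofReal_add (by positivity) (by positivity),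
    ENNReal.ofReal_le_ofReal_iff (by positivity)] at h
  rw [← ENNReal.ofReal_coe_nnreal, ← ENNReal.ofReal_coe_nnreal, ← ENNReal.ofReal_mul (by positivity)]
  apply ENNReal.ofReal_le_ofReal
  rw [inv_mul_eq_div, le_div_iff₀ h1']
  linarith

/-- A monotone function is uniformly close to a Lipschitz function as soon as it is close to it
on a grid. -/
theorem abs_sub_le_sum_grid {F L : ℝ → ℝ} {c : ℝ} (hF : MonotoneOn F (Set.Icc 0 1))
    (hL : ∀ x ∈ Set.Icc (0 : ℝ) 1, ∀ y ∈ Set.Icc (0 : ℝ) 1, |L x - L y| ≤ c * |x - y|) (hc : 0 ≤ c)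
    {m : ℕ} (hm : 0 < m) {v : ℝ} (hv : v ∈ Set.Icc (0 : ℝ) 1) :
    |F v - L v| ≤ (∑ j ∈ Finset.range (m + 1), |F (j / m) - L (j / m)|) + c / m := by
  have hm' : (0 : ℝ) < m := by exact_mod_cast hm
  have hgrid : ∀ j : ℕ, j ≤ m → |F (j / m) - L (j / m)|
      ≤ ∑ j ∈ Finset.range (m + 1), |F (j / m) - L (j / m)| := fun j hj =>
    Finset.single_le_sum (f := fun j : ℕ => |F (j / m) - L (j / m)|)
      (fun _ _ => abs_nonneg _) (Finset.mem_range.2 (by omega))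
  have hmem : ∀ j : ℕ, j ≤ m → (j / m : ℝ) ∈ Set.Icc (0 : ℝ) 1 := fun j hj =>
    ⟨by positivity, by rw [div_le_one hm']; exact_mod_cast hj⟩
  set S := ∑ j ∈ Finset.range (m + 1), |F (j / m) - L (j / m)|
  -- The cell containing `v`, so that `F (j/m) ≤ F v ≤ F ((j+1)/m)`. At `v = 1` the floor would give
  -- `j = m`, beyond the last cell.
  obtain ⟨j, hj, hj1, hj2⟩ : ∃ j : ℕ, j < m ∧ (j / m : ℝ) ≤ v ∧ v ≤ ((j + 1 : ℕ) / m : ℝ) := by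
    rcases eq_or_lt_of_le hv.2 with h | h
    · refine ⟨m - 1, by omega, ?_, ?_⟩
      · rw [div_le_iff₀ hm', h, one_mul]; exact_mod_cast Nat.sub_le m 1
      · rw [le_div_iff₀ hm', h, one_mul, Nat.sub_add_cancel hm]
    · refine ⟨⌊v * m⌋₊, ?_, ?_, ?_⟩
      · rw [Nat.floor_lt (mul_nonneg hv.1 hm'.le)]
        nlinarith
      · rw [div_le_iff₀ hm']
        exact Nat.floor_le (mul_nonneg hv.1 hm'.le)
      · rw [le_div_iff₀ hm']
        push_cast
        exact (Nat.lt_floor_add_one _).le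
  have hlen : ((j + 1 : ℕ) / m : ℝ) - j / m = 1 / m := by push_cast; ring
  have h1 := hF (hmem j hj.le) hv hj1
  have h2 := hF hv (hmem (j + 1) hj) hj2
  have h3 := abs_le.1 (hgrid j hj.le)
  have h4 := abs_le.1 (hgrid (j + 1) hj)
  have hcm : ∀ d : ℝ, d ≤ 1 / m → c * d ≤ c / m := fun d hd => by
    rw [div_eq_mul_one_div c]; exact mul_le_mul_of_nonneg_left hd hc
  have h5 := (abs_le.1 ((hL _ hv _ (hmem j hj.le)).trans
    (hcm _ (by rw [abs_of_nonneg (by linarith)]; linarith)))).2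
  have h6 := (abs_le.1 ((hL _ hv _ (hmem (j + 1) hj)).trans
    (hcm _ (by rw [abs_of_nonpos (by linarith)]; linarith)))).1
  rw [abs_le]
  constructor <;> linarith

end Inequalities

/-! ### Second moments of compensated jump processes -/

section Bracket

/-- The squared distance of two extended nonnegative reals, as an element of `[0, ∞]`
(meaningful for finite arguments). -/
noncomputable def sqDist (x y : ℝ≥0∞) : ℝ≥0∞ := ENNReal.ofReal ((x.toReal - y.toReal) ^ 2)

theorem measurable_sqDist {α : Type*} {mα : MeasurableSpace α} {f g : α → ℝ≥0∞}
    (hf : Measurable f) (hg : Measurable g) : Measurable fun a => sqDist (f a) (g a) := by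
  unfold sqDist
  fun_prop

theorem ENNReal.ofReal_toReal_sq {x : ℝ≥0∞} (hx : x ≠ ∞) : ENNReal.ofReal (x.toReal ^ 2) = x ^ 2 := by
  rw [ENNReal.ofReal_pow ENNReal.toReal_nonneg, ENNReal.ofReal_toReal hx]

theorem le_enorm_sub_add {x y : ℝ≥0∞} (hx : x ≠ ∞) (hy : y ≠ ∞) :
    x ≤ ‖x.toReal - y.toReal‖ₑ + y := by
  calc x = ‖x.toReal‖ₑ := by
        rw [Real.enorm_eq_ofReal ENNReal.toReal_nonneg, ENNReal.ofReal_toReal hx]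
    _ = ‖(x.toReal - y.toReal) + y.toReal‖ₑ := by rw [sub_add_cancel]
    _ ≤ ‖x.toReal - y.toReal‖ₑ + ‖y.toReal‖ₑ := enorm_add_le _ _
    _ = _ := by rw [Real.enorm_eq_ofReal (r := y.toReal) ENNReal.toReal_nonneg, ENNReal.ofReal_toReal hy]

theorem sqDist_eq_enorm (x y : ℝ≥0∞) : sqDist x y = ‖x.toReal - y.toReal‖ₑ ^ 2 := by
  rw [sqDist, Real.enorm_eq_ofReal_abs, ← ENNReal.ofReal_pow (abs_nonneg _), sq_abs]

/-- The cells of the dyadic partition of `(a, b]`. -/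
def dyadicCell (a b : ℝ) (m j : ℕ) : Set ℝ :=
  Set.Ioc (a + (b - a) * (j / 2 ^ m)) (a + (b - a) * ((j + 1 : ℕ) / 2 ^ m))

theorem dyadicCell_split {a b : ℝ} (hab : a ≤ b) (m j : ℕ) :
    dyadicCell a b m j = dyadicCell a b (m + 1) (2 * j) ∪ dyadicCell a b (m + 1) (2 * j + 1) := by
  have h0 : 0 ≤ b - a := by linarith
  unfold dyadicCell
  rw [Set.Ioc_union_Ioc_eq_Ioc]
  · congr 2 <;> · congr 1; push_cast; field_simp; ring
  · gcongr; omega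
  · gcongr; omega

theorem dyadicCell_disjoint {a b : ℝ} (m j : ℕ) :
    Disjoint (dyadicCell a b m j) (dyadicCell a b m (j + 1)) :=
  Set.Ioc_disjoint_Ioc_of_le le_rfl

theorem measurableSet_dyadicCell (a b : ℝ) (m j : ℕ) : MeasurableSet (dyadicCell a b m j) :=
  measurableSet_Ioc

theorem Finset.sum_range_two_mul {M : Type*} [AddCommMonoid M] (f : ℕ → M) (n : ℕ) :
    ∑ j ∈ Finset.range (2 * n), f j = ∑ j ∈ Finset.range n, (f (2 * j) + f (2 * j + 1)) := by
  induction n with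
  | zero => simp
  | succ n ih => rw [Finset.sum_range_succ, ← ih, mul_add_one, Finset.sum_range_succ,
      Finset.sum_range_succ, add_assoc]

/-- The sum of the squared masses of the dyadic cells. -/
noncomputable def dyadicVariation (a b : ℝ) (m : ℕ) (ν : Measure ℝ) : ℝ≥0∞ :=
  ∑ j ∈ Finset.range (2 ^ m), ν (dyadicCell a b m j) ^ 2

/-- Splitting a cell replaces `(x + y)²` by `x² + y²`. -/
theorem dyadicVariation_antitone {a b : ℝ} (hab : a ≤ b) (ν : Measure ℝ) :
    Antitone fun m => dyadicVariation a b m ν := by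
  refine antitone_nat_of_succ_le fun m => ?_
  unfold dyadicVariation
  rw [pow_succ', Finset.sum_range_two_mul]
  refine Finset.sum_le_sum fun j _ => ?_
  rw [dyadicCell_split hab m j,
    measure_union (dyadicCell_disjoint _ _) (measurableSet_dyadicCell _ _ _ _)]
  rw [add_sq]
  gcongr
  exact le_self_add

theorem iUnion_dyadicCell {a b : ℝ} (hab : a ≤ b) (m : ℕ) :
    ∀ n : ℕ, ⋃ j ∈ Finset.range n, dyadicCell a b m j = Set.Ioc a (a + (b - a) * (n / 2 ^ m)) := by
  have h0 : 0 ≤ b - a := by linarith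
  intro n
  induction n with
  | zero => simp
  | succ n ih =>
    rw [Finset.range_add_one, Finset.set_biUnion_insert, ih, Set.union_comm, dyadicCell,
      Set.Ioc_union_Ioc_eq_Ioc]
    · have : (0 : ℝ) ≤ (b - a) * (n / 2 ^ m) := by positivity
      linarith
    · gcongr; omega

theorem dyadicCell_pairwiseDisjoint {a b : ℝ} (hab : a ≤ b) (m : ℕ) :
    Pairwise fun i j => Disjoint (dyadicCell a b m i) (dyadicCell a b m j) := by
  have h0 : 0 ≤ b - a := by linarith
  have hlt : ∀ i j : ℕ, i < j → Disjoint (dyadicCell a b m i) (dyadicCell a b m j) := by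
    intro i j hij
    refine Set.Ioc_disjoint_Ioc_of_le ?_
    gcongr
    omega
  intro i j hij
  rcases lt_or_gt_of_ne hij with h | h
  · exact hlt i j h
  · exact (hlt j i h).symm

/-- In the limit only the atoms contribute to the dyadic variation. -/
theorem iInf_dyadicVariation_le {a b : ℝ} (hab : a ≤ b) (ν : Measure ℝ)
    (hν : ν (Set.Ioc a b) ≠ ∞) :
    ⨅ m, dyadicVariation a b m ν ≤ ∫⁻ x in Set.Ioc a b, ν {x} ∂ν := by
  have h0 : 0 ≤ b - a := by linarith
  set ν' := ν.restrict (Set.Ioc a b) with hν'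
  have : IsFiniteMeasure ν' := ⟨by rw [hν', Measure.restrict_apply_univ]; exact hν.lt_top⟩
  -- The dyadic variation is the product measure of the squares along the diagonal. These decrease
  -- into the diagonal, whose product measure is the integral of the atoms by Fubini.
  let D : ℕ → Set (ℝ × ℝ) := fun m =>
    ⋃ j ∈ Finset.range (2 ^ m), dyadicCell a b m j ×ˢ dyadicCell a b m j
  have hsub : ∀ m, ∀ j < 2 ^ m, dyadicCell a b m j ⊆ Set.Ioc a b := by
    intro m j hj
    have h := iUnion_dyadicCell hab m (2 ^ m)
    rw [show a + (b - a) * (((2 ^ m : ℕ) : ℝ) / 2 ^ m) = b by push_cast; field_simp; ring] at h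
    rw [← h]
    exact Set.subset_biUnion_of_mem (u := fun j => dyadicCell a b m j) (Finset.mem_range.2 hj)
  have hDm : ∀ m, MeasurableSet (D m) := fun m =>
    Finset.measurableSet_biUnion _ fun j _ =>
      (measurableSet_dyadicCell _ _ _ _).prod (measurableSet_dyadicCell _ _ _ _)
  have hD : ∀ m, (ν'.prod ν') (D m) = dyadicVariation a b m ν := by
    intro m
    simp only [D]
    rw [measure_biUnion_finset]
    · refine Finset.sum_congr rfl fun j hj => ?_
      rw [Measure.prod_prod, hν', Measure.restrict_apply (measurableSet_dyadicCell _ _ _ _),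
        Set.inter_eq_left.2 (hsub m j (Finset.mem_range.1 hj)), sq]
    · intro i _ j _ hij
      exact Set.disjoint_left.2 fun x hx hy =>
        Set.disjoint_left.1 (dyadicCell_pairwiseDisjoint hab m hij) hx.1 hy.1
    · exact fun j _ => (measurableSet_dyadicCell _ _ _ _).prod (measurableSet_dyadicCell _ _ _ _)
  have hDanti : Antitone D := by
    refine antitone_nat_of_succ_le fun m => ?_
    intro x hx
    simp only [D, Set.mem_iUnion, Finset.mem_range, exists_prop, Set.mem_prod] at hx ⊢
    obtain ⟨j, hj, hx1, hx2⟩ := hx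
    refine ⟨j / 2, by rw [pow_succ] at hj; omega, ?_⟩
    rw [dyadicCell_split hab m (j / 2)]
    rcases Nat.even_or_odd' j with ⟨k, rfl | rfl⟩
    · rw [Nat.mul_div_cancel_left k (by norm_num)]; exact ⟨Or.inl hx1, Or.inl hx2⟩
    · rw [show (2 * k + 1) / 2 = k by omega]; exact ⟨Or.inr hx1, Or.inr hx2⟩
  have hlim := tendsto_measure_iInter_atTop (μ := ν'.prod ν') (s := D)
    (fun m => (hDm m).nullMeasurableSet) hDanti ⟨0, measure_ne_top _ _⟩
  simp only [Function.comp_def, hD] at hlim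
  rw [tendsto_nhds_unique (tendsto_atTop_iInf (dyadicVariation_antitone hab ν)) hlim]
  have hdiag : MeasurableSet {x : ℝ × ℝ | x.1 = x.2} := measurableSet_eq_fun measurable_fst measurable_snd
  have hsubset : (⋂ m, D m) ⊆ {x : ℝ × ℝ | x.1 = x.2} := by
    intro x hx
    have hx' : ∀ m : ℕ, |x.1 - x.2| ≤ (b - a) * (1 / 2) ^ m := by
      intro m
      have := Set.mem_iInter.1 hx m
      simp only [D, Set.mem_iUnion, Finset.mem_range, exists_prop, Set.mem_prod, dyadicCell,
        Set.mem_Ioc] at this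
      obtain ⟨j, -, ⟨h1, h2⟩, h3, h4⟩ := this
      have : (b - a) * ((j + 1 : ℕ) / 2 ^ m) = (b - a) * (j / 2 ^ m) + (b - a) * (1 / 2) ^ m := by
        push_cast; rw [one_div_pow]; ring
      rw [abs_le]
      constructor <;> linarith
    have hl : Tendsto (fun m : ℕ => (b - a) * (1 / 2 : ℝ) ^ m) atTop (𝓝 ((b - a) * 0)) :=
      (tendsto_pow_atTop_nhds_zero_of_lt_one (by norm_num) (by norm_num)).const_mul _
    have := ge_of_tendsto' hl hx'
    rw [mul_zero] at this
    exact sub_eq_zero.1 (abs_eq_zero.1 (le_antisymm this (abs_nonneg _)))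
  refine (measure_mono hsubset).trans ?_
  rw [Measure.prod_apply hdiag]
  refine lintegral_mono fun x => ?_
  refine (measure_mono (t := {x}) ?_).trans (Measure.restrict_apply_le _ _)
  intro y hy
  simpa using hy.symm

variable {Ω : Type*} {mΩ : MeasurableSpace Ω}

/-- The second moment of a martingale of finite variation `N - Λ` with continuous compensator `Λ`
is controlled by the squares of the atoms of `N`.  The martingale property is only used through
the orthogonality of increments. -/
theorem lintegral_sqDist_le_atoms (P : Measure Ω) [IsFiniteMeasure P] {N Λ : Ω → Measure ℝ}
    {a b : ℝ} (hab : a ≤ b)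
    (hNm : ∀ s t, Measurable fun ω => N ω (Set.Ioc s t))
    (hΛm : ∀ s t, Measurable fun ω => Λ ω (Set.Ioc s t))
    (hN2 : ∫⁻ ω, N ω (Set.Ioc a b) ^ 2 ∂P ≠ ∞) (hΛ2 : ∫⁻ ω, Λ ω (Set.Ioc a b) ^ 2 ∂P ≠ ∞)
    (hNorth : ∀ s t, a ≤ s → s ≤ t → t ≤ b →
      ∫⁻ ω, N ω (Set.Ioc a s) * N ω (Set.Ioc s t) ∂P =
        ∫⁻ ω, N ω (Set.Ioc a s) * Λ ω (Set.Ioc s t) ∂P)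
    (hΛorth : ∀ s t, a ≤ s → s ≤ t → t ≤ b →
      ∫⁻ ω, Λ ω (Set.Ioc a s) * N ω (Set.Ioc s t) ∂P =
        ∫⁻ ω, Λ ω (Set.Ioc a s) * Λ ω (Set.Ioc s t) ∂P)
    (hΛ0 : ∀ ω x, Λ ω {x} = 0) :
    ∫⁻ ω, sqDist (N ω (Set.Ioc a b)) (Λ ω (Set.Ioc a b)) ∂P ≤
      2 * ∫⁻ ω, ∫⁻ x in Set.Ioc a b, N ω {x} ∂(N ω) ∂P := by
  have hfin : ∀ X : Ω → Measure ℝ, (∀ s t, Measurable fun ω => X ω (Set.Ioc s t)) →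
      ∫⁻ ω, X ω (Set.Ioc a b) ^ 2 ∂P ≠ ∞ → ∀ᵐ ω ∂P, X ω (Set.Ioc a b) ≠ ∞ := by
    intro X hX hX2
    filter_upwards [ae_lt_top ((hX a b).pow_const 2) hX2] with ω hω
    rintro h
    simp [h] at hω
  have hsub : ∀ s t, a ≤ s → t ≤ b → Set.Ioc s t ⊆ Set.Ioc a b := fun s t hs ht =>
    Set.Ioc_subset_Ioc hs ht
  have hmem : ∀ X : Ω → Measure ℝ, (∀ s t, Measurable fun ω => X ω (Set.Ioc s t)) →
      ∫⁻ ω, X ω (Set.Ioc a b) ^ 2 ∂P ≠ ∞ → ∀ s t, a ≤ s → t ≤ b →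
      MemLp (fun ω => (X ω (Set.Ioc s t)).toReal) 2 P := by
    intro X hX hX2 s t hs ht
    rw [memLp_two_iff_integrable_sq ((hX s t).ennreal_toReal.aestronglyMeasurable)]
    refine ⟨((hX s t).ennreal_toReal.pow_const 2).aestronglyMeasurable, ?_⟩
    rw [hasFiniteIntegral_iff_ofReal (Eventually.of_forall fun _ => by positivity)]
    refine lt_of_le_of_lt (lintegral_mono_ae ?_) hX2.lt_top
    filter_upwards [hfin X hX hX2] with ω hω
    have hle : X ω (Set.Ioc s t) ≤ X ω (Set.Ioc a b) := measure_mono (hsub s t hs ht)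
    rw [ENNReal.ofReal_toReal_sq (ne_top_of_le_ne_top hω hle)]
    gcongr
  have hmul : ∀ X Y : Ω → Measure ℝ, (∀ s t, Measurable fun ω => X ω (Set.Ioc s t)) →
      (∀ s t, Measurable fun ω => Y ω (Set.Ioc s t)) → ∀ s t,
      ∫ ω, (X ω (Set.Ioc a s)).toReal * (Y ω (Set.Ioc s t)).toReal ∂P =
        (∫⁻ ω, X ω (Set.Ioc a s) * Y ω (Set.Ioc s t) ∂P).toReal ∨
      ¬ ∀ᵐ ω ∂P, X ω (Set.Ioc a s) * Y ω (Set.Ioc s t) < ∞ := by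
    intro X Y hX hY s t
    by_cases h : ∀ᵐ ω ∂P, X ω (Set.Ioc a s) * Y ω (Set.Ioc s t) < ∞
    · left
      have hm : Measurable fun ω => X ω (Set.Ioc a s) * Y ω (Set.Ioc s t) := (hX a s).mul (hY s t)
      rw [← integral_toReal hm.aemeasurable h]
      simp_rw [ENNReal.toReal_mul]
    · exact Or.inr h
  have hmul' : ∀ X Y : Ω → Measure ℝ, (∀ s t, Measurable fun ω => X ω (Set.Ioc s t)) →
      ∫⁻ ω, X ω (Set.Ioc a b) ^ 2 ∂P ≠ ∞ →
      (∀ s t, Measurable fun ω => Y ω (Set.Ioc s t)) →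
      ∫⁻ ω, Y ω (Set.Ioc a b) ^ 2 ∂P ≠ ∞ → ∀ s t, a ≤ s → s ≤ t → t ≤ b →
      ∫ ω, (X ω (Set.Ioc a s)).toReal * (Y ω (Set.Ioc s t)).toReal ∂P =
        (∫⁻ ω, X ω (Set.Ioc a s) * Y ω (Set.Ioc s t) ∂P).toReal := by
    intro X Y hX hX2 hY hY2 s t hs hst ht
    refine (hmul X Y hX hY s t).resolve_right (not_not.2 ?_)
    filter_upwards [hfin X hX hX2, hfin Y hY hY2] with ω h1 h2
    exact ENNReal.mul_lt_top (lt_of_le_of_lt (measure_mono (hsub a s le_rfl (hst.trans ht))) h1.lt_top)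
      (lt_of_le_of_lt (measure_mono (hsub s t hs ht)) h2.lt_top)
  set M : ℝ → ℝ → Ω → ℝ := fun s t ω => (N ω (Set.Ioc s t)).toReal - (Λ ω (Set.Ioc s t)).toReal
    with hM
  have hMmem : ∀ s t, a ≤ s → t ≤ b → MemLp (M s t) 2 P := fun s t hs ht =>
    (hmem N hNm hN2 s t hs ht).sub (hmem Λ hΛm hΛ2 s t hs ht)
  -- Of the four products in `M a s * M s t`, `N N` cancels `N Λ` by `hNorth` and `Λ N` cancels `Λ
  -- Λ` by `hΛorth`.
  have horth : ∀ s t, a ≤ s → s ≤ t → t ≤ b → ∫ ω, M a s ω * M s t ω ∂P = 0 := by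
    intro s t hs hst ht
    have hN1 := hmem N hNm hN2 a s le_rfl (hst.trans ht)
    have hN2' := hmem N hNm hN2 s t hs ht
    have hL1 := hmem Λ hΛm hΛ2 a s le_rfl (hst.trans ht)
    have hL2 := hmem Λ hΛm hΛ2 s t hs ht
    have hexp : ∀ ω, M a s ω * M s t ω =
        ((N ω (Set.Ioc a s)).toReal * (N ω (Set.Ioc s t)).toReal -
          (N ω (Set.Ioc a s)).toReal * (Λ ω (Set.Ioc s t)).toReal) -
        ((Λ ω (Set.Ioc a s)).toReal * (N ω (Set.Ioc s t)).toReal -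
          (Λ ω (Set.Ioc a s)).toReal * (Λ ω (Set.Ioc s t)).toReal) := fun ω => by
      simp only [hM]; ring
    simp_rw [hexp]
    have i1 := hN1.integrable_mul hN2'
    have i2 := hN1.integrable_mul hL2
    have i3 := hL1.integrable_mul hN2'
    have i4 := hL1.integrable_mul hL2
    simp only [Pi.mul_def] at i1 i2 i3 i4
    have i12 : Integrable (fun ω => (N ω (Set.Ioc a s)).toReal * (N ω (Set.Ioc s t)).toReal -
        (N ω (Set.Ioc a s)).toReal * (Λ ω (Set.Ioc s t)).toReal) P := i1.sub i2
    have i34 : Integrable (fun ω => (Λ ω (Set.Ioc a s)).toReal * (N ω (Set.Ioc s t)).toReal -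
        (Λ ω (Set.Ioc a s)).toReal * (Λ ω (Set.Ioc s t)).toReal) P := i3.sub i4
    rw [integral_sub i12 i34, integral_sub i1 i2, integral_sub i3 i4,
      hmul' N N hNm hN2 hNm hN2 s t hs hst ht, hmul' N Λ hNm hN2 hΛm hΛ2 s t hs hst ht,
      hmul' Λ N hΛm hΛ2 hNm hN2 s t hs hst ht, hmul' Λ Λ hΛm hΛ2 hΛm hΛ2 s t hs hst ht,
      hNorth s t hs hst ht, hΛorth s t hs hst ht]
    simp
  have hadd : ∀ s t, a ≤ s → s ≤ t → t ≤ b → ∀ᵐ ω ∂P, M a t ω = M a s ω + M s t ω := by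
    intro s t hs hst ht
    have hadd' : ∀ ν : Measure ℝ, ν (Set.Ioc a b) ≠ ∞ → (ν (Set.Ioc a t)).toReal =
        (ν (Set.Ioc a s)).toReal + (ν (Set.Ioc s t)).toReal := by
      intro ν hν
      rw [← ENNReal.toReal_add
        (ne_top_of_le_ne_top hν (measure_mono (hsub a s le_rfl (hst.trans ht))))
        (ne_top_of_le_ne_top hν (measure_mono (hsub s t hs ht))),
        ← measure_union (Set.Ioc_disjoint_Ioc_of_le le_rfl) measurableSet_Ioc,
        Set.Ioc_union_Ioc_eq_Ioc hs hst]
    filter_upwards [hfin N hNm hN2, hfin Λ hΛm hΛ2] with ω h1 h2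
    simp only [hM]
    rw [hadd' _ h1, hadd' _ h2]
    ring
  have hpyth : ∀ s t, a ≤ s → s ≤ t → t ≤ b →
      ∫ ω, M a t ω ^ 2 ∂P = ∫ ω, M a s ω ^ 2 ∂P + ∫ ω, M s t ω ^ 2 ∂P := by
    intro s t hs hst ht
    have i1 := (hMmem a s le_rfl (hst.trans ht)).integrable_sq
    have i2 := (hMmem s t hs ht).integrable_sq
    have i3 := ((hMmem a s le_rfl (hst.trans ht)).integrable_mul (hMmem s t hs ht))
    simp only [Pi.mul_def] at i3
    have : ∫ ω, M a t ω ^ 2 ∂P =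
        ∫ ω, (M a s ω ^ 2 + M s t ω ^ 2 + 2 * (M a s ω * M s t ω)) ∂P := by
      refine integral_congr_ae ?_
      filter_upwards [hadd s t hs hst ht] with ω h
      rw [h]; ring
    have i12 : Integrable (fun ω => M a s ω ^ 2 + M s t ω ^ 2) P := i1.add i2
    rw [this, integral_add i12 (i3.const_mul 2), integral_add i1 i2, integral_const_mul,
      horth s t hs hst ht]
    ring
  have h0 : 0 ≤ b - a := by linarith
  have hgrid : ∀ m n : ℕ, n ≤ 2 ^ m → ∫ ω, M a (a + (b - a) * (n / 2 ^ m)) ω ^ 2 ∂P =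
      ∑ j ∈ Finset.range n, ∫ ω, M (a + (b - a) * (j / 2 ^ m))
        (a + (b - a) * ((j + 1 : ℕ) / 2 ^ m)) ω ^ 2 ∂P := by
    intro m n
    induction n with
    | zero => simp [hM]
    | succ n ih =>
      intro hn
      rw [Finset.sum_range_succ, ← ih (by omega)]
      refine hpyth _ _ ?_ ?_ ?_
      · have : (0 : ℝ) ≤ (b - a) * (n / 2 ^ m) := by positivity
        linarith
      · gcongr; omega
      · have : ((n + 1 : ℕ) : ℝ) / 2 ^ m ≤ 1 := by
          rw [div_le_one (by positivity)]; exact_mod_cast hn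
        nlinarith
  have hofReal : ∀ s t, a ≤ s → t ≤ b →
      ENNReal.ofReal (∫ ω, M s t ω ^ 2 ∂P) = ∫⁻ ω, ENNReal.ofReal (M s t ω ^ 2) ∂P := fun s t hs ht =>
    ofReal_integral_eq_lintegral_ofReal (hMmem s t hs ht).integrable_sq
      (Eventually.of_forall fun _ => sq_nonneg _)
  have hVm : ∀ X : Ω → Measure ℝ, (∀ s t, Measurable fun ω => X ω (Set.Ioc s t)) → ∀ m,
      Measurable fun ω => dyadicVariation a b m (X ω) := fun X hX m =>
    Finset.measurable_sum _ fun j _ => (hX _ _).pow_const 2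
  -- By Pythagoras the second moment is the sum over the cells; on each cell `(x - y)² ≤ 2 x² + 2
  -- y²` is precise enough, since the part due to `Λ` vanishes in the limit.
  have hbound : ∀ m, ∫⁻ ω, sqDist (N ω (Set.Ioc a b)) (Λ ω (Set.Ioc a b)) ∂P ≤
      2 * ∫⁻ ω, dyadicVariation a b m (N ω) ∂P + 2 * ∫⁻ ω, dyadicVariation a b m (Λ ω) ∂P := by
    intro m
    have hb : a + (b - a) * (((2 ^ m : ℕ) : ℝ) / 2 ^ m) = b := by push_cast; field_simp; ring
    have h1 := hgrid m (2 ^ m) le_rfl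
    rw [hb] at h1
    have hcell : ∀ j ∈ Finset.range (2 ^ m), a ≤ a + (b - a) * ((j : ℝ) / 2 ^ m) ∧
        a + (b - a) * ((j + 1 : ℕ) / 2 ^ m) ≤ b := by
      intro j hj
      constructor
      · have : (0 : ℝ) ≤ (b - a) * (j / 2 ^ m) := by positivity
        linarith
      · have : ((j + 1 : ℕ) : ℝ) / 2 ^ m ≤ 1 := by
          rw [div_le_one (by positivity)]; exact_mod_cast Finset.mem_range.1 hj
        nlinarith
    calc ∫⁻ ω, sqDist (N ω (Set.Ioc a b)) (Λ ω (Set.Ioc a b)) ∂P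
        = ENNReal.ofReal (∫ ω, M a b ω ^ 2 ∂P) := (hofReal a b le_rfl le_rfl).symm
      _ = ∑ j ∈ Finset.range (2 ^ m), ∫⁻ ω, ENNReal.ofReal (M (a + (b - a) * (j / 2 ^ m))
            (a + (b - a) * ((j + 1 : ℕ) / 2 ^ m)) ω ^ 2) ∂P := by
          rw [h1, ENNReal.ofReal_sum_of_nonneg fun j _ => integral_nonneg fun _ => sq_nonneg _]
          exact Finset.sum_congr rfl fun j hj => hofReal _ _ (hcell j hj).1 (hcell j hj).2
      _ ≤ ∑ j ∈ Finset.range (2 ^ m), (2 * ∫⁻ ω, N ω (dyadicCell a b m j) ^ 2 ∂P +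
            2 * ∫⁻ ω, Λ ω (dyadicCell a b m j) ^ 2 ∂P) := by
          refine Finset.sum_le_sum fun j hj => ?_
          have m1 : Measurable fun ω => N ω (dyadicCell a b m j) ^ 2 := (hNm _ _).pow_const 2
          have m2 : Measurable fun ω => Λ ω (dyadicCell a b m j) ^ 2 := (hΛm _ _).pow_const 2
          rw [← lintegral_const_mul _ m1, ← lintegral_const_mul _ m2,
            ← lintegral_add_left (m1.const_mul 2)]
          refine lintegral_mono fun ω => ?_
          simp only [hM]
          set x := N ω (dyadicCell a b m j)
          set y := Λ ω (dyadicCell a b m j)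
          have hx : ENNReal.ofReal (x.toReal ^ 2) ≤ x ^ 2 := by
            rw [ENNReal.ofReal_pow ENNReal.toReal_nonneg]
            gcongr
            exact ENNReal.ofReal_toReal_le
          have hy : ENNReal.ofReal (y.toReal ^ 2) ≤ y ^ 2 := by
            rw [ENNReal.ofReal_pow ENNReal.toReal_nonneg]
            gcongr
            exact ENNReal.ofReal_toReal_le
          calc ENNReal.ofReal ((x.toReal - y.toReal) ^ 2)
              ≤ ENNReal.ofReal (2 * x.toReal ^ 2 + 2 * y.toReal ^ 2) := by
                apply ENNReal.ofReal_le_ofReal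
                nlinarith [sq_nonneg (x.toReal + y.toReal)]
            _ = 2 * ENNReal.ofReal (x.toReal ^ 2) + 2 * ENNReal.ofReal (y.toReal ^ 2) := by
                rw [ENNReal.ofReal_add (by positivity) (by positivity),
                  ENNReal.ofReal_mul (by norm_num), ENNReal.ofReal_mul (by norm_num)]
                norm_num
            _ ≤ _ := by gcongr
      _ = _ := by
          rw [Finset.sum_add_distrib, ← Finset.mul_sum, ← Finset.mul_sum]
          unfold dyadicVariation
          have m1 : ∀ j ∈ Finset.range (2 ^ m), Measurable fun ω => N ω (dyadicCell a b m j) ^ 2 :=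
            fun j _ => (hNm _ _).pow_const 2
          have m2 : ∀ j ∈ Finset.range (2 ^ m), Measurable fun ω => Λ ω (dyadicCell a b m j) ^ 2 :=
            fun j _ => (hΛm _ _).pow_const 2
          rw [lintegral_finsetSum _ m1, lintegral_finsetSum _ m2]
  have hlim : ∀ X : Ω → Measure ℝ, (∀ s t, Measurable fun ω => X ω (Set.Ioc s t)) →
      ∫⁻ ω, X ω (Set.Ioc a b) ^ 2 ∂P ≠ ∞ →
      Tendsto (fun m => ∫⁻ ω, dyadicVariation a b m (X ω) ∂P) atTop
        (𝓝 (∫⁻ ω, ⨅ m, dyadicVariation a b m (X ω) ∂P)) := by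
    intro X hX hX2
    rw [lintegral_iInf (hVm X hX)
      (fun m n hmn ω => dyadicVariation_antitone hab (X ω) hmn)]
    · exact tendsto_atTop_iInf fun m n hmn =>
        lintegral_mono fun ω => dyadicVariation_antitone hab (X ω) hmn
    -- At level `0` the only cell is `(a, b]`, so the decreasing sequence starts from a finite
    -- integral.
    · simpa [dyadicVariation, dyadicCell] using hX2
  have hfinal := ge_of_tendsto' (((ENNReal.Tendsto.const_mul (hlim N hNm hN2) (Or.inr (by norm_num))).add
    (ENNReal.Tendsto.const_mul (hlim Λ hΛm hΛ2) (Or.inr (by norm_num))))) hbound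
  refine hfinal.trans ?_
  have hz : ∫⁻ ω, ⨅ m, dyadicVariation a b m (Λ ω) ∂P = 0 := by
    rw [lintegral_congr_ae (g := fun _ => 0), lintegral_zero]
    filter_upwards [hfin Λ hΛm hΛ2] with ω hω
    refine le_antisymm ((iInf_dyadicVariation_le hab _ hω).trans ?_) zero_le
    simp [hΛ0]
  rw [hz, mul_zero, add_zero]
  gcongr 2 * ?_
  refine lintegral_mono_ae ?_
  filter_upwards [hfin N hNm hN2] with ω hω
  exact iInf_dyadicVariation_le hab _ hω

end Bracket

/-! ### Parameters of the model, weights and integrated excitation -/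

/-- The parameters of a Hawkes model whose kernel is contracting: law `ρ` of the marks, baseline
`μ`, kernel `k`, and weights `w` for which the matrix `E(J) ∫ k` is a contraction. -/
structure HawkesModel where
  ρ : Measure ℝ
  prob : IsProbabilityMeasure ρ
  pos : ρ (Set.Iic 0) = 0
  sq_ne_top : ∫⁻ x, ENNReal.ofReal x ^ 2 ∂ρ ≠ ∞
  μ : ℝ → ℝ
  measurable_μ : Measurable μ
  μbar : ℝ
  μ_le : ∀ s, μ s ≤ μbar
  k : Fin 2 → Fin 2 → ℝ → ℝ≥0∞
  measurable_k : ∀ p q, Measurable (k p q)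
  w : Fin 2 → ℝ≥0∞
  one_le_w : ∀ p, 1 ≤ w p
  w_ne_top : ∀ p, w p ≠ ∞
  w_eq : ∀ p, w p = 1 + ∑ q, (∫⁻ u in Set.Ioi 0, (∫⁻ x, ENNReal.ofReal x ∂ρ) * k p q u) * w q
  r : ℝ
  r_pos : 0 < r
  r_lt_one : r < 1
  contract : ∀ p, ∑ q, (∫⁻ u in Set.Ioi 0, (∫⁻ x, ENNReal.ofReal x ∂ρ) * k p q u) * w q ≤
    ENNReal.ofReal r * w p

/-- The sum of the point masses `c n` sitting at times `τ n ≤ t`. -/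
noncomputable def pointSum (τ : ℕ → ℝ) (c : ℕ → ℝ≥0∞) (t : ℝ) : ℝ≥0∞ :=
  ∑' n, if τ n ≤ t then c n else 0

/-- The excitation at time `t` of the points `τ n` with masses `c n`, for the kernel `k`. -/
noncomputable def excitation (k : Fin 2 → Fin 2 → ℝ → ℝ≥0∞) (τ : ℕ → ℝ) (c : ℕ → Fin 2 → ℝ≥0∞)
    (p : Fin 2) (t : ℝ) : ℝ≥0∞ :=
  ∑ q, ∑' n, if τ n < t then k p q (t - τ n) * c n q else 0

theorem pointSum_mono (τ : ℕ → ℝ) (c : ℕ → ℝ≥0∞) : Monotone (pointSum τ c) := by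
  intro s t hst
  refine ENNReal.tsum_le_tsum fun n => ?_
  split_ifs with h1 h2
  · exact le_rfl
  · exact absurd (h1.trans hst) h2
  · exact zero_le
  · exact le_rfl

theorem measurable_pointSum {α : Type*} {mα : MeasurableSpace α} {τ : ℕ → α → ℝ}
    {c : ℕ → α → ℝ≥0∞} (hτ : ∀ n, Measurable (τ n)) (hc : ∀ n, Measurable (c n)) :
    Measurable fun x : ℝ × α => pointSum (fun n => τ n x.2) (fun n => c n x.2) x.1 := by
  refine Measurable.tsum fun n => Measurable.ite ?_ ?_ measurable_const
  · exact measurableSet_le ((hτ n).comp measurable_snd) measurable_fst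
  · exact (hc n).comp measurable_snd

theorem measurable_excitation {α : Type*} {mα : MeasurableSpace α}
    {k : Fin 2 → Fin 2 → ℝ → ℝ≥0∞} (hk : ∀ p q, Measurable (k p q)) {τ : ℕ → α → ℝ}
    {c : ℕ → α → Fin 2 → ℝ≥0∞} (hτ : ∀ n, Measurable (τ n))
    (hc : ∀ n q, Measurable fun a => c n a q) (p : Fin 2) :
    Measurable fun x : ℝ × α => excitation k (fun n => τ n x.2) (fun n => c n x.2) p x.1 := by
  refine Finset.measurable_sum _ fun q _ => Measurable.tsum fun n =>
    Measurable.ite ?_ ?_ measurable_const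
  · exact measurableSet_lt ((hτ n).comp measurable_snd) measurable_fst
  · exact ((hk p q).comp (measurable_fst.sub ((hτ n).comp measurable_snd))).mul
      ((hc n q).comp measurable_snd)

/-- The total excitation on `(0, t]`. -/
theorem lintegral_excitation {k : Fin 2 → Fin 2 → ℝ → ℝ≥0∞} (hk : ∀ p q, Measurable (k p q))
    {τ : ℕ → ℝ} (hτ : ∀ n, 0 < τ n) (c : ℕ → Fin 2 → ℝ≥0∞) (p : Fin 2) (t : ℝ) :
    ∫⁻ u in Set.Ioc 0 t, excitation k τ c p u =
      ∑ q, ∫⁻ v in Set.Ioi 0, k p q v * pointSum τ (fun n => c n q) (t - v) := by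
  unfold excitation pointSum
  have hm : ∀ q n, Measurable fun u => if τ n < u then k p q (u - τ n) * c n q else 0 := fun q n =>
    Measurable.ite measurableSet_Ioi (((hk p q).comp (measurable_id.sub_const _)).mul_const _)
      measurable_const
  rw [lintegral_finsetSum _ fun q _ => Measurable.tsum fun n => hm q n]
  refine Finset.sum_congr rfl fun q _ => ?_
  rw [lintegral_tsum fun n => (hm q n).aemeasurable]
  simp_rw [← ENNReal.tsum_mul_left]
  rw [lintegral_tsum fun n => Measurable.aemeasurable ?_]
  swap
  · exact (hk p q).mul (Measurable.ite (measurableSet_le measurable_const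
      (measurable_const.sub measurable_id)) measurable_const measurable_const)
  congr 1 with n
  calc ∫⁻ u in Set.Ioc 0 t, (if τ n < u then k p q (u - τ n) * c n q else 0)
      = ∫⁻ u, (fun v => (Set.Ioc 0 (t - τ n)).indicator (fun v => k p q v * c n q) v) (u - τ n) := by
        rw [← lintegral_indicator measurableSet_Ioc]
        congr 1 with u
        simp only [Set.indicator, Set.mem_Ioc, sub_pos, sub_le_sub_iff_right]
        have := hτ n
        by_cases h1 : τ n < u
        · by_cases h2 : u ≤ t
          · simp [h1, h2, this.trans h1]
          · simp [h2]
        · simp [h1]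
    _ = ∫⁻ v, (Set.Ioc 0 (t - τ n)).indicator (fun v => k p q v * c n q) v :=
        lintegral_sub_right_eq_self (fun v => (Set.Ioc 0 (t - τ n)).indicator
          (fun v => k p q v * c n q) v) (τ n)
    _ = ∫⁻ v in Set.Ioi 0, k p q v * (if τ n ≤ t - v then c n q else 0) := by
        rw [← lintegral_indicator measurableSet_Ioi]
        congr 1 with v
        simp only [Set.indicator, Set.mem_Ioc, Set.mem_Ioi]
        have : τ n ≤ t - v ↔ v ≤ t - τ n := by constructor <;> intro h <;> linarith
        by_cases h1 : 0 < v <;> by_cases h2 : v ≤ t - τ n <;> simp [h1, h2, this]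

/-- The densities `F` and `H` define measures that agree on `m`, and the integral of an
`m`-measurable function only sees the restriction to `m`. This upgrades the compensator identity
from events of the past to random factors of the past. -/
theorem lintegral_mul_eq_of_forall_setLIntegral_eq {Ω : Type*} {m mΩ : MeasurableSpace Ω}
    (hm : m ≤ mΩ) {P : Measure Ω} {F H : Ω → ℝ≥0∞} (hF : Measurable F) (hH : Measurable H)
    (h : ∀ A, MeasurableSet[m] A → ∫⁻ ω in A, F ω ∂P = ∫⁻ ω in A, H ω ∂P) {G : Ω → ℝ≥0∞}
    (hG : Measurable[m] G) : ∫⁻ ω, G ω * F ω ∂P = ∫⁻ ω, G ω * H ω ∂P := by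
  have heq : (P.withDensity F).trim hm = (P.withDensity H).trim hm := by
    refine @Measure.ext _ m _ _ fun A hA => ?_
    rw [trim_measurableSet_eq hm hA, trim_measurableSet_eq hm hA, withDensity_apply _ (hm A hA),
      withDensity_apply _ (hm A hA), h A hA]
  have hG' : Measurable G := hG.mono hm le_rfl
  have h1 := lintegral_withDensity_eq_lintegral_mul P hF hG'
  have h2 := lintegral_withDensity_eq_lintegral_mul P hH hG'
  simp only [Pi.mul_apply, mul_comm (F _), mul_comm (H _)] at h1 h2
  rw [← h1, ← h2, ← lintegral_trim hm hG, heq, lintegral_trim hm hG]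

namespace HawkesModel

variable (H : HawkesModel)

/-- The moments of the marks. -/
noncomputable def mom (i : ℕ) : ℝ≥0∞ := ∫⁻ x, ENNReal.ofReal x ^ i ∂H.ρ

theorem mom_zero : H.mom 0 = 1 := by
  have := H.prob
  simp [mom]

theorem mom_one : H.mom 1 = ∫⁻ x, ENNReal.ofReal x ∂H.ρ := by simp [mom]

theorem mom_two_ne_top : H.mom 2 ≠ ∞ := H.sq_ne_top

theorem mom_ne_top_of_two_mul {i : ℕ} (hi : H.mom (2 * i) ≠ ∞) : H.mom i ≠ ∞ := by
  have := H.prob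
  refine ne_top_of_le_ne_top (b := 1 + H.mom (2 * i)) (by simp [hi]) ?_
  rw [mom, mom, show (1 : ℝ≥0∞) = ∫⁻ _, 1 ∂H.ρ by simp, ← lintegral_add_left measurable_const]
  refine lintegral_mono fun x => ?_
  set y := ENNReal.ofReal x ^ i
  rw [mul_comm 2 i, pow_mul, show ENNReal.ofReal x ^ i = y from rfl]
  rcases le_total y 1 with h | h
  · exact h.trans le_self_add
  · calc y = y * 1 := (mul_one y).symm
      _ ≤ y * y := by gcongr
      _ ≤ 1 + y ^ 2 := by rw [sq]; exact le_add_self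

theorem mom_one_ne_top : H.mom 1 ≠ ∞ := H.mom_ne_top_of_two_mul H.mom_two_ne_top

/-- A vanishing mean would force nonpositive marks, against `pos`. The later divisions by `mom 1`
rest on this. -/
theorem mom_one_ne_zero : H.mom 1 ≠ 0 := by
  have := H.prob
  rw [mom_one]
  intro h
  rw [lintegral_eq_zero_iff (by fun_prop)] at h
  have h2 : ∀ᵐ x ∂H.ρ, x ∈ Set.Iic (0 : ℝ) := by
    filter_upwards [h] with x hx
    simpa using hx
  have h3 : H.ρ (Set.Iic 0) = 1 := prob_compl_eq_zero_iff measurableSet_Iic |>.1 h2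
  rw [H.pos] at h3
  exact zero_ne_one h3

/-- The kernel of the renewal equation. -/
noncomputable def κ (p q : Fin 2) (u : ℝ) : ℝ≥0∞ := H.mom 1 * H.k p q u

theorem measurable_κ (p q : Fin 2) : Measurable (H.κ p q) := (H.measurable_k p q).const_mul _

theorem sum_κ_w (p : Fin 2) :
    ∑ q, (∫⁻ u in Set.Ioi 0, H.κ p q u) * H.w q ≤ ENNReal.ofReal H.r * H.w p := by
  have := H.contract p
  rw [← H.mom_one] at this
  exact this

theorem w_eq' (p : Fin 2) : H.w p = 1 + ∑ q, (∫⁻ u in Set.Ioi 0, H.κ p q u) * H.w q := by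
  have := H.w_eq p
  rw [← H.mom_one] at this
  exact this

theorem w_ne_zero (p : Fin 2) : H.w p ≠ 0 := (zero_lt_one.trans_le (H.one_le_w p)).ne'

/-- The equation `w_eq` encodes integrability of the kernel: an infinite entry, multiplied by a
nonzero weight, would make the finite `w p` infinite. -/
theorem lintegral_κ_ne_top (p q : Fin 2) : ∫⁻ u in Set.Ioi 0, H.κ p q u ≠ ∞ := by
  intro h
  have h1 := H.w_ne_top p
  rw [H.w_eq' p] at h1
  refine h1 (ENNReal.add_eq_top.2 (Or.inr (ENNReal.sum_eq_top.2 ⟨q, Finset.mem_univ q, ?_⟩)))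
  rw [h, ENNReal.top_mul (H.w_ne_zero q)]

theorem lintegral_κ_eq (p q : Fin 2) :
    ∫⁻ u in Set.Ioi 0, H.κ p q u = H.mom 1 * ∫⁻ u in Set.Ioi 0, H.k p q u :=
  lintegral_const_mul _ (H.measurable_k p q)

theorem lintegral_k_ne_top (p q : Fin 2) : ∫⁻ u in Set.Ioi 0, H.k p q u ≠ ∞ := by
  intro h
  have := H.lintegral_κ_ne_top p q
  rw [lintegral_κ_eq, h, ENNReal.mul_top H.mom_one_ne_zero] at this
  exact this rfl

/-- The constant `(1 - r)⁻¹`. -/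
noncomputable def gain : ℝ≥0∞ := ENNReal.ofReal (1 - H.r)⁻¹

theorem gain_ne_top : H.gain ≠ ∞ := ENNReal.ofReal_ne_top

/-- A finite vector with `x ≤ a + K x` satisfies `x ≤ a (1 - r)⁻¹ w`. -/
theorem le_of_le_add_sum {x : Fin 2 → ℝ≥0∞} (hx : ∀ q, x q ≠ ∞) {a : ℝ≥0∞}
    (h : ∀ p, x p ≤ a + ∑ q, (∫⁻ u in Set.Ioi 0, H.κ p q u) * x q) (p : Fin 2) :
    x p ≤ H.w p * (H.gain * a) := by
  -- The smallest `β` with `x ≤ w β`. Inserting this bound in the hypothesis gives `β ≤ a + r β`,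
  -- which can be solved because `β` is finite.
  set β : ℝ≥0∞ := Finset.univ.sup fun q => x q * (H.w q)⁻¹ with hβ
  have hxβ : ∀ q, x q ≤ H.w q * β := by
    intro q
    have h1 : x q * (H.w q)⁻¹ ≤ β := Finset.le_sup (f := fun q => x q * (H.w q)⁻¹) (Finset.mem_univ q)
    calc x q = H.w q * (x q * (H.w q)⁻¹) := by
          rw [mul_left_comm, ENNReal.mul_inv_cancel (H.w_ne_zero q) (H.w_ne_top q), mul_one]
      _ ≤ _ := by gcongr
  have hfin : β ≠ ∞ := by
    rw [hβ, ← lt_top_iff_ne_top, Finset.sup_lt_iff ENNReal.zero_lt_top]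
    exact fun q _ => ENNReal.mul_lt_top (hx q).lt_top (ENNReal.inv_lt_top.2
      (pos_iff_ne_zero.2 (H.w_ne_zero q)))
  have hstep : β ≤ a + ENNReal.ofReal H.r * β := by
    refine Finset.sup_le fun p _ => ?_
    have h1 : x p ≤ H.w p * (a + ENNReal.ofReal H.r * β) := by
      calc x p ≤ a + ∑ q, (∫⁻ u in Set.Ioi 0, H.κ p q u) * x q := h p
        _ ≤ a + ∑ q, (∫⁻ u in Set.Ioi 0, H.κ p q u) * H.w q * β := by
          refine add_le_add le_rfl (Finset.sum_le_sum fun q _ => ?_)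
          rw [mul_assoc]
          gcongr
          exact hxβ q
        _ ≤ H.w p * a + ENNReal.ofReal H.r * H.w p * β := by
          rw [← Finset.sum_mul]
          gcongr
          · exact le_mul_of_one_le_left zero_le (H.one_le_w p)
          · exact H.sum_κ_w p
        _ = _ := by ring
    calc x p * (H.w p)⁻¹ ≤ H.w p * (a + ENNReal.ofReal H.r * β) * (H.w p)⁻¹ := by gcongr
      _ = (a + ENNReal.ofReal H.r * β) * (H.w p * (H.w p)⁻¹) := by ring
      _ = _ := by rw [ENNReal.mul_inv_cancel (H.w_ne_zero p) (H.w_ne_top p), mul_one]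
  exact (hxβ p).trans (by gcongr; exact ENNReal.le_of_le_add_mul H.r_pos H.r_lt_one hfin hstep)

/-- The baseline on the horizon `T`. -/
noncomputable def base (T t : ℝ) : ℝ≥0∞ := ENNReal.ofReal (H.μ (t / T))

theorem measurable_base (T : ℝ) : Measurable (H.base T) :=
  ENNReal.measurable_ofReal.comp (H.measurable_μ.comp (measurable_id.div_const T))

theorem base_le (T t : ℝ) : H.base T t ≤ ENNReal.ofReal H.μbar :=
  ENNReal.ofReal_le_ofReal (H.μ_le _)

/-- The integrated baseline. -/
noncomputable def baseInt (T t : ℝ) : ℝ≥0∞ := ∫⁻ u in Set.Ioc 0 t, H.base T u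

theorem baseInt_le (T t : ℝ) : H.baseInt T t ≤ ENNReal.ofReal H.μbar * ENNReal.ofReal t := by
  calc H.baseInt T t ≤ ∫⁻ _ in Set.Ioc 0 t, ENNReal.ofReal H.μbar :=
        lintegral_mono fun u => H.base_le T u
    _ = _ := by simp

theorem baseInt_ne_top (T t : ℝ) : H.baseInt T t ≠ ∞ :=
  ne_top_of_le_ne_top (ENNReal.mul_ne_top ENNReal.ofReal_ne_top ENNReal.ofReal_ne_top)
    (H.baseInt_le T t)

end HawkesModel

/-! ### Stopped intensities, adaptedness and the compensator of the mark sums -/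

/-- At levels `a ≥ s` the sublevel set is the whole space, so only information before `s` is needed;
this is what makes `min τ s` measurable at time `s`. -/
theorem measurable_min_of_forall_lt {α : Type*} {mα : MeasurableSpace α} {f : α → ℝ} {s : ℝ}
    (h : ∀ a < s, MeasurableSet {x | f x ≤ a}) : Measurable fun x => min (f x) s := by
  refine measurable_of_Iic fun a => ?_
  rcases lt_or_ge a s with hsa | hsa
  · convert! h a hsa using 1
    ext x; simp [not_le.2 hsa]
  · convert! MeasurableSet.univ
    ext x; simp [hsa]

/-- Stated for an arbitrary σ-algebra, so that it can be applied with that of the filtration at time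
`s`. -/
theorem measurable_lintegral_stopped_excitation {α : Type*} {mα : MeasurableSpace α}
    {b : ℝ → ℝ≥0∞} (hb : Measurable b) {k : Fin 2 → Fin 2 → ℝ → ℝ≥0∞}
    (hk : ∀ p q, Measurable (k p q)) {σ : α → ℝ} (hσ : Measurable σ) {τ : ℕ → α → ℝ}
    {c : ℕ → α → Fin 2 → ℝ≥0∞} (hτ : ∀ n, Measurable (τ n))
    (hc : ∀ n q, Measurable fun a => c n a q) (p : Fin 2) (S : Set ℝ) :
    Measurable fun a => ∫⁻ u in S, if u ≤ σ a then
      b u + excitation k (fun n => τ n a) (fun n => c n a) p u else 0 := by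
  have h : Measurable fun x : α × ℝ => if x.2 ≤ σ x.1 then
      b x.2 + excitation k (fun n => τ n x.1) (fun n => c n x.1) p x.2 else 0 :=
    Measurable.ite (measurableSet_le measurable_snd (hσ.comp measurable_fst))
      ((hb.comp measurable_snd).add ((measurable_excitation hk hτ hc p).comp measurable_swap))
      measurable_const
  exact h.lintegral_prod_right'

namespace MarkedArrivals

variable {Ω : Type*} (X : MarkedArrivals Ω)

/-- The `i`-th power of the mark of the `n`-th arrival, if it is on side `p`. -/
noncomputable def wt (i n : ℕ) (p : Fin 2) (ω : Ω) : ℝ≥0∞ :=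
  if X.side n ω = p then ENNReal.ofReal (X.mark n ω) ^ i else 0

/-- The `[0, ∞]`-valued sum of the `i`-th powers of the marks up to time `t`. -/
noncomputable def cnt (i : ℕ) (p : Fin 2) (t : ℝ) (ω : Ω) : ℝ≥0∞ :=
  pointSum (fun n => X.time n ω) (fun n => X.wt i n p ω) t

/-- The Hawkes intensity, in terms of `HawkesModel`. -/
noncomputable def lam (H : HawkesModel) (T : ℝ) (p : Fin 2) (t : ℝ) (ω : Ω) : ℝ≥0∞ :=
  H.base T t + excitation H.k (fun n => X.time n ω) (fun n q => X.wt 1 n q ω) p t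

/-- The measure of the first `n + 1` arrivals on side `p`, weighted by the powers of the marks. -/
noncomputable def jumpMeasure (n i : ℕ) (p : Fin 2) (ω : Ω) : Measure ℝ :=
  ∑ j ∈ Finset.range (n + 1), X.wt i j p ω • Measure.dirac (X.time j ω)

/-- The integrated intensity, stopped at the `n`-th arrival. -/
noncomputable def stoppedIntensity (H : HawkesModel) (T : ℝ) (n : ℕ) (p : Fin 2) (ω : Ω) :
    Measure ℝ :=
  (volume.restrict (Set.Iic (X.time n ω))).withDensity fun u => X.lam H T p u ω

/-- The defining properties of a marked Hawkes process for the parameters `H` on the horizon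
`T`. -/
structure IsHawkes {mΩ : MeasurableSpace Ω} (P : Measure Ω) (ℱ : Filtration ℝ≥0 mΩ)
    (H : HawkesModel) (T : ℝ) : Prop where
  measurable_time : ∀ n, Measurable (X.time n)
  measurable_side : ∀ n, Measurable (X.side n)
  measurable_mark : ∀ n, Measurable (X.mark n)
  time_pos : ∀ n ω, 0 < X.time n ω
  time_strictMono : ∀ ω, StrictMono fun n => X.time n ω
  adapted : ∀ (n : ℕ) (t : ℝ≥0), (t : ℝ) ≤ T → ∀ (p : Fin 2) (B : Set ℝ), MeasurableSet B →
    MeasurableSet[ℱ t] {ω | X.time n ω ≤ t ∧ X.side n ω = p ∧ X.mark n ω ∈ B}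
  compensator : ∀ (n : ℕ) (s t : ℝ≥0), s ≤ t → (t : ℝ) ≤ T → ∀ A, MeasurableSet[ℱ s] A →
    ∀ (p : Fin 2) (B : Set ℝ), MeasurableSet B →
    ∑ k ∈ Finset.range (n + 1), P (A ∩ {ω | (s : ℝ) < X.time k ω ∧ X.time k ω ≤ t ∧
        X.side k ω = p ∧ X.mark k ω ∈ B}) =
      H.ρ B * ∫⁻ ω in A, X.stoppedIntensity H T n p ω (Set.Ioc (s : ℝ) t) ∂P

variable {X}

theorem wt_sq (i n : ℕ) (p : Fin 2) (ω : Ω) : X.wt i n p ω ^ 2 = X.wt (2 * i) n p ω := by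
  unfold wt
  split_ifs
  · rw [← pow_mul, mul_comm]
  · simp

theorem jumpMeasure_apply (n i : ℕ) (p : Fin 2) (ω : Ω) {S : Set ℝ} (hS : MeasurableSet S) :
    X.jumpMeasure n i p ω S =
      ∑ j ∈ Finset.range (n + 1), S.indicator (fun _ => X.wt i j p ω) (X.time j ω) := by
  unfold jumpMeasure
  rw [Measure.finsetSum_apply]
  refine Finset.sum_congr rfl fun j _ => ?_
  rw [Measure.smul_apply, Measure.dirac_apply' _ hS, smul_eq_mul]
  by_cases h : X.time j ω ∈ S <;> simp [h]

theorem stoppedIntensity_apply (H : HawkesModel) (T : ℝ) (n : ℕ) (p : Fin 2) (ω : Ω) {S : Set ℝ}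
    (hS : MeasurableSet S) :
    X.stoppedIntensity H T n p ω S = ∫⁻ u in S ∩ Set.Iic (X.time n ω), X.lam H T p u ω := by
  rw [stoppedIntensity, withDensity_apply _ hS, Measure.restrict_restrict hS]

variable {mΩ : MeasurableSpace Ω} {P : Measure Ω} {ℱ : Filtration ℝ≥0 mΩ} {H : HawkesModel} {T : ℝ}

namespace IsHawkes

theorem measurable_wt (h : X.IsHawkes P ℱ H T) (i n : ℕ) (p : Fin 2) : Measurable (X.wt i n p) :=
  Measurable.ite (h.measurable_side n (measurableSet_singleton p))
    ((ENNReal.measurable_ofReal.comp (h.measurable_mark n)).pow_const i) measurable_const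

theorem measurable_cnt (h : X.IsHawkes P ℱ H T) (i : ℕ) (p : Fin 2) :
    Measurable fun x : ℝ × Ω => X.cnt i p x.1 x.2 :=
  measurable_pointSum h.measurable_time fun n => h.measurable_wt i n p

theorem measurable_lam (h : X.IsHawkes P ℱ H T) (p : Fin 2) :
    Measurable fun x : ℝ × Ω => X.lam H T p x.1 x.2 :=
  ((H.measurable_base T).comp measurable_fst).add
    (measurable_excitation H.measurable_k h.measurable_time (fun n q => h.measurable_wt 1 n q) p)

theorem measurable_jumpMeasure (h : X.IsHawkes P ℱ H T) (n i : ℕ) (p : Fin 2) {S : Set ℝ}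
    (hS : MeasurableSet S) : Measurable fun ω => X.jumpMeasure n i p ω S := by
  simp_rw [jumpMeasure_apply n i p _ hS]
  refine Finset.measurable_sum _ fun j _ => ?_
  simp only [Set.indicator]
  exact Measurable.ite (h.measurable_time j hS) (h.measurable_wt i j p) measurable_const

theorem measurable_stoppedIntensity (h : X.IsHawkes P ℱ H T) (n : ℕ) (p : Fin 2) {S : Set ℝ}
    (hS : MeasurableSet S) : Measurable fun ω => X.stoppedIntensity H T n p ω S := by
  have h1 : ∀ ω, X.stoppedIntensity H T n p ω S =
      ∫⁻ u in S, if u ≤ X.time n ω then X.lam H T p u ω else 0 := fun ω => by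
    rw [stoppedIntensity_apply _ _ _ _ _ hS, Set.inter_comm, ← Measure.restrict_restrict measurableSet_Iic,
      ← lintegral_indicator measurableSet_Iic]
    rfl
  simp_rw [h1]
  have h2 : Measurable fun x : Ω × ℝ => if x.2 ≤ X.time n x.1 then X.lam H T p x.2 x.1 else 0 :=
    Measurable.ite (measurableSet_le measurable_snd ((h.measurable_time n).comp measurable_fst))
      ((h.measurable_lam p).comp measurable_swap) measurable_const
  exact h2.lintegral_prod_right'

/-- The compensator of the sums of the powers of the marks. -/
theorem lintegral_mul_jumpMeasure (h : X.IsHawkes P ℱ H T) (n i : ℕ) (p : Fin 2) {s t : ℝ≥0}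
    (hst : s ≤ t) (ht : (t : ℝ) ≤ T) {G : Ω → ℝ≥0∞} (hG : Measurable[ℱ s] G) :
    ∫⁻ ω, G ω * X.jumpMeasure n i p ω (Set.Ioc (s : ℝ) t) ∂P =
      ∫⁻ ω, G ω * (H.mom i * X.stoppedIntensity H T n p ω (Set.Ioc (s : ℝ) t)) ∂P := by
  refine lintegral_mul_eq_of_forall_setLIntegral_eq (ℱ.le s)
    (h.measurable_jumpMeasure n i p measurableSet_Ioc)
    ((h.measurable_stoppedIntensity n p measurableSet_Ioc).const_mul _) (fun A hA => ?_) hG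
  have hA' := ℱ.le s A hA
  set E : ℕ → Set Ω := fun k => {ω | (s : ℝ) < X.time k ω ∧ X.time k ω ≤ t ∧ X.side k ω = p} with hE
  have hEm : ∀ k, MeasurableSet (E k) := fun k =>
    (measurableSet_lt measurable_const (h.measurable_time k)).inter
      ((measurableSet_le (h.measurable_time k) measurable_const).inter
        (h.measurable_side k (measurableSet_singleton p)))
  -- Read as an identity of measures in `B`, the compensator says that the marks in the window,
  -- restricted to `A`, have law `ρ` times the expected intensity. Integrating `xⁱ` then gives the
  -- moment of order `i`.
  have hmeas : ∑ k ∈ Finset.range (n + 1), (P.restrict (A ∩ E k)).map (X.mark k) =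
      (∫⁻ ω in A, X.stoppedIntensity H T n p ω (Set.Ioc (s : ℝ) t) ∂P) • H.ρ := by
    refine Measure.ext fun B hB => ?_
    rw [Measure.finsetSum_apply, Measure.smul_apply, smul_eq_mul, mul_comm,
      ← h.compensator n s t hst ht A hA p B hB]
    refine Finset.sum_congr rfl fun k _ => ?_
    rw [Measure.map_apply (h.measurable_mark k) hB,
      Measure.restrict_apply (h.measurable_mark k hB)]
    congr 1
    ext ω
    simp only [hE, Set.mem_inter_iff, Set.mem_preimage, Set.mem_ofPred_eq]
    tauto
  have hf : Measurable fun x : ℝ => ENNReal.ofReal x ^ i := by fun_prop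
  rw [lintegral_const_mul _ (h.measurable_stoppedIntensity n p measurableSet_Ioc)]
  calc ∫⁻ ω in A, X.jumpMeasure n i p ω (Set.Ioc (s : ℝ) t) ∂P
      = ∑ k ∈ Finset.range (n + 1), ∫⁻ ω in A, (E k).indicator
          (fun ω => ENNReal.ofReal (X.mark k ω) ^ i) ω ∂P := by
        have hmk : ∀ k ∈ Finset.range (n + 1), Measurable ((E k).indicator
            fun ω => ENNReal.ofReal (X.mark k ω) ^ i) := fun k _ =>
          (hf.comp (h.measurable_mark k)).indicator (hEm k)
        rw [← lintegral_finsetSum _ hmk]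
        congr 1 with ω
        rw [jumpMeasure_apply _ _ _ _ measurableSet_Ioc]
        refine Finset.sum_congr rfl fun k _ => ?_
        simp only [Set.indicator, Set.mem_Ioc, hE, Set.mem_ofPred_eq, wt]
        by_cases h1 : (s : ℝ) < X.time k ω <;> by_cases h2 : X.time k ω ≤ t <;>
          by_cases h3 : X.side k ω = p <;> simp [h1, h2, h3]
    _ = ∑ k ∈ Finset.range (n + 1), ∫⁻ x, ENNReal.ofReal x ^ i ∂((P.restrict (A ∩ E k)).map (X.mark k)) := by
        refine Finset.sum_congr rfl fun k _ => ?_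
        rw [lintegral_map hf (h.measurable_mark k), lintegral_indicator (hEm k),
          Measure.restrict_restrict (hEm k), Set.inter_comm]
    _ = ∫⁻ x, ENNReal.ofReal x ^ i ∂(∑ k ∈ Finset.range (n + 1), (P.restrict (A ∩ E k)).map (X.mark k)) := by
        rw [lintegral_finsetSum_measure]
    _ = H.mom i * ∫⁻ ω in A, X.stoppedIntensity H T n p ω (Set.Ioc (s : ℝ) t) ∂P := by
        rw [hmeas, lintegral_smul_measure, smul_eq_mul, mul_comm, HawkesModel.mom]

theorem measurableSet_time_le (h : X.IsHawkes P ℱ H T) (n : ℕ) {s : ℝ≥0} (hs : (s : ℝ) ≤ T) :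
    MeasurableSet[ℱ s] {ω | X.time n ω ≤ s} := by
  have : {ω | X.time n ω ≤ s} =
      ⋃ p : Fin 2, {ω | X.time n ω ≤ s ∧ X.side n ω = p ∧ X.mark n ω ∈ Set.univ} := by
    ext ω; simp
  rw [this]
  exact MeasurableSet.iUnion fun p => h.adapted n s hs p _ MeasurableSet.univ

theorem measurable_min_time (h : X.IsHawkes P ℱ H T) (n : ℕ) {s : ℝ≥0} (hs : (s : ℝ) ≤ T) :
    Measurable[ℱ s] fun ω => min (X.time n ω) s := by
  refine measurable_min_of_forall_lt fun a ha => ?_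
  rcases lt_or_ge a 0 with h0 | h0
  · convert! @MeasurableSet.empty _ (ℱ s)
    ext ω
    simpa using h0.trans (h.time_pos n ω)
  · lift a to ℝ≥0 using h0
    exact ℱ.mono (show a ≤ s by exact_mod_cast ha.le) _
      (h.measurableSet_time_le n (ha.le.trans hs))

theorem measurable_stopped_wt (h : X.IsHawkes P ℱ H T) (i n : ℕ) (p : Fin 2) {s : ℝ≥0}
    (hs : (s : ℝ) ≤ T) :
    Measurable[ℱ s] fun ω => if X.time n ω ≤ s then X.wt i n p ω else 0 := by
  have hE : MeasurableSet[ℱ s] {ω | X.time n ω ≤ s ∧ X.side n ω = p} := by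
    convert! h.adapted n s hs p _ MeasurableSet.univ using 1
    ext ω; simp
  have heq : (fun ω => if X.time n ω ≤ s then X.wt i n p ω else 0) =
      {ω | X.time n ω ≤ s ∧ X.side n ω = p}.indicator
        fun ω => ENNReal.ofReal (X.mark n ω) ^ i := by
    ext ω
    simp only [Set.indicator, Set.mem_ofPred_eq, wt]
    by_cases h1 : X.time n ω ≤ s <;> by_cases h2 : X.side n ω = p <;> simp [h1, h2]
  rw [heq]
  intro S hS
  rw [Set.indicator_preimage]
  have hf : Measurable fun x : ℝ => ENNReal.ofReal x ^ i := by fun_prop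
  have h1 := h.adapted n s hs p _ (hf hS)
  have h2 : (Set.ite {ω | X.time n ω ≤ s ∧ X.side n ω = p}
      ((fun ω => ENNReal.ofReal (X.mark n ω) ^ i) ⁻¹' S) ((0 : Ω → ℝ≥0∞) ⁻¹' S)) =
      {ω | X.time n ω ≤ s ∧ X.side n ω = p ∧ X.mark n ω ∈ (fun x : ℝ => ENNReal.ofReal x ^ i) ⁻¹' S} ∪
        ({ω | X.time n ω ≤ s ∧ X.side n ω = p}ᶜ ∩ ((fun _ : Ω => (0 : ℝ≥0∞)) ⁻¹' S)) := by
    ext ω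
    simp only [Set.ite, Set.mem_union, Set.mem_inter_iff, Set.mem_preimage, Set.mem_ofPred_eq,
      Set.mem_sdiff, Set.mem_compl_iff, Pi.zero_apply]
    tauto
  rw [h2]
  exact @MeasurableSet.union _ (ℱ s) _ _ h1 (@MeasurableSet.inter _ (ℱ s) _ _
    (@MeasurableSet.compl _ _ (ℱ s) hE) (@measurable_const _ _ _ (ℱ s) 0 S hS))

theorem adapted_jumpMeasure (h : X.IsHawkes P ℱ H T) (n i : ℕ) (p : Fin 2) {s : ℝ≥0}
    (hs : (s : ℝ) ≤ T) : Measurable[ℱ s] fun ω => X.jumpMeasure n i p ω (Set.Ioc 0 (s : ℝ)) := by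
  have heq : (fun ω => X.jumpMeasure n i p ω (Set.Ioc 0 (s : ℝ))) = fun ω =>
      ∑ j ∈ Finset.range (n + 1), if X.time j ω ≤ s then X.wt i j p ω else 0 := by
    ext ω
    rw [jumpMeasure_apply _ _ _ _ measurableSet_Ioc]
    refine Finset.sum_congr rfl fun j _ => ?_
    simp [Set.indicator, h.time_pos j ω]
  rw [heq]
  exact @Finset.measurable_sum _ _ _ _ _ _ (ℱ s) _ _ fun j _ => h.measurable_stopped_wt i j p hs

/-- Up to time `s` the intensity only feels arrivals before `s`. The times may therefore be replaced
by `min τ_j s` and the weights by zero after `s`, and these are measurable at time `s`. -/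
theorem adapted_stoppedIntensity (h : X.IsHawkes P ℱ H T) (n : ℕ) (p : Fin 2) {s : ℝ≥0}
    (hs : (s : ℝ) ≤ T) :
    Measurable[ℱ s] fun ω => X.stoppedIntensity H T n p ω (Set.Ioc 0 (s : ℝ)) := by
  have heq : (fun ω => X.stoppedIntensity H T n p ω (Set.Ioc 0 (s : ℝ))) = fun ω =>
      ∫⁻ u in Set.Ioc 0 (s : ℝ), if u ≤ min (X.time n ω) s then
        H.base T u + excitation H.k (fun j => min (X.time j ω) s)
          (fun j q => if X.time j ω ≤ s then X.wt 1 j q ω else 0) p u else 0 := by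
    ext ω
    rw [stoppedIntensity_apply _ _ _ _ _ measurableSet_Ioc, Set.inter_comm,
      ← Measure.restrict_restrict measurableSet_Iic, ← lintegral_indicator measurableSet_Iic]
    refine setLIntegral_congr_fun measurableSet_Ioc fun u hu => ?_
    simp only [Set.indicator, Set.mem_Iic, le_min_iff, hu.2, and_true]
    split_ifs with h1
    · unfold lam excitation
      congr 1
      refine Finset.sum_congr rfl fun q _ => tsum_congr fun j => ?_
      by_cases h2 : X.time j ω ≤ s
      · simp [h2]
      · have h3 : ¬ X.time j ω < u := fun h4 => h2 (h4.le.trans hu.2)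
        simp [h2, h3]
    · rfl
  rw [heq]
  exact measurable_lintegral_stopped_excitation (mα := ℱ s) (H.measurable_base T) H.measurable_k
    (h.measurable_min_time n hs) (fun j => h.measurable_min_time j hs)
    (fun j q => h.measurable_stopped_wt 1 j q hs) p _

end IsHawkes

end MarkedArrivals

/-! ### Self-improving bounds and moments stopped at the `n`-th arrival -/

/-- A finite family which improves its own bounds by a contraction is bounded by the fixed
point. -/
theorem ENNReal.le_of_self_improving {ι : Type*} {r : ℝ} (h0 : 0 < r) (h1 : r < 1)
    {x W : ι → ℝ≥0∞} (hW0 : ∀ j, W j ≠ 0) (hWt : ∀ j, W j ≠ ∞) {a : ℝ≥0∞}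
    (hfin : ∃ B, B ≠ ∞ ∧ ∀ j, x j ≤ W j * B)
    (hstep : ∀ B, (∀ j, x j ≤ W j * B) → ∀ j, x j ≤ W j * (a + ENNReal.ofReal r * B)) (j : ι) :
    x j ≤ W j * (ENNReal.ofReal (1 - r)⁻¹ * a) := by
  set β : ℝ≥0∞ := ⨆ j, x j * (W j)⁻¹ with hβ
  have hmul : ∀ (j : ι) (c : ℝ≥0∞), x j ≤ W j * c ↔ x j * (W j)⁻¹ ≤ c := fun j c => by
    rw [← div_eq_mul_inv, ENNReal.div_le_iff (hW0 j) (hWt j), mul_comm]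
  have hxβ : ∀ j, x j ≤ W j * β := fun j => (hmul j β).2 (le_iSup (fun j => x j * (W j)⁻¹) j)
  have hβt : β ≠ ∞ := by
    obtain ⟨B, hB, hx⟩ := hfin
    exact ne_top_of_le_ne_top hB (iSup_le fun j => (hmul j B).1 (hx j))
  have h2 : β ≤ a + ENNReal.ofReal r * β := iSup_le fun j => (hmul j _).1 (hstep β hxβ j)
  exact (hxβ j).trans (by gcongr; exact ENNReal.le_of_le_add_mul h0 h1 hβt h2)

namespace HawkesModel

variable (H : HawkesModel)

theorem ofReal_r_inv_mul : ENNReal.ofReal H.r⁻¹ * ENNReal.ofReal H.r = 1 := by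
  rw [← ENNReal.ofReal_mul (inv_nonneg.2 H.r_pos.le), inv_mul_cancel₀ H.r_pos.ne', ENNReal.ofReal_one]

/-- The convolution with `κ` contracts the weighted `L²` norms. -/
theorem lintegral_sq_conv_le {Ω : Type*} {mΩ : MeasurableSpace Ω} (P : Measure Ω) [SFinite P]
    {f : Fin 2 → ℝ → Ω → ℝ≥0∞} (hf : ∀ q, Measurable fun x : ℝ × Ω => f q x.1 x.2) {B : ℝ≥0∞}
    (hB : ∀ q, ∀ u, 0 < u → ∫⁻ ω, f q u ω ^ 2 ∂P ≤ H.w q ^ 2 * B) (p : Fin 2) :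
    ENNReal.ofReal H.r⁻¹ * ∫⁻ ω, (∑ q, ∫⁻ u in Set.Ioi 0, H.κ p q u * f q u ω) ^ 2 ∂P ≤
      H.w p ^ 2 * (ENNReal.ofReal H.r * B) := by
  have h := lintegral_sq_convolution_le P (H.measurable_κ p) H.w_ne_zero H.w_ne_top (H.sum_κ_w p)
    hf hB
  calc _ ≤ ENNReal.ofReal H.r⁻¹ * ((ENNReal.ofReal H.r * H.w p) ^ 2 * B) := by gcongr
    _ = (ENNReal.ofReal H.r⁻¹ * ENNReal.ofReal H.r) * (H.w p ^ 2 * (ENNReal.ofReal H.r * B)) := by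
      ring
    _ = _ := by rw [H.ofReal_r_inv_mul, one_mul]

/-- The split is tuned to the contraction: the convolution term costs `r⁻¹`, while squaring the
contraction gains `r²`, so that a factor `r < 1` remains. -/
theorem add_sq_le (a b : ℝ≥0∞) :
    (a + b) ^ 2 ≤ H.gain * a ^ 2 + ENNReal.ofReal H.r⁻¹ * b ^ 2 :=
  ENNReal.add_sq_le_convex H.r_pos H.r_lt_one a b

theorem w_le_sq (p : Fin 2) : H.w p ≤ H.w p ^ 2 := by
  rw [sq]
  exact le_mul_of_one_le_left zero_le (H.one_le_w p)

theorem one_le_sq_w (p : Fin 2) : 1 ≤ H.w p ^ 2 := (H.one_le_w p).trans (H.w_le_sq p)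

end HawkesModel

namespace MarkedArrivals

variable {Ω : Type*} {X : MarkedArrivals Ω}
variable {mΩ : MeasurableSpace Ω} {P : Measure Ω} {ℱ : Filtration ℝ≥0 mΩ} {H : HawkesModel} {T : ℝ}

namespace IsHawkes

theorem jumpMeasure_Ioc (h : X.IsHawkes P ℱ H T) (n i : ℕ) (p : Fin 2) (t : ℝ) (ω : Ω) :
    X.jumpMeasure n i p ω (Set.Ioc 0 t) =
      ∑ j ∈ Finset.range (n + 1), if X.time j ω ≤ t then X.wt i j p ω else 0 := by
  rw [jumpMeasure_apply _ _ _ _ measurableSet_Ioc]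
  refine Finset.sum_congr rfl fun j _ => ?_
  simp [Set.indicator, h.time_pos j ω]

theorem jumpMeasure_Ioc_eq_pointSum (h : X.IsHawkes P ℱ H T) (n i : ℕ) (p : Fin 2) (t : ℝ) (ω : Ω) :
    X.jumpMeasure n i p ω (Set.Ioc 0 t) = pointSum (fun j => X.time j ω)
      (fun j => if j ≤ n then X.wt i j p ω else 0) t := by
  rw [h.jumpMeasure_Ioc, pointSum, tsum_eq_sum (s := Finset.range (n + 1))]
  · refine Finset.sum_congr rfl fun j hj => ?_
    rw [if_pos (Nat.lt_succ_iff.1 (Finset.mem_range.1 hj))]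
  · intro j hj
    rw [Finset.mem_range, Nat.lt_succ_iff] at hj
    simp [hj]

/-- Until the `n`-th arrival only arrivals already counted by `jumpMeasure n` excite. Bounding their
convolution by the mass of the kernel times the value at `t` closes the inequality among the stopped
quantities. -/
theorem stoppedIntensity_le (h : X.IsHawkes P ℱ H T) (n : ℕ) (p : Fin 2) (t : ℝ) (ω : Ω) :
    X.stoppedIntensity H T n p ω (Set.Ioc 0 t) ≤ H.baseInt T t +
      ∑ q, (∫⁻ v in Set.Ioi 0, H.k p q v) * X.jumpMeasure n 1 q ω (Set.Ioc 0 t) := by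
  set c : ℕ → Fin 2 → ℝ≥0∞ := fun j q => if j ≤ n then X.wt 1 j q ω else 0 with hc
  rw [stoppedIntensity_apply _ _ _ _ _ measurableSet_Ioc]
  calc ∫⁻ u in Set.Ioc 0 t ∩ Set.Iic (X.time n ω), X.lam H T p u ω
      ≤ ∫⁻ u in Set.Ioc 0 t ∩ Set.Iic (X.time n ω),
          H.base T u + excitation H.k (fun j => X.time j ω) c p u := by
        refine setLIntegral_mono' (measurableSet_Ioc.inter measurableSet_Iic) fun u hu => ?_
        unfold lam excitation
        refine add_le_add le_rfl (Finset.sum_le_sum fun q _ => ENNReal.tsum_le_tsum fun j => ?_)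
        split_ifs with h1
        · have : j ≤ n := ((h.time_strictMono ω).lt_iff_lt.1 (h1.trans_le hu.2)).le
          simp [hc, this]
        · exact le_rfl
    _ ≤ ∫⁻ u in Set.Ioc 0 t, H.base T u + excitation H.k (fun j => X.time j ω) c p u :=
        lintegral_mono_set Set.inter_subset_left
    _ = H.baseInt T t + ∑ q, ∫⁻ v in Set.Ioi 0,
          H.k p q v * X.jumpMeasure n 1 q ω (Set.Ioc 0 (t - v)) := by
        rw [lintegral_add_left (H.measurable_base T),
          lintegral_excitation H.measurable_k (fun j => h.time_pos j ω)]
        simp_rw [h.jumpMeasure_Ioc_eq_pointSum]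
        rfl
    _ ≤ _ := by
        refine add_le_add le_rfl (Finset.sum_le_sum fun q _ => ?_)
        rw [← lintegral_mul_const _ (H.measurable_k p q)]
        refine setLIntegral_mono' measurableSet_Ioi fun v hv => ?_
        gcongr
        have : (0 : ℝ) < v := hv
        linarith

theorem lintegral_jumpMeasure (h : X.IsHawkes P ℱ H T) (n i : ℕ) (p : Fin 2) {t : ℝ} (h0 : 0 ≤ t)
    (ht : t ≤ T) : ∫⁻ ω, X.jumpMeasure n i p ω (Set.Ioc 0 t) ∂P =
      H.mom i * ∫⁻ ω, X.stoppedIntensity H T n p ω (Set.Ioc 0 t) ∂P := by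
  lift t to ℝ≥0 using h0
  have := h.lintegral_mul_jumpMeasure n i p (s := 0) (t := t) zero_le ht
    (G := fun _ => 1) measurable_const
  simp only [one_mul, NNReal.coe_zero] at this
  rw [this, lintegral_const_mul _ (h.measurable_stoppedIntensity n p measurableSet_Ioc)]

/-- The arrival times are distinct, so the atom at an arrival is its own weight, and the square of
an `i`-th power is a `2i`-th power. -/
theorem lintegral_atoms_jumpMeasure (h : X.IsHawkes P ℱ H T) (n i : ℕ) (p : Fin 2) (t : ℝ) (ω : Ω) :
    ∫⁻ x in Set.Ioc 0 t, X.jumpMeasure n i p ω {x} ∂(X.jumpMeasure n i p ω) =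
      X.jumpMeasure n (2 * i) p ω (Set.Ioc 0 t) := by
  have hat : ∀ j ∈ Finset.range (n + 1), X.jumpMeasure n i p ω {X.time j ω} = X.wt i j p ω := by
    intro j hj
    rw [jumpMeasure_apply _ _ _ _ (measurableSet_singleton _), Finset.sum_eq_single_of_mem j hj]
    · simp
    · intro l _ hl
      have : X.time l ω ≠ X.time j ω := fun he => hl ((h.time_strictMono ω).injective he)
      simp [this]
  rw [h.jumpMeasure_Ioc, ← lintegral_indicator measurableSet_Ioc]
  conv_lhs => rw [show X.jumpMeasure n i p ω = ∑ j ∈ Finset.range (n + 1),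
    X.wt i j p ω • Measure.dirac (X.time j ω) from rfl]
  rw [lintegral_finsetSum_measure]
  refine Finset.sum_congr rfl fun j hj => ?_
  rw [lintegral_smul_measure, lintegral_dirac]
  have := hat j hj
  unfold jumpMeasure at this
  by_cases h1 : X.time j ω ≤ t
  · simp only [Set.indicator, Set.mem_Ioc, h.time_pos j ω, h1, and_self, if_true, this]
    rw [smul_eq_mul, ← sq, wt_sq]
  · simp [h1]

variable [IsProbabilityMeasure P]

/-- With `i = 0` the compensator equals an expected number of arrivals, which is at most `n + 1`.
This is the a priori finiteness behind every localized bound. -/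
theorem lintegral_stoppedIntensity_ne_top (h : X.IsHawkes P ℱ H T) (n : ℕ) (p : Fin 2) {t : ℝ}
    (h0 : 0 ≤ t) (ht : t ≤ T) :
    ∫⁻ ω, X.stoppedIntensity H T n p ω (Set.Ioc 0 t) ∂P ≠ ∞ := by
  have h1 := h.lintegral_jumpMeasure n 0 p h0 ht
  rw [H.mom_zero, one_mul] at h1
  rw [← h1]
  refine ne_top_of_le_ne_top (b := ∫⁻ _, (n + 1 : ℕ) ∂P) (by simp) (lintegral_mono fun ω => ?_)
  rw [h.jumpMeasure_Ioc]
  calc _ ≤ ∑ j ∈ Finset.range (n + 1), (1 : ℝ≥0∞) := by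
        refine Finset.sum_le_sum fun j _ => ?_
        unfold wt
        split_ifs <;> simp
    _ = _ := by simp

/-- The bound of the expected intensity, uniformly in the localization. -/
theorem lintegral_stoppedIntensity_le (h : X.IsHawkes P ℱ H T) (hT : 0 ≤ T) (n : ℕ) (p : Fin 2) :
    ∫⁻ ω, X.stoppedIntensity H T n p ω (Set.Ioc 0 T) ∂P ≤ H.w p * (H.gain * H.baseInt T T) := by
  refine H.le_of_le_add_sum
    (x := fun p => ∫⁻ ω, X.stoppedIntensity H T n p ω (Set.Ioc 0 T) ∂P)
    (fun q => h.lintegral_stoppedIntensity_ne_top n q hT le_rfl) (fun p => ?_) p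
  have hm : ∀ q, Measurable fun ω => X.jumpMeasure n 1 q ω (Set.Ioc 0 T) := fun q =>
    h.measurable_jumpMeasure n 1 q measurableSet_Ioc
  calc ∫⁻ ω, X.stoppedIntensity H T n p ω (Set.Ioc 0 T) ∂P
      ≤ ∫⁻ ω, (H.baseInt T T + ∑ q, (∫⁻ v in Set.Ioi 0, H.k p q v) *
          X.jumpMeasure n 1 q ω (Set.Ioc 0 T)) ∂P :=
        lintegral_mono fun ω => h.stoppedIntensity_le n p T ω
    _ = H.baseInt T T + ∑ q, (∫⁻ v in Set.Ioi 0, H.k p q v) *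
          ∫⁻ ω, X.jumpMeasure n 1 q ω (Set.Ioc 0 T) ∂P := by
        rw [lintegral_add_left measurable_const,
          lintegral_finsetSum _ fun q _ => (hm q).const_mul _]
        simp only [lintegral_const, measure_univ, mul_one]
        congr 1
        exact Finset.sum_congr rfl fun q _ => lintegral_const_mul _ (hm q)
    _ = _ := by
        congr 1
        refine Finset.sum_congr rfl fun q _ => ?_
        rw [h.lintegral_jumpMeasure n 1 q hT le_rfl, H.lintegral_κ_eq]
        ring

/-- Each of the `n + 1` terms has a square dominated by the sum of the `2i`-th powers, whose mean is
finite; finitely many square-integrable terms are added. -/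
theorem lintegral_jumpMeasure_sq_ne_top (h : X.IsHawkes P ℱ H T) (hT : 0 ≤ T) (n : ℕ) {i : ℕ}
    (hi : H.mom (2 * i) ≠ ∞) (p : Fin 2) :
    ∫⁻ ω, X.jumpMeasure n i p ω (Set.Ioc 0 T) ^ 2 ∂P ≠ ∞ := by
  have hterm : ∀ j ∈ Finset.range (n + 1),
      ∫⁻ ω, (if X.time j ω ≤ T then X.wt i j p ω else 0) ^ 2 ∂P ≠ ∞ := by
    intro j hj
    have h1 : ∫⁻ ω, X.jumpMeasure n (2 * i) p ω (Set.Ioc 0 T) ∂P ≠ ∞ := by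
      rw [h.lintegral_jumpMeasure n (2 * i) p hT le_rfl]
      exact ENNReal.mul_ne_top hi (h.lintegral_stoppedIntensity_ne_top n p hT le_rfl)
    refine ne_top_of_le_ne_top h1 (lintegral_mono fun ω => ?_)
    rw [h.jumpMeasure_Ioc]
    refine le_trans (le_of_eq ?_) (Finset.single_le_sum
      (f := fun j => if X.time j ω ≤ T then X.wt (2 * i) j p ω else 0) (fun _ _ => zero_le) hj)
    simp only [ite_pow, wt_sq]
    norm_num
  have hm : ∀ j, Measurable fun ω => if X.time j ω ≤ T then X.wt i j p ω else 0 := fun j =>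
    Measurable.ite (measurableSet_le (h.measurable_time j) measurable_const)
      (h.measurable_wt i j p) measurable_const
  simp_rw [h.jumpMeasure_Ioc]
  have hsum : ∀ m ≤ n + 1, ∫⁻ ω, (∑ j ∈ Finset.range m,
      if X.time j ω ≤ T then X.wt i j p ω else 0) ^ 2 ∂P ≠ ∞ := by
    intro m
    induction m with
    | zero => simp
    | succ m ih =>
      intro hmn
      have hm1 : Measurable fun ω => ∑ j ∈ Finset.range m,
          if X.time j ω ≤ T then X.wt i j p ω else 0 := Finset.measurable_sum _ fun j _ => hm j
      simp only [Finset.sum_range_succ]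
      refine ne_top_of_le_ne_top ?_ (lintegral_mono fun ω => ENNReal.add_sq_le_two _ _)
      rw [lintegral_add_left ((hm1.pow_const 2).const_mul 2), lintegral_const_mul _ (hm1.pow_const 2),
        lintegral_const_mul _ ((hm m).pow_const 2)]
      exact ENNReal.add_ne_top.2 ⟨ENNReal.mul_ne_top (by norm_num) (ih (by omega)),
        ENNReal.mul_ne_top (by norm_num) (hterm m (Finset.mem_range.2 (by omega)))⟩
  exact hsum (n + 1) le_rfl

theorem lintegral_stoppedIntensity_sq_ne_top (h : X.IsHawkes P ℱ H T) (hT : 0 ≤ T) (n : ℕ)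
    (p : Fin 2) : ∫⁻ ω, X.stoppedIntensity H T n p ω (Set.Ioc 0 T) ^ 2 ∂P ≠ ∞ := by
  have hm : ∀ q, Measurable fun ω => X.jumpMeasure n 1 q ω (Set.Ioc 0 T) := fun q =>
    h.measurable_jumpMeasure n 1 q measurableSet_Ioc
  have hJ : ∀ q, ∫⁻ ω, X.jumpMeasure n 1 q ω (Set.Ioc 0 T) ^ 2 ∂P ≠ ∞ := fun q =>
    h.lintegral_jumpMeasure_sq_ne_top hT n (by simpa using H.mom_two_ne_top) q
  refine ne_top_of_le_ne_top ?_ (lintegral_mono fun ω =>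
    (pow_le_pow_left' (h.stoppedIntensity_le n p T ω) 2).trans (ENNReal.add_sq_le_two _ _))
  rw [lintegral_add_left (measurable_const)]
  refine ENNReal.add_ne_top.2 ⟨by simp [H.baseInt_ne_top, ENNReal.mul_eq_top], ?_⟩
  rw [lintegral_const_mul _ (by fun_prop)]
  refine ENNReal.mul_ne_top (by norm_num) ?_
  simp only [Fin.sum_univ_two]
  refine ne_top_of_le_ne_top ?_ (lintegral_mono fun ω => ENNReal.add_sq_le_two _ _)
  simp only [mul_pow]
  rw [lintegral_add_left (by fun_prop), lintegral_const_mul _ (by fun_prop),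
    lintegral_const_mul _ (by fun_prop), lintegral_const_mul _ (by fun_prop),
    lintegral_const_mul _ (by fun_prop)]
  exact ENNReal.add_ne_top.2
    ⟨ENNReal.mul_ne_top (by norm_num) (ENNReal.mul_ne_top (ENNReal.pow_ne_top (H.lintegral_k_ne_top p 0)) (hJ 0)),
      ENNReal.mul_ne_top (by norm_num) (ENNReal.mul_ne_top (ENNReal.pow_ne_top (H.lintegral_k_ne_top p 1)) (hJ 1))⟩

/-- The second moment of the compensated sums of the powers of the marks, localized. -/
theorem lintegral_sqDist_jumpMeasure_le (h : X.IsHawkes P ℱ H T) (n : ℕ) {i : ℕ}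
    (hi : H.mom (2 * i) ≠ ∞) (p : Fin 2) {t : ℝ} (h0 : 0 ≤ t) (ht : t ≤ T) :
    ∫⁻ ω, sqDist (X.jumpMeasure n i p ω (Set.Ioc 0 t))
      (H.mom i * X.stoppedIntensity H T n p ω (Set.Ioc 0 t)) ∂P ≤
      2 * (H.mom (2 * i) * (H.w p * (H.gain * H.baseInt T T))) := by
  have hT : 0 ≤ T := h0.trans ht
  have hmi : H.mom i ≠ ∞ := H.mom_ne_top_of_two_mul hi
  have hsub : Set.Ioc 0 t ⊆ Set.Ioc 0 T := Set.Ioc_subset_Ioc le_rfl ht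
  have key := lintegral_sqDist_le_atoms P (N := X.jumpMeasure n i p)
    (Λ := fun ω => H.mom i • X.stoppedIntensity H T n p ω) h0
    (fun _ _ => h.measurable_jumpMeasure n i p measurableSet_Ioc)
    (fun _ _ => (h.measurable_stoppedIntensity n p measurableSet_Ioc).const_mul _)
    (ne_top_of_le_ne_top (h.lintegral_jumpMeasure_sq_ne_top hT n hi p)
      (lintegral_mono fun ω => pow_le_pow_left' (measure_mono hsub) 2)) ?_ ?_ ?_ ?_
  · refine key.trans ?_
    simp_rw [h.lintegral_atoms_jumpMeasure]
    rw [h.lintegral_jumpMeasure n (2 * i) p h0 ht]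
    gcongr
    exact (lintegral_mono fun ω => measure_mono hsub).trans (h.lintegral_stoppedIntensity_le hT n p)
  · simp only [Measure.smul_apply, smul_eq_mul, mul_pow]
    rw [lintegral_const_mul _ ((h.measurable_stoppedIntensity n p measurableSet_Ioc).pow_const 2)]
    exact ENNReal.mul_ne_top (ENNReal.pow_ne_top hmi)
      (ne_top_of_le_ne_top (h.lintegral_stoppedIntensity_sq_ne_top hT n p)
        (lintegral_mono fun ω => pow_le_pow_left' (measure_mono hsub) 2))
  · intro s u hs hsu hu
    lift s to ℝ≥0 using hs
    lift u to ℝ≥0 using s.2.trans hsu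
    exact h.lintegral_mul_jumpMeasure n i p (by exact_mod_cast hsu) (hu.trans ht)
      (h.adapted_jumpMeasure n i p (hsu.trans (hu.trans ht)))
  · intro s u hs hsu hu
    lift s to ℝ≥0 using hs
    lift u to ℝ≥0 using s.2.trans hsu
    exact h.lintegral_mul_jumpMeasure n i p (by exact_mod_cast hsu) (hu.trans ht)
      (G := fun ω => H.mom i * X.stoppedIntensity H T n p ω (Set.Ioc 0 (s : ℝ))) 
      ((measurable_const_mul (H.mom i)).comp
        (h.adapted_stoppedIntensity n p (hsu.trans (hu.trans ht))))
  · intro ω x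
    rw [Measure.smul_apply, stoppedIntensity_apply _ _ _ _ _ (measurableSet_singleton x),
      setLIntegral_measure_zero _ _ (measure_mono_null Set.inter_subset_left (by simp)), smul_zero]

/-- The second moment bound, uniformly in the localization. -/
theorem lintegral_jumpMeasure_sq_le (h : X.IsHawkes P ℱ H T) (hT : 0 ≤ T) (n : ℕ) (p : Fin 2) :
    ∫⁻ ω, X.jumpMeasure n 1 p ω (Set.Ioc 0 T) ^ 2 ∂P ≤ H.w p ^ 2 * (H.gain * (H.gain *
      (2 * (2 * (H.mom 2 * (H.gain * H.baseInt T T))) + 2 * (H.mom 1 * H.baseInt T T) ^ 2))) := by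
  have h2 : H.mom (2 * 1) ≠ ∞ := by simpa using H.mom_two_ne_top
  have hm : ∀ q, Measurable fun ω => X.jumpMeasure n 1 q ω (Set.Ioc 0 T) := fun q =>
    h.measurable_jumpMeasure n 1 q measurableSet_Ioc
  have hms : ∀ q, Measurable fun ω => X.stoppedIntensity H T n q ω (Set.Ioc 0 T) := fun q =>
    h.measurable_stoppedIntensity n q measurableSet_Ioc
  refine ENNReal.le_of_self_improving H.r_pos H.r_lt_one
    (x := fun p => ∫⁻ ω, X.jumpMeasure n 1 p ω (Set.Ioc 0 T) ^ 2 ∂P) (W := fun p => H.w p ^ 2)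
    (fun p => pow_ne_zero 2 (H.w_ne_zero p)) (fun p => ENNReal.pow_ne_top (H.w_ne_top p)) ?_ ?_ p
  · refine ⟨∑ q, ∫⁻ ω, X.jumpMeasure n 1 q ω (Set.Ioc 0 T) ^ 2 ∂P, ?_, fun q => ?_⟩
    · exact ENNReal.sum_ne_top.2 fun q _ => h.lintegral_jumpMeasure_sq_ne_top hT n h2 q
    · exact (Finset.single_le_sum (f := fun q => ∫⁻ ω, X.jumpMeasure n 1 q ω (Set.Ioc 0 T) ^ 2 ∂P)
        (fun _ _ => zero_le) (Finset.mem_univ q)).trans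
        (le_mul_of_one_le_left zero_le (H.one_le_sq_w q))
  · intro B hB p
    have hfin : ∀ᵐ ω ∂P, X.jumpMeasure n 1 p ω (Set.Ioc 0 T) ≠ ∞ ∧
        X.stoppedIntensity H T n p ω (Set.Ioc 0 T) ≠ ∞ := by
      have h3 := ae_lt_top (hms p) (h.lintegral_stoppedIntensity_ne_top n p hT le_rfl)
      have h4 := ae_lt_top (hm p) (by
        rw [h.lintegral_jumpMeasure n 1 p hT le_rfl]
        exact ENNReal.mul_ne_top H.mom_one_ne_top (h.lintegral_stoppedIntensity_ne_top n p hT le_rfl))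
      filter_upwards [h3, h4] with ω h5 h6
      exact ⟨h6.ne, h5.ne⟩
    set c : ℝ≥0∞ := H.mom 1 * H.baseInt T T
    set d : Ω → ℝ≥0∞ := fun ω => ‖(X.jumpMeasure n 1 p ω (Set.Ioc 0 T)).toReal -
      (H.mom 1 * X.stoppedIntensity H T n p ω (Set.Ioc 0 T)).toReal‖ₑ with hd
    set b : Ω → ℝ≥0∞ := fun ω => ∑ q, ∫⁻ u in Set.Ioi 0, H.κ p q u *
      X.jumpMeasure n 1 q ω (Set.Ioc 0 T) with hb
    have hdm : Measurable d := by
      have h1 := (hm p).ennreal_toReal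
      have h2 := ((hms p).const_mul (H.mom 1)).ennreal_toReal
      exact (h1.sub h2).enorm
    have hbm : Measurable b := by
      refine Finset.measurable_sum _ fun q _ => ?_
      simp_rw [lintegral_mul_const _ (H.measurable_κ p q)]
      exact (hm q).const_mul _
    -- Martingale part `d`, baseline `c`, feedback `b`. Only `b` contains the unknown, and it is a
    -- convolution, so the contraction applies to it.
    have hle : ∀ᵐ ω ∂P, X.jumpMeasure n 1 p ω (Set.Ioc 0 T) ≤ (d ω + c) + b ω := by
      filter_upwards [hfin] with ω hω
      refine (le_enorm_sub_add hω.1 (ENNReal.mul_ne_top H.mom_one_ne_top hω.2)).trans ?_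
      rw [add_assoc]
      refine add_le_add le_rfl ?_
      calc H.mom 1 * X.stoppedIntensity H T n p ω (Set.Ioc 0 T) ≤ H.mom 1 * (H.baseInt T T +
            ∑ q, (∫⁻ v in Set.Ioi 0, H.k p q v) * X.jumpMeasure n 1 q ω (Set.Ioc 0 T)) := by
            gcongr; exact h.stoppedIntensity_le n p T ω
        _ = c + b ω := by
            rw [mul_add, Finset.mul_sum]
            congr 1
            refine Finset.sum_congr rfl fun q _ => ?_
            rw [lintegral_mul_const _ (H.measurable_κ p q), H.lintegral_κ_eq, mul_assoc]
    have hdsq : ∫⁻ ω, d ω ^ 2 ∂P ≤ 2 * (H.mom 2 * (H.w p * (H.gain * H.baseInt T T))) := by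
      have := h.lintegral_sqDist_jumpMeasure_le n h2 p hT le_rfl
      simp_rw [sqDist_eq_enorm] at this
      exact this
    calc ∫⁻ ω, X.jumpMeasure n 1 p ω (Set.Ioc 0 T) ^ 2 ∂P
        ≤ ∫⁻ ω, (H.gain * (2 * d ω ^ 2 + 2 * c ^ 2) + ENNReal.ofReal H.r⁻¹ * b ω ^ 2) ∂P := by
          refine lintegral_mono_ae ?_
          filter_upwards [hle] with ω hω
          refine (pow_le_pow_left' hω 2).trans ((H.add_sq_le _ _).trans ?_)
          gcongr
          exact ENNReal.add_sq_le_two _ _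
      _ = H.gain * (2 * ∫⁻ ω, d ω ^ 2 ∂P + 2 * c ^ 2) +
            ENNReal.ofReal H.r⁻¹ * ∫⁻ ω, b ω ^ 2 ∂P := by
          rw [lintegral_add_left (by fun_prop), lintegral_const_mul _ (by fun_prop),
            lintegral_add_left (by fun_prop), lintegral_const_mul _ (by fun_prop),
            lintegral_const_mul _ (by fun_prop), lintegral_const_mul _ (by fun_prop)]
          simp
      _ ≤ H.gain * (2 * (2 * (H.mom 2 * (H.w p ^ 2 * (H.gain * H.baseInt T T)))) +
            2 * (H.w p ^ 2 * c ^ 2)) + H.w p ^ 2 * (ENNReal.ofReal H.r * B) := by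
          refine add_le_add ?_ (H.lintegral_sq_conv_le P (fun q => (hm q).comp measurable_snd)
            (fun q u _ => hB q) p)
          gcongr
          · exact hdsq.trans (by gcongr; exact H.w_le_sq p)
          · exact le_mul_of_one_le_left zero_le (H.one_le_sq_w p)
      _ = _ := by ring

end IsHawkes

end MarkedArrivals

/-! ### Real distances between extended nonnegative quantities -/

theorem le_enorm_sub_add' {x y : ℝ≥0∞} (hx : x ≠ ∞) (hy : y ≠ ∞) :
    y ≤ ‖x.toReal - y.toReal‖ₑ + x := by
  rw [enorm_sub_rev]
  exact le_enorm_sub_add hy hx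

theorem enorm_toReal_sub_le {x y d : ℝ≥0∞} (h1 : x ≤ y + d) (h2 : y ≤ x + d)
    (hx : x ≠ ∞) (hy : y ≠ ∞) : ‖x.toReal - y.toReal‖ₑ ≤ d := by
  rcases eq_or_ne d ∞ with rfl | hd
  · exact le_top
  have h1' := ENNReal.toReal_mono (ENNReal.add_ne_top.2 ⟨hy, hd⟩) h1
  have h2' := ENNReal.toReal_mono (ENNReal.add_ne_top.2 ⟨hx, hd⟩) h2
  rw [ENNReal.toReal_add hy hd] at h1'
  rw [ENNReal.toReal_add hx hd] at h2'
  rw [Real.enorm_eq_ofReal_abs, ← ENNReal.ofReal_toReal hd]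
  apply ENNReal.ofReal_le_ofReal
  rw [abs_le]
  constructor <;> linarith

theorem enorm_toReal_sub_triangle (x y z : ℝ≥0∞) :
    ‖x.toReal - z.toReal‖ₑ ≤ ‖x.toReal - y.toReal‖ₑ + ‖y.toReal - z.toReal‖ₑ := by
  rw [← sub_add_sub_cancel x.toReal y.toReal z.toReal]
  exact enorm_add_le _ _

theorem enorm_mul_toReal_sub (c x y : ℝ≥0∞) (hc : c ≠ ∞) :
    ‖(c * x).toReal - (c * y).toReal‖ₑ = c * ‖x.toReal - y.toReal‖ₑ := by
  rw [ENNReal.toReal_mul, ENNReal.toReal_mul, ← mul_sub, enorm_mul,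
    Real.enorm_eq_ofReal ENNReal.toReal_nonneg, ENNReal.ofReal_toReal hc]

theorem sqDist_le (x y : ℝ≥0∞) : sqDist x y ≤ 2 * x ^ 2 + 2 * y ^ 2 := by
  rw [sqDist_eq_enorm]
  refine le_trans (pow_le_pow_left' ?_ 2) (ENNReal.add_sq_le_two x y)
  refine (enorm_sub_le).trans (add_le_add ?_ ?_) <;>
  · rw [Real.enorm_eq_ofReal ENNReal.toReal_nonneg]
    exact ENNReal.ofReal_toReal_le

/-- Fatou's lemma. It removes the localization: with finitely many arrivals before the horizon, the
stopped quantities are eventually constant in `n`. -/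
theorem lintegral_le_of_ae_eventually_eq {α : Type*} {mα : MeasurableSpace α} {ν : Measure α}
    {f : ℕ → α → ℝ≥0∞} {g : α → ℝ≥0∞} (hf : ∀ n, Measurable (f n))
    (hfg : ∀ᵐ a ∂ν, ∀ᶠ n in atTop, f n a = g a) {C : ℝ≥0∞} (hC : ∀ n, ∫⁻ a, f n a ∂ν ≤ C) :
    ∫⁻ a, g a ∂ν ≤ C := by
  calc ∫⁻ a, g a ∂ν = ∫⁻ a, liminf (fun n => f n a) atTop ∂ν := by
        refine lintegral_congr_ae ?_
        filter_upwards [hfg] with a ha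
        rw [Filter.liminf_congr ha]
        simp
    _ ≤ liminf (fun n => ∫⁻ a, f n a ∂ν) atTop := lintegral_liminf_le hf
    _ ≤ C := by
        refine (Filter.liminf_le_liminf (Eventually.of_forall hC)).trans ?_
        simp

/-- The two one-sided inequalities `x ≤ |x - y| + y` and `y ≤ |x - y| + x` are integrated separately
in `[0, ∞]`, so no subtraction of integrals is needed. -/
theorem HawkesModel.enorm_convolution_sub_le (H : HawkesModel) (p : Fin 2) {a : ℝ≥0∞}
    {x y : Fin 2 → ℝ → ℝ≥0∞}
    (hm : ∀ q, Measurable fun v => ‖(x q v).toReal - (y q v).toReal‖ₑ)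
    (hx : ∀ q v, 0 < v → x q v ≠ ∞) (hy : ∀ q v, 0 < v → y q v ≠ ∞)
    (hxt : a + ∑ q, ∫⁻ v in Set.Ioi 0, H.κ p q v * x q v ≠ ∞)
    (hyt : a + ∑ q, ∫⁻ v in Set.Ioi 0, H.κ p q v * y q v ≠ ∞) :
    ‖(a + ∑ q, ∫⁻ v in Set.Ioi 0, H.κ p q v * x q v).toReal -
      (a + ∑ q, ∫⁻ v in Set.Ioi 0, H.κ p q v * y q v).toReal‖ₑ ≤
      ∑ q, ∫⁻ v in Set.Ioi 0, H.κ p q v * ‖(x q v).toReal - (y q v).toReal‖ₑ := by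
  have hm' : ∀ q, Measurable fun v => H.κ p q v * ‖(x q v).toReal - (y q v).toReal‖ₑ := fun q =>
    (H.measurable_κ p q).mul (hm q)
  refine enorm_toReal_sub_le ?_ ?_ hxt hyt
  · rw [add_assoc, ← Finset.sum_add_distrib]
    refine add_le_add le_rfl (Finset.sum_le_sum fun q _ => ?_)
    rw [← lintegral_add_right _ (hm' q)]
    refine setLIntegral_mono' measurableSet_Ioi fun v hv => ?_
    rw [← mul_add, add_comm (y q v)]
    exact mul_le_mul_right (le_enorm_sub_add (hx q v hv) (hy q v hv)) _
  · rw [add_assoc, ← Finset.sum_add_distrib]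
    refine add_le_add le_rfl (Finset.sum_le_sum fun q _ => ?_)
    rw [← lintegral_add_right _ (hm' q)]
    refine setLIntegral_mono' measurableSet_Ioi fun v hv => ?_
    rw [← mul_add, add_comm (x q v)]
    exact mul_le_mul_right (le_enorm_sub_add' (hx q v hv) (hy q v hv)) _

/-! ### Moments on the whole horizon: localization removed, renewal equation, variance -/

namespace MarkedArrivals

variable {Ω : Type*} (X : MarkedArrivals Ω)

/-- The integrated intensity. -/
noncomputable def cumInt (H : HawkesModel) (T : ℝ) (p : Fin 2) (t : ℝ) (ω : Ω) : ℝ≥0∞ :=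
  ∫⁻ u in Set.Ioc 0 t, X.lam H T p u ω

variable {X}
variable {mΩ : MeasurableSpace Ω} {P : Measure Ω} {ℱ : Filtration ℝ≥0 mΩ} {H : HawkesModel} {T : ℝ}

theorem cnt_mono (i : ℕ) (p : Fin 2) (ω : Ω) : Monotone fun t => X.cnt i p t ω :=
  pointSum_mono _ _

theorem cumInt_mono (p : Fin 2) (ω : Ω) : Monotone fun t => X.cumInt H T p t ω := fun _ _ hst =>
  lintegral_mono_set (Set.Ioc_subset_Ioc le_rfl hst)

namespace IsHawkes

theorem measurable_cumInt (h : X.IsHawkes P ℱ H T) (p : Fin 2) (t : ℝ) :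
    Measurable fun ω => X.cumInt H T p t ω :=
  Measurable.lintegral_prod_right' ((h.measurable_lam p).comp measurable_swap)

theorem measurable_cnt_right (h : X.IsHawkes P ℱ H T) (i : ℕ) (p : Fin 2) (t : ℝ) :
    Measurable fun ω => X.cnt i p t ω :=
  (h.measurable_cnt i p).comp measurable_prodMk_left

theorem cumInt_eq (h : X.IsHawkes P ℱ H T) (p : Fin 2) (t : ℝ) (ω : Ω) :
    X.cumInt H T p t ω =
      H.baseInt T t + ∑ q, ∫⁻ v in Set.Ioi 0, H.k p q v * X.cnt 1 q (t - v) ω := by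
  unfold cumInt lam
  rw [lintegral_add_left (H.measurable_base T),
    lintegral_excitation H.measurable_k (fun j => h.time_pos j ω)]
  rfl

theorem mom_mul_cumInt_eq (h : X.IsHawkes P ℱ H T) (p : Fin 2) (t : ℝ) (ω : Ω) :
    H.mom 1 * X.cumInt H T p t ω = H.mom 1 * H.baseInt T t +
      ∑ q, ∫⁻ v in Set.Ioi 0, H.κ p q v * X.cnt 1 q (t - v) ω := by
  rw [h.cumInt_eq, mul_add, Finset.mul_sum]
  congr 1
  refine Finset.sum_congr rfl fun q _ => ?_
  rw [← lintegral_const_mul' _ _ H.mom_one_ne_top]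
  simp_rw [HawkesModel.κ, mul_assoc]

theorem cnt_of_nonpos (h : X.IsHawkes P ℱ H T) (i : ℕ) (p : Fin 2) {t : ℝ} (ht : t ≤ 0) (ω : Ω) :
    X.cnt i p t ω = 0 := by
  simp only [cnt, pointSum, ENNReal.tsum_eq_zero]
  intro n
  rw [if_neg (not_le.2 (ht.trans_lt (h.time_pos n ω)))]

theorem cumInt_of_nonpos (p : Fin 2) {t : ℝ} (ht : t ≤ 0) (ω : Ω) : X.cumInt H T p t ω = 0 := by
  simp [cumInt, Set.Ioc_eq_empty (not_lt.2 ht)]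

theorem cnt_eq_iSup (h : X.IsHawkes P ℱ H T) (i : ℕ) (p : Fin 2) (t : ℝ) (ω : Ω) :
    X.cnt i p t ω = ⨆ n, X.jumpMeasure n i p ω (Set.Ioc 0 t) := by
  simp_rw [h.jumpMeasure_Ioc]
  exact ENNReal.tsum_eq_iSup_nat' (tendsto_add_atTop_nat 1)

theorem jumpMeasure_Ioc_mono (h : X.IsHawkes P ℱ H T) (i : ℕ) (p : Fin 2) (t : ℝ) (ω : Ω) :
    Monotone fun n => X.jumpMeasure n i p ω (Set.Ioc 0 t) := by
  intro m n hmn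
  simp only [h.jumpMeasure_Ioc]
  exact Finset.sum_le_sum_of_subset (Finset.range_subset_range.2 (by omega))

theorem stoppedIntensity_mono (h : X.IsHawkes P ℱ H T) (p : Fin 2) (t : ℝ) (ω : Ω) :
    Monotone fun n => X.stoppedIntensity H T n p ω (Set.Ioc 0 t) := by
  intro m n hmn
  simp only [stoppedIntensity_apply _ _ _ _ _ measurableSet_Ioc]
  exact lintegral_mono_set (Set.inter_subset_inter_right _
    (Set.Iic_subset_Iic.2 ((h.time_strictMono ω).monotone hmn)))

theorem lintegral_cnt_eq_iSup (h : X.IsHawkes P ℱ H T) (i : ℕ) (p : Fin 2) (t : ℝ) :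
    ∫⁻ ω, X.cnt i p t ω ∂P = ⨆ n, ∫⁻ ω, X.jumpMeasure n i p ω (Set.Ioc 0 t) ∂P := by
  simp_rw [h.cnt_eq_iSup]
  exact lintegral_iSup (fun n => h.measurable_jumpMeasure n i p measurableSet_Ioc)
    fun m n hmn ω => h.jumpMeasure_Ioc_mono i p t ω hmn

theorem jumpMeasure_eq_cnt (h : X.IsHawkes P ℱ H T) {n : ℕ} {ω : Ω} (hn : T < X.time n ω) (i : ℕ)
    (p : Fin 2) {t : ℝ} (ht : t ≤ T) : X.jumpMeasure n i p ω (Set.Ioc 0 t) = X.cnt i p t ω := by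
  rw [h.jumpMeasure_Ioc, cnt, pointSum, tsum_eq_sum]
  intro j hj
  rw [Finset.mem_range, not_lt] at hj
  rw [if_neg (not_le.2 ((ht.trans_lt hn).trans_le ((h.time_strictMono ω).monotone (by omega : n ≤ j))))]

theorem stoppedIntensity_eq_cumInt {n : ℕ} {ω : Ω} (hn : T < X.time n ω)
    (p : Fin 2) {t : ℝ} (ht : t ≤ T) :
    X.stoppedIntensity H T n p ω (Set.Ioc 0 t) = X.cumInt H T p t ω := by
  rw [stoppedIntensity_apply _ _ _ _ _ measurableSet_Ioc, cumInt, Set.inter_eq_left.2]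
  exact fun u hu => (hu.2.trans (ht.trans hn.le))

theorem cnt_ne_top_of_lt_time (h : X.IsHawkes P ℱ H T) {n : ℕ} {ω : Ω} (hn : T < X.time n ω) (i : ℕ)
    (p : Fin 2) {t : ℝ} (ht : t ≤ T) : X.cnt i p t ω ≠ ∞ := by
  rw [cnt, pointSum, tsum_eq_sum (s := Finset.range n)]
  · refine ENNReal.sum_ne_top.2 fun j _ => ?_
    unfold wt
    split_ifs <;> simp
  · intro j hj
    rw [Finset.mem_range, not_lt] at hj
    rw [if_neg (not_le.2 ((ht.trans_lt hn).trans_le ((h.time_strictMono ω).monotone hj)))]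

variable [IsProbabilityMeasure P]

theorem lintegral_cnt_le (h : X.IsHawkes P ℱ H T) (hT : 0 ≤ T) (i : ℕ) (p : Fin 2) :
    ∫⁻ ω, X.cnt i p T ω ∂P ≤ H.mom i * (H.w p * (H.gain * H.baseInt T T)) := by
  rw [h.lintegral_cnt_eq_iSup]
  refine iSup_le fun n => ?_
  rw [h.lintegral_jumpMeasure n i p hT le_rfl]
  gcongr
  exact h.lintegral_stoppedIntensity_le hT n p

/-- There are almost surely finitely many arrivals on `[0, T]`. -/
theorem ae_exists_lt_time (h : X.IsHawkes P ℱ H T) (hT : 0 ≤ T) :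
    ∀ᵐ ω ∂P, ∃ n, T < X.time n ω := by
  have hfin : ∀ p, ∀ᵐ ω ∂P, X.cnt 0 p T ω < ∞ := fun p => by
    refine ae_lt_top (h.measurable_cnt_right 0 p T) (ne_top_of_le_ne_top ?_ (h.lintegral_cnt_le hT 0 p))
    rw [H.mom_zero, one_mul]
    exact ENNReal.mul_ne_top (H.w_ne_top p) (ENNReal.mul_ne_top H.gain_ne_top (H.baseInt_ne_top _ _))
  filter_upwards [hfin 0, hfin 1] with ω h0 h1
  by_contra! hall
  -- If every arrival occurred by time `T`, the two counts would add up to infinitely many ones.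
  have h2 : X.cnt 0 0 T ω + X.cnt 0 1 T ω = ∑' _ : ℕ, (1 : ℝ≥0∞) := by
    unfold cnt pointSum
    rw [← ENNReal.tsum_add]
    refine tsum_congr fun n => ?_
    rw [if_pos (hall n), if_pos (hall n)]
    have hq : ∀ q : Fin 2, ((if q = 0 then 1 else 0) + if q = 1 then 1 else 0 : ℝ≥0∞) = 1 := by
      intro q
      fin_cases q <;> simp
    simpa [wt] using hq (X.side n ω)
  rw [ENNReal.tsum_const_eq_top_of_ne_zero one_ne_zero] at h2
  exact (ENNReal.add_lt_top.2 ⟨h0, h1⟩).ne h2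

theorem ae_eventually_eq (h : X.IsHawkes P ℱ H T) (hT : 0 ≤ T) :
    ∀ᵐ ω ∂P, ∀ᶠ n in atTop, ∀ t ≤ T, ∀ p, (∀ i, X.jumpMeasure n i p ω (Set.Ioc 0 t) = X.cnt i p t ω) ∧
      X.stoppedIntensity H T n p ω (Set.Ioc 0 t) = X.cumInt H T p t ω := by
  filter_upwards [h.ae_exists_lt_time hT] with ω ⟨n₀, hn₀⟩
  filter_upwards [eventually_ge_atTop n₀] with n hn t ht p
  have hlt : T < X.time n ω := hn₀.trans_le ((h.time_strictMono ω).monotone hn)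
  exact ⟨fun i => h.jumpMeasure_eq_cnt hlt i p ht, stoppedIntensity_eq_cumInt hlt p ht⟩

/-- Monotone convergence in `n` on both sides of the stopped identity. -/
theorem lintegral_cnt (h : X.IsHawkes P ℱ H T) (hT : 0 ≤ T) (i : ℕ) (p : Fin 2) {t : ℝ}
    (ht : t ≤ T) : ∫⁻ ω, X.cnt i p t ω ∂P = H.mom i * ∫⁻ ω, X.cumInt H T p t ω ∂P := by
  rcases lt_or_ge t 0 with h0 | h0
  · simp [h.cnt_of_nonpos i p h0.le, cumInt_of_nonpos p h0.le]
  have h1 : ∫⁻ ω, X.cumInt H T p t ω ∂P =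
      ⨆ n, ∫⁻ ω, X.stoppedIntensity H T n p ω (Set.Ioc 0 t) ∂P := by
    rw [← lintegral_iSup (fun n => h.measurable_stoppedIntensity n p measurableSet_Ioc)
      fun m n hmn ω => h.stoppedIntensity_mono p t ω hmn]
    refine lintegral_congr_ae ?_
    filter_upwards [h.ae_eventually_eq hT] with ω hω
    refine tendsto_nhds_unique ?_ (tendsto_atTop_iSup (h.stoppedIntensity_mono p t ω))
    exact tendsto_const_nhds.congr' (hω.mono fun n hn => (hn t ht p).2.symm)
  rw [h.lintegral_cnt_eq_iSup, h1, ENNReal.mul_iSup]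
  simp_rw [h.lintegral_jumpMeasure _ i p h0 ht]

theorem lintegral_cumInt_le (h : X.IsHawkes P ℱ H T) (hT : 0 ≤ T) (p : Fin 2) {t : ℝ}
    (ht : t ≤ T) : ∫⁻ ω, X.cumInt H T p t ω ∂P ≤ H.w p * (H.gain * H.baseInt T T) := by
  have h1 := h.lintegral_cnt hT 0 p le_rfl
  have h2 := h.lintegral_cnt_le hT 0 p
  rw [H.mom_zero, one_mul] at h1 h2
  exact (lintegral_mono fun ω => cumInt_mono p ω ht).trans (h1 ▸ h2)

theorem lintegral_cumInt_ne_top (h : X.IsHawkes P ℱ H T) (hT : 0 ≤ T) (p : Fin 2) {t : ℝ}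
    (ht : t ≤ T) : ∫⁻ ω, X.cumInt H T p t ω ∂P ≠ ∞ :=
  ne_top_of_le_ne_top (ENNReal.mul_ne_top (H.w_ne_top p)
    (ENNReal.mul_ne_top H.gain_ne_top (H.baseInt_ne_top _ _))) (h.lintegral_cumInt_le hT p ht)

theorem ae_cumInt_ne_top (h : X.IsHawkes P ℱ H T) (hT : 0 ≤ T) :
    ∀ᵐ ω ∂P, ∀ p, ∀ t ≤ T, X.cumInt H T p t ω ≠ ∞ := by
  have h1 : ∀ p, ∀ᵐ ω ∂P, X.cumInt H T p T ω < ∞ := fun p =>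
    ae_lt_top (h.measurable_cumInt p T) (h.lintegral_cumInt_ne_top hT p le_rfl)
  filter_upwards [ae_all_iff.2 h1] with ω hω p t ht
  exact ne_top_of_le_ne_top (hω p).ne (cumInt_mono p ω ht)

theorem ae_cnt_ne_top (h : X.IsHawkes P ℱ H T) (hT : 0 ≤ T) :
    ∀ᵐ ω ∂P, ∀ i p, ∀ t ≤ T, X.cnt i p t ω ≠ ∞ := by
  filter_upwards [h.ae_exists_lt_time hT] with ω ⟨n, hn⟩ i p t ht
  exact h.cnt_ne_top_of_lt_time hn i p ht

/-- The second moment of the compensated sums of the powers of the marks. -/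
theorem lintegral_sqDist_cnt_cumInt_le (h : X.IsHawkes P ℱ H T) (hT : 0 ≤ T) {i : ℕ}
    (hi : H.mom (2 * i) ≠ ∞) (p : Fin 2) {t : ℝ} (ht : t ≤ T) :
    ∫⁻ ω, sqDist (X.cnt i p t ω) (H.mom i * X.cumInt H T p t ω) ∂P ≤
      2 * (H.mom (2 * i) * (H.w p * (H.gain * H.baseInt T T))) := by
  rcases lt_or_ge t 0 with h0 | h0
  · simp [h.cnt_of_nonpos i p h0.le, cumInt_of_nonpos p h0.le, sqDist]
  refine lintegral_le_of_ae_eventually_eq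
    (f := fun n ω => sqDist (X.jumpMeasure n i p ω (Set.Ioc 0 t))
      (H.mom i * X.stoppedIntensity H T n p ω (Set.Ioc 0 t))) (fun n => ?_) ?_
    fun n => h.lintegral_sqDist_jumpMeasure_le n hi p h0 ht
  · exact measurable_sqDist (h.measurable_jumpMeasure n i p measurableSet_Ioc)
      ((h.measurable_stoppedIntensity n p measurableSet_Ioc).const_mul _)
  · filter_upwards [h.ae_eventually_eq hT] with ω hω
    filter_upwards [hω] with n hn
    rw [(hn t ht p).1, (hn t ht p).2]

/-- Only finiteness matters here: the constant may depend on `T`. It is the starting point that the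
self-improving variance bound requires. -/
theorem exists_lintegral_cnt_sq_le (h : X.IsHawkes P ℱ H T) (hT : 0 ≤ T) :
    ∃ C, C ≠ ∞ ∧ ∀ p, ∀ t ≤ T, ∫⁻ ω, X.cnt 1 p t ω ^ 2 ∂P ≤ H.w p ^ 2 * C := by
  refine ⟨_, ?_, fun p t ht => (lintegral_mono fun ω => pow_le_pow_left' (cnt_mono 1 p ω ht) 2).trans
    (lintegral_le_of_ae_eventually_eq (f := fun n ω => X.jumpMeasure n 1 p ω (Set.Ioc 0 T) ^ 2)
      (fun n => (h.measurable_jumpMeasure n 1 p measurableSet_Ioc).pow_const 2) ?_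
      fun n => h.lintegral_jumpMeasure_sq_le hT n p)⟩
  · have h1 := H.gain_ne_top
    have h2 := H.baseInt_ne_top T T
    have h3 := H.mom_two_ne_top
    have h4 := H.mom_one_ne_top
    finiteness
  · filter_upwards [h.ae_eventually_eq hT] with ω hω
    filter_upwards [hω] with n hn
    rw [(hn T le_rfl p).1]

/-- The renewal equation for the mean of the integrated intensity. -/
theorem lintegral_cumInt_eq (h : X.IsHawkes P ℱ H T) (hT : 0 ≤ T) (p : Fin 2) {t : ℝ} (ht : t ≤ T) :
    ∫⁻ ω, X.cumInt H T p t ω ∂P = H.baseInt T t +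
      ∑ q, ∫⁻ v in Set.Ioi 0, H.κ p q v * ∫⁻ ω, X.cumInt H T q (t - v) ω ∂P := by
  have hm : ∀ q, Measurable fun x : Ω × ℝ => H.k p q x.2 * X.cnt 1 q (t - x.2) x.1 := fun q =>
    ((H.measurable_k p q).comp measurable_snd).mul ((h.measurable_cnt 1 q).comp
      ((measurable_const.sub measurable_snd).prodMk measurable_fst))
  simp_rw [h.cumInt_eq p t]
  rw [lintegral_add_left measurable_const, lintegral_finsetSum _ fun q _ => (hm q).lintegral_prod_right']
  simp only [lintegral_const, measure_univ, mul_one]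
  congr 1
  refine Finset.sum_congr rfl fun q _ => ?_
  rw [lintegral_lintegral_swap (hm q).aemeasurable]
  refine setLIntegral_congr_fun measurableSet_Ioi fun v hv => ?_
  have hv' : (0 : ℝ) < v := hv
  rw [lintegral_const_mul _ (h.measurable_cnt_right 1 q (t - v)), h.lintegral_cnt hT 1 q (by linarith),
    HawkesModel.κ]
  ring

/-- The variance of the sums of the marks grows at most linearly. -/
theorem lintegral_sqDist_cnt_one_le (h : X.IsHawkes P ℱ H T) (hT : 0 ≤ T) (p : Fin 2) {t : ℝ}
    (ht : t ≤ T) :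
    ∫⁻ ω, sqDist (X.cnt 1 p t ω) (H.mom 1 * ∫⁻ ω, X.cumInt H T p t ω ∂P) ∂P ≤
      H.w p ^ 2 * (H.gain * (H.gain * (2 * (H.mom 2 * (H.gain * H.baseInt T T))))) := by
  have h2 : H.mom (2 * 1) ≠ ∞ := by simpa using H.mom_two_ne_top
  set m : Fin 2 → ℝ → ℝ≥0∞ := fun q t => H.mom 1 * ∫⁻ ω, X.cumInt H T q t ω ∂P with hmdef
  have hmm : ∀ q, Measurable (m q) := fun q => by
    refine Monotone.measurable fun s t hst => ?_
    simp only [hmdef]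
    gcongr
    exact cumInt_mono q _ hst
  have hmt : ∀ q, ∀ t ≤ T, m q t ≠ ∞ := fun q t ht =>
    ENNReal.mul_ne_top H.mom_one_ne_top (h.lintegral_cumInt_ne_top hT q ht)
  -- Indexing by all times up to `T`, negative ones included, makes the family stable under the
  -- shift from `t` to `t - v`.
  refine ENNReal.le_of_self_improving H.r_pos H.r_lt_one (ι := Fin 2 × Set.Iic T)
    (x := fun j => ∫⁻ ω, sqDist (X.cnt 1 j.1 j.2 ω) (m j.1 j.2) ∂P)
    (W := fun j => H.w j.1 ^ 2) (fun j => pow_ne_zero 2 (H.w_ne_zero j.1))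
    (fun j => ENNReal.pow_ne_top (H.w_ne_top j.1)) ?_ ?_ (p, ⟨t, ht⟩)
  · obtain ⟨C, hC, hCb⟩ := h.exists_lintegral_cnt_sq_le hT
    refine ⟨2 * C + 2 * ∑ q, m q T ^ 2, ?_, fun ⟨q, s, hs⟩ => ?_⟩
    · have : ∑ q, m q T ^ 2 ≠ ∞ := ENNReal.sum_ne_top.2 fun q _ => ENNReal.pow_ne_top (hmt q T le_rfl)
      finiteness
    · have hms : m q s ≤ m q T := by
        simp only [hmdef]
        gcongr
        exact cumInt_mono q _ hs
      calc ∫⁻ ω, sqDist (X.cnt 1 q s ω) (m q s) ∂P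
          ≤ ∫⁻ ω, (2 * X.cnt 1 q s ω ^ 2 + 2 * m q s ^ 2) ∂P := lintegral_mono fun ω => sqDist_le _ _
        _ = 2 * ∫⁻ ω, X.cnt 1 q s ω ^ 2 ∂P + 2 * m q s ^ 2 := by
          have := (h.measurable_cnt_right 1 q s).pow_const 2
          rw [lintegral_add_left (this.const_mul 2), lintegral_const_mul _ this]
          simp
        _ ≤ 2 * (H.w q ^ 2 * C) + 2 * (H.w q ^ 2 * ∑ q, m q T ^ 2) := by
          gcongr
          · exact hCb q s hs
          · refine le_trans ?_ (le_mul_of_one_le_left zero_le (H.one_le_sq_w q))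
            exact (pow_le_pow_left' hms 2).trans (Finset.single_le_sum (f := fun q => m q T ^ 2)
              (fun _ _ => zero_le) (Finset.mem_univ q))
        _ = _ := by ring
  · rintro B hB ⟨p, t, ht⟩
    have ht' : t ≤ T := ht
    have hmeq : m p t = H.mom 1 * H.baseInt T t +
        ∑ q, ∫⁻ v in Set.Ioi 0, H.κ p q v * m q (t - v) := by
      simp only [hmdef]
      rw [h.lintegral_cumInt_eq hT p ht', mul_add, Finset.mul_sum]
      congr 1
      refine Finset.sum_congr rfl fun q _ => ?_
      rw [← lintegral_const_mul' _ _ H.mom_one_ne_top]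
      congr 1 with v
      rw [mul_left_comm]
    obtain ⟨D, hD⟩ : ∃ D : Fin 2 → ℝ → Ω → ℝ≥0∞, ∀ q v ω, D q v ω =
      ‖(X.cnt 1 q (t - v) ω).toReal - (m q (t - v)).toReal‖ₑ := ⟨_, fun _ _ _ => rfl⟩
    obtain ⟨d, hd⟩ : ∃ d : Ω → ℝ≥0∞, ∀ ω, d ω =
      ‖(X.cnt 1 p t ω).toReal - (H.mom 1 * X.cumInt H T p t ω).toReal‖ₑ := ⟨_, fun _ => rfl⟩
    have hDm : ∀ q, Measurable fun x : ℝ × Ω => D q x.1 x.2 := fun q => by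
      have e1 : Measurable fun x : ℝ × Ω => X.cnt 1 q (t - x.1) x.2 :=
        (h.measurable_cnt 1 q).comp ((measurable_const.sub measurable_fst).prodMk measurable_snd)
      have e2 : Measurable fun x : ℝ × Ω => m q (t - x.1) :=
        (hmm q).comp (measurable_const.sub measurable_fst)
      simp_rw [hD]
      exact (e1.ennreal_toReal.sub e2.ennreal_toReal).enorm
    have hDmv : ∀ q ω, Measurable fun v => D q v ω := fun q ω =>
      (hDm q).comp (measurable_prodMk_right (y := ω))
    have hdm : Measurable d := by
      have e1 := (h.measurable_cnt_right 1 p t).ennreal_toReal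
      have e2 := ((h.measurable_cumInt p t).const_mul (H.mom 1)).ennreal_toReal
      simp_rw [funext hd]
      exact (e1.sub e2).enorm
    have hbm : Measurable fun ω => ∑ q, ∫⁻ v in Set.Ioi 0, H.κ p q v * D q v ω :=
      Finset.measurable_sum _ fun q _ => (((H.measurable_κ p q).comp measurable_snd).mul
        ((hDm q).comp measurable_swap)).lintegral_prod_right'
    -- The integrated intensity and its mean satisfy the same affine equation, so their difference
    -- is the convolution of the kernel with the past fluctuations `D`; the martingale part `d` is
    -- added to it.
    have hle : ∀ᵐ ω ∂P, ‖(X.cnt 1 p t ω).toReal - (m p t).toReal‖ₑ ≤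
        d ω + ∑ q, ∫⁻ v in Set.Ioi 0, H.κ p q v * D q v ω := by
      filter_upwards [h.ae_cumInt_ne_top hT, h.ae_cnt_ne_top hT] with ω h3 h4
      refine (enorm_toReal_sub_triangle _ (H.mom 1 * X.cumInt H T p t ω) _).trans ?_
      rw [hd]
      refine add_le_add le_rfl ?_
      have e1 := h.mom_mul_cumInt_eq p t ω
      have key := H.enorm_convolution_sub_le p (a := H.mom 1 * H.baseInt T t)
        (x := fun q v => X.cnt 1 q (t - v) ω) (y := fun q v => m q (t - v))
        (fun q => by simpa only [hD] using hDmv q ω) (fun q v hv => h4 1 q _ (by linarith))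
        (fun q v hv => hmt q _ (by linarith))
        (e1 ▸ ENNReal.mul_ne_top H.mom_one_ne_top (h3 p t ht')) (hmeq ▸ hmt p t ht')
      rw [e1, hmeq]
      simpa only [hD] using key
    calc ∫⁻ ω, sqDist (X.cnt 1 p t ω) (m p t) ∂P
        ≤ ∫⁻ ω, (H.gain * d ω ^ 2 + ENNReal.ofReal H.r⁻¹ *
            (∑ q, ∫⁻ v in Set.Ioi 0, H.κ p q v * D q v ω) ^ 2) ∂P := by
          refine lintegral_mono_ae ?_
          filter_upwards [hle] with ω hω
          rw [sqDist_eq_enorm]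
          exact (pow_le_pow_left' hω 2).trans (H.add_sq_le _ _)
      _ = H.gain * ∫⁻ ω, d ω ^ 2 ∂P + ENNReal.ofReal H.r⁻¹ *
            ∫⁻ ω, (∑ q, ∫⁻ v in Set.Ioi 0, H.κ p q v * D q v ω) ^ 2 ∂P := by
          rw [lintegral_add_left (by fun_prop), lintegral_const_mul _ (by fun_prop),
            lintegral_const_mul _ (hbm.pow_const 2)]
      _ ≤ H.gain * (2 * (H.mom 2 * (H.w p ^ 2 * (H.gain * H.baseInt T T)))) +
            H.w p ^ 2 * (ENNReal.ofReal H.r * B) := by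
          refine add_le_add ?_ (H.lintegral_sq_conv_le P hDm (fun q v hv => ?_) p)
          · gcongr H.gain * ?_
            have := h.lintegral_sqDist_cnt_cumInt_le hT h2 p ht'
            simp_rw [sqDist_eq_enorm, ← hd] at this
            refine this.trans ?_
            simp only [mul_one]
            gcongr
            exact H.w_le_sq p
          · have := hB (q, ⟨t - v, by simp only [Set.mem_Iic]; linarith⟩)
            simp_rw [sqDist_eq_enorm, ← hD] at this
            exact this
      _ = _ := by ring

end IsHawkes

end MarkedArrivals

/-! ### Comparison of the mean with its limit, and variance constants -/

namespace HawkesModel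

variable (H : HawkesModel)

theorem baseInt_mono (T : ℝ) : Monotone (H.baseInt T) := fun _ _ hst =>
  lintegral_mono_set (Set.Ioc_subset_Ioc le_rfl hst)

theorem baseInt_of_nonpos (T : ℝ) {t : ℝ} (ht : t ≤ 0) : H.baseInt T t = 0 := by
  simp [baseInt, Set.Ioc_eq_empty (not_lt.2 ht)]

/-- A shift by `v` loses at most the integral over a window of length `min v t`. Keeping the minimum
with the horizon is essential, because `∫ v κ(v) dv` may be infinite. -/
theorem baseInt_le_add (T : ℝ) {t v : ℝ} (ht : t ≤ T) :
    H.baseInt T t ≤ H.baseInt T (t - v) + ENNReal.ofReal H.μbar * ENNReal.ofReal (min v T) := by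
  rcases le_total t 0 with h0 | h0
  · simp [H.baseInt_of_nonpos T h0]
  have hsub : Set.Ioc 0 t ⊆ Set.Ioc 0 (t - v) ∪ Set.Ioc (t - min v t) t := by
    intro u hu
    rcases le_or_gt u (t - v) with h1 | h1
    · exact Or.inl ⟨hu.1, h1⟩
    · refine Or.inr ⟨?_, hu.2⟩
      rcases min_choice v t with h2 | h2 <;> rw [h2]
      · exact h1
      · simpa using hu.1
  calc H.baseInt T t ≤ ∫⁻ u in Set.Ioc 0 (t - v) ∪ Set.Ioc (t - min v t) t, H.base T u :=
        lintegral_mono_set hsub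
    _ ≤ H.baseInt T (t - v) + ∫⁻ u in Set.Ioc (t - min v t) t, H.base T u := lintegral_union_le _ _ _
    _ ≤ H.baseInt T (t - v) + ∫⁻ _ in Set.Ioc (t - min v t) t, ENNReal.ofReal H.μbar := by
        gcongr with u
        exact H.base_le T u
    _ ≤ _ := by
        simp only [lintegral_const, Measure.restrict_apply_univ, Real.volume_Ioc]
        gcongr
        rw [sub_sub_cancel]
        exact min_le_min_left v ht

/-- The error made by replacing `∫₀ᵗ k(v) h(t - v) dv` by `h(t) ∫ k`. -/
noncomputable def tailErr (T : ℝ) : ℝ≥0∞ :=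
  ∑ p, ∑ q, ∫⁻ v in Set.Ioi 0, H.κ p q v * (H.w q * (ENNReal.ofReal H.μbar * ENNReal.ofReal (min v T)))

theorem measurable_tailErr_integrand (T : ℝ) (p q : Fin 2) : Measurable fun v =>
    H.κ p q v * (H.w q * (ENNReal.ofReal H.μbar * ENNReal.ofReal (min v T))) :=
  (H.measurable_κ p q).mul (by fun_prop)

/-- Dominated convergence: `min v T / T` is at most `1` and tends to `0` for each `v`. Integrability
of the kernel suffices, without a first moment. -/
theorem tailErr_div_tendsto :
    Tendsto (fun T => H.tailErr T / ENNReal.ofReal T) atTop (𝓝 0) := by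
  have hterm : ∀ p q, Tendsto (fun T => ∫⁻ v in Set.Ioi 0,
      H.κ p q v * (H.w q * ENNReal.ofReal H.μbar) * ENNReal.ofReal (min v T / T)) atTop (𝓝 0) := by
    intro p q
    have h0 : (0 : ℝ≥0∞) = ∫⁻ v in Set.Ioi (0 : ℝ), (0 : ℝ≥0∞) := by simp
    rw [h0]
    have hm : Measurable fun v => H.κ p q v * (H.w q * ENNReal.ofReal H.μbar) :=
      (H.measurable_κ p q).mul_const _
    refine tendsto_lintegral_filter_of_dominated_convergence
      (fun v => H.κ p q v * (H.w q * ENNReal.ofReal H.μbar)) ?_ ?_ ?_ ?_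
    · exact Eventually.of_forall fun T => hm.mul (by fun_prop)
    · filter_upwards [eventually_gt_atTop 0] with T hT
      refine Eventually.of_forall fun v => mul_le_of_le_one_right zero_le ?_
      rw [ENNReal.ofReal_le_one, div_le_one hT]
      exact min_le_right _ _
    · rw [lintegral_mul_const _ (H.measurable_κ p q)]
      exact ENNReal.mul_ne_top (H.lintegral_κ_ne_top p q)
        (ENNReal.mul_ne_top (H.w_ne_top q) ENNReal.ofReal_ne_top)
    · have hk : ∀ᵐ v ∂(volume.restrict (Set.Ioi (0 : ℝ))), H.κ p q v < ∞ :=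
        ae_lt_top (H.measurable_κ p q) (H.lintegral_κ_ne_top p q)
      filter_upwards [hk] with v hv
      have h1 : Tendsto (fun T : ℝ => ENNReal.ofReal (min v T / T)) atTop (𝓝 0) := by
        rw [show (0 : ℝ≥0∞) = ENNReal.ofReal 0 by simp]
        refine ENNReal.tendsto_ofReal ?_
        have h2 : Tendsto (fun T : ℝ => v / T) atTop (𝓝 0) := tendsto_const_nhds.div_atTop tendsto_id
        refine h2.congr' ?_
        filter_upwards [eventually_ge_atTop v] with T hT
        rw [min_eq_left hT]
      have h3 := ENNReal.Tendsto.const_mul (a := H.κ p q v * (H.w q * ENNReal.ofReal H.μbar)) h1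
        (Or.inr (ENNReal.mul_ne_top hv.ne (ENNReal.mul_ne_top (H.w_ne_top q) ENNReal.ofReal_ne_top)))
      simpa using h3
  have hsum : Tendsto (fun T => ∑ p, ∑ q, ∫⁻ v in Set.Ioi 0,
      H.κ p q v * (H.w q * ENNReal.ofReal H.μbar) * ENNReal.ofReal (min v T / T)) atTop
      (𝓝 (∑ _p : Fin 2, ∑ _q : Fin 2, 0)) :=
    tendsto_finsetSum _ fun p _ => tendsto_finsetSum _ fun q _ => hterm p q
  simp only [Finset.sum_const_zero] at hsum
  refine hsum.congr' ?_
  filter_upwards [eventually_gt_atTop 0] with T hT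
  rw [tailErr, ENNReal.div_eq_inv_mul, Finset.mul_sum]
  refine Finset.sum_congr rfl fun p _ => ?_
  rw [Finset.mul_sum]
  refine Finset.sum_congr rfl fun q _ => ?_
  rw [← lintegral_const_mul _ (H.measurable_tailErr_integrand T p q)]
  congr 1 with v
  rw [ENNReal.ofReal_div_of_pos hT, ENNReal.div_eq_inv_mul]
  ring

/-- The variance constant for the sums of the `i`-th powers of the marks. -/
noncomputable def varConst (i : ℕ) (p : Fin 2) : ℝ≥0∞ :=
  (2 * (2 * (H.mom (2 * i) * (H.w p * H.gain))) + 2 * (H.mom i ^ 2 * ((H.mom 1)⁻¹ ^ 2 *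
    (2 * (2 * (H.mom 2 * (H.w p * H.gain))) +
      2 * (H.w p ^ 2 * (H.gain * (H.gain * (2 * (H.mom 2 * H.gain))))))))) * ENNReal.ofReal H.μbar

theorem varConst_ne_top {i : ℕ} (hi : H.mom (2 * i) ≠ ∞) (p : Fin 2) : H.varConst i p ≠ ∞ := by
  have h1 := H.gain_ne_top
  have h2 := H.w_ne_top p
  have h3 := H.mom_two_ne_top
  have h4 := H.mom_ne_top_of_two_mul hi
  have h5 : (H.mom 1)⁻¹ ≠ ∞ := ENNReal.inv_ne_top.2 H.mom_one_ne_zero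
  unfold varConst
  finiteness

end HawkesModel

namespace MarkedArrivals

variable {Ω : Type*} {X : MarkedArrivals Ω}
variable {mΩ : MeasurableSpace Ω} {P : Measure Ω} {ℱ : Filtration ℝ≥0 mΩ} {H : HawkesModel} {T : ℝ}

namespace IsHawkes

variable [IsProbabilityMeasure P]

/-- The variance of the sums of the powers of the marks grows at most linearly. -/
theorem lintegral_sqDist_cnt_le (h : X.IsHawkes P ℱ H T) (hT : 0 ≤ T) {i : ℕ}
    (hi : H.mom (2 * i) ≠ ∞) (p : Fin 2) {t : ℝ} (ht : t ≤ T) :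
    ∫⁻ ω, sqDist (X.cnt i p t ω) (H.mom i * ∫⁻ ω, X.cumInt H T p t ω ∂P) ∂P ≤
      H.varConst i p * ENNReal.ofReal T := by
  have h2 : H.mom (2 * 1) ≠ ∞ := by simpa using H.mom_two_ne_top
  have hmi := H.mom_ne_top_of_two_mul hi
  set m : ℝ≥0∞ := ∫⁻ ω, X.cumInt H T p t ω ∂P with hm
  obtain ⟨d, hd⟩ : ∃ d : ℕ → Ω → ℝ≥0∞, ∀ j ω, d j ω =
    ‖(X.cnt j p t ω).toReal - (H.mom j * X.cumInt H T p t ω).toReal‖ₑ := ⟨_, fun _ _ => rfl⟩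
  obtain ⟨D, hD⟩ : ∃ D : Ω → ℝ≥0∞, ∀ ω, D ω =
    ‖(X.cnt 1 p t ω).toReal - (H.mom 1 * m).toReal‖ₑ := ⟨_, fun _ => rfl⟩
  have hdm : ∀ j, Measurable (d j) := fun j => by
    have e1 := (h.measurable_cnt_right j p t).ennreal_toReal
    have e2 := ((h.measurable_cumInt p t).const_mul (H.mom j)).ennreal_toReal
    rw [funext (hd j)]
    exact (e1.sub e2).enorm
  have hDm : Measurable D := by
    have e1 := (h.measurable_cnt_right 1 p t).ennreal_toReal
    rw [funext hD]
    exact (e1.sub_const _).enorm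
  have hd2 : ∀ j, H.mom (2 * j) ≠ ∞ → ∫⁻ ω, d j ω ^ 2 ∂P ≤
      2 * (H.mom (2 * j) * (H.w p * (H.gain * H.baseInt T T))) := fun j hj => by
    have := h.lintegral_sqDist_cnt_cumInt_le hT hj p ht
    simpa only [sqDist_eq_enorm, ← hd] using this
  have hD2 : ∫⁻ ω, D ω ^ 2 ∂P ≤
      H.w p ^ 2 * (H.gain * (H.gain * (2 * (H.mom 2 * (H.gain * H.baseInt T T))))) := by
    have := h.lintegral_sqDist_cnt_one_le hT p ht
    simpa only [sqDist_eq_enorm, ← hm, ← hD] using this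
  -- The fluctuation of the integrated intensity does not depend on `i`; it is recovered from the
  -- sums of the marks, `i = 1`, after division by `mom 1`.
  have hpt : ∀ ω, ‖(X.cnt i p t ω).toReal - (H.mom i * m).toReal‖ₑ ≤
      d i ω + H.mom i * ((H.mom 1)⁻¹ * (d 1 ω + D ω)) := fun ω => by
    refine (enorm_toReal_sub_triangle _ (H.mom i * X.cumInt H T p t ω) _).trans ?_
    rw [hd]
    refine add_le_add le_rfl ?_
    rw [enorm_mul_toReal_sub _ _ _ hmi]
    refine mul_le_mul_right ?_ _
    rw [← ENNReal.div_eq_inv_mul, ENNReal.le_div_iff_mul_le (Or.inl H.mom_one_ne_zero)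
      (Or.inl H.mom_one_ne_top), mul_comm, ← enorm_mul_toReal_sub _ _ _ H.mom_one_ne_top, hd, hD, enorm_sub_rev (X.cnt 1 p t ω).toReal]
    exact enorm_toReal_sub_triangle _ _ _
  calc ∫⁻ ω, sqDist (X.cnt i p t ω) (H.mom i * m) ∂P
      ≤ ∫⁻ ω, (2 * d i ω ^ 2 + 2 * (H.mom i ^ 2 * ((H.mom 1)⁻¹ ^ 2 *
          (2 * d 1 ω ^ 2 + 2 * D ω ^ 2)))) ∂P := by
        refine lintegral_mono fun ω => ?_
        rw [sqDist_eq_enorm]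
        refine (pow_le_pow_left' (hpt ω) 2).trans ((ENNReal.add_sq_le_two _ _).trans ?_)
        rw [mul_pow, mul_pow]
        gcongr
        exact ENNReal.add_sq_le_two _ _
    _ = 2 * ∫⁻ ω, d i ω ^ 2 ∂P + 2 * (H.mom i ^ 2 * ((H.mom 1)⁻¹ ^ 2 *
          (2 * ∫⁻ ω, d 1 ω ^ 2 ∂P + 2 * ∫⁻ ω, D ω ^ 2 ∂P))) := by
        have e0 := (hdm i).pow_const 2
        have e1 := (hdm 1).pow_const 2
        have e2 := hDm.pow_const 2
        rw [lintegral_add_left (e0.const_mul 2), lintegral_const_mul _ e0,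
          lintegral_const_mul _ (by fun_prop), lintegral_const_mul _ (by fun_prop),
          lintegral_const_mul _ (by fun_prop), lintegral_add_left (e1.const_mul 2),
          lintegral_const_mul _ e1, lintegral_const_mul _ e2]
    _ ≤ 2 * (2 * (H.mom (2 * i) * (H.w p * (H.gain * (ENNReal.ofReal H.μbar * ENNReal.ofReal T))))) +
          2 * (H.mom i ^ 2 * ((H.mom 1)⁻¹ ^ 2 *
          (2 * (2 * (H.mom 2 * (H.w p * (H.gain * (ENNReal.ofReal H.μbar * ENNReal.ofReal T))))) +
            2 * (H.w p ^ 2 * (H.gain * (H.gain * (2 * (H.mom 2 *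
              (H.gain * (ENNReal.ofReal H.μbar * ENNReal.ofReal T)))))))))) := by
        have hb := H.baseInt_le T T
        have e0 := hd2 i hi
        have e1 := hd2 1 h2
        rw [mul_one] at e1
        gcongr
        · exact e0.trans (by gcongr)
        · exact e1.trans (by gcongr)
        · exact hD2.trans (by gcongr)
    _ = H.varConst i p * ENNReal.ofReal T := by rw [HawkesModel.varConst]; ring

/-- The mean is close to the solution of the limiting linear equation. -/
theorem enorm_mean_sub_le (h : X.IsHawkes P ℱ H T) (hT : 0 ≤ T) (p : Fin 2) {t : ℝ} (ht : t ≤ T) :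
    ‖(∫⁻ ω, X.cumInt H T p t ω ∂P).toReal - (H.w p * H.baseInt T t).toReal‖ₑ ≤
      H.w p * (H.gain * H.tailErr T) := by
  obtain ⟨m, hmdef⟩ : ∃ m : Fin 2 → ℝ → ℝ≥0∞, ∀ q t, m q t = ∫⁻ ω, X.cumInt H T q t ω ∂P :=
    ⟨_, fun _ _ => rfl⟩
  have hmono : ∀ q, Monotone (m q) := fun q s t hst => by
    rw [hmdef, hmdef]
    exact lintegral_mono fun ω => cumInt_mono q ω hst
  have hmt : ∀ q, ∀ t ≤ T, m q t ≠ ∞ := fun q t ht => by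
    rw [hmdef]
    exact h.lintegral_cumInt_ne_top hT q ht
  have hwb : ∀ q t, H.w q * H.baseInt T t ≠ ∞ := fun q t =>
    ENNReal.mul_ne_top (H.w_ne_top q) (H.baseInt_ne_top T t)
  have hbm : Measurable (H.baseInt T) := (H.baseInt_mono T).measurable
  rw [← hmdef]
  refine ENNReal.le_of_self_improving H.r_pos H.r_lt_one (ι := Fin 2 × Set.Iic T)
    (x := fun j => ‖(m j.1 j.2).toReal - (H.w j.1 * H.baseInt T j.2).toReal‖ₑ)
    (W := fun j => H.w j.1) (fun j => H.w_ne_zero j.1) (fun j => H.w_ne_top j.1)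
    ?_ ?_ (p, ⟨t, ht⟩)
  · refine ⟨∑ q, (m q T + H.w q * H.baseInt T T), ENNReal.sum_ne_top.2 fun q _ =>
      ENNReal.add_ne_top.2 ⟨hmt q T le_rfl, hwb q T⟩, fun ⟨q, s, hs⟩ => ?_⟩
    have hs' : s ≤ T := hs
    refine le_trans ?_ (le_mul_of_one_le_left zero_le (H.one_le_w q))
    refine le_trans ?_ (Finset.single_le_sum (f := fun q => m q T + H.w q * H.baseInt T T)
      (fun _ _ => zero_le) (Finset.mem_univ q))
    refine enorm_toReal_sub_le ?_ ?_ (hmt q s hs') (hwb q s)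
    · exact (hmono q hs').trans (le_self_add.trans le_add_self)
    · have : H.w q * H.baseInt T s ≤ H.w q * H.baseInt T T := by
        gcongr
        exact H.baseInt_mono T hs'
      exact this.trans (le_add_self.trans le_add_self)
  · rintro B hB ⟨p, t, ht⟩
    have ht' : t ≤ T := ht
    have e1 : m p t = H.baseInt T t + ∑ q, ∫⁻ v in Set.Ioi 0, H.κ p q v * m q (t - v) := by
      simp_rw [hmdef]
      exact h.lintegral_cumInt_eq hT p ht'
    -- By `w = 1 + K w`, the candidate `w * baseInt` solves the renewal equation with the
    -- convolution frozen at time `t`. The cost of freezing is bounded by `baseInt_le_add` and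
    -- collected in `tailErr`.
    have e2 : H.w p * H.baseInt T t = H.baseInt T t +
        ∑ q, ∫⁻ v in Set.Ioi 0, H.κ p q v * (H.w q * H.baseInt T t) := by
      conv_lhs => rw [H.w_eq' p]
      rw [add_mul, one_mul, Finset.sum_mul]
      congr 1
      refine Finset.sum_congr rfl fun q _ => ?_
      rw [lintegral_mul_const _ (H.measurable_κ p q), mul_assoc]
    have hmeas : ∀ q, Measurable fun v => ‖(m q (t - v)).toReal - (H.w q * H.baseInt T t).toReal‖ₑ := by
      intro q
      have := ((hmono q).measurable.comp (measurable_const.sub measurable_id : Measurable fun v => t - v))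
      exact (this.ennreal_toReal.sub_const _).enorm
    have key := H.enorm_convolution_sub_le p (a := H.baseInt T t)
      (x := fun q v => m q (t - v)) (y := fun q _ => H.w q * H.baseInt T t) hmeas
      (fun q v hv => hmt q _ (by linarith)) (fun q v _ => hwb q t) (e1 ▸ hmt p t ht') (e2 ▸ hwb p t)
    rw [← e1, ← e2] at key
    calc ‖(m p t).toReal - (H.w p * H.baseInt T t).toReal‖ₑ
        ≤ ∑ q, ∫⁻ v in Set.Ioi 0, (H.κ p q v * (H.w q * B) + H.κ p q v *
            (H.w q * (ENNReal.ofReal H.μbar * ENNReal.ofReal (min v T)))) := by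
          refine key.trans (Finset.sum_le_sum fun q _ => ?_)
          refine setLIntegral_mono' measurableSet_Ioi fun v hv => ?_
          have hv' : (0 : ℝ) < v := hv
          rw [← mul_add]
          refine mul_le_mul_right ?_ _
          refine (enorm_toReal_sub_triangle _ (H.w q * H.baseInt T (t - v)) _).trans ?_
          refine add_le_add (hB (q, ⟨t - v, by simp only [Set.mem_Iic]; linarith⟩)) ?_
          refine enorm_toReal_sub_le ?_ ?_ (hwb q _) (hwb q _)
          · refine le_trans ?_ le_self_add
            gcongr
            exact H.baseInt_mono T (by linarith)
          · rw [← mul_add]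
            gcongr
            exact H.baseInt_le_add T ht'
      _ = ∑ q, (∫⁻ v in Set.Ioi 0, H.κ p q v) * H.w q * B + ∑ q, ∫⁻ v in Set.Ioi 0, H.κ p q v *
            (H.w q * (ENNReal.ofReal H.μbar * ENNReal.ofReal (min v T))) := by
          rw [← Finset.sum_add_distrib]
          refine Finset.sum_congr rfl fun q _ => ?_
          rw [lintegral_add_right _ (H.measurable_tailErr_integrand T p q),
            lintegral_mul_const _ (H.measurable_κ p q), mul_assoc]
      _ ≤ ENNReal.ofReal H.r * H.w p * B + H.tailErr T := by
          rw [← Finset.sum_mul]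
          refine add_le_add (mul_le_mul_left (H.sum_κ_w p) B) ?_
          exact Finset.single_le_sum (f := fun p => ∑ q, ∫⁻ v in Set.Ioi 0, H.κ p q v *
            (H.w q * (ENNReal.ofReal H.μbar * ENNReal.ofReal (min v T)))) (fun _ _ => zero_le)
            (Finset.mem_univ p)
      _ ≤ H.w p * (H.tailErr T + ENNReal.ofReal H.r * B) := by
          rw [mul_add, add_comm]
          refine add_le_add (le_mul_of_one_le_left zero_le (H.one_le_w p)) (le_of_eq ?_)
          ring

end IsHawkes

end MarkedArrivals

/-! ### Mecke's formula for finitely many counts -/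

/-- Size biasing: `(n + 1) p_{n+1} = r p_n` for the Poisson weights, and the term `n = 0` vanishes.
This is Mecke's formula for a single count. -/
theorem lintegral_mul_poissonMeasure (r : ℝ≥0) (h : ℕ → ℝ≥0∞) :
    ∫⁻ n, (n : ℝ≥0∞) * h n ∂poissonMeasure r = r * ∫⁻ n, h (n + 1) ∂poissonMeasure r := by
  simp only [poissonMeasure, lintegral_sum_measure, lintegral_smul_measure, lintegral_dirac,
    smul_eq_mul]
  rw [tsum_eq_zero_add' ENNReal.summable, ← ENNReal.tsum_mul_left]
  simp only [Nat.cast_zero, zero_mul, mul_zero, zero_add]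
  congr 1 with n
  have : ENNReal.ofReal (Real.exp (-r) * r ^ (n + 1) / (n + 1).factorial) * ((n + 1 : ℕ) : ℝ≥0∞) =
      r * ENNReal.ofReal (Real.exp (-r) * r ^ n / n.factorial) := by
    rw [← ENNReal.ofReal_coe_nnreal, ← ENNReal.ofReal_natCast, ← ENNReal.ofReal_mul (by positivity),
      ← ENNReal.ofReal_mul (by positivity), Nat.factorial_succ]
    congr 1
    push_cast
    field_simp
    ring
  rw [← mul_assoc, this, mul_assoc]

theorem measurableSet_forall_mem_iff {ι E : Type*} [Countable ι] [MeasurableSpace E] {C : ι → Set E}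
    (hC : ∀ j, MeasurableSet (C j)) (σ : ι → Bool) :
    MeasurableSet {e | ∀ j, e ∈ C j ↔ σ j = true} := by
  have : {e | ∀ j, e ∈ C j ↔ σ j = true} = ⋂ j, if σ j then C j else (C j)ᶜ := by
    ext e
    simp only [Set.mem_ofPred_eq, Set.mem_iInter]
    refine forall_congr' fun j => ?_
    rcases σ j <;> simp
  rw [this]
  refine MeasurableSet.iInter fun j => ?_
  split_ifs
  · exact hC j
  · exact (hC j).compl

namespace IsPoissonRandomMeasure

variable {Ω E : Type*} {mΩ : MeasurableSpace Ω} {mE : MeasurableSpace E} {P : Measure Ω}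
  {ν : Measure E} {Q : Ω → Measure E}

theorem measurable_coe (h : IsPoissonRandomMeasure P ν Q) : Measurable Q :=
  Measure.measurable_of_measurable_coe _ h.measurable

theorem measurable_add_dirac (h : IsPoissonRandomMeasure P ν Q) :
    Measurable fun x : E × Ω => Q x.2 + Measure.dirac x.1 := by
  refine Measure.measurable_of_measurable_coe _ fun A hA => ?_
  simp only [Measure.add_apply]
  exact ((h.measurable A hA).comp measurable_snd).add
    ((Measure.measurable_coe hA).comp (Measure.measurable_dirac.comp measurable_fst))

theorem lintegral_mul_self (h : IsPoissonRandomMeasure P ν Q) {A : Set E} (hA : MeasurableSet A)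
    (hνA : ν A ≠ ∞) {g : ℝ≥0∞ → ℝ≥0∞} (hg : Measurable g) :
    ∫⁻ ω, Q ω A * g (Q ω A) ∂P = ν A * ∫⁻ ω, g (Q ω A + 1) ∂P := by
  have hm := h.measurable A hA
  have hcast : Measurable (Nat.cast : ℕ → ℝ≥0∞) := .of_discrete
  calc ∫⁻ ω, Q ω A * g (Q ω A) ∂P
      = ∫⁻ z, z * g z ∂(P.map fun ω => Q ω A) := by rw [lintegral_map (by fun_prop) hm]
    _ = ∫⁻ n, (n : ℝ≥0∞) * g n ∂poissonMeasure (ν A).toNNReal := by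
        rw [h.law A hA hνA, lintegral_map (by fun_prop) hcast]
    _ = ν A * ∫⁻ n : ℕ, g ((n + 1 : ℕ) : ℝ≥0∞) ∂poissonMeasure (ν A).toNNReal := by
        rw [lintegral_mul_poissonMeasure _ (fun n => g n), ENNReal.coe_toNNReal hνA]
    _ = ν A * ∫⁻ z, g (z + 1) ∂(P.map fun ω => Q ω A) := by
        rw [h.law A hA hνA, lintegral_map (by fun_prop) hcast]
        simp
    _ = _ := by rw [lintegral_map (by fun_prop) hm]

theorem iIndepFun_of_pairwise_disjoint (h : IsPoissonRandomMeasure P ν Q) {κ : Type*} [Fintype κ]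
    {A : κ → Set E} (hA : ∀ j, MeasurableSet (A j)) (hd : Pairwise fun j k => Disjoint (A j) (A k)) :
    iIndepFun (fun j ω => Q ω (A j)) P := by
  have e := Fintype.equivFin κ
  have := h.indep _ (fun j => A (e.symm j)) (fun j => hA _)
    (fun j k hjk => hd (fun h' => hjk (e.symm.injective h')))
  have h2 := this.precomp e.injective
  simpa using h2

/-- The sets `C j` may overlap. Cutting the complement of `A` into the atoms that they generate
yields disjoint sets, independent of `A`, and each `Q (C j)` is a sum over atoms. -/
theorem indepFun_of_disjoint (h : IsPoissonRandomMeasure P ν Q) {ι : Type*} [Fintype ι] {A : Set E}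
    (hA : MeasurableSet A) {C : ι → Set E} (hC : ∀ j, MeasurableSet (C j))
    (hd : ∀ j, Disjoint A (C j)) :
    IndepFun (fun ω => Q ω A) (fun ω j => Q ω (C j)) P := by
  classical
  let F : Option (ι → Bool) → Set E := fun o => o.elim A fun σ => {e | e ∉ A ∧ ∀ j, e ∈ C j ↔ σ j}
  have hF : ∀ o, MeasurableSet (F o) := by
    rintro (_ | σ)
    · exact hA
    · exact hA.compl.inter (measurableSet_forall_mem_iff hC σ)
  have hFd : Pairwise fun o o' => Disjoint (F o) (F o') := by
    rintro (_ | σ) (_ | τ) hne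
    · exact absurd rfl hne
    · exact Set.disjoint_left.2 fun e h1 h2 => h2.1 h1
    · exact Set.disjoint_left.2 fun e h1 h2 => h1.1 h2
    · refine Set.disjoint_left.2 fun e h1 h2 => hne ?_
      congr 1
      ext j
      have := (h1.2 j).symm.trans (h2.2 j)
      rcases hσ : σ j <;> rcases hτ : τ j <;> simp_all
  have hind := (h.iIndepFun_of_pairwise_disjoint hF hFd).indepFun_finset {none}
    (Finset.univ \ {none}) Finset.disjoint_sdiff (fun o => h.measurable _ (hF o))
  have h1 : Measurable fun x : ({none} : Finset (Option (ι → Bool))) → ℝ≥0∞ =>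
      x ⟨none, Finset.mem_singleton_self _⟩ := measurable_pi_apply _
  have h2 : Measurable fun (x : (Finset.univ \ {none} : Finset (Option (ι → Bool))) → ℝ≥0∞) (j : ι) =>
      ∑ σ : ι → Bool, if σ j then x ⟨some σ, by simp⟩ else 0 := by
    refine measurable_pi_lambda _ fun j => Finset.measurable_sum _ fun σ _ => ?_
    by_cases hj : σ j
    · simpa [hj] using measurable_pi_apply _
    · simp [hj]
  have := hind.comp h1 h2
  convert! this using 1
  ext ω j
  have hcover : C j = ⋃ σ ∈ (Finset.univ.filter fun σ : ι → Bool => σ j), F (some σ) := by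
    ext e
    simp only [Set.mem_iUnion, Finset.mem_filter, Finset.mem_univ, true_and, exists_prop]
    constructor
    · intro he
      exact ⟨fun k => decide (e ∈ C k), by simpa using he,
        fun h' => Set.disjoint_left.1 (hd j) h' he, fun k => by simp⟩
    · rintro ⟨σ, hσ, -, h2⟩
      exact (h2 j).2 hσ
  simp only [Function.comp]
  rw [hcover, measure_biUnion_finset (fun σ _ τ _ hne => hFd (by simpa using hne))
    (fun σ _ => hF _), Finset.sum_filter]

/-- As `A` lies inside or outside each `C j`, one has `Q (C j) = Y j + b j * Q A` with `Y`
independent of `Q A`. For fixed `Y` the scalar formula applies, and raising `Q A` by one is the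
effect of a Dirac mass at any point of `A`. -/
theorem lintegral_mul_of_atom [IsProbabilityMeasure P] (h : IsPoissonRandomMeasure P ν Q)
    {ι : Type*} [Fintype ι] {A : Set E}
    (hA : MeasurableSet A) (hνA : ν A ≠ ∞) {C : ι → Set E} (hC : ∀ j, MeasurableSet (C j))
    (hAC : ∀ j, A ⊆ C j ∨ Disjoint A (C j)) {g : (ι → ℝ≥0∞) → ℝ≥0∞} (hg : Measurable g) :
    ∫⁻ ω, Q ω A * g (fun j => Q ω (C j)) ∂P =
      ∫⁻ e in A, ∫⁻ ω, g (fun j => (Q ω + Measure.dirac e) (C j)) ∂P ∂ν := by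
  classical
  rcases A.eq_empty_or_nonempty with rfl | ⟨a, ha⟩
  · simp
  let b : ι → ℝ≥0∞ := fun j => if A ⊆ C j then 1 else 0
  let Y : Ω → ι → ℝ≥0∞ := fun ω j => Q ω (C j \ A)
  have hYm : Measurable Y := measurable_pi_lambda _ fun j => h.measurable _ ((hC j).diff hA)
  have hZm := h.measurable A hA
  have hind : IndepFun (fun ω => Q ω A) Y P :=
    h.indepFun_of_disjoint hA (fun j => (hC j).diff hA) fun j => Set.disjoint_sdiff_right
  have hsplit : ∀ ω j, Q ω (C j) = Y ω j + b j * Q ω A := by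
    intro ω j
    rcases hAC j with hj | hj
    · simp only [Y, b, hj, if_true, one_mul]
      rw [measure_sdiff_add_inter (C j) hA |>.symm, Set.inter_eq_right.2 hj]
    · have hn : ¬ A ⊆ C j := fun h' => Set.disjoint_left.1 hj ha (h' ha)
      simp only [Y, b, hn, if_false, zero_mul, add_zero]
      rw [hj.symm.sdiff_eq_left]
  have hdirac : ∀ e ∈ A, ∀ j, Measure.dirac e (C j) = b j := by
    intro e he j
    rw [Measure.dirac_apply' _ (hC j)]
    rcases hAC j with hj | hj
    · simp [b, hj, hj he]
    · have hn : ¬ A ⊆ C j := fun h' => Set.disjoint_left.1 hj ha (h' ha)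
      simp [b, hn, Set.disjoint_left.1 hj he]
  have hlaw := (indepFun_iff_map_prod_eq_prod_map_map hZm.aemeasurable hYm.aemeasurable).1 hind
  have hΦ : Measurable fun x : ℝ≥0∞ × (ι → ℝ≥0∞) => g fun j => x.2 j + b j * x.1 :=
    hg.comp (measurable_pi_lambda _ fun j => by fun_prop)
  have hΦ0 : Measurable fun x : ℝ≥0∞ × (ι → ℝ≥0∞) => x.1 * g fun j => x.2 j + b j * x.1 :=
    measurable_fst.mul hΦ
  have hΦ1 : Measurable fun x : ℝ≥0∞ × (ι → ℝ≥0∞) => g fun j => x.2 j + b j * (x.1 + 1) :=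
    hg.comp (measurable_pi_lambda _ fun j => by fun_prop)
  have := Measure.isProbabilityMeasure_map (μ := P) hZm.aemeasurable
  have := Measure.isProbabilityMeasure_map (μ := P) hYm.aemeasurable
  have hR : ∫⁻ e in A, ∫⁻ ω, g (fun j => (Q ω + Measure.dirac e) (C j)) ∂P ∂ν =
      ν A * ∫⁻ ω, g (fun j => Y ω j + b j * (Q ω A + 1)) ∂P := by
    rw [setLIntegral_congr_fun hA (g := fun _ => ∫⁻ ω, g (fun j => Y ω j + b j * (Q ω A + 1)) ∂P)]
    · rw [setLIntegral_const, mul_comm]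
    · intro e he
      simp only [Measure.add_apply, hdirac e he, hsplit, mul_add, mul_one, add_assoc]
  rw [hR]
  simp only [hsplit]
  calc ∫⁻ ω, Q ω A * g (fun j => Y ω j + b j * Q ω A) ∂P
      = ∫⁻ x, x.1 * g (fun j => x.2 j + b j * x.1) ∂(P.map fun ω => (Q ω A, Y ω)) := by
        rw [lintegral_map hΦ0 (hZm.prodMk hYm)]
    _ = ∫⁻ y, ∫⁻ z, z * g (fun j => y j + b j * z) ∂(P.map fun ω => Q ω A) ∂(P.map Y) := by
        rw [hlaw, lintegral_prod_symm' _ hΦ0]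
    _ = ∫⁻ y, ν A * ∫⁻ z, g (fun j => y j + b j * (z + 1)) ∂(P.map fun ω => Q ω A) ∂(P.map Y) := by
        congr 1 with y
        have hgy : Measurable fun z : ℝ≥0∞ => g fun j => y j + b j * z :=
          hg.comp (measurable_pi_lambda _ fun j => by fun_prop)
        have hgy1 : Measurable fun z : ℝ≥0∞ => g fun j => y j + b j * (z + 1) :=
          hg.comp (measurable_pi_lambda _ fun j => by fun_prop)
        have hgy0 : Measurable fun z : ℝ≥0∞ => z * g fun j => y j + b j * z := measurable_id.mul hgy
        rw [lintegral_map hgy0 hZm, lintegral_map hgy1 hZm]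
        exact h.lintegral_mul_self hA hνA hgy
    _ = ν A * ∫⁻ x, g (fun j => x.2 j + b j * (x.1 + 1)) ∂(P.map fun ω => (Q ω A, Y ω)) := by
        rw [lintegral_const_mul _ hΦ1.lintegral_prod_left', hlaw, lintegral_prod_symm' _ hΦ1]
    _ = _ := by rw [lintegral_map hΦ1 (hZm.prodMk hYm)]

/-- Mecke's formula for functions of finitely many counts. -/
theorem lintegral_mul_of_fintype [IsProbabilityMeasure P] (h : IsPoissonRandomMeasure P ν Q)
    {ι : Type*} [Fintype ι] {A : Set E}
    (hA : MeasurableSet A) (hνA : ν A ≠ ∞) {C : ι → Set E} (hC : ∀ j, MeasurableSet (C j))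
    {g : (ι → ℝ≥0∞) → ℝ≥0∞} (hg : Measurable g) :
    ∫⁻ ω, Q ω A * g (fun j => Q ω (C j)) ∂P =
      ∫⁻ e in A, ∫⁻ ω, g (fun j => (Q ω + Measure.dirac e) (C j)) ∂P ∂ν := by
  classical
  -- Both sides are additive in `A`, so `A` may be cut into the atoms generated by the sets `C j`.
  let F : (ι → Bool) → Set E := fun σ => {e | e ∈ A ∧ ∀ j, e ∈ C j ↔ σ j}
  have hF : ∀ σ, MeasurableSet (F σ) := fun σ => hA.inter (measurableSet_forall_mem_iff hC σ)
  have hFd : Pairwise (Function.onFun Disjoint F) := by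
    intro σ τ hne
    refine Set.disjoint_left.2 fun e h1 h2 => hne ?_
    ext j
    have := (h1.2 j).symm.trans (h2.2 j)
    rcases hσ : σ j <;> rcases hτ : τ j <;> simp_all
  have hU : A = ⋃ σ, F σ := by
    ext e
    simp only [Set.mem_iUnion]
    exact ⟨fun he => ⟨fun k => decide (e ∈ C k), he, fun k => by simp⟩, fun ⟨σ, h1, _⟩ => h1⟩
  have hgm : Measurable fun ω => g fun j => Q ω (C j) :=
    hg.comp (measurable_pi_lambda _ fun j => h.measurable _ (hC j))
  have hsum : ∀ ω, Q ω A = ∑ σ, Q ω (F σ) := fun ω => by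
    rw [hU, measure_iUnion hFd hF, tsum_fintype]
  simp only [hsum, Finset.sum_mul]
  have hm : ∀ σ ∈ Finset.univ, Measurable fun ω => Q ω (F σ) * g fun j => Q ω (C j) :=
    fun σ _ => (h.measurable _ (hF σ)).mul hgm
  rw [lintegral_finsetSum _ hm]
  rw [show ν.restrict A = ν.restrict (⋃ σ, F σ) by rw [← hU], lintegral_iUnion hF hFd, tsum_fintype]
  refine Finset.sum_congr rfl fun σ _ => h.lintegral_mul_of_atom (hF σ)
    (ne_top_of_le_ne_top hνA (measure_mono fun e he => he.1)) hC (fun j => ?_) hg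
  by_cases hj : σ j
  · exact Or.inl fun e he => (he.2 j).2 hj
  · exact Or.inr (Set.disjoint_left.2 fun e he h' => hj ((he.2 j).1 h'))

end IsPoissonRandomMeasure

/-! ### An s-finite kernel acting as the identity on locally finite measures -/

section Shells

variable {E : Type*} {mE : MeasurableSpace E} (ν : Measure E) [SigmaFinite ν]

/-- A measurable partition of the space into sets of finite measure. -/
def shell (j : ℕ) : Set E := disjointed (spanningSets ν) j

theorem measurableSet_shell (j : ℕ) : MeasurableSet (shell ν j) :=
  MeasurableSet.disjointed (measurableSet_spanningSets ν) j

theorem disjoint_shell : Pairwise (Function.onFun Disjoint (shell ν)) := disjoint_disjointed _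

theorem iUnion_shell : ⋃ j, shell ν j = Set.univ := by
  simp only [shell, iUnion_disjointed, iUnion_spanningSets]

theorem measure_shell_ne_top (j : ℕ) : ν (shell ν j) ≠ ∞ :=
  ne_top_of_le_ne_top (measure_spanningSets_lt_top ν j).ne (measure_mono (disjointed_subset _ _))

theorem measure_eq_tsum_shell (m : Measure E) {A : Set E} (hA : MeasurableSet A) :
    m A = ∑' j, m (A ∩ shell ν j) := by
  rw [← measure_iUnion (fun i j hij => ((disjoint_shell ν hij).mono Set.inter_subset_right
    Set.inter_subset_right)) fun j => hA.inter (measurableSet_shell ν j), ← Set.inter_iUnion,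
    iUnion_shell, Set.inter_univ]

/-- The measures that are finite on the shells. -/
def ShellFinite (m : Measure E) : Prop := ∀ j, m (shell ν j) ≠ ∞

theorem ShellFinite.add_dirac {m : Measure E} (h : ShellFinite ν m) (e : E) :
    ShellFinite ν (m + Measure.dirac e) := fun j => by
  rw [Measure.add_apply]
  exact ENNReal.add_ne_top.2 ⟨h j, measure_ne_top _ _⟩

/-- The restriction of a measure `m` to the shell `S` if `n ≤ m(S) < n + 1`. -/
noncomputable def shellKernel (j : ℕ × ℕ) : Kernel (Measure E) E :=
  open Classical in
  { toFun := fun m => if m (shell ν j.1) ≠ ∞ ∧ ⌊(m (shell ν j.1)).toReal⌋₊ = j.2 then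
      m.restrict (shell ν j.1) else 0
    measurable' := by
      have hm := Measure.measurable_coe (measurableSet_shell ν j.1)
      refine Measurable.ite ?_ (Measure.measurable_of_measurable_coe _ fun s hs => ?_)
        measurable_const
      · exact (hm (measurableSet_singleton ∞).compl).inter
          ((Nat.measurable_floor.comp hm.ennreal_toReal) (measurableSet_singleton j.2))
      · simp only [Measure.restrict_apply hs]
        exact Measure.measurable_coe (hs.inter (measurableSet_shell ν j.1)) }

theorem shellKernel_apply (j : ℕ × ℕ) (m : Measure E) : open Classical in shellKernel ν j m =
    if m (shell ν j.1) ≠ ∞ ∧ ⌊(m (shell ν j.1)).toReal⌋₊ = j.2 then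
      m.restrict (shell ν j.1) else 0 := rfl

/-- The selected mass is below `j.2 + 1` by construction. Sorting measures by the integer part of
their mass serves to obtain this uniform bound, as the mass of a shell is unbounded over all
measures. -/
instance (j : ℕ × ℕ) : IsFiniteKernel (shellKernel ν j) := by
  refine ⟨⟨j.2 + 1, by finiteness, fun m => ?_⟩⟩
  rw [shellKernel_apply]
  split_ifs with h
  · rw [Measure.restrict_apply_univ, ← ENNReal.ofReal_toReal h.1]
    have := (Nat.lt_floor_add_one (m (shell ν j.1)).toReal).le
    rw [h.2] at this
    calc _ ≤ ENNReal.ofReal (j.2 + 1) := ENNReal.ofReal_le_ofReal this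
      _ = _ := by rw [ENNReal.ofReal_add (by positivity) zero_le_one]; simp
  · simp

/-- An s-finite kernel that maps a measure that is finite on the shells to itself. -/
noncomputable def shellPart : Kernel (Measure E) E := Kernel.sum (shellKernel ν)

instance : IsSFiniteKernel (shellPart ν) := Kernel.isSFiniteKernel_sum

/-- On each shell exactly one index contributes, namely the integer part of the mass. -/
theorem ShellFinite.shellPart_apply {m : Measure E} (h : ShellFinite ν m) : shellPart ν m = m := by
  ext A hA
  rw [shellPart, Kernel.sum_apply, Measure.sum_apply _ hA, ENNReal.tsum_prod',
    measure_eq_tsum_shell ν m hA]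
  congr 1 with j
  simp only [shellKernel_apply, h j, ne_eq, not_false_eq_true, true_and]
  rw [tsum_eq_single ⌊(m (shell ν j)).toReal⌋₊ fun n hn => by simp [hn.symm]]
  simp [Measure.restrict_apply hA]

end Shells

/-! ### Mecke's formula for general functionals -/

namespace IsPoissonRandomMeasure

variable {Ω E : Type*} {mΩ : MeasurableSpace Ω} {mE : MeasurableSpace E} {P : Measure Ω}
  [IsProbabilityMeasure P] {ν : Measure E} {Q : Ω → Measure E}

theorem lintegral_coe (h : IsPoissonRandomMeasure P ν Q) {A : Set E} (hA : MeasurableSet A)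
    (hνA : ν A ≠ ∞) : ∫⁻ ω, Q ω A ∂P = ν A := by
  simpa using h.lintegral_mul_self hA hνA (g := fun _ => 1) measurable_const

theorem ae_shellFinite [SigmaFinite ν] (h : IsPoissonRandomMeasure P ν Q) :
    ∀ᵐ ω ∂P, ShellFinite ν (Q ω) := by
  refine ae_all_iff.2 fun j => ?_
  have hm := h.measurable _ (measurableSet_shell ν j)
  have := h.lintegral_coe (measurableSet_shell ν j) (measure_shell_ne_top ν j)
  filter_upwards [ae_lt_top hm (by rw [this]; exact measure_shell_ne_top ν j)] with ω hω using hω.ne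

/-- Events given by finitely many counts form a π-system generating the σ-algebra on measures. On
them the equality is Mecke's formula for finitely many counts, and the total mass `ν A` is finite.
-/
theorem map_withDensity_eq (h : IsPoissonRandomMeasure P ν Q) {A : Set E} (hA : MeasurableSet A)
    (hνA : ν A ≠ ∞) [SigmaFinite ν] :
    (P.withDensity fun ω => Q ω A).map Q =
      ((ν.restrict A).prod P).map fun x => Q x.2 + Measure.dirac x.1 := by
  classical
  have hQ := h.measurable_coe
  have hkey : ∀ (t : Finset (Set E)), (∀ C ∈ t, MeasurableSet C) → ∀ D : Set E → Set ℝ≥0∞,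
      (∀ C ∈ t, MeasurableSet (D C)) →
      (P.withDensity fun ω => Q ω A).map Q (⋂ C ∈ t, (fun m => m C) ⁻¹' D C) =
        ((ν.restrict A).prod P).map (fun x => Q x.2 + Measure.dirac x.1)
          (⋂ C ∈ t, (fun m => m C) ⁻¹' D C) := by
    intro t ht D hD
    have hG : MeasurableSet (⋂ C ∈ t, (fun m : Measure E => m C) ⁻¹' D C) :=
      Finset.measurableSet_biInter t fun C hC => Measure.measurable_coe (ht C hC) (hD C hC)
    set G := ⋂ C ∈ t, (fun m : Measure E => m C) ⁻¹' D C with hGdef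
    have hS : MeasurableSet {y : t → ℝ≥0∞ | ∀ C : t, y C ∈ D C} := by
      have : {y : t → ℝ≥0∞ | ∀ C : t, y C ∈ D C} = ⋂ C : t, (fun y => y C) ⁻¹' D C := by
        ext y; simp
      rw [this]
      exact MeasurableSet.iInter fun C => measurable_pi_apply C (hD C C.2)
    have hgm : Measurable ({y : t → ℝ≥0∞ | ∀ C : t, y C ∈ D C}.indicator fun _ => (1 : ℝ≥0∞)) :=
      measurable_const.indicator hS
    have hind : ∀ m : Measure E, G.indicator (fun _ => (1 : ℝ≥0∞)) m =
        {y : t → ℝ≥0∞ | ∀ C : t, y C ∈ D C}.indicator (fun _ => 1) fun C => m C := fun m => by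
      simp [Set.indicator, hGdef]
    rw [Measure.map_apply hQ hG, withDensity_apply _ (hQ hG), Measure.map_apply
      h.measurable_add_dirac hG, ← lintegral_indicator (hQ hG), ← lintegral_indicator_one
      (h.measurable_add_dirac hG), lintegral_prod _ ((measurable_one.indicator
      (h.measurable_add_dirac hG)).aemeasurable)]
    have := h.lintegral_mul_of_fintype hA hνA (C := fun C : t => (C : Set E)) (fun C => ht C C.2) hgm
    convert! this using 1
    · congr 1 with ω
      rw [← hind]
      by_cases hω : Q ω ∈ G <;> simp [Set.indicator, hω]
    · congr 1 with e
      congr 1 with ω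
      rw [← hind]
      rfl
  have hfin : IsFiniteMeasure ((P.withDensity fun ω => Q ω A).map Q) := by
    constructor
    rw [Measure.map_apply hQ .univ]
    simp only [Set.preimage_univ, withDensity_apply _ MeasurableSet.univ, Measure.restrict_univ]
    rw [h.lintegral_coe hA hνA]
    exact hνA.lt_top
  refine ext_of_generate_finite _
    (generateFrom_piiUnionInter_measurableSet
      (fun s : Set E => (ENNReal.measurableSpace).comap fun μ : Measure E => μ s)
      {s : Set E | MeasurableSet s}).symm (isPiSystem_piiUnionInter _ (fun s => ?_) _) ?_ ?_
  · exact @MeasurableSpace.isPiSystem_measurableSet _ (_)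
  · rintro _ ⟨t, ht, f, hf, rfl⟩
    choose! D hD using hf
    have : (⋂ C ∈ t, f C) = ⋂ C ∈ t, (fun m : Measure E => m C) ⁻¹' D C :=
      Set.iInter₂_congr fun C hC => (hD C hC).2.symm
    rw [this]
    exact hkey t (fun C hC => ht hC) D fun C hC => (hD C hC).1
  · simpa using hkey ∅ (by simp) (fun _ => Set.univ) (by simp)

/-- **Mecke's formula** for a Poisson random measure. -/
theorem lintegral_lintegral [SigmaFinite ν] (h : IsPoissonRandomMeasure P ν Q)
    {f : Measure E × E → ℝ≥0∞} (hf : Measurable f) :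
    ∫⁻ ω, ∫⁻ e, f (Q ω, e) ∂(Q ω) ∂P = ∫⁻ e, ∫⁻ ω, f (Q ω + Measure.dirac e, e) ∂P ∂ν := by
  have hQ := h.measurable_coe
  have hmap : Measurable fun x : E × Ω => (Q x.2 + Measure.dirac x.1, x.1) :=
    h.measurable_add_dirac.prodMk measurable_fst
  have := Measure.isProbabilityMeasure_map (μ := P) hQ.aemeasurable
  -- On one shell both sides are finite measures on pairs (configuration, point), so rectangles
  -- determine them. The composition product requires an s-finite kernel, hence `shellPart` in place
  -- of the identity.
  have hkey : ∀ j, (P.map Q) ⊗ₘ ((shellPart ν).restrict (measurableSet_shell ν j)) =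
      ((ν.restrict (shell ν j)).prod P).map fun x => (Q x.2 + Measure.dirac x.1, x.1) := by
    intro j
    have hrect : ∀ {G : Set (Measure E)} {A : Set E}, MeasurableSet G → MeasurableSet A →
        ((P.map Q) ⊗ₘ ((shellPart ν).restrict (measurableSet_shell ν j))) (G ×ˢ A) =
          (((ν.restrict (shell ν j)).prod P).map fun x => (Q x.2 + Measure.dirac x.1, x.1))
            (G ×ˢ A) := by
      intro G A hG hA
      have hfin : ν (A ∩ shell ν j) ≠ ∞ :=
        ne_top_of_le_ne_top (measure_shell_ne_top ν j) (measure_mono Set.inter_subset_right)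
      have heq := congrArg (fun m => m G) (h.map_withDensity_eq (hA.inter (measurableSet_shell ν j))
        hfin)
      rw [Measure.compProd_apply_prod hG hA, Measure.map_apply hmap (hG.prod hA),
        ← lintegral_indicator hG,
        lintegral_map ((Kernel.measurable_coe _ hA).indicator hG) hQ]
      rw [Measure.map_apply hQ hG, withDensity_apply _ (hQ hG), Measure.map_apply
        h.measurable_add_dirac hG] at heq
      calc ∫⁻ ω, G.indicator (fun m => ((shellPart ν).restrict (measurableSet_shell ν j)) m A)
              (Q ω) ∂P
          = ∫⁻ ω in Q ⁻¹' G, Q ω (A ∩ shell ν j) ∂P := by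
            rw [← lintegral_indicator (hQ hG)]
            refine lintegral_congr_ae ?_
            filter_upwards [h.ae_shellFinite] with ω hω
            by_cases hG' : Q ω ∈ G <;>
              simp [Set.indicator, hG', Kernel.restrict_apply, Measure.restrict_apply hA,
                hω.shellPart_apply]
        _ = _ := heq
        _ = _ := by
            rw [← Measure.restrict_restrict hA, ← Measure.restrict_univ (μ := P),
              Measure.prod_restrict, Measure.restrict_apply (h.measurable_add_dirac hG)]
            simp only [Measure.restrict_univ]
            congr 1
            ext x
            simp
    have hfin : IsFiniteMeasure ((P.map Q) ⊗ₘ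
        ((shellPart ν).restrict (measurableSet_shell ν j))) := by
      constructor
      rw [← Set.univ_prod_univ, hrect .univ .univ, Set.univ_prod_univ,
        Measure.map_apply hmap .univ]
      simp only [Set.preimage_univ]
      rw [← Set.univ_prod_univ, Measure.prod_prod]
      simpa using (measure_shell_ne_top ν j).lt_top
    exact Measure.ext_prod hrect
  have hunion : ∀ m : Measure E, ∀ g : E → ℝ≥0∞, ∫⁻ e, g e ∂m = ∑' j, ∫⁻ e in shell ν j, g e ∂m := by
    intro m g
    rw [← lintegral_iUnion (measurableSet_shell ν) (disjoint_shell ν), iUnion_shell,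
      Measure.restrict_univ]
  have hker : ∀ j, Measurable fun m : Measure E => ∫⁻ e, f (m, e)
      ∂((shellPart ν).restrict (measurableSet_shell ν j) m) := fun j =>
    Measurable.lintegral_kernel_prod_right' hf
  calc ∫⁻ ω, ∫⁻ e, f (Q ω, e) ∂(Q ω) ∂P
      = ∫⁻ ω, ∑' j, ∫⁻ e, f (Q ω, e) ∂((shellPart ν).restrict (measurableSet_shell ν j) (Q ω)) ∂P := by
        refine lintegral_congr_ae ?_
        filter_upwards [h.ae_shellFinite] with ω hω
        simp only [Kernel.restrict_apply, hω.shellPart_apply]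
        exact hunion _ _
    _ = ∑' j, ∫⁻ ω, ∫⁻ e, f (Q ω, e) ∂((shellPart ν).restrict (measurableSet_shell ν j) (Q ω)) ∂P :=
        lintegral_tsum fun j => ((hker j).comp hQ).aemeasurable
    _ = ∑' j, ∫⁻ e in shell ν j, ∫⁻ ω, f (Q ω + Measure.dirac e, e) ∂P ∂ν := by
        congr 1 with j
        have := congrArg (fun m => ∫⁻ x, f x ∂m) (hkey j)
        have hfm : Measurable fun x : E × Ω => f (Q x.2 + Measure.dirac x.1, x.1) := hf.comp hmap
        rw [Measure.lintegral_compProd hf, lintegral_map (hker j) hQ, lintegral_map hf hmap,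
          lintegral_prod _ hfm.aemeasurable] at this
        exact this
    _ = _ := (hunion _ _).symm

end IsPoissonRandomMeasure

/-! ### The driving intensity and Poisson laws on the space of measures -/

theorem measurable_uncurry_of_finite {α β : Type*} {mα : MeasurableSpace α} {ι : Type*} [Fintype ι]
    [MeasurableSpace ι] [MeasurableSingletonClass ι] {mβ : MeasurableSpace β}
    {f : ι → α → β} (hf : ∀ i, Measurable (f i)) {g : α → ι} (hg : Measurable g) :
    Measurable fun a => f (g a) a := by
  intro s hs
  have : (fun a => f (g a) a) ⁻¹' s = ⋃ i, g ⁻¹' {i} ∩ f i ⁻¹' s := by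
    ext a; simp
  rw [this]
  exact MeasurableSet.iUnion fun i => (hg (measurableSet_singleton i)).inter (hf i hs)

/-- The levels below `c` have Lebesgue measure `c`, infinite values included: keeping the points
below a level `c` produces points at rate `c`. -/
theorem setLIntegral_Ioi_ofReal_lt (c : ℝ≥0∞) :
    ∫⁻ z in Set.Ioi (0 : ℝ), (if ENNReal.ofReal z < c then 1 else 0) = c := by
  have hm : MeasurableSet {z : ℝ | ENNReal.ofReal z < c} :=
    measurableSet_lt ENNReal.measurable_ofReal measurable_const
  have h1 : ∫⁻ z in Set.Ioi (0 : ℝ), (if ENNReal.ofReal z < c then (1 : ℝ≥0∞) else 0) =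
      volume ({z : ℝ | ENNReal.ofReal z < c} ∩ Set.Ioi 0) := by
    rw [← Measure.restrict_apply hm, ← lintegral_indicator_one hm]
    simp [Set.indicator]
  rw [h1]
  induction c with
  | top => simp
  | coe c =>
    have : {z : ℝ | ENNReal.ofReal z < c} ∩ Set.Ioi 0 = Set.Ioo 0 (c : ℝ) := by
      ext z
      simp only [Set.mem_inter_iff, Set.mem_ofPred_eq, Set.mem_Ioi, Set.mem_Ioo]
      rw [and_comm, ← ENNReal.ofReal_coe_nnreal]
      refine and_congr_right fun hz => ?_
      rw [ENNReal.ofReal_lt_ofReal_iff_of_nonneg hz.le]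
    rw [this]
    simp

instance (ρ : Measure ℝ) [SigmaFinite ρ] : SigmaFinite (drivingIntensity ρ) := by
  unfold drivingIntensity
  infer_instance

theorem lintegral_drivingIntensity (ρ : Measure ℝ) [SigmaFinite ρ]
    {f : Fin 2 × ℝ × ℝ × ℝ → ℝ≥0∞} (hf : Measurable f) :
    ∫⁻ e, f e ∂drivingIntensity ρ =
      ∑ q, ∫⁻ t in Set.Ioi (0 : ℝ), ∫⁻ z in Set.Ioi (0 : ℝ), ∫⁻ x, f (q, t, z, x) ∂ρ := by
  rw [drivingIntensity, lintegral_prod _ hf.aemeasurable, lintegral_count, tsum_fintype]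
  refine Finset.sum_congr rfl fun q _ => ?_
  have h1 : Measurable fun y : ℝ × ℝ × ℝ => f (q, y) := hf.comp measurable_prodMk_left
  rw [lintegral_prod _ h1.aemeasurable]
  congr 1 with t
  have h2 : Measurable fun y : ℝ × ℝ => f (q, t, y) := h1.comp measurable_prodMk_left
  rw [lintegral_prod _ h2.aemeasurable]

/-- The law `L` of a Poisson random measure with intensity `ν`, described by Mecke's formula. -/
structure IsPoissonLaw {E : Type*} {mE : MeasurableSpace E} (ν : Measure E) [SigmaFinite ν]
    (L : Measure (Measure E)) : Prop where
  prob : IsProbabilityMeasure L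
  ae_shellFinite : ∀ᵐ m ∂L, ShellFinite ν m
  mecke : ∀ {f : Measure E × E → ℝ≥0∞}, Measurable f →
    ∫⁻ m, ∫⁻ e, f (m, e) ∂(shellPart ν m) ∂L = ∫⁻ e, ∫⁻ m, f (m + Measure.dirac e, e) ∂L ∂ν

theorem measurableSet_shellFinite {E : Type*} {mE : MeasurableSpace E} (ν : Measure E)
    [SigmaFinite ν] : MeasurableSet {m : Measure E | ShellFinite ν m} := by
  have : {m : Measure E | ShellFinite ν m} = ⋂ j, (fun m => m (shell ν j)) ⁻¹' {∞}ᶜ := by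
    ext m; simp [ShellFinite]
  rw [this]
  exact MeasurableSet.iInter fun j => Measure.measurable_coe (measurableSet_shell ν j)
    (measurableSet_singleton ∞).compl

theorem measurable_add_dirac_right {E : Type*} {mE : MeasurableSpace E} (e : E) :
    Measurable fun m : Measure E => m + Measure.dirac e := by
  refine Measure.measurable_of_measurable_coe _ fun A hA => ?_
  simp only [Measure.add_apply]
  exact (Measure.measurable_coe hA).add measurable_const

/-- Passing to the law moves the later estimates to the space of configurations, where rates are
functions of `m` and a point can be added. -/
theorem IsPoissonRandomMeasure.isPoissonLaw {Ω E : Type*} {mΩ : MeasurableSpace Ω}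
    {mE : MeasurableSpace E} {P : Measure Ω} [IsProbabilityMeasure P] {ν : Measure E}
    [SigmaFinite ν] {Q : Ω → Measure E} (h : IsPoissonRandomMeasure P ν Q) :
    IsPoissonLaw ν (P.map Q) where
  prob := Measure.isProbabilityMeasure_map h.measurable_coe.aemeasurable
  ae_shellFinite := (ae_map_iff h.measurable_coe.aemeasurable (measurableSet_shellFinite ν)).2
    h.ae_shellFinite
  mecke {f} hf := by
    have h1 : Measurable fun m : Measure E => ∫⁻ e, f (m, e) ∂(shellPart ν m) :=
      Measurable.lintegral_kernel_prod_right' hf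
    rw [lintegral_map h1 h.measurable_coe]
    calc _ = ∫⁻ ω, ∫⁻ e, f (Q ω, e) ∂(Q ω) ∂P := by
          refine lintegral_congr_ae ?_
          filter_upwards [h.ae_shellFinite] with ω hω
          simp only [hω.shellPart_apply]
      _ = _ := by
          rw [h.lintegral_lintegral hf]
          congr 1 with e
          have h2 : Measurable fun m : Measure E => f (m + Measure.dirac e, e) :=
            hf.comp ((measurable_add_dirac_right e).prodMk measurable_const)
          rw [lintegral_map h2 h.measurable_coe]

/-! ### Thinning by a predictable rate -/

section Thinning

/-- The points `(q, t, z, x)`: side, time, level and mark. -/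
abbrev DrivingPoint := Fin 2 × ℝ × ℝ × ℝ

variable (ρ : Measure ℝ) [SigmaFinite ρ] (G : Measure DrivingPoint → Fin 2 → ℝ → ℝ≥0∞)

/-- The rate `G` at time `t` is measurable and does not depend on the points after `t`. -/
structure IsPredictableRate : Prop where
  measurable : Measurable fun x : Measure DrivingPoint × Fin 2 × ℝ => G x.1 x.2.1 x.2.2
  add_dirac : ∀ m, ShellFinite (drivingIntensity ρ) m → ∀ (e : DrivingPoint) (q : Fin 2) (t : ℝ),
    t ≤ e.2.1 → G (m + Measure.dirac e) q t = G m q t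

open Classical in
/-- The weight of the point `e`, kept if its level is below the rate `G`. -/
noncomputable def thinWeight (ψ : Fin 2 → ℝ → ℝ≥0∞) (i : ℕ) (m : Measure DrivingPoint)
    (e : DrivingPoint) : ℝ≥0∞ :=
  if ENNReal.ofReal e.2.2.1 < G m e.1 e.2.1 then ψ e.1 e.2.1 * ENNReal.ofReal e.2.2.2 ^ i else 0

/-- The total weight of the points of `m` whose level is below the rate `G`. -/
noncomputable def thinSum (ψ : Fin 2 → ℝ → ℝ≥0∞) (i : ℕ) (m : Measure DrivingPoint) : ℝ≥0∞ :=
  ∫⁻ e, thinWeight G ψ i m e ∂(shellPart (drivingIntensity ρ) m)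

variable {ρ G}

theorem measurable_thinWeight (hG : IsPredictableRate ρ G) {α : Type*} {mα : MeasurableSpace α}
    {ψ : α → Fin 2 → ℝ → ℝ≥0∞} (hψ : ∀ q, Measurable fun x : α × ℝ => ψ x.1 q x.2) (i : ℕ) :
    Measurable fun x : (Measure DrivingPoint × α) × DrivingPoint =>
      thinWeight G (ψ x.1.2) i x.1.1 x.2 := by
  unfold thinWeight
  refine Measurable.ite (measurableSet_lt (by fun_prop) ?_) ?_ measurable_const
  · exact hG.measurable.comp ((measurable_fst.comp measurable_fst).prodMk
      ((measurable_fst.comp measurable_snd).prodMk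
        (measurable_fst.comp (measurable_snd.comp measurable_snd))))
  · refine Measurable.mul ?_ (by fun_prop)
    exact measurable_uncurry_of_finite
      (f := fun q (x : (Measure DrivingPoint × α) × DrivingPoint) => ψ x.1.2 q x.2.2.1)
      (fun q => (hψ q).comp ((measurable_snd.comp measurable_fst).prodMk
        (measurable_fst.comp (measurable_snd.comp measurable_snd)))) (g := fun x => x.2.1)
      (measurable_fst.comp measurable_snd)

theorem measurable_thinWeight_const (hG : IsPredictableRate ρ G) {ψ : Fin 2 → ℝ → ℝ≥0∞}
    (hψ : ∀ q, Measurable (ψ q)) (i : ℕ) :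
    Measurable fun x : Measure DrivingPoint × DrivingPoint => thinWeight G ψ i x.1 x.2 :=
  (measurable_thinWeight hG (mα := inferInstanceAs (MeasurableSpace Unit)) (ψ := fun _ => ψ)
    (fun q => (hψ q).comp measurable_snd) i).comp
    ((measurable_fst.prodMk (measurable_const (a := ()))).prodMk measurable_snd)

theorem measurable_thinSum_param (hG : IsPredictableRate ρ G) {α : Type*} {mα : MeasurableSpace α}
    {ψ : α → Fin 2 → ℝ → ℝ≥0∞} (hψ : ∀ q, Measurable fun x : α × ℝ => ψ x.1 q x.2) (i : ℕ) :
    Measurable fun x : Measure DrivingPoint × α => thinSum ρ G (ψ x.2) i x.1 :=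
  Measurable.lintegral_kernel_prod_right'
    (κ := (shellPart (drivingIntensity ρ)).comap Prod.fst measurable_fst)
    (measurable_thinWeight hG hψ i)

theorem measurable_thinSum (hG : IsPredictableRate ρ G) {ψ : Fin 2 → ℝ → ℝ≥0∞}
    (hψ : ∀ q, Measurable (ψ q)) (i : ℕ) : Measurable (thinSum ρ G ψ i) :=
  Measurable.lintegral_kernel_prod_right' (measurable_thinWeight_const hG hψ i)

/-- A thinned sum does not depend on the points at times with larger weights zero. -/
theorem thinSum_add_dirac (hG : IsPredictableRate ρ G) {ψ : Fin 2 → ℝ → ℝ≥0∞} (i : ℕ)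
    {m : Measure DrivingPoint} (hm : ShellFinite (drivingIntensity ρ) m) {e : DrivingPoint}
    (he : ∀ q t, e.2.1 ≤ t → ψ q t = 0) :
    thinSum ρ G ψ i (m + Measure.dirac e) = thinSum ρ G ψ i m := by
  rw [thinSum, thinSum, (hm.add_dirac _ e).shellPart_apply, hm.shellPart_apply,
    lintegral_add_measure, lintegral_dirac]
  have h0 : thinWeight G ψ i (m + Measure.dirac e) e = 0 := by
    simp [thinWeight, he e.1 e.2.1 le_rfl]
  rw [h0, add_zero]
  refine lintegral_congr fun e' => ?_
  rcases le_or_gt e.2.1 e'.2.1 with h | h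
  · simp [thinWeight, he e'.1 e'.2.1 h]
  · simp only [thinWeight, hG.add_dirac m hm e e'.1 e'.2.1 h.le]

/-- Mecke's formula for the thinned points, with a factor that does not depend on them. -/
theorem lintegral_mul_thinSum {L : Measure (Measure DrivingPoint)}
    (hL : IsPoissonLaw (drivingIntensity ρ) L)
    (hG : IsPredictableRate ρ G) {ψ : Fin 2 → ℝ → ℝ≥0∞} (hψ : ∀ q, Measurable (ψ q)) (i : ℕ)
    {g : Measure DrivingPoint → ℝ≥0∞} (hg : Measurable g)
    (hgd : ∀ m, ShellFinite (drivingIntensity ρ) m → ∀ e : DrivingPoint, ψ e.1 e.2.1 ≠ 0 →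
      g (m + Measure.dirac e) = g m) :
    ∫⁻ m, g m * thinSum ρ G ψ i m ∂L =
      (∫⁻ x, ENNReal.ofReal x ^ i ∂ρ) *
        ∑ q, ∫⁻ t in Set.Ioi (0 : ℝ), ψ q t * ∫⁻ m, g m * G m q t ∂L := by
  have := hL.prob
  have hGm : ∀ q, Measurable fun x : Measure DrivingPoint × ℝ => G x.1 q x.2 := fun q =>
    hG.measurable.comp (measurable_fst.prodMk (measurable_const.prodMk measurable_snd))
  have hw := measurable_thinWeight_const hG hψ i
  have hf : Measurable fun x : Measure DrivingPoint × DrivingPoint =>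
      g x.1 * thinWeight G ψ i x.1 x.2 := (hg.comp measurable_fst).mul hw
  have hf' : Measurable fun x : DrivingPoint × Measure DrivingPoint =>
      g x.2 * thinWeight G ψ i x.2 x.1 := hf.comp measurable_swap
  have hR : Measurable fun e : DrivingPoint => ∫⁻ m, g m * thinWeight G ψ i m e ∂L :=
    hf'.lintegral_prod_right'
  calc ∫⁻ m, g m * thinSum ρ G ψ i m ∂L
      = ∫⁻ m, ∫⁻ e, g m * thinWeight G ψ i m e ∂(shellPart (drivingIntensity ρ) m) ∂L := by
        congr 1 with m
        have hwm : Measurable fun e => thinWeight G ψ i m e := hw.comp measurable_prodMk_left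
        rw [thinSum, lintegral_const_mul _ hwm]
    _ = ∫⁻ e, ∫⁻ m, g m * thinWeight G ψ i m e ∂L ∂drivingIntensity ρ := by
        -- The added point `e` alters neither the rate at its own time nor, where its weight is
        -- nonzero, the factor `g`; the shift by the Dirac mass therefore disappears.
        rw [hL.mecke hf]
        congr 1 with e
        refine lintegral_congr_ae ?_
        filter_upwards [hL.ae_shellFinite] with m hm
        by_cases h0 : ψ e.1 e.2.1 = 0
        · simp [thinWeight, h0]
        · simp only [thinWeight, hgd m hm e h0, hG.add_dirac m hm e _ _ le_rfl]
    _ = ∑ q, ∫⁻ t in Set.Ioi (0 : ℝ), ∫⁻ z in Set.Ioi (0 : ℝ), ∫⁻ x,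
          ∫⁻ m, g m * thinWeight G ψ i m (q, t, z, x) ∂L ∂ρ := lintegral_drivingIntensity ρ hR
    _ = ∑ q, ∫⁻ t in Set.Ioi (0 : ℝ), (∫⁻ x, ENNReal.ofReal x ^ i ∂ρ) *
          (ψ q t * ∫⁻ m, g m * G m q t ∂L) := by
        refine Finset.sum_congr rfl fun q _ => lintegral_congr fun t => ?_
        have hGt : Measurable fun m => G m q t := (hGm q).comp measurable_prodMk_right
        have hA : Measurable fun x : ℝ × Measure DrivingPoint =>
            g x.2 * if ENNReal.ofReal x.1 < G x.2 q t then (1 : ℝ≥0∞) else 0 :=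
          (hg.comp measurable_snd).mul (Measurable.ite (measurableSet_lt (by fun_prop)
            (hGt.comp measurable_snd)) measurable_const measurable_const)
        have hA1 : Measurable fun z : ℝ =>
            ∫⁻ m, g m * (if ENNReal.ofReal z < G m q t then (1 : ℝ≥0∞) else 0) ∂L :=
          hA.lintegral_prod_right'
        have hx : Measurable fun x : ℝ => ψ q t * ENNReal.ofReal x ^ i := by fun_prop
        calc ∫⁻ z in Set.Ioi (0 : ℝ), ∫⁻ x, ∫⁻ m, g m * thinWeight G ψ i m (q, t, z, x) ∂L ∂ρ
            = ∫⁻ z in Set.Ioi (0 : ℝ), (∫⁻ m, g m * (if ENNReal.ofReal z < G m q t then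
                (1 : ℝ≥0∞) else 0) ∂L) * ∫⁻ x, ψ q t * ENNReal.ofReal x ^ i ∂ρ := by
              refine lintegral_congr fun z => ?_
              rw [← lintegral_const_mul _ hx]
              refine lintegral_congr fun x => ?_
              have := hA.comp (measurable_prodMk_left (x := z))
              simp only [Function.comp_def] at this
              rw [← lintegral_mul_const _ this]
              refine lintegral_congr fun m => ?_
              simp only [thinWeight]
              split_ifs <;> ring
          _ = (∫⁻ m, ∫⁻ z in Set.Ioi (0 : ℝ), g m * (if ENNReal.ofReal z < G m q t then
                (1 : ℝ≥0∞) else 0) ∂volume ∂L) * ∫⁻ x, ψ q t * ENNReal.ofReal x ^ i ∂ρ := by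
              rw [lintegral_mul_const _ hA1]
              congr 1
              exact lintegral_lintegral_swap hA.aemeasurable
          _ = (∫⁻ m, g m * G m q t ∂L) * (ψ q t * ∫⁻ x, ENNReal.ofReal x ^ i ∂ρ) := by
              congr 1
              · congr 1 with m
                rw [lintegral_const_mul _ (Measurable.ite (measurableSet_lt (by fun_prop)
                  measurable_const) measurable_const measurable_const), setLIntegral_Ioi_ofReal_lt]
              · rw [lintegral_const_mul _ (by fun_prop)]
          _ = _ := by ring
    _ = _ := by
        rw [Finset.mul_sum]
        refine Finset.sum_congr rfl fun q _ => ?_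
        have hgG : Measurable fun x : ℝ × Measure DrivingPoint => g x.2 * G x.2 q x.1 :=
          (hg.comp measurable_snd).mul ((hGm q).comp measurable_swap)
        have hψG : Measurable fun t => ψ q t * ∫⁻ m, g m * G m q t ∂L :=
          (hψ q).mul hgG.lintegral_prod_right'
        rw [lintegral_const_mul _ hψG]

theorem lintegral_thinSum {L : Measure (Measure DrivingPoint)}
    (hL : IsPoissonLaw (drivingIntensity ρ) L)
    (hG : IsPredictableRate ρ G) {ψ : Fin 2 → ℝ → ℝ≥0∞} (hψ : ∀ q, Measurable (ψ q)) (i : ℕ) :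
    ∫⁻ m, thinSum ρ G ψ i m ∂L = (∫⁻ x, ENNReal.ofReal x ^ i ∂ρ) *
      ∑ q, ∫⁻ t in Set.Ioi (0 : ℝ), ψ q t * ∫⁻ m, G m q t ∂L := by
  simpa using lintegral_mul_thinSum hL hG hψ i (g := fun _ => 1) measurable_const (by simp)

end Thinning

/-! ### Second moments of thinned processes -/

section Thinning

variable {ρ : Measure ℝ} [SigmaFinite ρ] {G : Measure DrivingPoint → Fin 2 → ℝ → ℝ≥0∞}
  {L : Measure (Measure DrivingPoint)}

open Classical in
/-- The weight that selects the points on side `p` with time in `S`. -/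
noncomputable def sideWeight (p : Fin 2) (S : Set ℝ) (q : Fin 2) (t : ℝ) : ℝ≥0∞ :=
  if q = p ∧ t ∈ S then 1 else 0

theorem measurable_sideWeight (p : Fin 2) {S : Set ℝ} (hS : MeasurableSet S) (q : Fin 2) :
    Measurable (sideWeight p S q) := by
  unfold sideWeight
  exact Measurable.ite (by measurability) measurable_const measurable_const

theorem sum_lintegral_sideWeight_mul (p : Fin 2) {S : Set ℝ} (hS : MeasurableSet S)
    (hS0 : S ⊆ Set.Ioi 0) (h : Fin 2 → ℝ → ℝ≥0∞) :
    ∑ q, ∫⁻ t in Set.Ioi (0 : ℝ), sideWeight p S q t * h q t = ∫⁻ t in S, h p t := by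
  rw [Finset.sum_eq_single p]
  · rw [← lintegral_indicator hS, ← lintegral_indicator measurableSet_Ioi]
    congr 1 with t
    by_cases ht : t ∈ S
    · simp [sideWeight, Set.indicator, ht, Set.mem_Ioi.1 (hS0 ht)]
    · simp [sideWeight, Set.indicator, ht]
  · intro q _ hq
    simp [sideWeight, hq]
  · simp

/-- The random measure on the time axis of the thinned points on side `p`, weighted with the powers
of the marks. -/
noncomputable def thinMeasure (ρ : Measure ℝ) [SigmaFinite ρ]
    (G : Measure DrivingPoint → Fin 2 → ℝ → ℝ≥0∞) (i : ℕ) (p : Fin 2) (m : Measure DrivingPoint) :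
    Measure ℝ :=
  ((shellPart (drivingIntensity ρ) m).withDensity
    (thinWeight G (sideWeight p Set.univ) i m)).map fun e => e.2.1

theorem lintegral_thinMeasure (hG : IsPredictableRate ρ G) (i : ℕ) (p : Fin 2)
    (m : Measure DrivingPoint) {h : ℝ → ℝ≥0∞} (hh : Measurable h) :
    ∫⁻ t, h t ∂(thinMeasure ρ G i p m) =
      thinSum ρ G (fun q t => if q = p then h t else 0) i m := by
  have hw : Measurable (thinWeight G (sideWeight p Set.univ) i m) :=
    (measurable_thinWeight_const hG (measurable_sideWeight p .univ) i).comp measurable_prodMk_left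
  have ht : Measurable fun e : DrivingPoint => e.2.1 := by fun_prop
  have hh' : Measurable fun e : DrivingPoint => h e.2.1 := hh.comp ht
  rw [thinMeasure, lintegral_map hh ht, lintegral_withDensity_eq_lintegral_mul _ hw hh', thinSum]
  congr 1 with e
  simp only [Pi.mul_apply, thinWeight, sideWeight, Set.mem_univ, and_true]
  split_ifs <;> ring

theorem thinMeasure_apply (hG : IsPredictableRate ρ G) (i : ℕ) (p : Fin 2)
    (m : Measure DrivingPoint) {S : Set ℝ} (hS : MeasurableSet S) :
    thinMeasure ρ G i p m S = thinSum ρ G (sideWeight p S) i m := by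
  rw [← lintegral_indicator_one hS, lintegral_thinMeasure hG i p m (measurable_one.indicator hS)]
  congr 1
  ext q t
  by_cases hq : q = p <;> by_cases ht : t ∈ S <;> simp [sideWeight, hq, ht, Set.indicator]

theorem measurable_thinMeasure (hG : IsPredictableRate ρ G) (i : ℕ) (p : Fin 2) {S : Set ℝ}
    (hS : MeasurableSet S) : Measurable fun m => thinMeasure ρ G i p m S := by
  simp only [thinMeasure_apply hG i p _ hS]
  exact measurable_thinSum hG (measurable_sideWeight p hS) i

/-- The compensator of `thinMeasure ρ G i p`, up to the factor `∫ xⁱ dρ`. -/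
noncomputable def rateMeasure (G : Measure DrivingPoint → Fin 2 → ℝ → ℝ≥0∞) (c : ℝ≥0∞) (p : Fin 2)
    (m : Measure DrivingPoint) : Measure ℝ :=
  (volume.restrict (Set.Ioi 0)).withDensity fun t => c * G m p t

theorem rateMeasure_apply (hG : IsPredictableRate ρ G) (c : ℝ≥0∞) (p : Fin 2)
    (m : Measure DrivingPoint) {S : Set ℝ} (hS : MeasurableSet S) (hS0 : S ⊆ Set.Ioi 0) :
    rateMeasure G c p m S = c * ∫⁻ t in S, G m p t := by
  have hGt : Measurable fun t => G m p t := hG.measurable.comp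
    (measurable_const.prodMk (measurable_const.prodMk measurable_id))
  rw [rateMeasure, withDensity_apply _ hS, Measure.restrict_restrict hS,
    Set.inter_eq_left.2 hS0, lintegral_const_mul _ hGt]

theorem measurable_lintegral_rate (hG : IsPredictableRate ρ G) (p : Fin 2) (S : Set ℝ) :
    Measurable fun m => ∫⁻ t in S, G m p t := by
  have : Measurable fun x : Measure DrivingPoint × ℝ => G x.1 p x.2 := hG.measurable.comp
    (measurable_fst.prodMk (measurable_const.prodMk measurable_snd))
  exact this.lintegral_prod_right'

/-- This is the compensator identity: `g` stands for a variable known before the window, expressed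
by its insensitivity to points added in `S`. -/
theorem lintegral_mul_thinMeasure (hL : IsPoissonLaw (drivingIntensity ρ) L)
    (hG : IsPredictableRate ρ G) (i : ℕ) (p : Fin 2) {g : Measure DrivingPoint → ℝ≥0∞}
    (hg : Measurable g) {S : Set ℝ} (hS : MeasurableSet S) (hS0 : S ⊆ Set.Ioi 0)
    (hgd : ∀ m, ShellFinite (drivingIntensity ρ) m → ∀ e : DrivingPoint, e.2.1 ∈ S →
      g (m + Measure.dirac e) = g m) :
    ∫⁻ m, g m * thinMeasure ρ G i p m S ∂L =
      (∫⁻ x, ENNReal.ofReal x ^ i ∂ρ) * ∫⁻ m, g m * ∫⁻ t in S, G m p t ∂volume ∂L := by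
  have := hL.prob
  have hGm : Measurable fun x : Measure DrivingPoint × ℝ => G x.1 p x.2 := hG.measurable.comp
    (measurable_fst.prodMk (measurable_const.prodMk measurable_snd))
  simp only [thinMeasure_apply hG i p _ hS]
  rw [lintegral_mul_thinSum hL hG (measurable_sideWeight p hS) i hg,
    sum_lintegral_sideWeight_mul p hS hS0 (fun q t => ∫⁻ m, g m * G m q t ∂L)]
  · congr 1
    have hsw : Measurable fun x : ℝ × Measure DrivingPoint => g x.2 * G x.2 p x.1 :=
      (hg.comp measurable_snd).mul (hGm.comp measurable_swap)
    rw [lintegral_lintegral_swap hsw.aemeasurable]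
    congr 1 with m
    have hGt : Measurable fun t => G m p t := hGm.comp measurable_prodMk_left
    rw [lintegral_const_mul _ hGt]
  · intro m hm e he
    refine hgd m hm e ?_
    by_contra hne
    exact he (by simp [sideWeight, hne])

/-- The total weight of the points in a bounded window has a finite second moment. -/
theorem lintegral_thinSum_sq_ne_top (hL : IsPoissonLaw (drivingIntensity ρ) L)
    {k : ℝ≥0∞} (hk : k ≠ ∞) (hGk : ∀ m q t, G m q t ≤ k) {i : ℕ}
    (h1 : ∫⁻ x, ENNReal.ofReal x ^ i ∂ρ ≠ ∞) (h2 : ∫⁻ x, ENNReal.ofReal x ^ (2 * i) ∂ρ ≠ ∞)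
    {ψ : Fin 2 → ℝ → ℝ≥0∞} (hψ : ∀ q, Measurable (ψ q))
    (hψ1 : ∀ q t, ψ q t ≤ 1) (hψi : ∀ q, ∫⁻ t in Set.Ioi 0, ψ q t ≠ ∞) :
    ∫⁻ m, thinSum ρ G ψ i m ^ 2 ∂L ≠ ∞ := by
  have := hL.prob
  -- A constant rate dominates `G` and has a weight `h` free of `m`, so Mecke's formula gives `E Z²
  -- = (E Z)² + ∫ h²` for the dominating sum `Z`.
  set Gk : Measure DrivingPoint → Fin 2 → ℝ → ℝ≥0∞ := fun _ _ _ => k + 1 with hGk'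
  have hGkp : IsPredictableRate ρ Gk := ⟨measurable_const, fun _ _ _ _ _ _ => rfl⟩
  have hle : ∀ m, thinSum ρ G ψ i m ≤ thinSum ρ Gk ψ i m := fun m => by
    refine lintegral_mono fun e => ?_
    simp only [thinWeight, Gk]
    split_ifs with ha hb
    · exact le_rfl
    · exact absurd (ha.trans_le ((hGk m _ _).trans le_self_add)) hb
    · exact zero_le
    · exact le_rfl
  set h : DrivingPoint → ℝ≥0∞ := fun e => thinWeight Gk ψ i 0 e with hh
  have hhm : Measurable h := (measurable_thinWeight_const hGkp hψ i).comp
    (measurable_prodMk_left (x := (0 : Measure DrivingPoint)))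
  have hthin : ∀ m, thinSum ρ Gk ψ i m = ∫⁻ e, h e ∂(shellPart (drivingIntensity ρ) m) :=
    fun m => rfl
  have hZm : Measurable (thinSum ρ Gk ψ i) := measurable_thinSum hGkp hψ i
  have hsum : ∀ (j : ℕ) (ψ' : Fin 2 → ℝ → ℝ≥0∞), (∀ q, Measurable (ψ' q)) →
      (∫⁻ x, ENNReal.ofReal x ^ j ∂ρ ≠ ∞) → (∀ q, ∫⁻ t in Set.Ioi 0, ψ' q t ≠ ∞) →
      ∫⁻ m, thinSum ρ Gk ψ' j m ∂L ≠ ∞ := by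
    intro j ψ' hm' hj hi
    rw [lintegral_thinSum hL hGkp hm' j]
    refine ENNReal.mul_ne_top hj (ENNReal.sum_ne_top.2 fun q _ => ?_)
    simp only [Gk, lintegral_const, measure_univ, mul_one]
    rw [lintegral_mul_const _ (hm' q)]
    exact ENNReal.mul_ne_top (hi q) (by finiteness)
  have hZ1 : ∫⁻ m, thinSum ρ Gk ψ i m ∂L ≠ ∞ := hsum i ψ hψ h1 hψi
  have hZ2 : ∫⁻ e, h e ^ 2 ∂drivingIntensity ρ ≠ ∞ := by
    have := hL.mecke (f := fun x => h x.2 ^ 2) ((hhm.comp measurable_snd).pow_const 2)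
    simp only [lintegral_const, measure_univ, mul_one] at this
    rw [← this]
    refine ne_top_of_le_ne_top (hsum (2 * i) ψ hψ h2 hψi)
      (lintegral_mono fun m => lintegral_mono fun e => ?_)
    simp only [h, thinWeight, Gk]
    split_ifs
    · rw [mul_pow, ← pow_mul, mul_comm i 2]
      gcongr
      rw [sq]
      exact mul_le_of_le_one_left zero_le (hψ1 _ _)
    · simp
  refine ne_top_of_le_ne_top ?_ (lintegral_mono fun m => pow_le_pow_left' (hle m) 2)
  have hf : Measurable fun x : Measure DrivingPoint × DrivingPoint =>
      thinSum ρ Gk ψ i x.1 * h x.2 := (hZm.comp measurable_fst).mul (hhm.comp measurable_snd)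
  calc ∫⁻ m, thinSum ρ Gk ψ i m ^ 2 ∂L
      = ∫⁻ m, ∫⁻ e, thinSum ρ Gk ψ i m * h e ∂(shellPart (drivingIntensity ρ) m) ∂L := by
        congr 1 with m
        rw [lintegral_const_mul _ hhm, ← hthin, sq]
    _ = ∫⁻ e, ∫⁻ m, thinSum ρ Gk ψ i (m + Measure.dirac e) * h e ∂L ∂drivingIntensity ρ :=
        hL.mecke hf
    _ = ∫⁻ e, (∫⁻ m, thinSum ρ Gk ψ i m ∂L + h e) * h e ∂drivingIntensity ρ := by
        congr 1 with e
        have hsplit : ∫⁻ m, thinSum ρ Gk ψ i (m + Measure.dirac e) * h e ∂L =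
            ∫⁻ m, (thinSum ρ Gk ψ i m + h e) * h e ∂L := by
          refine lintegral_congr_ae ?_
          filter_upwards [hL.ae_shellFinite] with m hm
          rw [hthin, hthin, (hm.add_dirac _ e).shellPart_apply, hm.shellPart_apply,
            lintegral_add_measure, lintegral_dirac]
        have hZc : Measurable fun m => thinSum ρ Gk ψ i m + h e := hZm.add_const _
        rw [hsplit, lintegral_mul_const _ hZc, lintegral_add_right _ measurable_const]
        simp
    _ = (∫⁻ m, thinSum ρ Gk ψ i m ∂L) * (∫⁻ e, h e ∂drivingIntensity ρ) +
          ∫⁻ e, h e ^ 2 ∂drivingIntensity ρ := by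
        simp only [add_mul]
        rw [lintegral_add_left (hhm.const_mul _), lintegral_const_mul _ hhm]
        simp only [sq]
    _ ≠ ∞ := by
        have := hL.mecke (f := fun x => h x.2) (hhm.comp measurable_snd)
        simp only [lintegral_const, measure_univ, mul_one] at this
        rw [← this]
        exact ENNReal.add_ne_top.2 ⟨ENNReal.mul_ne_top hZ1 hZ1, hZ2⟩

theorem measurable_thinMeasure_singleton (hG : IsPredictableRate ρ G) (i : ℕ) (p : Fin 2) :
    Measurable fun x : Measure DrivingPoint × ℝ => thinMeasure ρ G i p x.1 {x.2} := by
  simp only [thinMeasure_apply hG i p _ (measurableSet_singleton _)]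
  refine measurable_thinSum_param hG (ψ := fun s => sideWeight p {s}) (fun q => ?_) i
  unfold sideWeight
  refine Measurable.ite ?_ measurable_const measurable_const
  by_cases hq : q = p
  · simpa [hq] using measurableSet_eq_fun measurable_snd measurable_fst
  · simp [hq]

/-- Tonelli on the diagonal: the atoms of an s-finite measure sit on a Lebesgue-null set. -/
theorem ae_thinMeasure_singleton (hG : IsPredictableRate ρ G) (i : ℕ) (p : Fin 2)
    (m : Measure DrivingPoint) : ∀ᵐ t : ℝ, thinMeasure ρ G i p m {t} = 0 := by
  have hsf : SFinite (thinMeasure ρ G i p m) := by unfold thinMeasure; infer_instance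
  refine (lintegral_eq_zero_iff ((measurable_thinMeasure_singleton hG i p).comp
    (measurable_prodMk_left (x := m)))).1 ?_
  have hd : Measurable fun x : ℝ × ℝ => (if x.2 = x.1 then (1 : ℝ≥0∞) else 0) :=
    Measurable.ite (measurableSet_eq_fun measurable_snd measurable_fst) measurable_const
      measurable_const
  have e1 : ∀ t : ℝ, thinMeasure ρ G i p m {t} =
      ∫⁻ s, (if s = t then (1 : ℝ≥0∞) else 0) ∂(thinMeasure ρ G i p m) := fun t => by
    rw [← lintegral_indicator_one (measurableSet_singleton t)]
    simp [Set.indicator]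
  have e2 : ∀ s : ℝ, ∫⁻ t : ℝ, (if s = t then (1 : ℝ≥0∞) else 0) = 0 := fun s => by
    have : ∫⁻ t : ℝ, (if s = t then (1 : ℝ≥0∞) else 0) = volume ({s} : Set ℝ) := by
      rw [← lintegral_indicator_one (measurableSet_singleton s)]
      simp [Set.indicator, eq_comm]
    simp [this]
  simp only [Function.comp_def, e1]
  rw [lintegral_lintegral_swap hd.aemeasurable]
  simp [e2]

theorem thinWeight_add_dirac_self (hG : IsPredictableRate ρ G) (ψ : Fin 2 → ℝ → ℝ≥0∞) (i : ℕ)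
    {m : Measure DrivingPoint} (hm : ShellFinite (drivingIntensity ρ) m) (e : DrivingPoint) :
    thinWeight G ψ i (m + Measure.dirac e) e = thinWeight G ψ i m e := by
  simp only [thinWeight, hG.add_dirac m hm e _ _ le_rfl]

/-- The rate at the time of `e` ignores `e`, so the other points at that time are kept or rejected
as before and the atom grows only by the weight of `e`. -/
theorem thinMeasure_add_dirac_singleton (hG : IsPredictableRate ρ G) (i : ℕ) (p : Fin 2)
    {m : Measure DrivingPoint} (hm : ShellFinite (drivingIntensity ρ) m) (e : DrivingPoint) :
    thinMeasure ρ G i p (m + Measure.dirac e) {e.2.1} =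
      thinMeasure ρ G i p m {e.2.1} + thinWeight G (sideWeight p Set.univ) i m e := by
  have hw : ∀ e', thinWeight G (sideWeight p {e.2.1}) i (m + Measure.dirac e) e' =
      thinWeight G (sideWeight p {e.2.1}) i m e' := fun e' => by
    by_cases he : e'.2.1 = e.2.1
    · simp only [thinWeight, he, hG.add_dirac m hm e _ _ le_rfl]
    · simp [thinWeight, sideWeight, he]
  rw [thinMeasure_apply hG i p _ (measurableSet_singleton _),
    thinMeasure_apply hG i p _ (measurableSet_singleton _), thinSum, thinSum,
    (hm.add_dirac _ e).shellPart_apply, hm.shellPart_apply, lintegral_add_measure,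
    lintegral_dirac]
  simp only [hw]
  congr 1
  simp [thinWeight, sideWeight]

theorem thinWeight_mul_univ (p : Fin 2) (S : Set ℝ) (i : ℕ) (m : Measure DrivingPoint)
    (e : DrivingPoint) :
    thinWeight G (sideWeight p S) i m e * thinWeight G (sideWeight p Set.univ) i m e =
      thinWeight G (sideWeight p S) (2 * i) m e := by
  have h2 : ENNReal.ofReal e.2.2.2 ^ (2 * i) =
      ENNReal.ofReal e.2.2.2 ^ i * ENNReal.ofReal e.2.2.2 ^ i := by rw [two_mul, pow_add]
  simp only [thinWeight, sideWeight, h2, Set.mem_univ, and_true]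
  split_ifs <;> simp_all

theorem setLIntegral_thinMeasure (hG : IsPredictableRate ρ G) (i : ℕ) (p : Fin 2)
    (m : Measure DrivingPoint) {h : ℝ → ℝ≥0∞} (hh : Measurable h) {S : Set ℝ}
    (hS : MeasurableSet S) : ∫⁻ t in S, h t ∂(thinMeasure ρ G i p m) =
      ∫⁻ e, thinWeight G (sideWeight p S) i m e * h e.2.1 ∂(shellPart (drivingIntensity ρ) m) := by
  rw [← lintegral_indicator hS, lintegral_thinMeasure hG i p m (hh.indicator hS), thinSum]
  refine lintegral_congr fun e => ?_
  by_cases c1 : ENNReal.ofReal e.2.2.1 < G m e.1 e.2.1 <;> by_cases c2 : e.1 = p <;>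
    by_cases c3 : e.2.1 ∈ S <;> simp [thinWeight, sideWeight, Set.indicator, c1, c2, c3, mul_comm]

/-- The squared jumps of the thinned process are the jumps of the process of squared marks. -/
theorem lintegral_atoms_thinMeasure (hL : IsPoissonLaw (drivingIntensity ρ) L)
    (hG : IsPredictableRate ρ G) (i : ℕ) (p : Fin 2) {a b : ℝ} (ha : 0 ≤ a) :
    ∫⁻ m, ∫⁻ x in Set.Ioc a b, thinMeasure ρ G i p m {x} ∂(thinMeasure ρ G i p m) ∂L =
      (∫⁻ x, ENNReal.ofReal x ^ (2 * i) ∂ρ) * (∫⁻ m, ∫⁻ t in Set.Ioc a b, G m p t ∂volume ∂L) := by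
  have := hL.prob
  have hatm := measurable_thinMeasure_singleton hG i p
  obtain ⟨h, hh⟩ : ∃ h : ℕ → Measure DrivingPoint × DrivingPoint → ℝ≥0∞, ∀ j x, h j x =
    thinWeight G (sideWeight p (Set.Ioc a b)) j x.1 x.2 := ⟨_, fun _ _ => rfl⟩
  obtain ⟨at', hat'⟩ : ∃ at' : Measure DrivingPoint × DrivingPoint → ℝ≥0∞, ∀ x, at' x =
    thinMeasure ρ G i p x.1 {x.2.2.1} := ⟨_, fun _ => rfl⟩
  have hhm : ∀ j, Measurable (h j) := fun j => by
    rw [funext (hh j)]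
    exact measurable_thinWeight_const hG (measurable_sideWeight p measurableSet_Ioc) j
  have hatm' : Measurable at' := by
    have h0 : Measurable fun x : Measure DrivingPoint × DrivingPoint => (x.1, x.2.2.1) := by
      fun_prop
    have h1 := hatm.comp h0
    rw [funext hat']
    exact h1
  have hf : Measurable fun x => h i x * at' x := (hhm i).mul hatm'
  have hfs : Measurable fun x : DrivingPoint × Measure DrivingPoint =>
      h i (x.2, x.1) * at' (x.2, x.1) := hf.comp measurable_swap
  -- A new point almost never falls on an existing atom, as the driving intensity is diffuse in
  -- time. After Mecke's formula only the product of the new point with itself survives.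
  have hnull : ∀ m, ∫⁻ e, h i (m, e) * at' (m, e) ∂drivingIntensity ρ = 0 := by
    intro m
    have hfm : Measurable fun e => h i (m, e) * at' (m, e) :=
      hf.comp (measurable_prodMk_left (x := m))
    rw [lintegral_drivingIntensity ρ hfm]
    refine Finset.sum_eq_zero fun q _ => ?_
    refine lintegral_eq_zero_of_ae_eq_zero ?_
    filter_upwards [ae_restrict_of_ae (ae_thinMeasure_singleton hG i p m)] with t ht
    simp [hat', ht]
  have hpath : ∀ m, ∫⁻ x in Set.Ioc a b, thinMeasure ρ G i p m {x} ∂(thinMeasure ρ G i p m) =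
      ∫⁻ e, h i (m, e) * at' (m, e) ∂(shellPart (drivingIntensity ρ) m) := by
    intro m
    have hm0 := hatm.comp (measurable_prodMk_left (x := m))
    have hm1 : Measurable fun t => thinMeasure ρ G i p m {t} := hm0
    rw [setLIntegral_thinMeasure hG i p m hm1 measurableSet_Ioc]
    simp only [hh, hat']
  calc ∫⁻ m, ∫⁻ x in Set.Ioc a b, thinMeasure ρ G i p m {x} ∂(thinMeasure ρ G i p m) ∂L
      = ∫⁻ e, ∫⁻ m, (h i (m, e) * at' (m, e) + h (2 * i) (m + Measure.dirac e, e)) ∂L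
          ∂drivingIntensity ρ := by
        rw [lintegral_congr hpath]
        refine (hL.mecke hf).trans (lintegral_congr fun e => lintegral_congr_ae ?_)
        filter_upwards [hL.ae_shellFinite] with m hm
        rw [hh, hh, hh, hat', hat',thinWeight_add_dirac_self hG _ _ hm, thinWeight_add_dirac_self hG _ _ hm,
          thinMeasure_add_dirac_singleton hG i p hm, mul_add, thinWeight_mul_univ]
    _ = ∫⁻ e, ∫⁻ m, h i (m, e) * at' (m, e) ∂L ∂drivingIntensity ρ +
          ∫⁻ e, ∫⁻ m, h (2 * i) (m + Measure.dirac e, e) ∂L ∂drivingIntensity ρ := by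
        rw [← lintegral_add_left hfs.lintegral_prod_right']
        congr 1 with e
        exact lintegral_add_left (hf.comp (measurable_prodMk_right (y := e))) _
    _ = ∫⁻ m, 1 * thinMeasure ρ G (2 * i) p m (Set.Ioc a b) ∂L := by
        rw [lintegral_lintegral_swap hfs.aemeasurable, ← hL.mecke (hhm (2 * i))]
        rw [lintegral_congr hnull, lintegral_zero, zero_add]
        simp only [one_mul, thinMeasure_apply hG _ p _ measurableSet_Ioc, thinSum, hh]
    _ = _ := by
        rw [lintegral_mul_thinMeasure hL hG (2 * i) p measurable_const measurableSet_Ioc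
          (fun t ht => ha.trans_lt ht.1) (fun _ _ _ _ => rfl)]
        simp only [one_mul]

theorem measurable_rateMeasure (hG : IsPredictableRate ρ G) (c : ℝ≥0∞) (p : Fin 2) {S : Set ℝ}
    (hS : MeasurableSet S) : Measurable fun m => rateMeasure G c p m S := by
  have hGt : ∀ m, Measurable fun t => G m p t := fun m => hG.measurable.comp
    (measurable_const.prodMk (measurable_const.prodMk measurable_id))
  have : ∀ m, rateMeasure G c p m S = c * ∫⁻ t in S ∩ Set.Ioi 0, G m p t := fun m => by
    rw [rateMeasure, withDensity_apply _ hS, Measure.restrict_restrict hS,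
      lintegral_const_mul _ (hGt m)]
  simp only [this]
  exact (measurable_lintegral_rate hG p _).const_mul c

/-- The variance of the compensated thinned process. -/
theorem lintegral_sqDist_thinMeasure_le (hL : IsPoissonLaw (drivingIntensity ρ) L)
    (hG : IsPredictableRate ρ G) {k : ℝ≥0∞} (hk : k ≠ ∞) (hGk : ∀ m q t, G m q t ≤ k) {i : ℕ}
    (h1 : ∫⁻ x, ENNReal.ofReal x ^ i ∂ρ ≠ ∞) (h2 : ∫⁻ x, ENNReal.ofReal x ^ (2 * i) ∂ρ ≠ ∞)
    (p : Fin 2) {a b : ℝ} (ha : 0 ≤ a) (hab : a ≤ b) :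
    ∫⁻ m, sqDist (thinMeasure ρ G i p m (Set.Ioc a b))
        ((∫⁻ x, ENNReal.ofReal x ^ i ∂ρ) * ∫⁻ t in Set.Ioc a b, G m p t) ∂L ≤
      2 * ((∫⁻ x, ENNReal.ofReal x ^ (2 * i) ∂ρ) *
        ∫⁻ m, ∫⁻ t in Set.Ioc a b, G m p t ∂volume ∂L) := by
  have := hL.prob
  obtain ⟨c, hc⟩ : ∃ c, c = ∫⁻ x, ENNReal.ofReal x ^ i ∂ρ := ⟨_, rfl⟩
  have hIoc : ∀ {s t : ℝ}, 0 ≤ s → Set.Ioc s t ⊆ Set.Ioi 0 := fun hs u hu => hs.trans_lt hu.1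
  have hrate : ∀ m {s t : ℝ}, 0 ≤ s → rateMeasure G c p m (Set.Ioc s t) =
      c * ∫⁻ u in Set.Ioc s t, G m p u := fun m s t hs =>
    rateMeasure_apply hG c p m measurableSet_Ioc (hIoc hs)
  -- Both orthogonality conditions are instances of this: the thinned mass and the integrated rate
  -- of `(a, s]` ignore points added after `s`.
  have horth : ∀ g : Measure DrivingPoint → ℝ≥0∞, Measurable g → ∀ s t, a ≤ s →
      (∀ m, ShellFinite (drivingIntensity ρ) m → ∀ e : DrivingPoint, s < e.2.1 →
        g (m + Measure.dirac e) = g m) →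
      ∫⁻ m, g m * thinMeasure ρ G i p m (Set.Ioc s t) ∂L =
        ∫⁻ m, g m * rateMeasure G c p m (Set.Ioc s t) ∂L := by
    intro g hg s t hs hgd
    have hgm : Measurable fun m => g m * ∫⁻ u in Set.Ioc s t, G m p u :=
      hg.mul (measurable_lintegral_rate hG p _)
    rw [lintegral_mul_thinMeasure hL hG i p hg measurableSet_Ioc (hIoc (ha.trans hs))
      fun m hm e he => hgd m hm e he.1, ← hc, ← lintegral_const_mul _ hgm]
    congr 1 with m
    rw [hrate m (ha.trans hs)]
    ring
  rw [← hc]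
  simp only [← hrate _ ha]
  refine (lintegral_sqDist_le_atoms L hab (N := thinMeasure ρ G i p) (Λ := rateMeasure G c p)
    (fun s t => measurable_thinMeasure hG i p measurableSet_Ioc)
    (fun s t => measurable_rateMeasure hG c p measurableSet_Ioc) ?_ ?_ ?_ ?_ ?_).trans ?_
  · simp only [thinMeasure_apply hG i p _ measurableSet_Ioc]
    refine lintegral_thinSum_sq_ne_top hL hk hGk h1 h2
      (measurable_sideWeight p measurableSet_Ioc) (fun q t => ?_) fun q => ?_
    · unfold sideWeight
      split_ifs <;> simp
    · have hle : ∀ t, sideWeight p (Set.Ioc a b) q t ≤ (Set.Ioc a b).indicator 1 t := fun t => by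
        by_cases ht : t ∈ Set.Ioc a b
        · simp only [sideWeight, Set.indicator_of_mem ht, Pi.one_apply]
          split_ifs <;> simp
        · simp [sideWeight, ht]
      refine ne_top_of_le_ne_top ?_ (lintegral_mono hle)
      rw [lintegral_indicator_one measurableSet_Ioc]
      exact ne_top_of_le_ne_top (b := volume (Set.Ioc a b)) (by simp)
        (Measure.restrict_apply_le _ _)
  · refine ne_top_of_le_ne_top (b := ∫⁻ _, (c * (k * ENNReal.ofReal (b - a))) ^ 2 ∂L) ?_
      (lintegral_mono fun m => ?_)
    · have hc' : c ≠ ∞ := hc ▸ h1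
      simp only [lintegral_const, measure_univ, mul_one]
      finiteness
    · rw [hrate m ha]
      gcongr
      calc ∫⁻ u in Set.Ioc a b, G m p u ≤ ∫⁻ _ in Set.Ioc a b, k := lintegral_mono fun u => hGk m p u
        _ = _ := by simp
  · intro s t hs hst htb
    refine horth _ (measurable_thinMeasure hG i p measurableSet_Ioc) s t hs fun m hm e he => ?_
    rw [thinMeasure_apply hG i p _ measurableSet_Ioc, thinMeasure_apply hG i p _ measurableSet_Ioc]
    refine thinSum_add_dirac hG i hm fun q u hu => ?_
    have : ¬ u ∈ Set.Ioc a s := fun h' => (he.trans_le (hu.trans h'.2)).false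
    simp [sideWeight, this]
  · intro s t hs hst htb
    refine horth _ (measurable_rateMeasure hG c p measurableSet_Ioc) s t hs fun m hm e he => ?_
    rw [hrate _ ha, hrate _ ha]
    congr 1
    refine setLIntegral_congr_fun measurableSet_Ioc fun u hu => ?_
    exact hG.add_dirac m hm e p u (hu.2.trans he.le)
  · intro m x
    unfold rateMeasure
    exact withDensity_absolutelyContinuous _ _ (by simp)
  · rw [lintegral_atoms_thinMeasure hL hG i p ha]

end Thinning

/-! ### A dominating process by Picard iteration -/

namespace HawkesModel

variable (H : HawkesModel)

instance : IsProbabilityMeasure H.ρ := H.prob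

open Classical in
/-- The kernel `k` as a weight on the points that precede `t`. -/
noncomputable def kernelWeight (p : Fin 2) (t : ℝ) (q : Fin 2) (s : ℝ) : ℝ≥0∞ :=
  if s < t then H.k p q (t - s) else 0

theorem measurable_kernelWeight (q : Fin 2) :
    Measurable fun x : (Fin 2 × ℝ) × ℝ => H.kernelWeight x.1.1 x.1.2 q x.2 := by
  refine measurable_uncurry_of_finite
    (f := fun p (x : (Fin 2 × ℝ) × ℝ) => H.kernelWeight p x.1.2 q x.2) (fun p => ?_)
    (g := fun x => x.1.1) (by fun_prop)
  unfold kernelWeight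
  refine Measurable.ite (measurableSet_lt (by fun_prop) (by fun_prop)) ?_ measurable_const
  exact (H.measurable_k p q).comp (by fun_prop)

theorem measurable_kernelWeight_right (p : Fin 2) (t : ℝ) (q : Fin 2) :
    Measurable (H.kernelWeight p t q) :=
  (H.measurable_kernelWeight q).comp (measurable_prodMk_left (x := (p, t)))

/-- The strict upper bound of the baseline used in the dominating process. -/
noncomputable def envConst : ℝ≥0∞ := ENNReal.ofReal H.μbar + 1

theorem envConst_ne_top : H.envConst ≠ ∞ := by unfold envConst; finiteness

open Classical in
/-- The restriction of a rate to positive times, truncated at the level `k`. -/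
noncomputable def cutRate (k : ℕ) (F : Measure DrivingPoint → Fin 2 → ℝ → ℝ≥0∞)
    (m : Measure DrivingPoint) (q : Fin 2) (t : ℝ) : ℝ≥0∞ :=
  if 0 < t then min (F m q t) k else 0

/-- The Picard iteration for the intensity of a dominating Hawkes process. -/
noncomputable def envelope : ℕ → Measure DrivingPoint → Fin 2 → ℝ → ℝ≥0∞
  | 0 => fun _ _ _ => 0
  | k + 1 => fun m p t =>
      H.envConst + thinSum H.ρ (cutRate k (envelope k)) (H.kernelWeight p t) 1 m

/-- The truncated rates of the Picard iteration. -/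
noncomputable def envRate (k : ℕ) : Measure DrivingPoint → Fin 2 → ℝ → ℝ≥0∞ :=
  cutRate k (H.envelope k)

theorem envelope_succ (k : ℕ) (m : Measure DrivingPoint) (p : Fin 2) (t : ℝ) :
    H.envelope (k + 1) m p t =
      H.envConst + thinSum H.ρ (H.envRate k) (H.kernelWeight p t) 1 m := rfl

theorem envRate_le_envelope (k : ℕ) (m : Measure DrivingPoint) (q : Fin 2) (t : ℝ) :
    H.envRate k m q t ≤ H.envelope k m q t := by
  unfold envRate cutRate
  split_ifs
  · exact min_le_left _ _
  · exact zero_le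

theorem envRate_le (k : ℕ) (m : Measure DrivingPoint) (q : Fin 2) (t : ℝ) :
    H.envRate k m q t ≤ k := by
  unfold envRate cutRate
  split_ifs
  · exact min_le_right _ _
  · exact zero_le

variable {H} in
theorem _root_.IsPredictableRate.cutRate {F : Measure DrivingPoint → Fin 2 → ℝ → ℝ≥0∞}
    (hF : IsPredictableRate H.ρ F) (k : ℕ) : IsPredictableRate H.ρ (cutRate k F) where
  measurable := by
    unfold HawkesModel.cutRate
    exact Measurable.ite (measurableSet_lt measurable_const (by fun_prop))
      (hF.measurable.min measurable_const) measurable_const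
  add_dirac m hm e q t ht := by
    simp only [HawkesModel.cutRate, hF.add_dirac m hm e q t ht]

/-- Induction: `kernelWeight p t` vanishes at times `≥ t`, so each iterate at time `t` only uses
points strictly before `t`. -/
theorem isPredictableRate_envelope (k : ℕ) : IsPredictableRate H.ρ (H.envelope k) := by
  induction k with
  | zero => exact ⟨measurable_const, fun _ _ _ _ _ _ => rfl⟩
  | succ k ih =>
    have hc := ih.cutRate k
    refine ⟨?_, fun m hm e q t ht => ?_⟩
    · simp only [envelope_succ]
      exact (measurable_thinSum_param hc (ψ := fun x : Fin 2 × ℝ => H.kernelWeight x.1 x.2)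
        H.measurable_kernelWeight 1).const_add _
    · rw [envelope_succ, envelope_succ]
      congr 1
      refine thinSum_add_dirac hc 1 hm fun q' s hs => ?_
      simp [kernelWeight, not_lt.2 (ht.trans hs)]

theorem isPredictableRate_envRate (k : ℕ) : IsPredictableRate H.ρ (H.envRate k) :=
  (H.isPredictableRate_envelope k).cutRate k

theorem _root_.thinSum_mono {ρ : Measure ℝ} [SigmaFinite ρ]
    {G G' : Measure DrivingPoint → Fin 2 → ℝ → ℝ≥0∞} {m : Measure DrivingPoint}
    (h : ∀ q t, G m q t ≤ G' m q t) (ψ : Fin 2 → ℝ → ℝ≥0∞) (i : ℕ) :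
    thinSum ρ G ψ i m ≤ thinSum ρ G' ψ i m := by
  refine lintegral_mono fun e => ?_
  unfold thinWeight
  split_ifs with ha hb
  · exact le_rfl
  · exact absurd (ha.trans_le (h _ _)) hb
  · exact zero_le
  · exact le_rfl

theorem envelope_le_succ (k : ℕ) (m : Measure DrivingPoint) (p : Fin 2) (t : ℝ) :
    H.envelope k m p t ≤ H.envelope (k + 1) m p t := by
  induction k generalizing p t with
  | zero => exact zero_le
  | succ k ih =>
    rw [envelope_succ, envelope_succ]
    refine add_le_add le_rfl (thinSum_mono (fun q s => ?_) _ _)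
    unfold envRate cutRate
    split_ifs
    · exact min_le_min (ih q s) (by exact_mod_cast k.le_succ)
    · exact le_rfl

theorem envelope_mono (m : Measure DrivingPoint) (p : Fin 2) (t : ℝ) :
    Monotone fun k => H.envelope k m p t :=
  monotone_nat_of_le_succ fun k => H.envelope_le_succ k m p t

theorem envRate_mono (m : Measure DrivingPoint) (p : Fin 2) (t : ℝ) :
    Monotone fun k => H.envRate k m p t := by
  intro k l hkl
  simp only [envRate, cutRate]
  split_ifs
  · exact min_le_min (H.envelope_mono m p t hkl) (by exact_mod_cast hkl)
  · exact le_rfl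

theorem lintegral_kernelWeight_le (p q : Fin 2) (t : ℝ) :
    ∫⁻ s in Set.Ioi 0, H.kernelWeight p t q s ≤ ∫⁻ u in Set.Ioi 0, H.k p q u := by
  calc ∫⁻ s in Set.Ioi 0, H.kernelWeight p t q s
      ≤ ∫⁻ s, H.kernelWeight p t q s := setLIntegral_le_lintegral _ _
    _ = ∫⁻ s, (Set.Ioi 0).indicator (H.k p q) (t - s) := by
        congr 1 with s
        simp [kernelWeight, Set.indicator]
    _ = ∫⁻ u, (Set.Ioi 0).indicator (H.k p q) u :=
        lintegral_sub_left_eq_self (fun u => (Set.Ioi 0).indicator (H.k p q) u) t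
    _ = _ := lintegral_indicator measurableSet_Ioi _

variable {L : Measure (Measure DrivingPoint)}

/-- `envConst * w` is a fixed point of the averaged equation, because `w = 1 + K w`; the iterates
start at zero and stay below it. -/
theorem lintegral_envelope_le (hL : IsPoissonLaw (drivingIntensity H.ρ) L) (k : ℕ) (p : Fin 2)
    (t : ℝ) : ∫⁻ m, H.envelope k m p t ∂L ≤ H.envConst * H.w p := by
  have := hL.prob
  induction k generalizing p t with
  | zero => simp [envelope]
  | succ k ih =>
    simp only [envelope_succ]
    rw [lintegral_add_left measurable_const, lintegral_thinSum hL (H.isPredictableRate_envRate k)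
      (H.measurable_kernelWeight_right p t), lintegral_const, measure_univ, mul_one, H.w_eq' p,
      mul_add, mul_one]
    refine add_le_add le_rfl ?_
    rw [Finset.mul_sum, Finset.mul_sum]
    refine Finset.sum_le_sum fun q _ => ?_
    calc _ ≤ (∫⁻ x, ENNReal.ofReal x ^ 1 ∂H.ρ) *
          ∫⁻ s in Set.Ioi 0, H.kernelWeight p t q s * (H.envConst * H.w q) := by
          gcongr with s
          exact (lintegral_mono fun m => H.envRate_le_envelope k m q s).trans (ih q s)
      _ = H.mom 1 * ((∫⁻ s in Set.Ioi 0, H.kernelWeight p t q s) * (H.envConst * H.w q)) := by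
          rw [lintegral_mul_const _ (H.measurable_kernelWeight_right p t q)]
          rfl
      _ ≤ H.mom 1 * ((∫⁻ u in Set.Ioi 0, H.k p q u) * (H.envConst * H.w q)) := by
          exact mul_le_mul_right (mul_le_mul_left (H.lintegral_kernelWeight_le p q t) _) _
      _ = _ := by
          rw [lintegral_κ_eq]
          ring

theorem lintegral_envRate_le (hL : IsPoissonLaw (drivingIntensity H.ρ) L) (k : ℕ) (p : Fin 2)
    (a b : ℝ) : ∫⁻ m, ∫⁻ t in Set.Ioc a b, H.envRate k m p t ∂volume ∂L ≤
      H.envConst * H.w p * ENNReal.ofReal (b - a) := by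
  have := hL.prob
  have hm : Measurable fun x : Measure DrivingPoint × ℝ => H.envRate k x.1 p x.2 :=
    (H.isPredictableRate_envRate k).measurable.comp
      (measurable_fst.prodMk (measurable_const.prodMk measurable_snd))
  rw [lintegral_lintegral_swap hm.aemeasurable]
  calc _ ≤ ∫⁻ _ in Set.Ioc a b, H.envConst * H.w p := lintegral_mono fun t =>
        (lintegral_mono fun m => H.envRate_le_envelope k m p t).trans
          (H.lintegral_envelope_le hL k p t)
    _ = _ := by simp

/-- The integrated excitation in a window is a convolution of the kernel with the sums of the marks
in shifted windows. -/
theorem lintegral_thinSum_kernelWeight {G : Measure DrivingPoint → Fin 2 → ℝ → ℝ≥0∞}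
    (hG : IsPredictableRate H.ρ G) (p : Fin 2) (a b : ℝ) (m : Measure DrivingPoint) :
    ∫⁻ t in Set.Ioc a b, thinSum H.ρ G (H.kernelWeight p t) 1 m =
      ∑ q, ∫⁻ u in Set.Ioi 0, H.k p q u *
        thinMeasure H.ρ G 1 q m (Set.Ioc (a - u) (b - u)) := by
  have hψ : ∀ q, Measurable fun x : ℝ × ℝ => H.kernelWeight p x.1 q x.2 := fun q =>
    (H.measurable_kernelWeight q).comp
      (((measurable_const (a := p)).prodMk measurable_fst).prodMk measurable_snd)
  have h1 : Measurable fun x : ℝ × DrivingPoint => thinWeight G (H.kernelWeight p x.1) 1 m x.2 :=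
    (measurable_thinWeight hG hψ 1).comp (((measurable_const (a := m)).prodMk
      measurable_fst).prodMk measurable_snd)
  have hψ2 : ∀ q q', Measurable fun x : ℝ × ℝ =>
      sideWeight q (Set.Ioc (a - x.1) (b - x.1)) q' x.2 := fun q q' => by
    unfold sideWeight
    refine Measurable.ite ?_ measurable_const measurable_const
    by_cases hq : q' = q
    · have hA : MeasurableSet {x : ℝ × ℝ | a - x.1 < x.2} :=
        measurableSet_lt (by fun_prop) (by fun_prop)
      have hB : MeasurableSet {x : ℝ × ℝ | x.2 ≤ b - x.1} :=
        measurableSet_le (by fun_prop) (by fun_prop)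
      simp only [hq, true_and, Set.mem_Ioc]
      exact hA.inter hB
    · simp [hq]
  have h2 : ∀ q, Measurable fun x : ℝ × DrivingPoint => H.k p q x.1 *
      thinWeight G (sideWeight q (Set.Ioc (a - x.1) (b - x.1))) 1 m x.2 := fun q =>
    ((H.measurable_k p q).comp measurable_fst).mul ((measurable_thinWeight hG
      (ψ := fun u => sideWeight q (Set.Ioc (a - u) (b - u))) (hψ2 q) 1).comp
      (((measurable_const (a := m)).prodMk measurable_fst).prodMk measurable_snd))
  -- Substitution `u = t - s`: for a fixed point at time `s`, the window for `t` becomes the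
  -- condition that `s` lie in the window shifted back by the lag `u`.
  have hint : ∀ (q : Fin 2) (s : ℝ), ∫⁻ t in Set.Ioc a b, H.kernelWeight p t q s =
      ∫⁻ u in Set.Ioi 0, H.k p q u * (if s ∈ Set.Ioc (a - u) (b - u) then 1 else 0) := by
    intro q s
    calc ∫⁻ t in Set.Ioc a b, H.kernelWeight p t q s
        = ∫⁻ t, (fun u => (Set.Ioi 0).indicator (fun u => H.k p q u *
            (if s ∈ Set.Ioc (a - u) (b - u) then 1 else 0)) u) (t - s) := by
          rw [← lintegral_indicator measurableSet_Ioc]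
          congr 1 with t
          have e : s ∈ Set.Ioc (a - (t - s)) (b - (t - s)) ↔ t ∈ Set.Ioc a b := by
            simp only [Set.mem_Ioc]
            constructor <;> intro h <;> constructor <;> linarith [h.1, h.2]
          simp only [Set.indicator, kernelWeight, e, Set.mem_Ioi, sub_pos]
          by_cases c1 : t ∈ Set.Ioc a b <;> by_cases c2 : s < t <;> simp [c1, c2]
      _ = ∫⁻ u, (Set.Ioi 0).indicator (fun u => H.k p q u *
            (if s ∈ Set.Ioc (a - u) (b - u) then 1 else 0)) u :=
          lintegral_sub_right_eq_self _ s
      _ = _ := lintegral_indicator measurableSet_Ioi _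
  calc ∫⁻ t in Set.Ioc a b, thinSum H.ρ G (H.kernelWeight p t) 1 m
      = ∫⁻ e, ∫⁻ t in Set.Ioc a b, thinWeight G (H.kernelWeight p t) 1 m e
          ∂volume ∂(shellPart (drivingIntensity H.ρ) m) :=
        lintegral_lintegral_swap h1.aemeasurable
    _ = ∫⁻ e, ∑ q, ∫⁻ u in Set.Ioi 0, H.k p q u *
          thinWeight G (sideWeight q (Set.Ioc (a - u) (b - u))) 1 m e
          ∂volume ∂(shellPart (drivingIntensity H.ρ) m) := by
        congr 1 with e
        rw [Finset.sum_eq_single e.1]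
        · by_cases hc : ENNReal.ofReal e.2.2.1 < G m e.1 e.2.1
          · have hm1 : Measurable fun t => H.kernelWeight p t e.1 e.2.1 :=
              (hψ e.1).comp measurable_prodMk_right
            have hm2 : Measurable fun u : ℝ => H.k p e.1 u *
                (if e.2.1 ∈ Set.Ioc (a - u) (b - u) then (1 : ℝ≥0∞) else 0) := by
              have hA : MeasurableSet {u : ℝ | a - u < e.2.1} :=
                measurableSet_lt (by fun_prop) (by fun_prop)
              have hB : MeasurableSet {u : ℝ | e.2.1 ≤ b - u} :=
                measurableSet_le (by fun_prop) (by fun_prop)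
              exact (H.measurable_k p e.1).mul
                (Measurable.ite (hA.inter hB) measurable_const measurable_const)
            simp only [thinWeight, hc, if_true]
            rw [lintegral_mul_const _ hm1, hint, ← lintegral_mul_const _ hm2]
            congr 1 with u
            simp [sideWeight]
          · simp [thinWeight, hc]
        · intro q _ hq
          simp [thinWeight, sideWeight, hq.symm]
        · simp
    _ = ∑ q, ∫⁻ u in Set.Ioi 0, ∫⁻ e, H.k p q u *
          thinWeight G (sideWeight q (Set.Ioc (a - u) (b - u))) 1 m e
          ∂(shellPart (drivingIntensity H.ρ) m) := by
        rw [lintegral_finsetSum]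
        · refine Finset.sum_congr rfl fun q _ => ?_
          exact (lintegral_lintegral_swap (h2 q).aemeasurable).symm
        · intro q _
          exact (h2 q).lintegral_prod_left'
    _ = _ := by
        refine Finset.sum_congr rfl fun q _ => lintegral_congr fun u => ?_
        have hm : Measurable fun e =>
            thinWeight G (sideWeight q (Set.Ioc (a - u) (b - u))) 1 m e :=
          (measurable_thinWeight_const hG (measurable_sideWeight q measurableSet_Ioc) 1).comp
            (measurable_prodMk_left (x := m))
        rw [lintegral_const_mul _ hm, thinMeasure_apply hG 1 q m measurableSet_Ioc, thinSum]

end HawkesModel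

/-! ### Second moments of the dominating process in windows -/

namespace HawkesModel

variable (H : HawkesModel) {L : Measure (Measure DrivingPoint)}

theorem envRate_of_nonpos (k : ℕ) (m : Measure DrivingPoint) (q : Fin 2) {t : ℝ} (ht : t ≤ 0) :
    H.envRate k m q t = 0 := by
  simp [envRate, cutRate, not_lt.2 ht]

/-- The rates vanish at nonpositive times. Windows shifted back by a lag can thus be clipped to the
positive axis, where the variance bound is available. -/
theorem thinMeasure_envRate_Ioc (k i : ℕ) (p : Fin 2) (m : Measure DrivingPoint) (s t : ℝ) :
    thinMeasure H.ρ (H.envRate k) i p m (Set.Ioc s t) =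
      thinMeasure H.ρ (H.envRate k) i p m (Set.Ioc (max s 0) (max t 0)) := by
  have hG := H.isPredictableRate_envRate k
  rw [thinMeasure_apply hG i p m measurableSet_Ioc, thinMeasure_apply hG i p m measurableSet_Ioc]
  refine lintegral_congr fun e => ?_
  rcases le_or_gt e.2.1 0 with h | h
  · simp [thinWeight, H.envRate_of_nonpos k m _ h]
  · have : e.2.1 ∈ Set.Ioc s t ↔ e.2.1 ∈ Set.Ioc (max s 0) (max t 0) := by
      simp [h, not_le.2 h]
    have hs : sideWeight p (Set.Ioc s t) e.1 e.2.1 =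
        sideWeight p (Set.Ioc (max s 0) (max t 0)) e.1 e.2.1 := by
      by_cases c : e.2.1 ∈ Set.Ioc s t
      · simp only [sideWeight, c, this.1 c, and_true]
      · simp only [sideWeight, c, mt this.2 c, and_false, if_false]
    simp only [thinWeight, hs]

theorem lintegral_sqDist_env_le (hL : IsPoissonLaw (drivingIntensity H.ρ) L) (k : ℕ) {i : ℕ}
    (hi : H.mom (2 * i) ≠ ∞) (p : Fin 2) {a b : ℝ} (ha : 0 ≤ a) (hab : a ≤ b) :
    ∫⁻ m, sqDist (thinMeasure H.ρ (H.envRate k) i p m (Set.Ioc a b))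
        (H.mom i * ∫⁻ t in Set.Ioc a b, H.envRate k m p t) ∂L ≤
      2 * (H.mom (2 * i) * (H.envConst * H.w p * ENNReal.ofReal (b - a))) := by
  refine (lintegral_sqDist_thinMeasure_le hL (H.isPredictableRate_envRate k)
    (k := k) (by finiteness) (H.envRate_le k) (H.mom_ne_top_of_two_mul hi) hi p ha hab).trans ?_
  exact mul_le_mul_right (mul_le_mul_right (H.lintegral_envRate_le hL k p a b) _) _

theorem ae_thinMeasure_env_ne_top (hL : IsPoissonLaw (drivingIntensity H.ρ) L) (k : ℕ) {i : ℕ}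
    (hi : H.mom i ≠ ∞) (p : Fin 2) (b : ℝ) :
    ∀ᵐ m ∂L, thinMeasure H.ρ (H.envRate k) i p m (Set.Ioc 0 b) ≠ ∞ := by
  have hm := measurable_thinMeasure (H.isPredictableRate_envRate k) i p
    (measurableSet_Ioc (a := (0 : ℝ)) (b := b))
  have hint := lintegral_mul_thinMeasure hL (H.isPredictableRate_envRate k) i p
    (g := fun _ => 1) measurable_const (measurableSet_Ioc (a := (0 : ℝ)) (b := b))
    (fun t ht => ht.1) (fun _ _ _ _ => rfl)
  simp only [one_mul] at hint
  have hfin : ∫⁻ m, thinMeasure H.ρ (H.envRate k) i p m (Set.Ioc 0 b) ∂L ≠ ∞ := by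
    rw [hint]
    refine ENNReal.mul_ne_top hi (ne_top_of_le_ne_top ?_ (H.lintegral_envRate_le hL k p 0 b))
    exact ENNReal.mul_ne_top (ENNReal.mul_ne_top H.envConst_ne_top (H.w_ne_top p))
      ENNReal.ofReal_ne_top
  filter_upwards [ae_lt_top hm hfin] with m hm using hm.ne

/-- The forcing term in the second moment bound of the dominating process. -/
noncomputable def envForce (ℓ : ℝ) : ℝ≥0∞ :=
  2 * (H.envConst * ENNReal.ofReal ℓ) ^ 2 +
    2 * ((H.mom 1)⁻¹ ^ 2 * (2 * (H.mom 2 * (H.envConst * ENNReal.ofReal ℓ))))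

theorem envForce_mono : Monotone H.envForce := fun a b hab => by
  have := ENNReal.ofReal_le_ofReal hab
  unfold envForce
  gcongr

/-- The second moment of the integrated rate of the dominating process. -/
theorem lintegral_envRate_sq_le (hL : IsPoissonLaw (drivingIntensity H.ρ) L) (k : ℕ) (p : Fin 2)
    {a b : ℝ} (ha : 0 ≤ a) (hab : a ≤ b) :
    ∫⁻ m, (∫⁻ t in Set.Ioc a b, H.envRate k m p t) ^ 2 ∂L ≤
      H.w p ^ 2 * (H.gain * (H.gain * H.envForce (b - a))) := by
  have := hL.prob
  induction k generalizing p a b with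
  | zero => simp [envRate, cutRate, envelope]
  | succ k ih =>
    have h2 : H.mom (2 * 1) ≠ ∞ := by simpa using H.mom_two_ne_top
    have hG := H.isPredictableRate_envRate k
    obtain ⟨B, hB⟩ : ∃ B, B = H.gain * (H.gain * H.envForce (b - a)) := ⟨_, rfl⟩
    obtain ⟨W, hW⟩ : ∃ W : Fin 2 → ℝ → Measure DrivingPoint → ℝ≥0∞, ∀ q u m, W q u m =
      ∫⁻ t in Set.Ioc (max (a - u) 0) (max (b - u) 0), H.envRate k m q t := ⟨_, fun _ _ _ => rfl⟩
    obtain ⟨N, hN⟩ : ∃ N : Fin 2 → ℝ → Measure DrivingPoint → ℝ≥0∞, ∀ q u m, N q u m =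
      thinMeasure H.ρ (H.envRate k) 1 q m (Set.Ioc (max (a - u) 0) (max (b - u) 0)) :=
      ⟨_, fun _ _ _ => rfl⟩
    obtain ⟨D, hD⟩ : ∃ D : Fin 2 → ℝ → Measure DrivingPoint → ℝ≥0∞, ∀ q u m, D q u m =
      ‖(N q u m).toReal - (H.mom 1 * W q u m).toReal‖ₑ := ⟨_, fun _ _ _ => rfl⟩
    have hGq : ∀ q, Measurable fun x : (ℝ × Measure DrivingPoint) × ℝ =>
        H.envRate k x.1.2 q x.2 := fun q => hG.measurable.comp
      ((measurable_snd.comp measurable_fst).prodMk (measurable_const.prodMk measurable_snd))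
    have hwin : MeasurableSet {x : (ℝ × Measure DrivingPoint) × ℝ |
        x.2 ∈ Set.Ioc (max (a - x.1.1) 0) (max (b - x.1.1) 0)} := by
      have hA : MeasurableSet {x : (ℝ × Measure DrivingPoint) × ℝ | max (a - x.1.1) 0 < x.2} :=
        measurableSet_lt (by fun_prop) (by fun_prop)
      have hB : MeasurableSet {x : (ℝ × Measure DrivingPoint) × ℝ | x.2 ≤ max (b - x.1.1) 0} :=
        measurableSet_le (by fun_prop) (by fun_prop)
      exact hA.inter hB
    have hWm : ∀ q, Measurable fun x : ℝ × Measure DrivingPoint => W q x.1 x.2 := fun q => by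
      have h0 := ((hGq q).indicator hwin).lintegral_prod_right' (ν := (volume : Measure ℝ))
      convert! h0 using 2 with x
      rw [hW, ← lintegral_indicator measurableSet_Ioc]
      rfl
    have hNm : ∀ q, Measurable fun x : ℝ × Measure DrivingPoint => N q x.1 x.2 := fun q => by
      have hs : ∀ q', Measurable fun x : ℝ × ℝ =>
          sideWeight q (Set.Ioc (max (a - x.1) 0) (max (b - x.1) 0)) q' x.2 := fun q' => by
        have hA : MeasurableSet {x : ℝ × ℝ | max (a - x.1) 0 < x.2} :=
          measurableSet_lt (by fun_prop) (by fun_prop)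
        have hB : MeasurableSet {x : ℝ × ℝ | x.2 ≤ max (b - x.1) 0} :=
          measurableSet_le (by fun_prop) (by fun_prop)
        unfold sideWeight
        refine Measurable.ite ?_ measurable_const measurable_const
        by_cases hq : q' = q
        · simp only [hq, true_and]
          exact hA.inter hB
        · simp [hq]
      have h0 := (measurable_thinSum_param hG (ψ := fun u =>
        sideWeight q (Set.Ioc (max (a - u) 0) (max (b - u) 0))) hs 1).comp measurable_swap
      convert! h0 using 2 with x
      rw [hN, thinMeasure_apply hG 1 q _ measurableSet_Ioc]
      rfl
    have hDm : ∀ q, Measurable fun x : ℝ × Measure DrivingPoint => D q x.1 x.2 := fun q => by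
      have e1 := (hNm q).ennreal_toReal
      have e2 := ((hWm q).const_mul (H.mom 1)).ennreal_toReal
      have e3 := (e1.sub e2).enorm
      convert! e3 using 2 with x
      rw [hD]
      rfl
    -- Shifting and clipping never lengthen a window, so the induction hypothesis, monotone in the
    -- length, covers all lags with the same constant.
    have hwlen : ∀ u, max (b - u) 0 - max (a - u) 0 ≤ b - a := fun u => by
      rcases max_cases (b - u) 0 with ⟨h1, _⟩ | ⟨h1, _⟩ <;>
        rcases max_cases (a - u) 0 with ⟨h2, _⟩ | ⟨h2, _⟩ <;> rw [h1, h2] <;> linarith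
    have hwle : ∀ u, max (a - u) 0 ≤ max (b - u) 0 := fun u =>
      max_le_max (by linarith) le_rfl
    have hW2 : ∀ q u, 0 < u → ∫⁻ m, W q u m ^ 2 ∂L ≤ H.w q ^ 2 * B := fun q u _ => by
      simp only [hW, hB]
      refine (ih q (le_max_right _ _) (hwle u)).trans ?_
      have := H.envForce_mono (hwlen u)
      gcongr
    have hD2 : ∀ q u, 0 < u → ∫⁻ m, D q u m ^ 2 ∂L ≤
        H.w q ^ 2 * (2 * (H.mom 2 * (H.envConst * ENNReal.ofReal (b - a)))) := fun q u _ => by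
      have h0 := H.lintegral_sqDist_env_le hL k h2 q (le_max_right (a - u) 0) (hwle u)
      simp only [sqDist_eq_enorm, ← hW, ← hN, ← hD] at h0
      refine h0.trans ?_
      calc _ ≤ 2 * (H.mom (2 * 1) * (H.envConst * H.w q ^ 2 * ENNReal.ofReal (b - a))) := by
            have := ENNReal.ofReal_le_ofReal (hwlen u)
            have := H.w_le_sq q
            gcongr
        _ = _ := by ring
    obtain ⟨x, hx⟩ : ∃ x : Measure DrivingPoint → ℝ≥0∞, ∀ m, x m =
      ∑ q, ∫⁻ u in Set.Ioi 0, H.κ p q u * D q u m := ⟨_, fun _ => rfl⟩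
    obtain ⟨y, hy⟩ : ∃ y : Measure DrivingPoint → ℝ≥0∞, ∀ m, y m =
      ∑ q, ∫⁻ u in Set.Ioi 0, H.κ p q u * W q u m := ⟨_, fun _ => rfl⟩
    have hconvm : ∀ f : Fin 2 → ℝ → Measure DrivingPoint → ℝ≥0∞,
        (∀ q, Measurable fun x : ℝ × Measure DrivingPoint => f q x.1 x.2) →
        Measurable fun m => ∑ q, ∫⁻ u in Set.Ioi 0, H.κ p q u * f q u m := fun f hf =>
      Finset.measurable_sum _ fun q _ => Measurable.lintegral_prod_left'
        (f := fun x : ℝ × Measure DrivingPoint => H.κ p q x.1 * f q x.1 x.2)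
        (((H.measurable_κ p q).comp measurable_fst).mul (hf q))
    have hxm : Measurable x := by rw [funext hx]; exact hconvm D hDm
    have hym : Measurable y := by rw [funext hy]; exact hconvm W hWm
    have hx2 := H.lintegral_sq_conv_le L hDm hD2 p
    have hy2 := H.lintegral_sq_conv_le L hWm hW2 p
    simp only [← hx] at hx2
    simp only [← hy] at hy2
    have hx2' : ∫⁻ m, x m ^ 2 ∂L ≤
        H.w p ^ 2 * (2 * (H.mom 2 * (H.envConst * ENNReal.ofReal (b - a)))) := by
      have hr1 : 1 ≤ ENNReal.ofReal H.r⁻¹ := by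
        rw [ENNReal.one_le_ofReal]
        exact (one_le_inv₀ H.r_pos).2 H.r_lt_one.le
      have hr2 : ENNReal.ofReal H.r ≤ 1 := ENNReal.ofReal_le_one.2 H.r_lt_one.le
      calc _ ≤ ENNReal.ofReal H.r⁻¹ * ∫⁻ m, x m ^ 2 ∂L := le_mul_of_one_le_left zero_le hr1
        _ ≤ _ := hx2
        _ ≤ _ := mul_le_mul_right (mul_le_of_le_one_left zero_le hr2) _
    -- The mass of marks `N` in a shifted window is at most its compensated part `D` plus `mom 1 *
    -- W`. Convolution turns these into `x`, controlled by the variance bound, and `y`, controlled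
    -- by the induction hypothesis.
    have hpt : ∀ᵐ m ∂L, ∫⁻ t in Set.Ioc a b, H.envRate (k + 1) m p t ≤
        (H.envConst * ENNReal.ofReal (b - a) + (H.mom 1)⁻¹ * x m) + y m := by
      have hfin : ∀ᵐ m ∂L, ∀ q, thinMeasure H.ρ (H.envRate k) 1 q m (Set.Ioc 0 b) ≠ ∞ :=
        ae_all_iff.2 fun q => H.ae_thinMeasure_env_ne_top hL k H.mom_one_ne_top q b
      filter_upwards [hfin] with m hm
      have hker : ∀ q u, 0 < u → H.k p q u * N q u m ≤
          (H.mom 1)⁻¹ * (H.κ p q u * D q u m) + H.κ p q u * W q u m := fun q u hu => by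
        have hNf : N q u m ≠ ∞ := by
          rw [hN]
          refine ne_top_of_le_ne_top (hm q) (measure_mono (Set.Ioc_subset_Ioc (le_max_right _ _) ?_))
          exact max_le (by linarith) (ha.trans hab)
        have hWf : W q u m ≠ ∞ := by
          rw [hW]
          refine ne_top_of_le_ne_top (b := ∫⁻ _ in Set.Ioc (max (a - u) 0) (max (b - u) 0), (k : ℝ≥0∞))
            ?_ (lintegral_mono fun t => H.envRate_le k m q t)
          simp only [lintegral_const, Measure.restrict_apply_univ, Real.volume_Ioc]
          finiteness
        have h0 := le_enorm_sub_add hNf (ENNReal.mul_ne_top H.mom_one_ne_top hWf)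
        rw [← hD] at h0
        calc H.k p q u * N q u m ≤ H.k p q u * (D q u m + H.mom 1 * W q u m) := by gcongr
          _ = ((H.mom 1)⁻¹ * H.mom 1) * (H.k p q u * D q u m) + H.κ p q u * W q u m := by
              rw [ENNReal.inv_mul_cancel H.mom_one_ne_zero H.mom_one_ne_top, κ]
              ring
          _ = _ := by rw [κ]; ring
      have hmeasD : ∀ q, Measurable fun u => H.κ p q u * D q u m := fun q =>
        (H.measurable_κ p q).mul ((hDm q).comp (measurable_prodMk_right (y := m)))
      calc ∫⁻ t in Set.Ioc a b, H.envRate (k + 1) m p t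
          ≤ ∫⁻ t in Set.Ioc a b, (H.envConst + thinSum H.ρ (H.envRate k) (H.kernelWeight p t) 1 m) :=
            lintegral_mono fun t => H.envRate_le_envelope (k + 1) m p t
        _ = H.envConst * ENNReal.ofReal (b - a) +
              ∑ q, ∫⁻ u in Set.Ioi 0, H.k p q u * N q u m := by
            rw [lintegral_add_left measurable_const, H.lintegral_thinSum_kernelWeight hG]
            simp only [lintegral_const, Measure.restrict_apply_univ, Real.volume_Ioc, hN,
              ← thinMeasure_envRate_Ioc]
        _ ≤ H.envConst * ENNReal.ofReal (b - a) + ∑ q, ∫⁻ u in Set.Ioi 0,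
              ((H.mom 1)⁻¹ * (H.κ p q u * D q u m) + H.κ p q u * W q u m) :=
            add_le_add le_rfl (Finset.sum_le_sum fun q _ =>
              setLIntegral_mono' measurableSet_Ioi fun u hu => hker q u hu)
        _ = _ := by
            rw [hx, hy, add_assoc, Finset.mul_sum, ← Finset.sum_add_distrib]
            congr 2 with q
            rw [lintegral_add_left ((hmeasD q).const_mul _), lintegral_const_mul _ (hmeasD q)]
    calc ∫⁻ m, (∫⁻ t in Set.Ioc a b, H.envRate (k + 1) m p t) ^ 2 ∂L
        ≤ ∫⁻ m, (H.gain * (2 * (H.envConst * ENNReal.ofReal (b - a)) ^ 2 +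
            2 * ((H.mom 1)⁻¹ ^ 2 * x m ^ 2)) + ENNReal.ofReal H.r⁻¹ * y m ^ 2) ∂L := by
          refine lintegral_mono_ae ?_
          filter_upwards [hpt] with m hm
          refine (pow_le_pow_left' hm 2).trans ((H.add_sq_le _ _).trans ?_)
          gcongr
          rw [← mul_pow]
          exact ENNReal.add_sq_le_two _ _
      _ = H.gain * (2 * (H.envConst * ENNReal.ofReal (b - a)) ^ 2 +
            2 * ((H.mom 1)⁻¹ ^ 2 * ∫⁻ m, x m ^ 2 ∂L)) +
            ENNReal.ofReal H.r⁻¹ * ∫⁻ m, y m ^ 2 ∂L := by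
          have e1 := hxm.pow_const 2
          have e2 := hym.pow_const 2
          have e3 : Measurable fun m => (H.mom 1)⁻¹ ^ 2 * x m ^ 2 := e1.const_mul _
          have e4 : Measurable fun m => 2 * (H.envConst * ENNReal.ofReal (b - a)) ^ 2 +
              2 * ((H.mom 1)⁻¹ ^ 2 * x m ^ 2) := (e3.const_mul 2).const_add _
          rw [lintegral_add_right _ (e2.const_mul _), lintegral_const_mul _ e2,
            lintegral_const_mul _ e4, lintegral_add_left measurable_const,
            lintegral_const_mul _ e3, lintegral_const_mul _ e1]
          simp
      _ ≤ H.gain * (2 * (H.envConst * ENNReal.ofReal (b - a)) ^ 2 +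
            2 * ((H.mom 1)⁻¹ ^ 2 * (H.w p ^ 2 *
              (2 * (H.mom 2 * (H.envConst * ENNReal.ofReal (b - a))))))) +
            H.w p ^ 2 * (ENNReal.ofReal H.r * B) := by gcongr
      _ ≤ H.w p ^ 2 * (H.gain * H.envForce (b - a)) + H.w p ^ 2 * (ENNReal.ofReal H.r * B) := by
          refine add_le_add ?_ le_rfl
          calc _ ≤ H.gain * (H.w p ^ 2 * (2 * (H.envConst * ENNReal.ofReal (b - a)) ^ 2) +
                2 * ((H.mom 1)⁻¹ ^ 2 * (H.w p ^ 2 *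
                  (2 * (H.mom 2 * (H.envConst * ENNReal.ofReal (b - a))))))) :=
                mul_le_mul_right (add_le_add
                  (le_mul_of_one_le_left zero_le (H.one_le_sq_w p)) le_rfl) _
            _ = _ := by unfold envForce; ring
      _ = H.w p ^ 2 * ((1 + ENNReal.ofReal H.r * H.gain) * (H.gain * H.envForce (b - a))) := by
          rw [hB]; ring
      _ = _ := by
          congr 1
          -- `1 + r / (1 - r) = 1 / (1 - r)`: the bound reproduces itself, hence is uniform in the
          -- number of iterations.
          have hg : 1 + ENNReal.ofReal H.r * H.gain = H.gain := by
            have h1r : 0 < 1 - H.r := by linarith [H.r_lt_one]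
            rw [gain, ← ENNReal.ofReal_mul H.r_pos.le, ← ENNReal.ofReal_one,
              ← ENNReal.ofReal_add zero_le_one (mul_nonneg H.r_pos.le (inv_nonneg.2 h1r.le))]
            congr 1
            field_simp
            ring
          rw [hg]

end HawkesModel

namespace HawkesModel

variable (H : HawkesModel) {L : Measure (Measure DrivingPoint)}

/-- The sum of the powers of the marks of the dominating process in the window `(a, b]`. -/
noncomputable def envTotal (i : ℕ) (p : Fin 2) (a b : ℝ) (m : Measure DrivingPoint) : ℝ≥0∞ :=
  ⨆ k, thinMeasure H.ρ (H.envRate k) i p m (Set.Ioc a b)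

/-- An intensity that dominates the intensities of all the Hawkes processes driven by `m`. -/
noncomputable def domRate (m : Measure DrivingPoint) (p : Fin 2) (t : ℝ) : ℝ≥0∞ :=
  ENNReal.ofReal H.μbar + ⨆ k, thinSum H.ρ (H.envRate k) (H.kernelWeight p t) 1 m

theorem measurable_envTotal (i : ℕ) (p : Fin 2) (a b : ℝ) : Measurable (H.envTotal i p a b) :=
  Measurable.iSup fun k => measurable_thinMeasure (H.isPredictableRate_envRate k) i p
    measurableSet_Ioc

/-- The sum is its compensated part, of variance linear in the length of the window, plus `mom i`
times the integrated rate, whose second moment has just been bounded. -/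
theorem lintegral_env_sq_le (hL : IsPoissonLaw (drivingIntensity H.ρ) L) (k : ℕ) {i : ℕ}
    (hi : H.mom (2 * i) ≠ ∞) (p : Fin 2) {a b : ℝ} (ha : 0 ≤ a) (hab : a ≤ b) :
    ∫⁻ m, thinMeasure H.ρ (H.envRate k) i p m (Set.Ioc a b) ^ 2 ∂L ≤
      2 * (2 * (H.mom (2 * i) * (H.envConst * H.w p * ENNReal.ofReal (b - a)))) +
        2 * (H.mom i ^ 2 * (H.w p ^ 2 * (H.gain * (H.gain * H.envForce (b - a))))) := by
  have hG := H.isPredictableRate_envRate k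
  have hmi := H.mom_ne_top_of_two_mul hi
  obtain ⟨N, hN⟩ : ∃ N : Measure DrivingPoint → ℝ≥0∞, ∀ m, N m =
    thinMeasure H.ρ (H.envRate k) i p m (Set.Ioc a b) := ⟨_, fun _ => rfl⟩
  obtain ⟨W, hW⟩ : ∃ W : Measure DrivingPoint → ℝ≥0∞, ∀ m, W m =
    ∫⁻ t in Set.Ioc a b, H.envRate k m p t := ⟨_, fun _ => rfl⟩
  obtain ⟨D, hD⟩ : ∃ D : Measure DrivingPoint → ℝ≥0∞, ∀ m, D m =
    ‖(N m).toReal - (H.mom i * W m).toReal‖ₑ := ⟨_, fun _ => rfl⟩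
  have hNm : Measurable N := by
    rw [funext hN]; exact measurable_thinMeasure hG i p measurableSet_Ioc
  have hWm : Measurable W := by
    rw [funext hW]; exact measurable_lintegral_rate hG p _
  have hDm : Measurable D := by
    have e1 := hNm.ennreal_toReal
    have e2 := (hWm.const_mul (H.mom i)).ennreal_toReal
    rw [funext hD]
    exact (e1.sub e2).enorm
  have hD2 := H.lintegral_sqDist_env_le hL k hi p ha hab
  have hW2 := H.lintegral_envRate_sq_le hL k p ha hab
  simp only [sqDist_eq_enorm, ← hN, ← hW, ← hD] at hD2 hW2 ⊢
  have hpt : ∀ᵐ m ∂L, N m ^ 2 ≤ 2 * D m ^ 2 + 2 * (H.mom i ^ 2 * W m ^ 2) := by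
    filter_upwards [H.ae_thinMeasure_env_ne_top hL k hmi p b] with m hm
    have hNf : N m ≠ ∞ := by
      rw [hN]
      exact ne_top_of_le_ne_top hm (measure_mono (Set.Ioc_subset_Ioc ha le_rfl))
    have hWf : W m ≠ ∞ := by
      rw [hW]
      refine ne_top_of_le_ne_top (b := ∫⁻ _ in Set.Ioc a b, (k : ℝ≥0∞)) ?_
        (lintegral_mono fun t => H.envRate_le k m p t)
      simp only [lintegral_const, Measure.restrict_apply_univ, Real.volume_Ioc]
      finiteness
    have h0 := le_enorm_sub_add hNf (ENNReal.mul_ne_top hmi hWf)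
    rw [← hD] at h0
    rw [← mul_pow]
    exact (pow_le_pow_left' h0 2).trans (ENNReal.add_sq_le_two _ _)
  have e1 := hDm.pow_const 2
  have e2 := hWm.pow_const 2
  calc ∫⁻ m, N m ^ 2 ∂L ≤ ∫⁻ m, (2 * D m ^ 2 + 2 * (H.mom i ^ 2 * W m ^ 2)) ∂L :=
        lintegral_mono_ae hpt
    _ = 2 * ∫⁻ m, D m ^ 2 ∂L + 2 * (H.mom i ^ 2 * ∫⁻ m, W m ^ 2 ∂L) := by
        rw [lintegral_add_left (e1.const_mul 2), lintegral_const_mul _ e1,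
          lintegral_const_mul _ (e2.const_mul _), lintegral_const_mul _ e2]
    _ ≤ _ := by gcongr

/-- The second moment of the dominating process in long windows. -/
theorem exists_lintegral_envTotal_sq_le (hL : IsPoissonLaw (drivingIntensity H.ρ) L) {i : ℕ}
    (hi : H.mom (2 * i) ≠ ∞) (p : Fin 2) : ∃ C : ℝ≥0∞, C ≠ ∞ ∧ ∀ a b : ℝ, 0 ≤ a → a + 1 ≤ b →
      ∫⁻ m, H.envTotal i p a b m ^ 2 ∂L ≤ C * ENNReal.ofReal (b - a) ^ 2 := by
  have hmi := H.mom_ne_top_of_two_mul hi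
  have h2 := H.mom_two_ne_top
  have hc := H.envConst_ne_top
  have hw := H.w_ne_top p
  have hg := H.gain_ne_top
  have hinv : (H.mom 1)⁻¹ ≠ ∞ := ENNReal.inv_ne_top.2 H.mom_one_ne_zero
  refine ⟨2 * (2 * (H.mom (2 * i) * (H.envConst * H.w p))) + 2 * (H.mom i ^ 2 * (H.w p ^ 2 *
    (H.gain * (H.gain * (2 * H.envConst ^ 2 +
      2 * ((H.mom 1)⁻¹ ^ 2 * (2 * (H.mom 2 * H.envConst)))))))), by finiteness, ?_⟩
  intro a b ha hab
  -- For windows of length at least one, the terms linear in the length are absorbed into the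
  -- quadratic one.
  have hl1 : ENNReal.ofReal (b - a) ≤ ENNReal.ofReal (b - a) ^ 2 := by
    rw [sq]
    exact le_mul_of_one_le_left zero_le (ENNReal.one_le_ofReal.2 (by linarith))
  have hmono : Monotone fun k m => thinMeasure H.ρ (H.envRate k) i p m (Set.Ioc a b) ^ 2 := by
    intro k l hkl m
    simp only [thinMeasure_apply (H.isPredictableRate_envRate _) i p m measurableSet_Ioc]
    exact pow_le_pow_left' (thinSum_mono (fun q t => H.envRate_mono m q t hkl) _ _) 2
  have hsup : ∀ m, H.envTotal i p a b m ^ 2 =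
      ⨆ k, thinMeasure H.ρ (H.envRate k) i p m (Set.Ioc a b) ^ 2 := fun m => by
    rw [envTotal, ENNReal.iSup_pow]
  simp only [hsup]
  rw [lintegral_iSup (fun k => (measurable_thinMeasure (H.isPredictableRate_envRate k) i p
    measurableSet_Ioc).pow_const 2) hmono]
  refine iSup_le fun k => (H.lintegral_env_sq_le hL k hi p ha (by linarith)).trans ?_
  obtain ⟨l, hl⟩ : ∃ l, l = ENNReal.ofReal (b - a) := ⟨_, rfl⟩
  rw [← hl] at hl1 ⊢
  have hforce : H.envForce (b - a) ≤ (2 * H.envConst ^ 2 +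
      2 * ((H.mom 1)⁻¹ ^ 2 * (2 * (H.mom 2 * H.envConst)))) * l ^ 2 := by
    rw [envForce, ← hl]
    calc _ ≤ 2 * (H.envConst * l) ^ 2 +
          2 * ((H.mom 1)⁻¹ ^ 2 * (2 * (H.mom 2 * (H.envConst * l ^ 2)))) := by gcongr
      _ = _ := by ring
  calc _ ≤ 2 * (2 * (H.mom (2 * i) * (H.envConst * H.w p * l ^ 2))) +
        2 * (H.mom i ^ 2 * (H.w p ^ 2 * (H.gain * (H.gain * ((2 * H.envConst ^ 2 +
      2 * ((H.mom 1)⁻¹ ^ 2 * (2 * (H.mom 2 * H.envConst)))) * l ^ 2))))) := by gcongr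
    _ = _ := by ring

-- The extra `1` in `envConst` turns a level `≤ domRate` into one strictly below the supremum of the
-- iterates, hence below some iterate; a larger index also lifts the truncation above the level.
-- Every point kept by `domRate` is thus kept at a finite stage, which makes `domRate` a
-- supersolution of the Hawkes equation.
open Classical in
theorem lintegral_domRate_le {m : Measure DrivingPoint}
    (hm : ShellFinite (drivingIntensity H.ρ) m) {ψ : Fin 2 → ℝ → ℝ≥0∞}
    (hψ : ∀ q, Measurable (ψ q)) (i : ℕ) :
    ∫⁻ e : DrivingPoint, (if 0 < e.2.1 ∧ ENNReal.ofReal e.2.2.1 ≤ H.domRate m e.1 e.2.1 then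
      ψ e.1 e.2.1 * ENNReal.ofReal e.2.2.2 ^ i else 0) ∂m ≤
      ⨆ k, thinSum H.ρ (H.envRate k) ψ i m := by
  have hmono : Monotone fun k e => thinWeight (H.envRate k) ψ i m e := by
    intro k l hkl e
    simp only [thinWeight]
    split_ifs with h1 h2
    · exact le_rfl
    · exact absurd (h1.trans_le (H.envRate_mono m _ _ hkl)) h2
    · exact zero_le
    · exact le_rfl
  simp only [thinSum, hm.shellPart_apply]
  have hwm : ∀ k, Measurable fun e => thinWeight (H.envRate k) ψ i m e := fun k =>
    (measurable_thinWeight_const (H.isPredictableRate_envRate k) hψ i).comp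
      (measurable_prodMk_left (x := m))
  rw [← lintegral_iSup hwm hmono]
  refine lintegral_mono fun e => ?_
  split_ifs with he
  · have hlt : ENNReal.ofReal e.2.2.1 < ⨆ k, H.envelope (k + 1) m e.1 e.2.1 := by
      simp only [envelope_succ, ← ENNReal.add_iSup]
      have h1 : H.envConst + ⨆ k, thinSum H.ρ (H.envRate k) (H.kernelWeight e.1 e.2.1) 1 m =
          H.domRate m e.1 e.2.1 + 1 := by
        rw [envConst, domRate]; ring
      rw [h1]
      by_cases ht : H.domRate m e.1 e.2.1 = ∞
      · rw [ht]; simp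
      · exact he.2.trans_lt (ENNReal.lt_add_right ht one_ne_zero)
    obtain ⟨k, hk⟩ := lt_iSup_iff.1 hlt
    obtain ⟨j, hj⟩ := ENNReal.exists_nat_gt (ENNReal.ofReal_ne_top (r := e.2.2.1))
    refine le_iSup_of_le (max (k + 1) j) ?_
    have hrate : ENNReal.ofReal e.2.2.1 < H.envRate (max (k + 1) j) m e.1 e.2.1 := by
      simp only [envRate, cutRate, he.1, if_true]
      refine lt_min (hk.trans_le (H.envelope_mono m _ _ (le_max_left _ _)))
        (hj.trans_le ?_)
      exact_mod_cast le_max_right _ _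
    simp [thinWeight, hrate]
  · exact zero_le

end HawkesModel

/-! ### Pathwise comparison of processes driven by the same points -/

open Classical in
/-- The sums over the arrivals of a process that solves a thinning equation. -/
theorem tsum_eq_lintegral_of_thinning {τ ξ : ℕ → ℝ} {σ : ℕ → Fin 2} {m : Measure DrivingPoint}
    {lam : Fin 2 → ℝ → ℝ≥0∞} (hlam : ∀ p, Measurable (lam p)) {T : ℝ}
    (h : ∀ (p : Fin 2) (A : Set (ℝ × ℝ)), MeasurableSet A → A ⊆ Set.Ioc 0 T ×ˢ Set.univ →
      (∑' n, if σ n = p ∧ (τ n, ξ n) ∈ A then (1 : ℝ≥0∞) else 0) =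
        m {e | e.1 = p ∧ (e.2.1, e.2.2.2) ∈ A ∧ ENNReal.ofReal e.2.2.1 ≤ lam p e.2.1})
    {f : Fin 2 → ℝ × ℝ → ℝ≥0∞} (hf : ∀ p, Measurable (f p))
    (hf0 : ∀ p x, x.1 ∉ Set.Ioc 0 T → f p x = 0) :
    ∑' n, f (σ n) (τ n, ξ n) = ∫⁻ e : DrivingPoint,
      (if ENNReal.ofReal e.2.2.1 ≤ lam e.1 e.2.1 then f e.1 (e.2.1, e.2.2.2) else 0) ∂m := by
  set R : Set (ℝ × ℝ) := Set.Ioc 0 T ×ˢ Set.univ with hR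
  have hRm : MeasurableSet R := measurableSet_Ioc.prod .univ
  have hπ : Measurable fun e : DrivingPoint => (e.2.1, e.2.2.2) := by fun_prop
  have hS : ∀ p, MeasurableSet {e : DrivingPoint | e.1 = p ∧
      ENNReal.ofReal e.2.2.1 ≤ lam p e.2.1} := fun p => by
    have hA : MeasurableSet {e : DrivingPoint | e.1 = p} :=
      measurable_fst (measurableSet_singleton p)
    have hB : MeasurableSet {e : DrivingPoint | ENNReal.ofReal e.2.2.1 ≤ lam p e.2.1} :=
      measurableSet_le (by fun_prop) ((hlam p).comp (by fun_prop))
    exact hA.inter hB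
  -- The hypothesis is an equality of two measures on `(0, T] × ℝ`, so it extends from sets to
  -- integrals.
  have hmeas : ∀ p, (Measure.sum fun n => if σ n = p then Measure.dirac (τ n, ξ n) else 0).restrict R =
      ((m.restrict {e : DrivingPoint | e.1 = p ∧ ENNReal.ofReal e.2.2.1 ≤ lam p e.2.1}).map
        fun e => (e.2.1, e.2.2.2)).restrict R := by
    intro p
    ext A hA
    rw [Measure.restrict_apply hA, Measure.restrict_apply hA, Measure.map_apply hπ (hA.inter hRm),
      Measure.restrict_apply (hπ (hA.inter hRm)), Measure.sum_apply _ (hA.inter hRm)]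
    convert! h p (A ∩ R) (hA.inter hRm) Set.inter_subset_right using 1
    · congr 1 with n
      by_cases hp : σ n = p
      · simp [hp, Measure.dirac_apply' _ (hA.inter hRm), Set.indicator]
      · simp [hp]
    · congr 1
      ext e
      simp only [Set.mem_inter_iff, Set.mem_preimage, Set.mem_ofPred_eq]
      tauto
  have hRf : ∀ p (ν : Measure (ℝ × ℝ)), ∫⁻ x, f p x ∂ν = ∫⁻ x in R, f p x ∂ν := fun p ν => by
    rw [← lintegral_indicator hRm]
    congr 1 with x
    by_cases hx : x ∈ R
    · simp [hx]
    · rw [Set.indicator_of_notMem hx]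
      exact hf0 p x fun h' => hx ⟨h', Set.mem_univ _⟩
  calc ∑' n, f (σ n) (τ n, ξ n)
      = ∑ p, ∑' n, (if σ n = p then f p (τ n, ξ n) else 0) := by
        rw [← Summable.tsum_finsetSum fun _ _ => ENNReal.summable]
        congr 1 with n
        simp
    _ = ∑ p, ∫⁻ x, f p x ∂(Measure.sum fun n => if σ n = p then Measure.dirac (τ n, ξ n) else 0) := by
        refine Finset.sum_congr rfl fun p _ => ?_
        rw [lintegral_sum_measure]
        congr 1 with n
        split_ifs <;> simp
    _ = ∑ p, ∫⁻ e in {e : DrivingPoint | e.1 = p ∧ ENNReal.ofReal e.2.2.1 ≤ lam p e.2.1},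
          f p (e.2.1, e.2.2.2) ∂m := by
        refine Finset.sum_congr rfl fun p _ => ?_
        rw [hRf, hmeas, ← hRf, lintegral_map (hf p) hπ]
    _ = _ := by
        have hint : ∀ p, Measurable ({e : DrivingPoint | e.1 = p ∧
            ENNReal.ofReal e.2.2.1 ≤ lam p e.2.1}.indicator fun e => f p (e.2.1, e.2.2.2)) :=
          fun p => ((hf p).comp hπ).indicator (hS p)
        simp only [← lintegral_indicator (hS _)]
        rw [← lintegral_finsetSum _ fun p _ => hint p]
        congr 1 with e
        simp only [Set.indicator, Set.mem_ofPred_eq]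
        rw [Finset.sum_eq_single e.1]
        · simp
        · intro p _ hp
          simp [hp.symm]
        · simp

namespace MarkedArrivals

variable {Ω : Type*} {X Y : MarkedArrivals Ω} {H : HawkesModel} {T S : ℝ}
  {m : Measure DrivingPoint} {ω : Ω}

/-- For the outcome `ω`, the arrivals of `X` up to time `T` are those points of `m` whose level is
below the Hawkes intensity. -/
structure IsThinning (X : MarkedArrivals Ω) (H : HawkesModel) (T : ℝ) (m : Measure DrivingPoint)
    (ω : Ω) : Prop where
  time_pos : ∀ n, 0 < X.time n ω
  time_strictMono : StrictMono fun n => X.time n ω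
  sum_eq : open Classical in ∀ (p : Fin 2) (A : Set (ℝ × ℝ)), MeasurableSet A →
    A ⊆ Set.Ioc 0 T ×ˢ Set.univ →
    (∑' n, if X.side n ω = p ∧ (X.time n ω, X.mark n ω) ∈ A then (1 : ℝ≥0∞) else 0) =
      m {e | e.1 = p ∧ (e.2.1, e.2.2.2) ∈ A ∧ ENNReal.ofReal e.2.2.1 ≤ X.lam H T p e.2.1 ω}

theorem lam_eq_tsum (X : MarkedArrivals Ω) (H : HawkesModel) (T : ℝ) (p : Fin 2) (t : ℝ) (ω : Ω) :
    X.lam H T p t ω = H.base T t + ∑' n, H.kernelWeight p t (X.side n ω) (X.time n ω) *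
      ENNReal.ofReal (X.mark n ω) := by
  rw [lam, excitation, ← Summable.tsum_finsetSum fun _ _ => ENNReal.summable]
  congr 2 with n
  rw [Finset.sum_eq_single (X.side n ω)]
  · simp [wt, HawkesModel.kernelWeight]
  · intro q _ hq
    simp [wt, hq.symm]
  · simp

theorem measurable_lam_right (X : MarkedArrivals Ω) (H : HawkesModel) (T : ℝ) (p : Fin 2) (ω : Ω) :
    Measurable fun t => X.lam H T p t ω := by
  simp only [lam_eq_tsum]
  refine (H.measurable_base T).add (Measurable.tsum fun n => Measurable.mul_const ?_ _)
  exact (H.measurable_kernelWeight _).comp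
    (((measurable_const (a := p)).prodMk measurable_id).prodMk measurable_const)

namespace IsThinning

theorem tsum_eq (h : X.IsThinning H T m ω) {f : Fin 2 → ℝ × ℝ → ℝ≥0∞} (hf : ∀ p, Measurable (f p))
    (hf0 : ∀ p x, x.1 ∉ Set.Ioc 0 T → f p x = 0) :
    open Classical in ∑' n, f (X.side n ω) (X.time n ω, X.mark n ω) = ∫⁻ e : DrivingPoint,
      (if ENNReal.ofReal e.2.2.1 ≤ X.lam H T e.1 e.2.1 ω then f e.1 (e.2.1, e.2.2.2) else 0) ∂m :=
  tsum_eq_lintegral_of_thinning (fun p => X.measurable_lam_right H T p ω) h.sum_eq hf hf0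

/-- The intensity of a thinning is dominated by every supersolution of the Hawkes equation. -/
theorem lam_le (h : X.IsThinning H T m ω) (hST : S ≤ T) {G : Fin 2 → ℝ → ℝ≥0∞}
    (hG : open Classical in ∀ p, ∀ t ∈ Set.Ioc 0 S, H.base T t + ∫⁻ e : DrivingPoint,
      (if 0 < e.2.1 ∧ ENNReal.ofReal e.2.2.1 ≤ G e.1 e.2.1 then
        H.kernelWeight p t e.1 e.2.1 * ENNReal.ofReal e.2.2.2 ^ 1 else 0) ∂m ≤ G p t)
    (p : Fin 2) {t : ℝ} (ht : t ∈ Set.Ioc 0 S) : X.lam H T p t ω ≤ G p t := by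
  classical
  obtain ⟨c, hc⟩ : ∃ c : Fin 2 → ℝ → ℕ → ℝ≥0∞, ∀ p t n, c p t n =
    H.kernelWeight p t (X.side n ω) (X.time n ω) * ENNReal.ofReal (X.mark n ω) :=
    ⟨_, fun _ _ _ => rfl⟩
  -- Induction on the number of exciting arrivals. Up to `time j` only the indices below `j` excite,
  -- and their contribution is below `G` by induction; the arrival `j` itself therefore lies below
  -- `G` and is counted in its supersolution inequality.
  have hpart : ∀ j p, ∀ t ∈ Set.Ioc 0 S,
      H.base T t + ∑ n ∈ Finset.range j, c p t n ≤ G p t := by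
    intro j
    induction j with
    | zero =>
      intro p t ht
      simpa using le_self_add.trans (hG p t ht)
    | succ j ih =>
      intro p t ht
      refine le_trans ?_ (hG p t ht)
      refine add_le_add le_rfl ?_
      obtain ⟨f, hf⟩ : ∃ f : Fin 2 → ℝ × ℝ → ℝ≥0∞, ∀ q x, f q x =
        if 0 < x.1 ∧ x.1 ≤ X.time j ω then H.kernelWeight p t q x.1 * ENNReal.ofReal x.2 else 0 :=
        ⟨_, fun _ _ => rfl⟩
      have hfm : ∀ q, Measurable (f q) := fun q => by
        have hA : MeasurableSet {x : ℝ × ℝ | 0 < x.1} :=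
          measurableSet_lt measurable_const measurable_fst
        have hB : MeasurableSet {x : ℝ × ℝ | x.1 ≤ X.time j ω} :=
          measurableSet_le measurable_fst measurable_const
        rw [funext (hf q)]
        exact Measurable.ite (hA.inter hB) (((H.measurable_kernelWeight_right p t q).comp
          measurable_fst).mul (ENNReal.measurable_ofReal.comp measurable_snd)) measurable_const
      have hf0 : ∀ q x, x.1 ∉ Set.Ioc 0 T → f q x = 0 := fun q x hx => by
        rw [hf]
        split_ifs with h'
        · have : ¬ x.1 < t := fun hlt => hx ⟨h'.1, (hlt.le.trans ht.2).trans hST⟩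
          simp [HawkesModel.kernelWeight, this]
        · rfl
      calc ∑ n ∈ Finset.range (j + 1), c p t n
          = ∑ n ∈ Finset.range (j + 1), f (X.side n ω) (X.time n ω, X.mark n ω) := by
            refine Finset.sum_congr rfl fun n hn => ?_
            have hle : X.time n ω ≤ X.time j ω :=
              h.time_strictMono.monotone (Nat.lt_succ_iff.1 (Finset.mem_range.1 hn))
            rw [hc, hf, if_pos ⟨h.time_pos n, hle⟩]
        _ ≤ ∑' n, f (X.side n ω) (X.time n ω, X.mark n ω) := ENNReal.sum_le_tsum _
        _ = _ := h.tsum_eq hfm hf0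
        _ ≤ _ := by
            refine lintegral_mono fun e => ?_
            simp only [hf]
            by_cases h1 : 0 < e.2.1 ∧ e.2.1 ≤ X.time j ω
            swap
            · simp [h1]
            by_cases h2 : e.2.1 < t
            swap
            · simp [HawkesModel.kernelWeight, h2]
            by_cases h3 : ENNReal.ofReal e.2.2.1 ≤ X.lam H T e.1 e.2.1 ω
            swap
            · simp [h3]
            have hlam : X.lam H T e.1 e.2.1 ω =
                H.base T e.2.1 + ∑ n ∈ Finset.range j, c e.1 e.2.1 n := by
              rw [lam_eq_tsum, tsum_eq_sum (s := Finset.range j)]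
              · simp only [hc]
              · intro n hn
                have hjn : j ≤ n := not_lt.1 fun h' => hn (Finset.mem_range.2 h')
                have : ¬ X.time n ω < e.2.1 :=
                  not_lt.2 (h1.2.trans (h.time_strictMono.monotone hjn))
                simp [HawkesModel.kernelWeight, this]
            have h4 : ENNReal.ofReal e.2.2.1 ≤ G e.1 e.2.1 :=
              h3.trans (hlam.le.trans (ih e.1 e.2.1 ⟨h1.1, h2.le.trans ht.2⟩))
            rw [if_pos h3, if_pos h1, if_pos ⟨h1.1, h4⟩, pow_one]
  rw [lam_eq_tsum, ENNReal.tsum_eq_iSup_nat, ENNReal.add_iSup]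
  refine iSup_le fun j => ?_
  simpa only [hc] using hpart j p t ht

/-- A longer horizon makes the intensity smaller. -/
theorem lam_le_lam (h : X.IsThinning H T m ω) (h' : Y.IsThinning H S m ω) (hμ : Monotone H.μ)
    (hST : S ≤ T) (p : Fin 2) {t : ℝ} (ht : t ∈ Set.Ioc 0 S) :
    X.lam H T p t ω ≤ Y.lam H S p t ω := by
  classical
  -- The intensity of `Y` solves its own equation, with a baseline at least that of `X`: it is a
  -- supersolution for `X`.
  refine h.lam_le hST (G := fun p t => Y.lam H S p t ω) (fun p t ht => ?_) p ht
  obtain ⟨f, hf⟩ : ∃ f : Fin 2 → ℝ × ℝ → ℝ≥0∞, ∀ q x, f q x =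
    if 0 < x.1 then H.kernelWeight p t q x.1 * ENNReal.ofReal x.2 else 0 :=
    ⟨_, fun _ _ => rfl⟩
  have hfm : ∀ q, Measurable (f q) := fun q => by
    have hA : MeasurableSet {x : ℝ × ℝ | 0 < x.1} :=
      measurableSet_lt measurable_const measurable_fst
    rw [funext (hf q)]
    exact Measurable.ite hA (((H.measurable_kernelWeight_right p t q).comp
      measurable_fst).mul (ENNReal.measurable_ofReal.comp measurable_snd)) measurable_const
  have hf0 : ∀ q x, x.1 ∉ Set.Ioc 0 S → f q x = 0 := fun q x hx => by
    rw [hf]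
    split_ifs with h'
    · have : ¬ x.1 < t := fun hlt => hx ⟨h', hlt.le.trans ht.2⟩
      simp [HawkesModel.kernelWeight, this]
    · rfl
  rw [lam_eq_tsum Y]
  refine add_le_add ?_ ?_
  -- Monotonicity of `μ` enters here: the longer horizon evaluates the baseline at the earlier point
  -- `t / T ≤ t / S`.
  · refine ENNReal.ofReal_le_ofReal (hμ ?_)
    exact div_le_div_of_nonneg_left ht.1.le (ht.1.trans_le ht.2) hST
  · have hsum : ∀ n, H.kernelWeight p t (Y.side n ω) (Y.time n ω) * ENNReal.ofReal (Y.mark n ω) =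
        f (Y.side n ω) (Y.time n ω, Y.mark n ω) := fun n => by rw [hf, if_pos (h'.time_pos n)]
    simp only [hsum]
    rw [h'.tsum_eq hfm hf0]
    refine lintegral_mono fun e => ?_
    simp only [hf, pow_one]
    split_ifs with h1 h2 h3 <;> first | exact le_rfl | exact zero_le | (exfalso; tauto)

/-- `domRate` does not involve `T`, so one dominating process serves all horizons for the same
outcome. -/
theorem lam_le_domRate (h : X.IsThinning H T m ω) (hm : ShellFinite (drivingIntensity H.ρ) m)
    (p : Fin 2) {t : ℝ} (ht : t ∈ Set.Ioc 0 T) : X.lam H T p t ω ≤ H.domRate m p t := by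
  refine h.lam_le le_rfl (G := H.domRate m) (fun p t _ => ?_) p ht
  exact add_le_add (H.base_le T t)
    (H.lintegral_domRate_le hm (fun q => H.measurable_kernelWeight_right p t q) 1)

/-- The sums over the arrivals in a window, as integrals for the driving measure. -/
theorem tsum_wt_eq (h : X.IsThinning H T m ω) (i : ℕ) (p : Fin 2) {a b : ℝ} (ha : 0 ≤ a)
    (hb : b ≤ T) : open Classical in
    (∑' n, if X.time n ω ∈ Set.Ioc a b then X.wt i n p ω else 0) =
      ∫⁻ e : DrivingPoint, (if ENNReal.ofReal e.2.2.1 ≤ X.lam H T e.1 e.2.1 ω then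
        sideWeight p (Set.Ioc a b) e.1 e.2.1 * ENNReal.ofReal e.2.2.2 ^ i else 0) ∂m := by
  classical
  rw [← h.tsum_eq (f := fun q x => sideWeight p (Set.Ioc a b) q x.1 * ENNReal.ofReal x.2 ^ i)]
  · congr 1 with n
    by_cases h1 : X.time n ω ∈ Set.Ioc a b <;> by_cases h2 : X.side n ω = p <;>
      simp only [sideWeight, wt, h1, h2, and_self, and_true, and_false, if_true, if_false,
        one_mul, zero_mul]
  · intro q
    exact ((measurable_sideWeight p measurableSet_Ioc q).comp measurable_fst).mul (by fun_prop)
  · intro q x hx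
    have : x.1 ∉ Set.Ioc a b := fun h' => hx ⟨ha.trans_lt h'.1, h'.2.trans hb⟩
    simp [sideWeight, this]

theorem tsum_wt_mono (h : X.IsThinning H T m ω) (h' : Y.IsThinning H S m ω) (hμ : Monotone H.μ)
    (hST : S ≤ T) (i : ℕ) (p : Fin 2) {a b : ℝ} (ha : 0 ≤ a) (hb : b ≤ S) : open Classical in
    (∑' n, if X.time n ω ∈ Set.Ioc a b then X.wt i n p ω else 0) ≤
      ∑' n, if Y.time n ω ∈ Set.Ioc a b then Y.wt i n p ω else 0 := by
  classical
  rw [h.tsum_wt_eq i p ha (hb.trans hST), h'.tsum_wt_eq i p ha hb]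
  refine lintegral_mono fun e => ?_
  by_cases h1 : e.2.1 ∈ Set.Ioc a b
  · have hle := h.lam_le_lam h' hμ hST e.1 ⟨ha.trans_lt h1.1, h1.2.trans hb⟩
    by_cases h2 : ENNReal.ofReal e.2.2.1 ≤ X.lam H T e.1 e.2.1 ω
    · rw [if_pos h2, if_pos (h2.trans hle)]
    · rw [if_neg h2]; exact zero_le
  · simp [sideWeight, h1]

theorem tsum_wt_le_envTotal (h : X.IsThinning H T m ω)
    (hm : ShellFinite (drivingIntensity H.ρ) m) (i : ℕ) (p : Fin 2) {a b : ℝ} (ha : 0 ≤ a)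
    (hb : b ≤ T) : open Classical in
    (∑' n, if X.time n ω ∈ Set.Ioc a b then X.wt i n p ω else 0) ≤ H.envTotal i p a b m := by
  classical
  rw [h.tsum_wt_eq i p ha hb]
  have hE : H.envTotal i p a b m =
      ⨆ k, thinSum H.ρ (H.envRate k) (sideWeight p (Set.Ioc a b)) i m := by
    rw [HawkesModel.envTotal]
    simp only [thinMeasure_apply (H.isPredictableRate_envRate _) i p m measurableSet_Ioc]
  rw [hE]
  refine le_trans (lintegral_mono fun e => ?_)
    (H.lintegral_domRate_le hm (measurable_sideWeight p measurableSet_Ioc) i)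
  by_cases h1 : e.2.1 ∈ Set.Ioc a b
  · have hpos := ha.trans_lt h1.1
    have hle := h.lam_le_domRate hm e.1 ⟨hpos, h1.2.trans hb⟩
    by_cases h2 : ENNReal.ofReal e.2.2.1 ≤ X.lam H T e.1 e.2.1 ω
    · rw [if_pos h2, if_pos ⟨hpos, h2.trans hle⟩]
    · rw [if_neg h2]; exact zero_le
  · simp [sideWeight, h1]

end IsThinning

theorem cnt_eq_add (X : MarkedArrivals Ω) (i : ℕ) (p : Fin 2) {a b : ℝ} (hab : a ≤ b) (ω : Ω) :
    open Classical in X.cnt i p b ω = X.cnt i p a ω +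
      ∑' n, if X.time n ω ∈ Set.Ioc a b then X.wt i n p ω else 0 := by
  classical
  rw [cnt, cnt, pointSum, pointSum, ← ENNReal.tsum_add]
  congr 1 with n
  by_cases h1 : X.time n ω ≤ a
  · simp [h1, h1.trans hab, not_lt.2 h1]
  · simp [h1, not_le.1 h1]

end MarkedArrivals

/-! ### From the stated hypotheses to `HawkesModel` -/

theorem lintegral_ofReal_pow_eq {Ω : Type*} {mΩ : MeasurableSpace Ω} {P : Measure Ω} {J : Ω → ℝ}
    (hJ_pos : ∀ᵐ ω ∂P, 0 < J ω) {i : ℕ} (hi : Integrable (fun ω => J ω ^ i) P) :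
    ∫⁻ ω, ENNReal.ofReal (J ω) ^ i ∂P = ENNReal.ofReal (∫ ω, J ω ^ i ∂P) := by
  rw [ofReal_integral_eq_lintegral_ofReal hi (by filter_upwards [hJ_pos] with ω h using by positivity)]
  refine lintegral_congr_ae ?_
  filter_upwards [hJ_pos] with ω h
  rw [ENNReal.ofReal_pow h.le]

theorem integrable_pow_of_two_mul {Ω : Type*} {mΩ : MeasurableSpace Ω} {P : Measure Ω}
    [IsFiniteMeasure P] {J : Ω → ℝ} (hJ : Measurable J) {i : ℕ}
    (hi : Integrable (fun ω => J ω ^ (2 * i)) P) : Integrable (fun ω => J ω ^ i) P := by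
  refine Integrable.mono' ((integrable_const (1 : ℝ)).add hi) (hJ.pow_const i).aestronglyMeasurable
    (Eventually.of_forall fun ω => ?_)
  simp only [Pi.add_apply, Real.norm_eq_abs]
  rw [mul_comm, pow_mul, ← sq_abs]
  nlinarith [sq_nonneg (|J ω ^ i| - 1), abs_nonneg (J ω ^ i)]

/-- The baseline is only controlled on `[0, 1]`; clamping its argument makes it monotone and bounded
by `μ 1` on the whole line without changing it at the times of interest. -/
theorem exists_hawkesModel {Ω : Type*} {mΩ : MeasurableSpace Ω} (P : Measure Ω)
    [IsProbabilityMeasure P] (J : Ω → ℝ) (hJ_meas : Measurable J) (hJ_pos : ∀ᵐ ω ∂P, 0 < J ω)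
    (hJ_sq : Integrable (fun ω => J ω ^ 2) P)
    (μ : ℝ → ℝ) (hμ_mono : MonotoneOn μ (Set.Icc 0 1))
    (φ : ℝ → Matrix (Fin 2) (Fin 2) ℝ) (hφ_meas : ∀ p q, Measurable fun u => φ u p q)
    (hφ_nonneg : ∀ u, 0 ≤ u → ∀ p q, 0 ≤ φ u p q)
    (hφ_int : ∀ p q, IntegrableOn (fun u => φ u p q) (Set.Ioi 0))
    (K : Matrix (Fin 2) (Fin 2) ℝ) (hK : K = kernelMatrix (∫ ω, J ω ∂P) φ)
    (hK_radius : spectralRadius ℂ (K.map (fun x : ℝ => (x : ℂ))) < 1) :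
    ∃ H : HawkesModel, H.ρ = P.map J ∧ (H.μ = fun s => μ (max 0 (min 1 s))) ∧
      (H.k = fun p q u => ENNReal.ofReal (φ u p q)) ∧
      ∀ p, H.w p = ENNReal.ofReal (((1 - K)⁻¹.mulVec fun _ => 1) p) := by
  have hJ1 : Integrable (fun ω => J ω ^ 1) P := integrable_pow_of_two_mul hJ_meas (by simpa using hJ_sq)
  have hEJ : 0 ≤ ∫ ω, J ω ∂P := integral_nonneg_of_ae (by
    filter_upwards [hJ_pos] with ω h using h.le)
  have hKnn : ∀ p q, 0 ≤ K p q := fun p q => by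
    rw [hK]
    exact mul_nonneg hEJ (integral_nonneg fun u => abs_nonneg _)
  obtain ⟨w, hw⟩ : ∃ w, w = (1 - K)⁻¹.mulVec fun _ => 1 := ⟨_, rfl⟩
  have hres := Matrix.resolvent_mulVec_one K hKnn hK_radius
  simp only [← hw] at hres
  obtain ⟨hw1, hweq⟩ := hres
  have hmom : ∫⁻ x, ENNReal.ofReal x ∂(P.map J) = ENNReal.ofReal (∫ ω, J ω ∂P) := by
    rw [lintegral_map ENNReal.measurable_ofReal hJ_meas]
    simpa using lintegral_ofReal_pow_eq hJ_pos hJ1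
  have hker : ∀ p q, ∫⁻ u in Set.Ioi 0, (∫⁻ x, ENNReal.ofReal x ∂(P.map J)) *
      ENNReal.ofReal (φ u p q) = ENNReal.ofReal (K p q) := fun p q => by
    have hφm : Measurable fun u => ENNReal.ofReal (φ u p q) :=
      ENNReal.measurable_ofReal.comp (hφ_meas p q)
    rw [hmom, lintegral_const_mul _ hφm, hK]
    simp only [kernelMatrix, Matrix.of_apply]
    rw [ENNReal.ofReal_mul hEJ]
    congr 1
    have habs : ∫ u in Set.Ioi (0 : ℝ), |φ u p q| = ∫ u in Set.Ioi (0 : ℝ), φ u p q :=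
      setIntegral_congr_fun measurableSet_Ioi fun u hu =>
        abs_of_nonneg (hφ_nonneg u (Set.mem_Ioi.1 hu).le p q)
    rw [habs, ofReal_integral_eq_lintegral_ofReal (hφ_int p q)]
    filter_upwards [ae_restrict_mem measurableSet_Ioi] with u hu
    exact hφ_nonneg u (Set.mem_Ioi.1 hu).le p q
  have hsum : ∀ p, ∑ q, (∫⁻ u in Set.Ioi 0, (∫⁻ x, ENNReal.ofReal x ∂(P.map J)) *
      ENNReal.ofReal (φ u p q)) * ENNReal.ofReal (w q) = ENNReal.ofReal (∑ q, K p q * w q) := by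
    intro p
    have hwq : ∀ q, 0 ≤ w q := fun q => zero_le_one.trans (hw1 q)
    rw [ENNReal.ofReal_sum_of_nonneg fun q _ => mul_nonneg (hKnn p q) (hwq q)]
    refine Finset.sum_congr rfl fun q _ => ?_
    rw [hker, ENNReal.ofReal_mul (hKnn p q)]
  have hS : 0 < w 0 + w 1 := by linarith [hw1 0, hw1 1]
  have hmono : Monotone fun s => μ (max 0 (min 1 s)) := fun s t hst =>
    hμ_mono ⟨le_max_left _ _, max_le zero_le_one (min_le_left _ _)⟩
      ⟨le_max_left _ _, max_le zero_le_one (min_le_left _ _)⟩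
      (max_le_max le_rfl (min_le_min le_rfl hst))
  refine ⟨{
    ρ := P.map J
    prob := Measure.isProbabilityMeasure_map hJ_meas.aemeasurable
    pos := ?_
    sq_ne_top := ?_
    μ := fun s => μ (max 0 (min 1 s))
    measurable_μ := hmono.measurable
    μbar := μ 1
    μ_le := fun s => hμ_mono ⟨le_max_left _ _, max_le zero_le_one (min_le_left _ _)⟩
      ⟨zero_le_one, le_rfl⟩ (max_le zero_le_one (min_le_left _ _))
    k := fun p q u => ENNReal.ofReal (φ u p q)
    measurable_k := fun p q => ENNReal.measurable_ofReal.comp (hφ_meas p q)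
    w := fun p => ENNReal.ofReal (w p)
    one_le_w := fun p => ENNReal.one_le_ofReal.2 (hw1 p)
    w_ne_top := fun p => ENNReal.ofReal_ne_top
    w_eq := fun p => ?_
    -- `K w = w - 1` and `w p ≤ w 0 + w 1` give `K w ≤ r w`; since `w 0 + w 1 ≥ 2`, this `r` lies
    -- strictly between `0` and `1`.
    r := 1 - 1 / (w 0 + w 1)
    r_pos := ?_
    r_lt_one := ?_
    contract := fun p => ?_ }, rfl, rfl, rfl, fun p => by rw [← hw]⟩
  · rw [Measure.map_apply hJ_meas measurableSet_Iic]
    refine measure_eq_zero_iff_ae_notMem.2 ?_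
    filter_upwards [hJ_pos] with ω h
    simpa using h
  · rw [lintegral_map (by fun_prop) hJ_meas, lintegral_ofReal_pow_eq hJ_pos hJ_sq]
    exact ENNReal.ofReal_ne_top
  · rw [hsum, ← ENNReal.ofReal_one, ← ENNReal.ofReal_add zero_le_one, ← hweq]
    exact Finset.sum_nonneg fun q _ => mul_nonneg (hKnn p q) (zero_le_one.trans (hw1 q))
  · have : 1 / (w 0 + w 1) < 1 := (div_lt_one hS).2 (by linarith [hw1 0, hw1 1])
    linarith
  · have : 0 < 1 / (w 0 + w 1) := by positivity
    linarith
  · rw [hsum, ← ENNReal.ofReal_mul]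
    · refine ENNReal.ofReal_le_ofReal ?_
      have h1 : ∑ q, K p q * w q = w p - 1 := by linarith [hweq p]
      have h2 : w p ≤ w 0 + w 1 := by
        fin_cases p <;> simp <;> linarith [hw1 0, hw1 1]
      have h3 : w p / (w 0 + w 1) ≤ 1 := (div_le_one hS).2 h2
      rw [h1, sub_mul, one_mul, one_div_mul_eq_div]
      linarith
    · have : 1 / (w 0 + w 1) < 1 := (div_lt_one hS).2 (by linarith [hw1 0, hw1 1])
      linarith

namespace MarkedArrivals

variable {Ω : Type*} {X : MarkedArrivals Ω} {H : HawkesModel}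

theorem intensity_eq_lam {μ : ℝ → ℝ} {φ : ℝ → Matrix (Fin 2) (Fin 2) ℝ}
    (hμ : H.μ = fun s => μ (max 0 (min 1 s))) (hk : H.k = fun p q u => ENNReal.ofReal (φ u p q))
    (hφ_nonneg : ∀ u, 0 ≤ u → ∀ p q, 0 ≤ φ u p q) {T : ℝ} (p : Fin 2) {t : ℝ}
    (ht : t ∈ Set.Ioc 0 T) (ω : Ω) : X.intensity μ φ T p t ω = X.lam H T p t ω := by
  have hT : 0 < T := ht.1.trans_le ht.2
  rw [lam_eq_tsum, intensity, HawkesModel.base, hμ]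
  have h1 : min 1 (t / T) = t / T := min_eq_right ((div_le_one hT).2 ht.2)
  have h2 : max 0 (t / T) = t / T := max_eq_right (div_nonneg ht.1.le hT.le)
  simp only [h1, h2]
  congr 2 with n
  by_cases hn : X.time n ω < t
  · rw [if_pos hn, HawkesModel.kernelWeight, if_pos hn, hk,
      ENNReal.ofReal_mul (hφ_nonneg _ (sub_nonneg.2 hn.le) _ _)]
  · rw [if_neg hn, HawkesModel.kernelWeight, if_neg hn, zero_mul]

theorem IsMarkedHawkes.isHawkes {mΩ : MeasurableSpace Ω} {P : Measure Ω} {ℱ : Filtration ℝ≥0 mΩ}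
    {μ : ℝ → ℝ} {φ : ℝ → Matrix (Fin 2) (Fin 2) ℝ} {J : Ω → ℝ} {T : ℝ}
    (h : X.IsMarkedHawkes P ℱ μ φ J T) (hJ : Measurable J) (hρ : H.ρ = P.map J)
    (hμ : H.μ = fun s => μ (max 0 (min 1 s))) (hk : H.k = fun p q u => ENNReal.ofReal (φ u p q))
    (hφ_nonneg : ∀ u, 0 ≤ u → ∀ p q, 0 ≤ φ u p q) : X.IsHawkes P ℱ H T where
  measurable_time := h.measurable_time
  measurable_side := h.measurable_side
  measurable_mark := h.measurable_mark
  time_pos := h.time_pos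
  time_strictMono := h.time_strictMono
  adapted := h.adapted
  compensator n s t hst ht A hA p B hB := by
    rw [h.compensator n s t hst ht A hA p B hB, hρ, Measure.map_apply hJ hB]
    congr 2 with ω
    rw [stoppedIntensity_apply _ _ _ _ _ measurableSet_Ioc]
    refine setLIntegral_congr_fun (measurableSet_Ioc.inter measurableSet_Iic) fun u hu => ?_
    exact intensity_eq_lam hμ hk hφ_nonneg p ⟨s.2.trans_lt hu.1.1, hu.1.2.trans ht⟩ ω

theorem SolvesThinning.isThinning {Q : Ω → Measure (Fin 2 × ℝ × ℝ × ℝ)} {μ : ℝ → ℝ}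
    {φ : ℝ → Matrix (Fin 2) (Fin 2) ℝ} {T : ℝ} {ω : Ω} (h : X.SolvesThinning Q μ φ T ω)
    (hμ : H.μ = fun s => μ (max 0 (min 1 s))) (hk : H.k = fun p q u => ENNReal.ofReal (φ u p q))
    (hφ_nonneg : ∀ u, 0 ≤ u → ∀ p q, 0 ≤ φ u p q) (htime : ∀ n, 0 < X.time n ω)
    (hmono : StrictMono fun n => X.time n ω) : X.IsThinning H T (Q ω) ω where
  time_pos := htime
  time_strictMono := hmono
  sum_eq p A hA hAT := by
    rw [h p A hA hAT]
    congr 1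
    ext e
    simp only [Set.mem_ofPred_eq]
    refine and_congr_right fun _ => and_congr_right fun he => ?_
    rw [intensity_eq_lam hμ hk hφ_nonneg p (hAT he).1 ω]

/-- The marks of the arrivals before the horizon are positive. -/
theorem IsHawkes.ae_mark_pos {mΩ : MeasurableSpace Ω} {P : Measure Ω} {ℱ : Filtration ℝ≥0 mΩ}
    {T : ℝ} (h : X.IsHawkes P ℱ H T) (hT : 0 ≤ T) :
    ∀ᵐ ω ∂P, ∀ n, X.time n ω ≤ T → 0 < X.mark n ω := by
  refine ae_all_iff.2 fun n => ?_
  lift T to ℝ≥0 using hT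
  have hp : ∀ p, ∀ᵐ ω ∂P, ¬ (X.time n ω ≤ T ∧ X.side n ω = p ∧ X.mark n ω ∈ Set.Iic 0) := by
    intro p
    have h0 := h.compensator n 0 T zero_le le_rfl Set.univ MeasurableSet.univ p (Set.Iic 0)
      measurableSet_Iic
    rw [H.pos, zero_mul, Finset.sum_eq_zero_iff] at h0
    have h1 := h0 n (Finset.self_mem_range_succ n)
    rw [Set.univ_inter] at h1
    refine measure_mono_null (fun ω hω => ?_) h1
    simp only [Set.mem_compl_iff, Set.mem_ofPred_eq, not_not] at hω ⊢
    exact ⟨by simpa using h.time_pos n ω, hω⟩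
  filter_upwards [ae_all_iff.2 hp] with ω hω hn
  by_contra hneg
  exact hω (X.side n ω) ⟨hn, rfl, not_lt.1 hneg⟩

/-- A pathwise version of the positivity of the marks: absence of driving points with nonpositive
marks is a single event, valid for all real horizons at once. -/
theorem IsThinning.mark_pos {T : ℝ} {m : Measure DrivingPoint} {ω : Ω} (h : X.IsThinning H T m ω)
    (hm : m {e | e.2.2.2 ≤ 0} = 0) (n : ℕ) (hn : X.time n ω ≤ T) : 0 < X.mark n ω := by
  classical
  by_contra hneg
  have h0 := h.sum_eq (X.side n ω) (Set.Ioc 0 T ×ˢ Set.Iic 0)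
    (measurableSet_Ioc.prod measurableSet_Iic) (Set.prod_mono le_rfl (Set.subset_univ _))
  have h1 : m {e | e.1 = X.side n ω ∧ (e.2.1, e.2.2.2) ∈ Set.Ioc 0 T ×ˢ Set.Iic (0 : ℝ) ∧
      ENNReal.ofReal e.2.2.1 ≤ X.lam H T (X.side n ω) e.2.1 ω} = 0 :=
    measure_mono_null (fun e he => he.2.1.2) hm
  rw [h1, ENNReal.tsum_eq_zero] at h0
  have h2 := h0 n
  rw [if_pos ⟨rfl, ⟨h.time_pos n, hn⟩, not_lt.1 hneg⟩] at h2
  exact one_ne_zero h2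

/-- No finiteness is assumed: if the sum diverges, the real `tsum` and `toReal ∞` both take the
default value `0`. -/
theorem powerSum_apply {i : ℕ} {p : Fin 2} {t : ℝ} {ω : Ω}
    (h : ∀ n, X.time n ω ≤ t → 0 < X.mark n ω) :
    X.powerSum i t ω p = (X.cnt i p t ω).toReal := by
  rw [powerSum, cnt, pointSum, ENNReal.tsum_toReal_eq]
  · refine tsum_congr fun n => ?_
    by_cases h1 : X.time n ω ≤ t <;> by_cases h2 : X.side n ω = p
    · simp [h1, h2, wt, (h n h1).le]
    · simp [h2, wt]
    · simp [h1]
    · simp [h1]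
  · intro n
    unfold wt
    split_ifs <;> finiteness

end MarkedArrivals

theorem drivingIntensity_mark_nonpos (H : HawkesModel) :
    drivingIntensity H.ρ {e | e.2.2.2 ≤ 0} = 0 := by
  have : {e : Fin 2 × ℝ × ℝ × ℝ | e.2.2.2 ≤ 0} =
      Set.univ ×ˢ (Set.univ ×ˢ (Set.univ ×ˢ Set.Iic (0 : ℝ))) := by
    ext e; simp
  rw [this, drivingIntensity, Measure.prod_prod, Measure.prod_prod, Measure.prod_prod, H.pos]
  simp

/-! ### Normalized errors and convergence in `L²` -/

/-- The constant is crude but sufficient, because the grid stays fixed while `T` tends to infinity.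
-/
theorem ENNReal.sum_sq_le {ι : Type*} (s : Finset ι) (f : ι → ℝ≥0∞) :
    (∑ j ∈ s, f j) ^ 2 ≤ 2 ^ s.card * ∑ j ∈ s, f j ^ 2 := by
  classical
  induction s using Finset.induction_on with
  | empty => simp
  | insert a s ha ih =>
    rw [Finset.sum_insert ha, Finset.sum_insert ha, Finset.card_insert_of_notMem ha, mul_add]
    refine (ENNReal.add_sq_le_two _ _).trans (add_le_add ?_ ?_)
    · gcongr
      exact le_self_pow₀ (by norm_num) (by omega)
    · calc 2 * (∑ j ∈ s, f j) ^ 2 ≤ 2 * (2 ^ s.card * ∑ j ∈ s, f j ^ 2) := by gcongr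
        _ = _ := by rw [pow_succ]; ring

/-- A family which is dominated, up to an arbitrarily small constant, by families tending to zero
tends to zero. -/
theorem ENNReal.tendsto_zero_of_eventually_le_add {α : Type*} {l : Filter α} {f : α → ℝ≥0∞}
    {a : ℕ → α → ℝ≥0∞} {b : ℕ → ℝ≥0∞} (ha : ∀ m, Tendsto (a m) l (𝓝 0))
    (hb : Tendsto b atTop (𝓝 0)) (h : ∀ m, ∀ᶠ x in l, f x ≤ a m x + b m) :
    Tendsto f l (𝓝 0) := by
  rw [ENNReal.tendsto_nhds_zero]
  intro ε hε
  have hε2 : 0 < ε / 2 := ENNReal.half_pos hε.ne'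
  obtain ⟨m, hm⟩ := ((ENNReal.tendsto_nhds_zero.1 hb) _ hε2).exists
  filter_upwards [(ENNReal.tendsto_nhds_zero.1 (ha m)) _ hε2, h m] with x h1 h2
  exact h2.trans ((add_le_add h1 hm).trans (ENNReal.add_halves ε).le)

theorem tendsto_ofReal_div_succ (c : ℝ) :
    Tendsto (fun m : ℕ => ENNReal.ofReal (c / (m + 1 : ℕ))) atTop (𝓝 0) := by
  rw [← ENNReal.ofReal_zero]
  exact (ENNReal.continuous_ofReal.tendsto 0).comp
    ((tendsto_const_div_atTop_nhds_zero_nat c).comp (tendsto_add_atTop_nat 1))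

namespace HawkesModel

variable (H : HawkesModel)

/-- The limit of the normalized sums of the `i`-th powers of the marks on side `p`. -/
noncomputable def limFun (i : ℕ) (p : Fin 2) (v : ℝ) : ℝ :=
  (H.mom i).toReal * (H.w p).toReal * ∫ s in (0 : ℝ)..v, H.μ s

/-- A Lipschitz constant of `limFun`. -/
noncomputable def limLip (i : ℕ) (p : Fin 2) : ℝ := (H.mom i).toReal * (H.w p).toReal * H.μbar

variable {H}

theorem limLip_nonneg (hμ0 : ∀ s, 0 ≤ H.μ s) (i : ℕ) (p : Fin 2) : 0 ≤ H.limLip i p :=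
  mul_nonneg (mul_nonneg ENNReal.toReal_nonneg ENNReal.toReal_nonneg) ((hμ0 0).trans (H.μ_le 0))

theorem abs_limFun_sub_le (hμ : Monotone H.μ) (hμ0 : ∀ s, 0 ≤ H.μ s) (i : ℕ) (p : Fin 2)
    (x y : ℝ) : |H.limFun i p x - H.limFun i p y| ≤ H.limLip i p * |x - y| := by
  have hint : ∀ a b, IntervalIntegrable H.μ volume a b := fun a b => hμ.intervalIntegrable
  unfold limFun limLip
  rw [← mul_sub, intervalIntegral.integral_interval_sub_left (hint _ _) (hint _ _), abs_mul,
    abs_of_nonneg (mul_nonneg ENNReal.toReal_nonneg ENNReal.toReal_nonneg), mul_assoc _ H.μbar]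
  refine mul_le_mul_of_nonneg_left ?_ (mul_nonneg ENNReal.toReal_nonneg ENNReal.toReal_nonneg)
  rw [← Real.norm_eq_abs]
  refine intervalIntegral.norm_integral_le_of_norm_le_const fun s _ => ?_
  rw [Real.norm_eq_abs, abs_of_nonneg (hμ0 s)]
  exact H.μ_le s

theorem toReal_baseInt (hμ0 : ∀ s, 0 ≤ H.μ s) {T v : ℝ} (hT : 0 < T)
    (hv : 0 ≤ v) : (H.baseInt T (v * T)).toReal = T * ∫ s in (0 : ℝ)..v, H.μ s := by
  have hm : Measurable fun u => H.μ (u / T) := H.measurable_μ.comp (measurable_id.div_const T)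
  have h1 : (H.baseInt T (v * T)).toReal = ∫ u in Set.Ioc 0 (v * T), H.μ (u / T) := by
    rw [integral_eq_lintegral_of_nonneg_ae (Eventually.of_forall fun u => hμ0 _)
      hm.aestronglyMeasurable]
    rfl
  rw [h1, ← intervalIntegral.integral_of_le (mul_nonneg hv hT.le),
    intervalIntegral.integral_comp_div _ hT.ne', zero_div, mul_div_cancel_right₀ _ hT.ne', smul_eq_mul]

variable (H)

/-- The error made by replacing the normalized mean by its limit. -/
noncomputable def meanErr (i : ℕ) (p : Fin 2) (T : ℝ) : ℝ≥0∞ :=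
  H.mom i * (H.w p * H.gain) * (H.tailErr T / ENNReal.ofReal T)

theorem meanErr_tendsto {i : ℕ} (hi : H.mom (2 * i) ≠ ∞) (p : Fin 2) :
    Tendsto (H.meanErr i p) atTop (𝓝 0) := by
  have h := ENNReal.Tendsto.const_mul (a := H.mom i * (H.w p * H.gain)) H.tailErr_div_tendsto
    (Or.inr (ENNReal.mul_ne_top (H.mom_ne_top_of_two_mul hi)
      (ENNReal.mul_ne_top (H.w_ne_top p) H.gain_ne_top)))
  rwa [mul_zero] at h

/-- A bound of the second moment of the normalized error. -/
noncomputable def errBound (i : ℕ) (p : Fin 2) (T : ℝ) : ℝ≥0∞ :=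
  2 * (H.varConst i p / ENNReal.ofReal T) + 2 * H.meanErr i p T ^ 2

theorem errBound_tendsto {i : ℕ} (hi : H.mom (2 * i) ≠ ∞) (p : Fin 2) :
    Tendsto (H.errBound i p) atTop (𝓝 0) := by
  have h1 : Tendsto (fun T => H.varConst i p / ENNReal.ofReal T) atTop (𝓝 0) := by
    rw [← ENNReal.div_top (a := H.varConst i p)]
    exact ENNReal.Tendsto.const_div (ENNReal.tendsto_ofReal_atTop)
      (Or.inr (H.varConst_ne_top hi p))
  have h2 := (ENNReal.Tendsto.const_mul (a := 2) h1 (Or.inr ENNReal.ofNat_ne_top)).add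
    (ENNReal.Tendsto.const_mul (a := 2) ((ENNReal.continuous_pow 2).tendsto 0 |>.comp
      (H.meanErr_tendsto hi p)) (Or.inr ENNReal.ofNat_ne_top))
  have h3 : H.errBound i p = fun T =>
      2 * (H.varConst i p / ENNReal.ofReal T) + 2 * H.meanErr i p T ^ 2 := rfl
  rw [h3]
  simpa using h2

end HawkesModel

namespace MarkedArrivals

variable {Ω : Type*} (X : MarkedArrivals Ω)

/-- The normalized sum of the `i`-th powers of the marks on side `p`. -/
noncomputable def normCnt (i : ℕ) (p : Fin 2) (T v : ℝ) (ω : Ω) : ℝ :=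
  T⁻¹ * (X.cnt i p (v * T) ω).toReal

/-- The normalized fluctuation around the mean. -/
noncomputable def fluct {mΩ : MeasurableSpace Ω} (P : Measure Ω) (H : HawkesModel) (i : ℕ)
    (p : Fin 2) (T v : ℝ) (ω : Ω) : ℝ≥0∞ :=
  ‖T⁻¹ * ((X.cnt i p (v * T) ω).toReal -
    (H.mom i * ∫⁻ ω, X.cumInt H T p (v * T) ω ∂P).toReal)‖ₑ

/-- The uniform error on side `p`. -/
noncomputable def compErr (H : HawkesModel) (i : ℕ) (p : Fin 2) (T : ℝ) (ω : Ω) : ℝ≥0∞ :=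
  ⨆ v ∈ Set.Icc (0 : ℝ) 1, ‖X.normCnt i p T v ω - H.limFun i p v‖ₑ

variable {X} {H : HawkesModel} {T : ℝ} {i : ℕ}

/-- The normalized sum is nondecreasing in `v`, the limit Lipschitz. Finiteness is needed because
`toReal` is not monotone at `∞`, and the mesh `1 / (m + 1)` avoids a division by zero. -/
theorem compErr_le_grid (hμ : Monotone H.μ) (hμ0 : ∀ s, 0 ≤ H.μ s) (hT : 0 < T) {p : Fin 2} {ω : Ω}
    (hfin : X.cnt i p T ω ≠ ∞) (m : ℕ) :
    X.compErr H i p T ω ≤ (∑ j ∈ Finset.range (m + 1 + 1),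
      ‖X.normCnt i p T (j / (m + 1 : ℕ)) ω - H.limFun i p (j / (m + 1 : ℕ))‖ₑ) +
        ENNReal.ofReal (H.limLip i p / (m + 1 : ℕ)) := by
  have hmono : MonotoneOn (fun v => X.normCnt i p T v ω) (Set.Icc 0 1) := by
    intro a _ b hb hab
    refine mul_le_mul_of_nonneg_left ?_ (inv_nonneg.2 hT.le)
    have h1 : b * T ≤ T := by nlinarith [hb.2]
    exact ENNReal.toReal_mono (ne_top_of_le_ne_top hfin (pointSum_mono _ _ h1))
      (pointSum_mono _ _ (mul_le_mul_of_nonneg_right hab hT.le))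
  refine iSup₂_le fun v hv => ?_
  have h := abs_sub_le_sum_grid hmono (fun x _ y _ => H.abs_limFun_sub_le hμ hμ0 i p x y)
    (H.limLip_nonneg hμ0 i p) (Nat.succ_pos m) hv
  rw [Real.enorm_eq_ofReal_abs]
  refine (ENNReal.ofReal_le_ofReal h).trans (ENNReal.ofReal_add_le.trans ?_)
  refine add_le_add ?_ le_rfl
  rw [ENNReal.ofReal_sum_of_nonneg fun _ _ => abs_nonneg _]
  simp_rw [Real.enorm_eq_ofReal_abs]
  rfl

variable {mΩ : MeasurableSpace Ω} {P : Measure Ω} {ℱ : Filtration ℝ≥0 mΩ}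

namespace IsHawkes

theorem measurable_normCnt (h : X.IsHawkes P ℱ H T) (i : ℕ) (p : Fin 2) (v : ℝ) :
    Measurable (X.normCnt i p T v) :=
  ((h.measurable_cnt_right i p (v * T)).ennreal_toReal).const_mul _

theorem measurable_fluct (h : X.IsHawkes P ℱ H T) (i : ℕ) (p : Fin 2) (v : ℝ) :
    Measurable (X.fluct P H i p T v) :=
  (((h.measurable_cnt_right i p (v * T)).ennreal_toReal.sub_const _).const_mul _).enorm

variable [IsProbabilityMeasure P]

/-- A variance of order `T` divided by `T²`. -/
theorem lintegral_fluct_sq_le (h : X.IsHawkes P ℱ H T) (hT : 0 < T) (hi : H.mom (2 * i) ≠ ∞)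
    (p : Fin 2) {v : ℝ} (hv : v ≤ 1) :
    ∫⁻ ω, X.fluct P H i p T v ω ^ 2 ∂P ≤ H.varConst i p / ENNReal.ofReal T := by
  have hvT : v * T ≤ T := by nlinarith
  have hle := h.lintegral_sqDist_cnt_le hT.le hi p hvT
  have hm : Measurable fun ω => sqDist (X.cnt i p (v * T) ω)
      (H.mom i * ∫⁻ ω, X.cumInt H T p (v * T) ω ∂P) :=
    measurable_sqDist (h.measurable_cnt_right i p (v * T)) measurable_const
  have hT0 : ENNReal.ofReal T ≠ 0 := by simpa using hT
  have heq : ∀ ω, X.fluct P H i p T v ω ^ 2 = (ENNReal.ofReal T)⁻¹ ^ 2 *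
      sqDist (X.cnt i p (v * T) ω) (H.mom i * ∫⁻ ω, X.cumInt H T p (v * T) ω ∂P) := fun ω => by
    rw [fluct, enorm_mul, mul_pow, sqDist_eq_enorm, Real.enorm_eq_ofReal (inv_nonneg.2 hT.le),
      ENNReal.ofReal_inv_of_pos hT]
  simp_rw [heq]
  rw [lintegral_const_mul _ hm]
  calc (ENNReal.ofReal T)⁻¹ ^ 2 * _
      ≤ (ENNReal.ofReal T)⁻¹ ^ 2 * (H.varConst i p * ENNReal.ofReal T) := by gcongr
    _ = H.varConst i p * (ENNReal.ofReal T)⁻¹ * ((ENNReal.ofReal T)⁻¹ * ENNReal.ofReal T) := by ring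
    _ = _ := by rw [ENNReal.inv_mul_cancel hT0 ENNReal.ofReal_ne_top, mul_one, div_eq_mul_inv]

theorem enorm_normCnt_sub_le (h : X.IsHawkes P ℱ H T) (hT : 0 < T)
    (hμ0 : ∀ s, 0 ≤ H.μ s) (hi : H.mom (2 * i) ≠ ∞) (p : Fin 2) {v : ℝ}
    (hv : v ∈ Set.Icc (0 : ℝ) 1) (ω : Ω) :
    ‖X.normCnt i p T v ω - H.limFun i p v‖ₑ ≤ X.fluct P H i p T v ω + H.meanErr i p T := by
  have hvT : v * T ≤ T := by nlinarith [hv.2]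
  have hTi : ‖T⁻¹‖ₑ = (ENNReal.ofReal T)⁻¹ := by
    rw [Real.enorm_eq_ofReal (inv_nonneg.2 hT.le), ENNReal.ofReal_inv_of_pos hT]
  have hlim : H.limFun i p v = T⁻¹ * (H.mom i * (H.w p * H.baseInt T (v * T))).toReal := by
    rw [ENNReal.toReal_mul, ENNReal.toReal_mul, H.toReal_baseInt hμ0 hT hv.1,
      HawkesModel.limFun]
    field_simp
  have hsplit : X.normCnt i p T v ω - H.limFun i p v =
      T⁻¹ * ((X.cnt i p (v * T) ω).toReal -
        (H.mom i * ∫⁻ ω, X.cumInt H T p (v * T) ω ∂P).toReal) +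
      T⁻¹ * ((H.mom i * ∫⁻ ω, X.cumInt H T p (v * T) ω ∂P).toReal -
        (H.mom i * (H.w p * H.baseInt T (v * T))).toReal) := by
    rw [hlim, normCnt]; ring
  rw [hsplit]
  refine (enorm_add_le _ _).trans (add_le_add le_rfl ?_)
  rw [enorm_mul, hTi, enorm_mul_toReal_sub _ _ _ (H.mom_ne_top_of_two_mul hi)]
  calc (ENNReal.ofReal T)⁻¹ * (H.mom i * _)
      ≤ (ENNReal.ofReal T)⁻¹ * (H.mom i * (H.w p * (H.gain * H.tailErr T))) := by
        gcongr
        exact h.enorm_mean_sub_le hT.le p hvT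
    _ = _ := by rw [HawkesModel.meanErr, div_eq_mul_inv]; ring

theorem lintegral_enorm_normCnt_sub_sq_le (h : X.IsHawkes P ℱ H T) (hT : 0 < T)
    (hμ0 : ∀ s, 0 ≤ H.μ s) (hi : H.mom (2 * i) ≠ ∞) (p : Fin 2) {v : ℝ}
    (hv : v ∈ Set.Icc (0 : ℝ) 1) :
    ∫⁻ ω, ‖X.normCnt i p T v ω - H.limFun i p v‖ₑ ^ 2 ∂P ≤ H.errBound i p T := by
  have hm := h.measurable_fluct i p v
  calc ∫⁻ ω, ‖X.normCnt i p T v ω - H.limFun i p v‖ₑ ^ 2 ∂P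
      ≤ ∫⁻ ω, (2 * X.fluct P H i p T v ω ^ 2 + 2 * H.meanErr i p T ^ 2) ∂P :=
        lintegral_mono fun ω => (pow_le_pow_left' (h.enorm_normCnt_sub_le hT hμ0 hi p hv ω) 2).trans
          (ENNReal.add_sq_le_two _ _)
    _ = 2 * ∫⁻ ω, X.fluct P H i p T v ω ^ 2 ∂P + 2 * H.meanErr i p T ^ 2 := by
        rw [lintegral_add_right _ measurable_const, lintegral_const_mul _ (hm.pow_const 2)]
        simp
    _ ≤ _ := by
        rw [HawkesModel.errBound]
        gcongr
        exact h.lintegral_fluct_sq_le hT hi p hv.2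

/-- The squared uniform error is dominated by its values on a grid. -/
theorem lintegral_sum_compErr_sq_le (h : X.IsHawkes P ℱ H T) (hT : 0 < T) (hμ : Monotone H.μ)
    (hμ0 : ∀ s, 0 ≤ H.μ s) (hi : H.mom (2 * i) ≠ ∞) (m : ℕ) :
    ∫⁻ ω, (∑ p, X.compErr H i p T ω) ^ 2 ∂P ≤
      8 * (2 ^ (m + 1 + 1) * ((m + 1 + 1 : ℕ) * ∑ p, H.errBound i p T)) +
        8 * ∑ p, ENNReal.ofReal (H.limLip i p / (m + 1 : ℕ)) ^ 2 := by
  obtain ⟨g, hg⟩ : ∃ g : Fin 2 → ℕ → Ω → ℝ≥0∞, ∀ p j ω, g p j ω =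
      ‖X.normCnt i p T (j / (m + 1 : ℕ)) ω - H.limFun i p (j / (m + 1 : ℕ))‖ₑ :=
    ⟨_, fun _ _ _ => rfl⟩
  have hgm : ∀ p j, Measurable (g p j) := fun p j => by
    have : g p j = fun ω => ‖X.normCnt i p T (j / (m + 1 : ℕ)) ω -
      H.limFun i p (j / (m + 1 : ℕ))‖ₑ := funext fun ω => hg p j ω
    rw [this]
    exact ((h.measurable_normCnt i p _).sub_const _).enorm
  have hgi : ∀ p, ∀ j ∈ Finset.range (m + 1 + 1), ∫⁻ ω, g p j ω ^ 2 ∂P ≤ H.errBound i p T := by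
    intro p j hj
    simp_rw [hg]
    refine h.lintegral_enorm_normCnt_sub_sq_le hT hμ0 hi p ⟨by positivity, ?_⟩
    rw [div_le_one (by positivity)]
    exact_mod_cast Nat.lt_succ_iff.1 (Finset.mem_range.1 hj)
  have hae : ∀ᵐ ω ∂P, (∑ p, X.compErr H i p T ω) ^ 2 ≤
      8 * (2 ^ (m + 1 + 1) * ∑ p, ∑ j ∈ Finset.range (m + 1 + 1), g p j ω ^ 2) +
        8 * ∑ p, ENNReal.ofReal (H.limLip i p / (m + 1 : ℕ)) ^ 2 := by
    filter_upwards [h.ae_exists_lt_time hT.le] with ω ⟨n, hn⟩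
    refine (ENNReal.sum_sq_le _ _).trans ?_
    calc 2 ^ (Finset.univ : Finset (Fin 2)).card * ∑ p, X.compErr H i p T ω ^ 2
        ≤ 4 * ∑ p, (2 * (2 ^ (m + 1 + 1) * ∑ j ∈ Finset.range (m + 1 + 1), g p j ω ^ 2) +
            2 * ENNReal.ofReal (H.limLip i p / (m + 1 : ℕ)) ^ 2) := by
          have h4 : (2 : ℝ≥0∞) ^ (Finset.univ : Finset (Fin 2)).card = 4 := by norm_num
          rw [h4]
          gcongr with p
          have h1 := compErr_le_grid hμ hμ0 hT (h.cnt_ne_top_of_lt_time hn i p le_rfl) m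
          refine (pow_le_pow_left' h1 2).trans ((ENNReal.add_sq_le_two _ _).trans ?_)
          refine add_le_add (mul_le_mul_right ?_ 2) le_rfl
          simp_rw [hg]
          refine (ENNReal.sum_sq_le _ _).trans ?_
          rw [Finset.card_range]
      _ = _ := by
          rw [Finset.sum_add_distrib, ← Finset.mul_sum, ← Finset.mul_sum, ← Finset.mul_sum]
          ring
  refine (lintegral_mono_ae hae).trans ?_
  rw [lintegral_add_right _ measurable_const]
  have hm2 : Measurable fun ω => ∑ p, ∑ j ∈ Finset.range (m + 1 + 1), g p j ω ^ 2 :=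
    Finset.measurable_sum _ fun p _ => Finset.measurable_sum _ fun j _ => (hgm p j).pow_const 2
  have hm1 : Measurable fun ω => 2 ^ (m + 1 + 1) * ∑ p, ∑ j ∈ Finset.range (m + 1 + 1), g p j ω ^ 2 :=
    hm2.const_mul _
  have hms : ∀ p, Measurable fun ω => ∑ j ∈ Finset.range (m + 1 + 1), g p j ω ^ 2 := fun p =>
    Finset.measurable_sum _ fun j _ => (hgm p j).pow_const 2
  have hmg : ∀ p j, Measurable fun ω => g p j ω ^ 2 := fun p j => (hgm p j).pow_const 2
  rw [lintegral_const_mul _ hm1, lintegral_const_mul _ hm2,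
    lintegral_finsetSum _ fun p _ => hms p]
  simp_rw [lintegral_finsetSum _ fun j _ => hmg _ j]
  simp only [lintegral_const, measure_univ, mul_one]
  gcongr
  rw [Finset.mul_sum]
  gcongr with p
  refine (Finset.sum_le_card_nsmul _ _ _ (hgi p)).trans ?_
  rw [Finset.card_range, nsmul_eq_mul]

end IsHawkes

/-- First `T → ∞` with the mesh fixed, then the mesh tends to zero. Each bound concerns a single
horizon, so the joint law plays no role. -/
theorem tendsto_lintegral_sum_compErr_sq [IsProbabilityMeasure P] {X : ℝ → MarkedArrivals Ω}
    {ℱ : ℝ → Filtration ℝ≥0 mΩ} (h : ∀ T, 0 < T → (X T).IsHawkes P (ℱ T) H T) (hμ : Monotone H.μ)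
    (hμ0 : ∀ s, 0 ≤ H.μ s) (hi : H.mom (2 * i) ≠ ∞) :
    Tendsto (fun T => ∫⁻ ω, (∑ p, (X T).compErr H i p T ω) ^ 2 ∂P) atTop (𝓝 0) := by
  refine ENNReal.tendsto_zero_of_eventually_le_add
    (a := fun m T => 8 * (2 ^ (m + 1 + 1) * ((m + 1 + 1 : ℕ) * ∑ p, H.errBound i p T)))
    (b := fun m => 8 * ∑ p, ENNReal.ofReal (H.limLip i p / (m + 1 : ℕ)) ^ 2) (fun m => ?_) ?_
    fun m => ?_
  · have h0 : Tendsto (fun T => ∑ p, H.errBound i p T) atTop (𝓝 0) := by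
      simpa using tendsto_finsetSum Finset.univ fun p _ => H.errBound_tendsto hi p
    have h1 := ENNReal.Tendsto.const_mul (a := 8 * (2 ^ (m + 1 + 1) * (m + 1 + 1 : ℕ))) h0
      (Or.inr (by finiteness))
    rw [mul_zero] at h1
    refine h1.congr fun T => by ring
  · have h0 : Tendsto (fun m : ℕ => ∑ p, ENNReal.ofReal (H.limLip i p / (m + 1 : ℕ)) ^ 2) atTop
        (𝓝 0) := by
      have := tendsto_finsetSum (Finset.univ : Finset (Fin 2)) fun p _ =>
        ((ENNReal.continuous_pow 2).tendsto 0).comp (tendsto_ofReal_div_succ (H.limLip i p))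
      simpa using this
    have h1 := ENNReal.Tendsto.const_mul (a := 8) h0 (Or.inr (by finiteness))
    rwa [mul_zero] at h1
  · filter_upwards [eventually_gt_atTop 0] with T hT
    exact (h T hT).lintegral_sum_compErr_sq_le hT hμ hμ0 hi m

end MarkedArrivals

/-! ### Measurability of the uniform error and identification of the limit -/

theorem EuclideanSpace.enorm_le_sum {ι : Type*} [Fintype ι] (x : EuclideanSpace ℝ ι) :
    ‖x‖ₑ ≤ ∑ p, ‖x p‖ₑ := by
  classical
  have h : x = ∑ p, EuclideanSpace.single p (x p) := by
    ext q
    simp [Pi.single_apply]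
  calc ‖x‖ₑ = ‖∑ p, EuclideanSpace.single p (x p)‖ₑ := by rw [← h]
    _ ≤ ∑ p, ‖EuclideanSpace.single p (x p)‖ₑ := enorm_sum_le _ _
    _ = _ := Finset.sum_congr rfl fun p _ => by
      rw [← ofReal_norm, ← ofReal_norm]
      exact congrArg ENNReal.ofReal (PiLp.norm_single 2 (fun _ : ι => ℝ) p (x p))

/-- The supremum over `[0, 1]` of a right-continuous function is attained along the rationals
and `1`. -/
theorem iSup_Icc_eq_iSup_rat {f : ℝ → ℝ≥0∞}
    (hf : ∀ v ∈ Set.Ico (0 : ℝ) 1, Tendsto f (𝓝[>] v) (𝓝 (f v))) :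
    ⨆ v ∈ Set.Icc (0 : ℝ) 1, f v =
      ⨆ v ∈ Set.Icc (0 : ℝ) 1 ∩ insert 1 (Set.range ((↑) : ℚ → ℝ)), f v := by
  refine le_antisymm (iSup₂_le fun v hv => ?_) (biSup_mono fun v hv => hv.1)
  rcases eq_or_lt_of_le hv.2 with h1 | h1
  · exact le_biSup f ⟨hv, by rw [h1]; exact Set.mem_insert _ _⟩
  refine le_of_tendsto_of_frequently (hf v ⟨hv.1, h1⟩) ?_
  rw [frequently_iff]
  intro U hU
  obtain ⟨u, hu, hsub⟩ := (mem_nhdsGT_iff_exists_Ioo_subset' h1).1 hU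
  obtain ⟨q, hq1, hq2⟩ := exists_rat_btwn (lt_min hu h1)
  have hq3 := lt_min_iff.1 hq2
  exact ⟨q, hsub ⟨hq1, hq3.1⟩, le_biSup f ⟨⟨hv.1.trans hq1.le, hq3.2.le⟩,
    Set.mem_insert_of_mem _ (Set.mem_range_self q)⟩⟩

namespace MarkedArrivals

variable {Ω : Type*} {X : MarkedArrivals Ω} {H : HawkesModel} {T : ℝ} {i : ℕ}

/-- Nothing changes between `t` and the first later arrival, which exists and is selected by
`Nat.find`. -/
theorem powerSum_eventuallyEq {ω : Ω} (hmono : StrictMono fun n => X.time n ω) {t : ℝ}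
    (hn : ∃ n, t < X.time n ω) : ∀ᶠ u in 𝓝[>] t, X.powerSum i u ω = X.powerSum i t ω := by
  classical
  have hlt := Nat.find_spec hn
  filter_upwards [Ioo_mem_nhdsGT hlt] with u hu
  have hiff : ∀ k, X.time k ω ≤ u ↔ X.time k ω ≤ t := fun k => by
    refine ⟨fun hk => not_lt.1 fun hkt => ?_, fun hk => hk.trans hu.1.le⟩
    exact (hu.2.trans_le (hmono.monotone (Nat.find_min' hn hkt))).not_ge hk
  unfold powerSum
  simp_rw [hiff]

theorem tendsto_powerSum_error {ω : Ω} (hmono : StrictMono fun n => X.time n ω) (hT : 0 < T)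
    (hn : ∃ n, T < X.time n ω) {L : ℝ → EuclideanSpace ℝ (Fin 2)} (hL : ContinuousOn L (Set.Icc 0 1))
    {v : ℝ} (hv : v ∈ Set.Ico (0 : ℝ) 1) :
    Tendsto (fun u => ‖T⁻¹ • X.powerSum i (u * T) ω - L u‖ₑ) (𝓝[>] v)
      (𝓝 ‖T⁻¹ • X.powerSum i (v * T) ω - L v‖ₑ) := by
  have hscale : Tendsto (fun u => u * T) (𝓝[>] v) (𝓝[>] (v * T)) := by
    refine tendsto_nhdsWithin_of_tendsto_nhds_of_eventually_within _
      ((continuous_mul_const T).continuousWithinAt) ?_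
    filter_upwards [self_mem_nhdsWithin] with u hu
    exact mul_lt_mul_of_pos_right hu hT
  have hlt : ∃ n, v * T < X.time n ω :=
    hn.imp fun n h => lt_of_le_of_lt (by nlinarith [hv.2]) h
  have hLv : Tendsto L (𝓝[>] v) (𝓝 (L v)) :=
    ((hL v ⟨hv.1, hv.2.le⟩).mono_of_mem_nhdsWithin (by
      filter_upwards [Ioo_mem_nhdsGT hv.2] with u hu using ⟨hv.1.trans hu.1.le, hu.2.le⟩))
  have hc : Tendsto (fun u => T⁻¹ • X.powerSum i (u * T) ω) (𝓝[>] v)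
      (𝓝 (T⁻¹ • X.powerSum i (v * T) ω)) := by
    refine tendsto_const_nhds.congr' ?_
    filter_upwards [hscale.eventually (powerSum_eventuallyEq (i := i) hmono hlt)] with u hu
    rw [hu]
  exact (hc.sub hLv).enorm

variable {mΩ : MeasurableSpace Ω} {P : Measure Ω} {ℱ : Filtration ℝ≥0 mΩ}

theorem supError_le_sum_compErr (hT : 0 < T) {L : ℝ → EuclideanSpace ℝ (Fin 2)}
    (hL : ∀ v ∈ Set.Icc (0 : ℝ) 1, ∀ p, L v p = H.limFun i p v) {ω : Ω}
    (hpos : ∀ n, X.time n ω ≤ T → 0 < X.mark n ω) :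
    X.supError i T L ω ≤ ∑ p, X.compErr H i p T ω := by
  refine iSup₂_le fun v hv => (EuclideanSpace.enorm_le_sum _).trans
    (Finset.sum_le_sum fun p _ => ?_)
  have hvT : v * T ≤ T := by nlinarith [hv.2]
  refine le_trans (le_of_eq ?_) (le_iSup₂ (f := fun v (_ : v ∈ Set.Icc (0 : ℝ) 1) =>
    ‖X.normCnt i p T v ω - H.limFun i p v‖ₑ) v hv)
  rw [← hL v hv p, normCnt, ← powerSum_apply fun n hn => hpos n (hn.trans hvT)]
  rfl

/-- Right-continuity reduces the supremum to a countable set of `v`. It holds only almost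
everywhere, since it requires some arrival after `T`; positivity of the marks is likewise almost
sure. -/
theorem IsHawkes.aemeasurable_supError [IsProbabilityMeasure P] (h : X.IsHawkes P ℱ H T)
    (hT : 0 < T) {L : ℝ → EuclideanSpace ℝ (Fin 2)} (hL : ContinuousOn L (Set.Icc 0 1)) :
    AEMeasurable (X.supError i T L) P := by
  obtain ⟨D, hD⟩ : ∃ D : Set ℝ, D = Set.Icc (0 : ℝ) 1 ∩ insert 1 (Set.range ((↑) : ℚ → ℝ)) :=
    ⟨_, rfl⟩
  have hDc : D.Countable := by
    rw [hD]
    exact ((Set.countable_range _).insert 1).mono Set.inter_subset_right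
  have hps : ∀ v ∈ D, AEMeasurable (fun ω => X.powerSum i (v * T) ω) P := fun v hv => by
    rw [hD] at hv
    have hvT : v * T ≤ T := by nlinarith [hv.1.2]
    refine ⟨fun ω => WithLp.toLp 2 fun p => (X.cnt i p (v * T) ω).toReal, ?_, ?_⟩
    · refine (WithLp.measurable_toLp 2 _).comp (measurable_pi_lambda _ fun p => ?_)
      exact (h.measurable_cnt_right i p (v * T)).ennreal_toReal
    · filter_upwards [h.ae_mark_pos hT.le] with ω hω
      ext p
      exact powerSum_apply fun n hn => hω n (hn.trans hvT)
  have hm : AEMeasurable (fun ω => ⨆ v ∈ D, ‖T⁻¹ • X.powerSum i (v * T) ω - L v‖ₑ) P :=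
    AEMeasurable.biSup D hDc fun v hv => (((hps v hv).const_smul T⁻¹).sub_const _).enorm
  refine hm.congr ?_
  filter_upwards [h.ae_exists_lt_time hT.le] with ω hω
  rw [hD]
  exact (iSup_Icc_eq_iSup_rat fun v hv =>
    tendsto_powerSum_error (h.time_strictMono ω) hT hω hL hv).symm

end MarkedArrivals

theorem llnLimit_apply_eq_limFun {H : HawkesModel} {μ : ℝ → ℝ} {K : Matrix (Fin 2) (Fin 2) ℝ}
    {i : ℕ} {m : ℝ} (hμ : H.μ = fun s => μ (max 0 (min 1 s))) (hm : H.mom i = ENNReal.ofReal m)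
    (hm0 : 0 ≤ m) (hw : ∀ p, H.w p = ENNReal.ofReal (((1 - K)⁻¹.mulVec fun _ => 1) p)) {v : ℝ}
    (hv : v ∈ Set.Icc (0 : ℝ) 1) (p : Fin 2) : llnLimit μ K m v p = H.limFun i p v := by
  have hw0 : 0 ≤ ((1 - K)⁻¹.mulVec fun _ => 1) p := by
    have := H.one_le_w p
    rw [hw, ENNReal.one_le_ofReal] at this
    linarith
  have hint : ∫ s in (0 : ℝ)..v, H.μ s = ∫ s in (0 : ℝ)..v, μ s := by
    refine intervalIntegral.integral_congr fun s hs => ?_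
    rw [Set.uIcc_of_le hv.1] at hs
    simp only [hμ]
    rw [min_eq_right (hs.2.trans hv.2), max_eq_right hs.1]
  rw [HawkesModel.limFun, hm, hw, ENNReal.toReal_ofReal hm0, ENNReal.toReal_ofReal hw0, hint,
    llnLimit]
  simp only [PiLp.smul_apply, smul_eq_mul]
  ring

theorem continuousOn_of_apply_eq_limFun {H : HawkesModel} (hμ : Monotone H.μ)
    (hμ0 : ∀ s, 0 ≤ H.μ s) {i : ℕ} {L : ℝ → EuclideanSpace ℝ (Fin 2)}
    (hL : ∀ v ∈ Set.Icc (0 : ℝ) 1, ∀ p, L v p = H.limFun i p v) :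
    ContinuousOn L (Set.Icc 0 1) := by
  have hc : ∀ p, Continuous (H.limFun i p) := fun p => by
    have : LipschitzWith (H.limLip i p).toNNReal (H.limFun i p) :=
      LipschitzWith.of_dist_le_mul fun x y => by
        rw [Real.dist_eq, Real.dist_eq, Real.coe_toNNReal _ (H.limLip_nonneg hμ0 i p)]
        exact H.abs_limFun_sub_le hμ hμ0 i p x y
    exact this.continuous
  have hcont : Continuous fun v => (WithLp.toLp 2 fun p => H.limFun i p v : EuclideanSpace ℝ (Fin 2)) :=
    (PiLp.continuous_toLp 2 _).comp (continuous_pi fun p => hc p)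
  refine hcont.continuousOn.congr fun v hv => ?_
  ext p
  exact hL v hv p

/-! ### Almost sure convergence along the square horizons -/

/-- The series of squares has a finite mean, hence converges almost surely, and its terms tend to
zero. -/
theorem ae_tendsto_zero_of_tsum_lintegral_sq_ne_top {Ω : Type*} {mΩ : MeasurableSpace Ω}
    {P : Measure Ω} {f : ℕ → Ω → ℝ≥0∞} (hf : ∀ n, Measurable (f n))
    (h : ∑' n, ∫⁻ ω, f n ω ^ 2 ∂P ≠ ∞) : ∀ᵐ ω ∂P, Tendsto (fun n => f n ω) atTop (𝓝 0) := by
  have hm : Measurable fun ω => ∑' n, f n ω ^ 2 := Measurable.tsum fun n => (hf n).pow_const 2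
  rw [← lintegral_tsum fun n => ((hf n).pow_const 2).aemeasurable] at h
  filter_upwards [ae_lt_top hm h] with ω hω
  have h0 := ENNReal.tendsto_atTop_zero_of_tsum_ne_top hω.ne
  rw [ENNReal.tendsto_nhds_zero] at h0 ⊢
  intro ε hε
  filter_upwards [h0 (ε ^ 2) (ENNReal.pow_pos hε 2)] with n hn
  exact (ENNReal.pow_le_pow_left_iff two_ne_zero).1 hn

/-- The horizons `(n + 1)²` along which almost sure convergence is first proved. -/
noncomputable def squareTime (n : ℕ) : ℝ := ((n : ℝ) + 1) ^ 2

theorem squareTime_pos (n : ℕ) : 0 < squareTime n := by unfold squareTime; positivity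

theorem squareTime_succ_sub (n : ℕ) : squareTime (n + 1) - squareTime n = 2 * n + 3 := by
  unfold squareTime; push_cast; ring

theorem tendsto_squareTime : Tendsto squareTime atTop atTop := by
  refine tendsto_atTop_mono (fun n => ?_) tendsto_natCast_atTop_atTop
  unfold squareTime
  nlinarith [(Nat.cast_nonneg n : (0 : ℝ) ≤ n)]

theorem tsum_div_squareTime_ne_top {C : ℝ≥0∞} (hC : C ≠ ∞) :
    ∑' n, C / ENNReal.ofReal (squareTime n) ≠ ∞ := by
  simp_rw [div_eq_mul_inv]
  rw [ENNReal.tsum_mul_left]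
  refine ENNReal.mul_ne_top hC ?_
  simp_rw [← ENNReal.ofReal_inv_of_pos (squareTime_pos _)]
  refine Summable.tsum_ofReal_ne_top ?_
  have h := (summable_nat_add_iff 1).2 (Real.summable_nat_pow_inv.2 one_lt_two)
  refine h.congr fun n => ?_
  simp [squareTime]

/-- The squares balance two needs: the inverse horizons are summable, and the gap `2 n + 3` is
negligible against the horizon. -/
theorem tendsto_squareTime_ratio :
    Tendsto (fun n => (squareTime (n + 1) - squareTime n) / squareTime n) atTop (𝓝 0) := by
  have h3 : Tendsto (fun n : ℕ => 3 * (1 / ((n : ℝ) + 1))) atTop (𝓝 0) := by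
    simpa using (tendsto_one_div_add_atTop_nhds_zero_nat (𝕜 := ℝ)).const_mul 3
  refine squeeze_zero (fun n => ?_) (fun n => ?_) h3
  · rw [squareTime_succ_sub]
    exact div_nonneg (by positivity) (squareTime_pos n).le
  · rw [squareTime_succ_sub, div_le_iff₀ (squareTime_pos n), squareTime]
    field_simp
    nlinarith [(Nat.cast_nonneg n : (0 : ℝ) ≤ n)]

namespace MarkedArrivals

variable {Ω : Type*} {H : HawkesModel} {i : ℕ}
  {mΩ : MeasurableSpace Ω} {P : Measure Ω}

/-- Almost sure uniform convergence along the horizons `(n + 1)²`. -/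
theorem ae_tendsto_compErr_squareTime [IsProbabilityMeasure P] {X : ℝ → MarkedArrivals Ω}
    {ℱ : ℝ → Filtration ℝ≥0 mΩ} (h : ∀ T, 0 < T → (X T).IsHawkes P (ℱ T) H T) (hμ : Monotone H.μ)
    (hμ0 : ∀ s, 0 ≤ H.μ s) (hi : H.mom (2 * i) ≠ ∞) (p : Fin 2) :
    ∀ᵐ ω ∂P, Tendsto (fun n => (X (squareTime n)).compErr H i p (squareTime n) ω) atTop (𝓝 0) := by
  have hX := fun n => h _ (squareTime_pos n)
  -- The grids of all meshes together have countably many points, so a single null set is discarded.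
  have hfl : ∀ᵐ ω ∂P, ∀ m j : ℕ, j ≤ m + 1 → Tendsto (fun n =>
      (X (squareTime n)).fluct P H i p (squareTime n) (j / (m + 1 : ℕ)) ω) atTop (𝓝 0) := by
    refine ae_all_iff.2 fun m => ae_all_iff.2 fun j => ?_
    by_cases hj : j ≤ m + 1
    · have hle : (j / (m + 1 : ℕ) : ℝ) ≤ 1 := by
        rw [div_le_one (by positivity)]
        exact_mod_cast hj
      have := ae_tendsto_zero_of_tsum_lintegral_sq_ne_top
        (fun n => (hX n).measurable_fluct i p (j / (m + 1 : ℕ)))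
        (ne_top_of_le_ne_top (tsum_div_squareTime_ne_top (H.varConst_ne_top hi p))
          (ENNReal.tsum_le_tsum fun n =>
            (hX n).lintegral_fluct_sq_le (squareTime_pos n) hi p hle))
      filter_upwards [this] with ω hω _ using hω
    · exact Eventually.of_forall fun ω hj' => absurd hj' hj
  filter_upwards [hfl, ae_all_iff.2 fun n => (hX n).ae_exists_lt_time (squareTime_pos n).le]
    with ω hω hfin
  refine ENNReal.tendsto_zero_of_eventually_le_add
    (a := fun m n => ∑ j ∈ Finset.range (m + 1 + 1),
      ((X (squareTime n)).fluct P H i p (squareTime n) (j / (m + 1 : ℕ)) ω +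
        H.meanErr i p (squareTime n)))
    (b := fun m => ENNReal.ofReal (H.limLip i p / (m + 1 : ℕ))) (fun m => ?_)
    (tendsto_ofReal_div_succ _) fun m => Eventually.of_forall fun n => ?_
  · have := tendsto_finsetSum (Finset.range (m + 1 + 1)) fun j hj =>
      (hω m j (Nat.lt_succ_iff.1 (Finset.mem_range.1 hj))).add
        ((H.meanErr_tendsto hi p).comp tendsto_squareTime)
    simpa using this
  · obtain ⟨k, hk⟩ := hfin n
    refine (compErr_le_grid hμ hμ0 (squareTime_pos n)
      ((hX n).cnt_ne_top_of_lt_time hk i p le_rfl) m).trans (add_le_add ?_ le_rfl)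
    refine Finset.sum_le_sum fun j hj => ?_
    refine (hX n).enorm_normCnt_sub_le (squareTime_pos n) hμ0 hi p ⟨by positivity, ?_⟩ ω
    rw [div_le_one (by positivity)]
    exact_mod_cast Nat.lt_succ_iff.1 (Finset.mem_range.1 hj)

/-! ### Interpolation between horizons -/

section Thinning

variable {m : Measure DrivingPoint} {ω : Ω}

theorem IsThinning.cnt_zero {X : MarkedArrivals Ω} {T : ℝ} (h : X.IsThinning H T m ω) (p : Fin 2) :
    X.cnt i p 0 ω = 0 := by
  simp [cnt, pointSum, not_le.2 (h.time_pos _)]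

theorem IsThinning.cnt_le_cnt {X Y : MarkedArrivals Ω} {S T : ℝ} (h : X.IsThinning H T m ω)
    (h' : Y.IsThinning H S m ω) (hμ : Monotone H.μ) (hST : S ≤ T) (p : Fin 2) {t : ℝ}
    (h0 : 0 ≤ t) (ht : t ≤ S) : X.cnt i p t ω ≤ Y.cnt i p t ω := by
  rw [cnt_eq_add X i p h0, cnt_eq_add Y i p h0, h.cnt_zero, h'.cnt_zero, zero_add, zero_add]
  exact h.tsum_wt_mono h' hμ hST i p le_rfl ht

theorem _root_.HawkesModel.envTotal_mono (H : HawkesModel) (i : ℕ) (p : Fin 2) {a b c : ℝ}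
    (hbc : b ≤ c) (m : Measure DrivingPoint) : H.envTotal i p a b m ≤ H.envTotal i p a c m :=
  iSup_mono fun _ => measure_mono (Set.Ioc_subset_Ioc_right hbc)

/-- Up to `S` the process with horizon `S` dominates, afterwards the dominating process. The window
ends at `b ≥ T` so that the bound is the same for every `T` up to `b`. -/
theorem IsThinning.cnt_le_add_envTotal {X Y : MarkedArrivals Ω} {S T : ℝ}
    (h : X.IsThinning H T m ω) (h' : Y.IsThinning H S m ω) (hμ : Monotone H.μ) (hS : 0 ≤ S)
    (hST : S ≤ T) (hm : ShellFinite (drivingIntensity H.ρ) m) (p : Fin 2) {t b : ℝ}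
    (h0 : 0 ≤ t) (ht : t ≤ T) (hTb : T ≤ b) :
    X.cnt i p t ω ≤ Y.cnt i p (min t S) ω + H.envTotal i p S b m := by
  rcases le_total t S with h1 | h1
  · rw [min_eq_left h1]
    exact (h.cnt_le_cnt h' hμ hST p h0 h1).trans le_self_add
  · rw [min_eq_right h1, cnt_eq_add X i p h1]
    exact add_le_add (h.cnt_le_cnt h' hμ hST p hS le_rfl)
      ((h.tsum_wt_le_envTotal hm i p hS ht).trans (H.envTotal_mono i p (ht.trans hTb) m))

/-- Finiteness for all real horizons at once, from countably many conditions on the dominating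
process. -/
theorem IsThinning.cnt_ne_top {X : MarkedArrivals Ω} {T : ℝ} (h : X.IsThinning H T m ω)
    (hm : ShellFinite (drivingIntensity H.ρ) m) (hT : 0 ≤ T) (p : Fin 2)
    (henv : ∀ n : ℕ, H.envTotal i p 0 (n + 1 : ℕ) m ≠ ∞) {t : ℝ} (ht : t ≤ T) :
    X.cnt i p t ω ≠ ∞ := by
  obtain ⟨n, hn⟩ := exists_nat_ge T
  have htT : X.cnt i p t ω ≤ X.cnt i p T ω := pointSum_mono _ _ ht
  refine ne_top_of_le_ne_top (henv n) (htT.trans ?_)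
  rw [cnt_eq_add X i p hT, h.cnt_zero, zero_add]
  refine (h.tsum_wt_le_envTotal hm i p le_rfl le_rfl).trans (H.envTotal_mono i p ?_ m)
  push_cast
  linarith

theorem abs_normCnt_sub_le_toReal {X : MarkedArrivals Ω} {T v : ℝ} {p : Fin 2}
    (hv : v ∈ Set.Icc (0 : ℝ) 1) (h : X.compErr H i p T ω ≠ ∞) :
    |X.normCnt i p T v ω - H.limFun i p v| ≤ (X.compErr H i p T ω).toReal := by
  have hle : ‖X.normCnt i p T v ω - H.limFun i p v‖ₑ ≤ X.compErr H i p T ω :=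
    le_iSup₂ (f := fun v (_ : v ∈ Set.Icc (0 : ℝ) 1) =>
      ‖X.normCnt i p T v ω - H.limFun i p v‖ₑ) v hv
  rw [Real.enorm_eq_ofReal_abs] at hle
  exact (ENNReal.ofReal_le_iff_le_toReal h).1 hle

/-- The error for a horizon `T ∈ [a, b]` is controlled by the errors for the horizons `a` and `b`
and by the total mass of the dominating process in `(a, b]`. -/
theorem IsThinning.compErr_le {X : ℝ → MarkedArrivals Ω}
    (h : ∀ T, 0 < T → (X T).IsThinning H T m ω) (hμ : Monotone H.μ) (hμ0 : ∀ s, 0 ≤ H.μ s)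
    (hm : ShellFinite (drivingIntensity H.ρ) m) (p : Fin 2)
    (henv : ∀ n : ℕ, H.envTotal i p 0 (n + 1 : ℕ) m ≠ ∞) {a T b : ℝ} (ha : 0 < a) (haT : a ≤ T)
    (hTb : T ≤ b) :
    (X T).compErr H i p T ω ≤ (X a).compErr H i p a ω + (X b).compErr H i p b ω +
      H.envTotal i p a b m / ENNReal.ofReal a + ENNReal.ofReal (H.limLip i p * ((b - a) / a)) := by
  have hT : 0 < T := ha.trans_le haT
  have hb : 0 < b := hT.trans_le hTb
  by_cases hea : (X a).compErr H i p a ω = ∞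
  · simp [hea]
  by_cases heb : (X b).compErr H i p b ω = ∞
  · simp [heb]
  by_cases hU : H.envTotal i p a b m = ∞
  · simp [hU, ENNReal.top_div]
  obtain ⟨U, hUdef⟩ : ∃ U, U = (H.envTotal i p a b m).toReal := ⟨_, rfl⟩
  have hU0 : 0 ≤ U := hUdef ▸ ENNReal.toReal_nonneg
  obtain ⟨c, hc⟩ : ∃ c, c = H.limLip i p := ⟨_, rfl⟩
  have hc0 : 0 ≤ c := hc ▸ H.limLip_nonneg hμ0 i p
  obtain ⟨δ, hδ⟩ : ∃ δ, δ = (b - a) / a := ⟨_, rfl⟩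
  have hδa : δ * a = b - a := by rw [hδ]; field_simp
  have hδ0 : 0 ≤ δ := hδ ▸ div_nonneg (by linarith) ha.le
  have hrhs : (X a).compErr H i p a ω + (X b).compErr H i p b ω +
      H.envTotal i p a b m / ENNReal.ofReal a + ENNReal.ofReal (H.limLip i p * ((b - a) / a)) =
      ENNReal.ofReal (((X a).compErr H i p a ω).toReal + ((X b).compErr H i p b ω).toReal +
        U / a + c * δ) := by
    rw [ENNReal.ofReal_add (by positivity) (by positivity),
      ENNReal.ofReal_add (by positivity) (by positivity),
      ENNReal.ofReal_add (by positivity) (by positivity), ENNReal.ofReal_toReal hea,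
      ENNReal.ofReal_toReal heb, ENNReal.ofReal_div_of_pos ha, hUdef, ENNReal.ofReal_toReal hU,
      hc, hδ]
  rw [hrhs]
  refine iSup₂_le fun v hv => ?_
  rw [Real.enorm_eq_ofReal_abs]
  refine ENNReal.ofReal_le_ofReal ?_
  have hvT0 : 0 ≤ v * T := mul_nonneg hv.1 hT.le
  have hvT : v * T ≤ T := by nlinarith [hv.2]
  -- comparison with the shorter horizon
  obtain ⟨v₁, hv₁⟩ : ∃ v₁, v₁ = min (v * T) a / a := ⟨_, rfl⟩
  have hv₁a : v₁ * a = min (v * T) a := by rw [hv₁]; field_simp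
  have hv₁m : v₁ ∈ Set.Icc (0 : ℝ) 1 := by
    rw [hv₁]
    exact ⟨div_nonneg (le_min hvT0 ha.le) ha.le, (div_le_one ha).2 (min_le_right _ _)⟩
  have hv₁v : |v₁ - v| ≤ δ := by
    have h1 : |v₁ - v| * a ≤ δ * a := by
      have h3 : |v₁ - v| * a = |(v₁ - v) * a| := by rw [abs_mul, abs_of_pos ha]
      rw [h3, sub_mul, hv₁a, hδa, abs_le]
      rcases le_total (v * T) a with h2 | h2
      · rw [min_eq_left h2]
        constructor <;> nlinarith [hv.1, hv.2]
      · rw [min_eq_right h2]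
        constructor <;> nlinarith [hv.1, hv.2]
    exact le_of_mul_le_mul_right h1 ha
  have hup : (X T).normCnt i p T v ω ≤ (X a).normCnt i p a v₁ ω + U / a := by
    have h1 : ((X T).cnt i p (v * T) ω).toReal ≤ ((X a).cnt i p (v₁ * a) ω).toReal + U := by
      rw [hv₁a, hUdef]
      have hfin := (h a ha).cnt_ne_top hm ha.le p henv (min_le_right (v * T) a)
      rw [← ENNReal.toReal_add hfin hU]
      exact ENNReal.toReal_mono (ENNReal.add_ne_top.2 ⟨hfin, hU⟩)
        ((h T hT).cnt_le_add_envTotal (h a ha) hμ ha.le haT hm p hvT0 hvT hTb)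
    have h2 : T⁻¹ ≤ a⁻¹ := inv_anti₀ ha haT
    calc (X T).normCnt i p T v ω ≤ a⁻¹ * (((X a).cnt i p (v₁ * a) ω).toReal + U) :=
          mul_le_mul h2 h1 ENNReal.toReal_nonneg (inv_nonneg.2 ha.le)
      _ = _ := by rw [normCnt]; ring
  -- comparison with the longer horizon
  obtain ⟨v₂, hv₂⟩ : ∃ v₂, v₂ = v * T / b := ⟨_, rfl⟩
  have hv₂b : v₂ * b = v * T := by rw [hv₂]; field_simp
  have hv₂m : v₂ ∈ Set.Icc (0 : ℝ) 1 := by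
    rw [hv₂]
    exact ⟨div_nonneg hvT0 hb.le, (div_le_one hb).2 (hvT.trans hTb)⟩
  have hv₂v : |v₂ - v| ≤ δ := by
    have h1 : |v₂ - v| * b ≤ δ * b := by
      have h3 : δ * a ≤ δ * b := mul_le_mul_of_nonneg_left (haT.trans hTb) hδ0
      have h4 : |v₂ - v| * b = |(v₂ - v) * b| := by rw [abs_mul, abs_of_pos hb]
      refine le_trans ?_ h3
      rw [h4, sub_mul, hv₂b, hδa, abs_le]
      constructor <;> nlinarith [hv.1, hv.2]
    exact le_of_mul_le_mul_right h1 hb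
  have hlow : (X b).normCnt i p b v₂ ω ≤ (X T).normCnt i p T v ω := by
    unfold normCnt
    rw [hv₂b]
    refine mul_le_mul (inv_anti₀ hT hTb) ?_ ENNReal.toReal_nonneg (inv_nonneg.2 hT.le)
    exact ENNReal.toReal_mono ((h T hT).cnt_ne_top hm hT.le p henv hvT)
      ((h b hb).cnt_le_cnt (h T hT) hμ hTb p hvT0 hvT)
  have e1 := abs_le.1 (abs_normCnt_sub_le_toReal hv₁m hea)
  have e2 := abs_le.1 (abs_normCnt_sub_le_toReal hv₂m heb)
  have l1 := abs_le.1 ((H.abs_limFun_sub_le hμ hμ0 i p v₁ v).trans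
    (mul_le_mul_of_nonneg_left hv₁v (H.limLip_nonneg hμ0 i p)))
  have l2 := abs_le.1 ((H.abs_limFun_sub_le hμ hμ0 i p v₂ v).trans
    (mul_le_mul_of_nonneg_left hv₂v (H.limLip_nonneg hμ0 i p)))
  rw [← hc] at l1 l2
  have hUa : 0 ≤ U / a := div_nonneg hU0 ha.le
  have p1 : 0 ≤ ((X a).compErr H i p a ω).toReal := ENNReal.toReal_nonneg
  have p2 : 0 ≤ ((X b).compErr H i p b ω).toReal := ENNReal.toReal_nonneg
  rw [abs_le]
  constructor <;> linarith [e1.1, e1.2, e2.1, e2.2, l1.1, l1.2, l2.1, l2.2]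

end Thinning

end MarkedArrivals

/-! ### Almost sure convergence for a common driving measure -/

section Envelope

variable {Ω : Type*} {mΩ : MeasurableSpace Ω} {P : Measure Ω} [IsProbabilityMeasure P]
  {H : HawkesModel} {i : ℕ} {Q : Ω → Measure DrivingPoint}

theorem IsPoissonRandomMeasure.exists_lintegral_envTotal_sq_le
    (hQ : IsPoissonRandomMeasure P (drivingIntensity H.ρ) Q) (hi : H.mom (2 * i) ≠ ∞) (p : Fin 2) :
    ∃ C : ℝ≥0∞, C ≠ ∞ ∧ ∀ a b : ℝ, 0 ≤ a → a + 1 ≤ b →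
      ∫⁻ ω, H.envTotal i p a b (Q ω) ^ 2 ∂P ≤ C * ENNReal.ofReal (b - a) ^ 2 := by
  obtain ⟨C, hC, h⟩ := H.exists_lintegral_envTotal_sq_le hQ.isPoissonLaw hi p
  refine ⟨C, hC, fun a b ha hab => ?_⟩
  have h1 := h a b ha hab
  have hm : Measurable fun m => H.envTotal i p a b m ^ 2 :=
    (H.measurable_envTotal i p a b).pow_const 2
  rwa [lintegral_map hm hQ.measurable_coe] at h1

theorem IsPoissonRandomMeasure.ae_envTotal_ne_top
    (hQ : IsPoissonRandomMeasure P (drivingIntensity H.ρ) Q) (hi : H.mom (2 * i) ≠ ∞) (p : Fin 2) :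
    ∀ᵐ ω ∂P, ∀ n : ℕ, H.envTotal i p 0 (n + 1 : ℕ) (Q ω) ≠ ∞ := by
  obtain ⟨C, hC, h⟩ := hQ.exists_lintegral_envTotal_sq_le hi p
  refine ae_all_iff.2 fun n => ?_
  have h1 := h 0 (n + 1 : ℕ) le_rfl (by push_cast; linarith [(Nat.cast_nonneg n : (0 : ℝ) ≤ n)])
  have hm : Measurable fun ω => H.envTotal i p 0 (n + 1 : ℕ) (Q ω) ^ 2 :=
    ((H.measurable_envTotal i p _ _).comp hQ.measurable_coe).pow_const 2
  filter_upwards [ae_lt_top hm (ne_top_of_le_ne_top (by finiteness) h1)] with ω hω h2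
  rw [h2] at hω
  simp at hω

/-- The second moment is at most `C (2 n + 3)² ≤ 9 C (n + 1)²`; after division by the square of the
horizon, `9 C / (n + 1)²` is summable. -/
theorem IsPoissonRandomMeasure.ae_tendsto_envTotal_div
    (hQ : IsPoissonRandomMeasure P (drivingIntensity H.ρ) Q) (hi : H.mom (2 * i) ≠ ∞) (p : Fin 2) :
    ∀ᵐ ω ∂P, Tendsto (fun n => H.envTotal i p (squareTime n) (squareTime (n + 1)) (Q ω) /
      ENNReal.ofReal (squareTime n)) atTop (𝓝 0) := by
  obtain ⟨C, hC, h⟩ := hQ.exists_lintegral_envTotal_sq_le hi p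
  have hm : ∀ n, Measurable fun ω => H.envTotal i p (squareTime n) (squareTime (n + 1)) (Q ω) :=
    fun n => (H.measurable_envTotal i p _ _).comp hQ.measurable_coe
  refine ae_tendsto_zero_of_tsum_lintegral_sq_ne_top (fun n => (hm n).div_const _)
    (ne_top_of_le_ne_top (tsum_div_squareTime_ne_top (C := C * 9) (by finiteness))
      (ENNReal.tsum_le_tsum fun n => ?_))
  have hn : (0 : ℝ) ≤ n := Nat.cast_nonneg n
  have hs := squareTime_pos n
  have hs0 : ENNReal.ofReal (squareTime n) ≠ 0 := by simpa using hs
  have h1 := h (squareTime n) (squareTime (n + 1)) hs.le (by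
    linarith [squareTime_succ_sub n])
  have h2 : ENNReal.ofReal (squareTime (n + 1) - squareTime n) ^ 2 ≤
      9 * ENNReal.ofReal (squareTime n) := by
    rw [squareTime_succ_sub, ← ENNReal.ofReal_pow (by positivity),
      show (9 : ℝ≥0∞) = ENNReal.ofReal 9 by simp, ← ENNReal.ofReal_mul (by norm_num)]
    refine ENNReal.ofReal_le_ofReal ?_
    rw [squareTime]
    nlinarith
  simp_rw [div_eq_mul_inv, mul_pow]
  rw [lintegral_mul_const _ ((hm n).pow_const 2)]
  calc (∫⁻ ω, H.envTotal i p (squareTime n) (squareTime (n + 1)) (Q ω) ^ 2 ∂P) *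
        (ENNReal.ofReal (squareTime n))⁻¹ ^ 2
      ≤ C * (9 * ENNReal.ofReal (squareTime n)) * (ENNReal.ofReal (squareTime n))⁻¹ ^ 2 := by
        gcongr
        exact h1.trans (by gcongr)
    _ = C * 9 * (ENNReal.ofReal (squareTime n) * (ENNReal.ofReal (squareTime n))⁻¹) *
        (ENNReal.ofReal (squareTime n))⁻¹ := by ring
    _ = _ := by rw [ENNReal.mul_inv_cancel hs0 ENNReal.ofReal_ne_top, mul_one]

/-- Almost sure uniform convergence for the processes driven by a common Poisson measure. -/
theorem IsPoissonRandomMeasure.ae_tendsto_compErr {X : ℝ → MarkedArrivals Ω}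
    {ℱ : ℝ → Filtration ℝ≥0 mΩ} (hQ : IsPoissonRandomMeasure P (drivingIntensity H.ρ) Q)
    (hX : ∀ T, 0 < T → (X T).IsHawkes P (ℱ T) H T)
    (h : ∀ᵐ ω ∂P, ∀ T, 0 < T → (X T).IsThinning H T (Q ω) ω) (hμ : Monotone H.μ)
    (hμ0 : ∀ s, 0 ≤ H.μ s) (hi : H.mom (2 * i) ≠ ∞) (p : Fin 2) :
    ∀ᵐ ω ∂P, Tendsto (fun T => (X T).compErr H i p T ω) atTop (𝓝 0) := by
  filter_upwards [h, hQ.ae_shellFinite, hQ.ae_envTotal_ne_top hi p,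
    hQ.ae_tendsto_envTotal_div hi p,
    MarkedArrivals.ae_tendsto_compErr_squareTime hX hμ hμ0 hi p] with ω hω hm henv hU he
  have hδ : Tendsto (fun n => ENNReal.ofReal (H.limLip i p *
      ((squareTime (n + 1) - squareTime n) / squareTime n))) atTop (𝓝 0) := by
    have h1 := tendsto_squareTime_ratio.const_mul (H.limLip i p)
    rw [mul_zero] at h1
    have h2 := (ENNReal.continuous_ofReal.tendsto 0).comp h1
    rw [ENNReal.ofReal_zero] at h2
    exact h2
  have hsum := ((he.add (he.comp (tendsto_add_atTop_nat 1))).add hU).add hδ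
  simp only [add_zero] at hsum
  -- With `n = ⌊√T⌋ - 1` the horizon lies between the squares of `n + 1` and `n + 2`; the truncated
  -- subtraction is harmless once `T ≥ 1`.
  have hidx : Tendsto (fun T : ℝ => ⌊√T⌋₊ - 1) atTop atTop :=
    (tendsto_sub_atTop_nat 1).comp (tendsto_nat_floor_atTop.comp Real.tendsto_sqrt_atTop)
  refine tendsto_of_tendsto_of_tendsto_of_le_of_le' tendsto_const_nhds (hsum.comp hidx)
    (Eventually.of_forall fun _ => zero_le) ?_
  filter_upwards [eventually_ge_atTop 1] with T hT
  have h1 : 1 ≤ ⌊√T⌋₊ := Nat.one_le_floor_iff _ |>.2 (Real.one_le_sqrt.2 hT)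
  have hk : ((⌊√T⌋₊ - 1 : ℕ) : ℝ) + 1 = ⌊√T⌋₊ := by
    rw [Nat.cast_sub h1]; simp
  have hT0 : 0 ≤ T := by linarith
  refine MarkedArrivals.IsThinning.compErr_le hω hμ hμ0 hm p henv (squareTime_pos _) ?_ ?_
  · rw [squareTime, hk, ← Real.sq_sqrt hT0]
    exact pow_le_pow_left₀ (Nat.cast_nonneg _) (by
      rw [Real.sq_sqrt hT0]; exact Nat.floor_le (Real.sqrt_nonneg T)) 2
  · have h3 := (Nat.lt_floor_add_one √T).le
    have h4 : T ≤ squareTime (⌊√T⌋₊ - 1 + 1) := by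
      rw [squareTime, Nat.cast_add, Nat.cast_one, hk]
      calc T = √T ^ 2 := (Real.sq_sqrt hT0).symm
        _ ≤ _ := pow_le_pow_left₀ (Real.sqrt_nonneg T) h3 2
    exact h4

end Envelope

/-! ### Conclusion -/

theorem proposition4p3 {Ω : Type*} {mΩ : MeasurableSpace Ω} (P : Measure Ω)
    [IsProbabilityMeasure P]
    -- the generic mark: a positive, square integrable random variable
    (J : Ω → ℝ) (hJ_meas : Measurable J) (hJ_pos : ∀ᵐ ω ∂P, 0 < J ω)
    (hJ_sq : Integrable (fun ω => J ω ^ 2) P)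
    -- the baseline: nonnegative and nondecreasing on `[0, 1]` (hence bounded)
    (μ : ℝ → ℝ) (hμ_nonneg : ∀ s ∈ Set.Icc (0 : ℝ) 1, 0 ≤ μ s)
    (hμ_mono : MonotoneOn μ (Set.Icc 0 1))
    -- the kernel: nonnegative, measurable, locally bounded, integrable, with `ρ(K) < 1`
    (φ : ℝ → Matrix (Fin 2) (Fin 2) ℝ) (hφ_meas : ∀ p q, Measurable fun u => φ u p q)
    (hφ_nonneg : ∀ u, 0 ≤ u → ∀ p q, 0 ≤ φ u p q)
    (hφ_bdd : ∀ R : ℝ, ∃ C : ℝ, ∀ u ∈ Set.Icc 0 R, ∀ p q, φ u p q ≤ C)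
    (hφ_int : ∀ p q, IntegrableOn (fun u => φ u p q) (Set.Ioi 0))
    (K : Matrix (Fin 2) (Fin 2) ℝ) (hK : K = kernelMatrix (∫ ω, J ω ∂P) φ)
    (hK_radius : spectralRadius ℂ (K.map (fun x : ℝ => (x : ℂ))) < 1)
    -- for every horizon `T > 0`, a process following the model on `[0, T]`
    (ℱ : ℝ → Filtration ℝ≥0 mΩ) (X : ℝ → MarkedArrivals Ω)
    (hX : ∀ T, 0 < T → (X T).IsMarkedHawkes P (ℱ T) μ φ J T)
    (i : ℕ) (hi : i ∈ ({0, 1, 2} : Set ℕ)) (hJ_int : Integrable (fun ω => J ω ^ (2 * i)) P) :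
    -- convergence in `L²`, whatever the joint law of the processes for the different `T`
    ((∀ T, 0 < T →
        AEMeasurable ((X T).supError i T (llnLimit μ K (∫ ω, J ω ^ i ∂P))) P) ∧
      Tendsto (fun T => ∫⁻ ω, (X T).supError i T (llnLimit μ K (∫ ω, J ω ^ i ∂P)) ω ^ 2 ∂P)
        atTop (𝓝 0)) ∧
    -- almost sure convergence, when the processes for the different `T` are built on the
    -- probability space by thinning one and the same marked Poisson random measure
    (∀ Q : Ω → Measure (Fin 2 × ℝ × ℝ × ℝ),
      IsPoissonRandomMeasure P (drivingIntensity (P.map J)) Q →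
      (∀ᵐ ω ∂P, ∀ T, 0 < T → (X T).SolvesThinning Q μ φ T ω) →
      ∀ᵐ ω ∂P, Tendsto (fun T => (X T).supError i T (llnLimit μ K (∫ ω, J ω ^ i ∂P)) ω)
        atTop (𝓝 0)) := by
  obtain ⟨H, hρ, hHμ, hHk, hw⟩ := exists_hawkesModel P J hJ_meas hJ_pos hJ_sq μ hμ_mono φ hφ_meas
    hφ_nonneg hφ_int K hK hK_radius
  have hclamp : ∀ s : ℝ, max 0 (min 1 s) ∈ Set.Icc (0 : ℝ) 1 := fun s =>
    ⟨le_max_left _ _, max_le zero_le_one (min_le_left _ _)⟩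
  have hμ0 : ∀ s, 0 ≤ H.μ s := fun s => by rw [hHμ]; exact hμ_nonneg _ (hclamp s)
  have hμm : Monotone H.μ := fun s t hst => by
    rw [hHμ]
    exact hμ_mono (hclamp s) (hclamp t) (max_le_max le_rfl (min_le_min le_rfl hst))
  have hmom : ∀ j, Integrable (fun ω => J ω ^ j) P →
      H.mom j = ENNReal.ofReal (∫ ω, J ω ^ j ∂P) := fun j hj => by
    rw [HawkesModel.mom, hρ, lintegral_map (by fun_prop) hJ_meas, lintegral_ofReal_pow_eq hJ_pos hj]
  have hmi : H.mom (2 * i) ≠ ∞ := by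
    rw [hmom _ hJ_int]
    exact ENNReal.ofReal_ne_top
  have hm0 : 0 ≤ ∫ ω, J ω ^ i ∂P := integral_nonneg_of_ae (by
    filter_upwards [hJ_pos] with ω h using pow_nonneg h.le i)
  have hL : ∀ v ∈ Set.Icc (0 : ℝ) 1, ∀ p,
      llnLimit μ K (∫ ω, J ω ^ i ∂P) v p = H.limFun i p v := fun v hv p =>
    llnLimit_apply_eq_limFun hHμ (hmom i (integrable_pow_of_two_mul hJ_meas hJ_int)) hm0 hw hv p
  have hXH : ∀ T, 0 < T → (X T).IsHawkes P (ℱ T) H T := fun T hT =>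
    (hX T hT).isHawkes hJ_meas hρ hHμ hHk hφ_nonneg
  refine ⟨⟨fun T hT => (hXH T hT).aemeasurable_supError hT
    (continuousOn_of_apply_eq_limFun hμm hμ0 hL), ?_⟩, fun Q hQ hthin => ?_⟩
  · refine tendsto_of_tendsto_of_tendsto_of_le_of_le' tendsto_const_nhds
      (MarkedArrivals.tendsto_lintegral_sum_compErr_sq hXH hμm hμ0 hmi)
      (Eventually.of_forall fun _ => zero_le) ?_
    filter_upwards [eventually_gt_atTop 0] with T hT
    refine lintegral_mono_ae ?_
    filter_upwards [(hXH T hT).ae_mark_pos hT.le] with ω hω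
    exact pow_le_pow_left' (MarkedArrivals.supError_le_sum_compErr hT hL hω) 2
  · rw [← hρ] at hQ
    have hthin' : ∀ᵐ ω ∂P, ∀ T, 0 < T → (X T).IsThinning H T (Q ω) ω := by
      filter_upwards [hthin] with ω hω T hT
      exact (hω T hT).isThinning hHμ hHk hφ_nonneg (fun n => (hX T hT).time_pos n ω)
        ((hX T hT).time_strictMono ω)
    have hset : MeasurableSet {e : Fin 2 × ℝ × ℝ × ℝ | e.2.2.2 ≤ 0} :=
      measurableSet_le (by fun_prop) measurable_const
    -- The expected number of points with nonpositive mark is zero. This single null set handles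
    -- uncountably many horizons, which the horizon-wise `ae_mark_pos` could not.
    have hnonpos : ∀ᵐ ω ∂P, Q ω {e | e.2.2.2 ≤ 0} = 0 := by
      have h0 := drivingIntensity_mark_nonpos H
      have h1 := hQ.lintegral_coe hset (by rw [h0]; exact ENNReal.zero_ne_top)
      rw [h0, lintegral_eq_zero_iff (hQ.measurable _ hset)] at h1
      exact h1
    filter_upwards [hthin', hnonpos,
      ae_all_iff.2 fun p => hQ.ae_tendsto_compErr hXH hthin' hμm hμ0 hmi p] with ω hω h0 hp
    have hsum := tendsto_finsetSum Finset.univ fun p _ => hp p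
    simp only [Finset.sum_const_zero] at hsum
    refine tendsto_of_tendsto_of_tendsto_of_le_of_le' tendsto_const_nhds hsum
      (Eventually.of_forall fun _ => zero_le) ?_
    filter_upwards [eventually_gt_atTop 0] with T hT
    exact MarkedArrivals.supError_le_sum_compErr hT hL ((hω T hT).mark_pos h0)
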